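/- **Setting.** Let $0<q<1$ and $[x]=\frac{q^x-q^{-x}}{q-q^{-1}}$. Let $\mathcal A=\mathcal O(\mathrm S^2_q)$ be the complex algebra with generators $A,B,B^*$ and relations $$BA=q^2AB,\quad AB^*=q^2B^*A,\quad B^*B=A-A^2,\quad BB^*=q^2A-q^4A^2 ,$$ and put $x_{-1}=(1+q^{-2})^{1/2}B$, $x_0=1-(1+q^2)A$, $x_1=-(1+q^2)^{1/2}B^*$. Let $\mathcal H$ be the Hilbert space with orthonormal basis $v^l_{k,\pm}$, $l=\frac12,\frac32,\dots$, $k=-l,-l+1,\dots,l$. On the span of these vectors define $Dv^l_{k,\pm}=[l+\tfrac12]v^l_{k,\mp}$, $|D|^{-z}v^l_{k,\pm}=[l+\tfrac12]^{-z}v^l_{k,\pm}$, $\gamma v^l_{k,\pm}=\pm v^l_{k,\pm}$, $Kv^l_{k,\pm}=q^kv^l_{k,\pm}$, $Ev^l_{k,\pm}=([l-k][l+k+1])^{1/2}v^l_{k+1,\pm}$, $Fv^l_{k,\pm}=([l-k+1][l+k])^{1/2}v^l_{k-1,\pm}$. There is exactly one representation of $\mathcal A$ on this span such that $$x_0v^l_{k,\pm}=\alpha^-(l,k)_\pm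 v^{l-1}_{k,\pm}+\alpha^0(l,k)_\pm v^l_{k,\pm}+\alpha^-(l+1,k)_\pm v^{l+1}_{k,\pm},$$ $$\alpha^-(l,k)_\pm=\frac{q^{k\pm1/2}[2]\,\big([l-k][l+k][l-\frac12][l+\frac12]\big)^{1/2}}{[2l-1]^{1/2}[2l][2l+1]^{1/2}},$$ $$\alpha^0(l,k)_\pm=\frac{[l-k+1][l+k]-q^2[l-k][l+k+1]}{[2l]}\cdot\frac{\pm q^{\mp1}+(q-q^{-1})\big([\frac12][\frac32]-[l][l+1]\big)}{q[2l+2]}$$ (vectors with labels out of range are $0$), and that $x_{1}=[2]^{-1/2}(Ex_0-x_0E)K^{-1}$, $x_{-1}=[2]^{-1/2}(Fx_0-x_0F)K^{-1}$ as operators. This is the Dąbrowski–Sitarz $\mathcal U_q(\mathfrak{su}(2))$-equivariant even spectral triple $(\mathcal A,\mathcal H,D,\gamma)$. Operators on the span are identified with their closures. Let $\mathcal O(\mathrm{SU}_q(2))$ be the algebra with generators $a,b,c,d$ and relations $ab=qba$, $ac=qca$, $bd=qdb$, $cd=qdc$, $bc=cb$, $ad=1+qbc$, $da=1+q^{-1}bc$.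 Map $\mathcal A$ to it by $A=-q^{-1}bc$, $B=ac$, $B^*=-q^{-1}bd$. Let $\varepsilon$ be its counit. The functionals $E,F$ on it are given by $E(xy)=E(x)K(y)+K^{-1}(x)E(y)$ and $F(xy)=F(x)K(y)+K^{-1}(x)F(y)$, $E(c)=F(b)=1$, $E$ and $F$ being $0$ on the other generators, where $K^{\pm1}$ are the characters with $K^{\pm1}(a)=q^{\mp1/2}$, $K^{\pm1}(d)=q^{\pm1/2}$, $K^{\pm1}(b)=K^{\pm1}(c)=0$. For an automorphism $\sigma$ of $\mathcal A$ and an $\mathcal A$-bimodule $M$ let ${}_\sigma M$ be $M$ with the left action $a\triangleright m=\sigma(a)m$. A *fundamental homology class* of $\mathcal A$ is a class $[c]\in H_2(\mathcal A,{}_\sigma\mathcal A)$ such that the cap product with $c$ gives the Poincaré duality isomorphisms $H^i(\mathcal A,M)\cong H_{2-i}(\mathcal A,{}_\sigma M)$ for all bimodules $M$ and all $i$ (so that $H^i(\mathcal A,M)=0$ for $i>2$). A *$\sigma$-twisted Hochschild 2-cocycle* is a trilinear $\varphi:\mathcal A^3\to\mathbb C$ with $$\varphi(a_0a_1,a_2,a_3)-\varphi(a_0,a_1a_2,a_3)+\varphi(a_0,a_1,a_2a_3)-\varphi(\sigma(a_3)a_0,a_1,a_2)=0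 .$$ It *represents the fundamental Hochschild cohomology class* (which is defined up to a nonzero scalar) if $H_2(\mathcal A,{}_\sigma\mathcal A)=\mathbb C[c]$ for a fundamental homology class $[c]$, and the functional on $H_2(\mathcal A,{}_\sigma\mathcal A)$ induced by $\varphi$ does not vanish at $[c]$. **Theorem.** 1. For all $a_0,a_1,a_2\in\mathcal A$ the operator $\gamma a_0[D,a_1][D,a_2]K^{-2}|D|^{-z}$ is of trace class for $\mathrm{Re}\,z>2$, and the function $\mathrm{tr}_{\mathcal H}(\gamma a_0[D,a_1][D,a_2]K^{-2}|D|^{-z})$ has a meromorphic continuation to $\{\mathrm{Re}\,z>1\}$ whose pole at $z=2$ has order at most $1$. 2. There is an automorphism $\sigma$ of $\mathcal A$ such that the residue $$\varphi(a_0,a_1,a_2)=\operatorname*{Res}_{z=2}\ \mathrm{tr}_{\mathcal H}(\gamma a_0[D,a_1][D,a_2]K^{-2}|D|^{-z})$$ is a $\sigma$-twisted Hochschild 2-cocycle that represents the fundamental Hochschild cohomology class of $\mathcal A$. It is cohomologous, in the $\sigma$-twisted Hochschild complex, to a nonzero multiple of $\tilde\varphi(a_0,a_1,a_2)=\varepsilon(a_0)E(a_1)F(a_2)$.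 -/

import Mathlib

open scoped TensorProduct

set_option linter.unusedSectionVars false
set_option linter.unusedSimpArgs false

noncomputable section

namespace Podles

/-! ## Hochschild (co)homology of a complex algebra, in the degrees that are needed -/

section Hochschild

variable {A : Type} [Ring A] [Algebra ℂ A]

section Bimodule

variable (M : Type) [AddCommGroup M] [Module ℂ M] [Module A M] [Module Aᵐᵒᵖ M]
  [SMulCommClass A Aᵐᵒᵖ M] [IsScalarTower ℂ A M] [IsScalarTower ℂ Aᵐᵒᵖ M]

/-- The right action `m ⊗ a ↦ m a`. -/
def rightAct : M ⊗[ℂ] A →ₗ[ℂ] M :=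
  TensorProduct.lift
    (((Algebra.lsmul ℂ ℂ M : Aᵐᵒᵖ →ₐ[ℂ] Module.End ℂ M).toLinearMap.comp
      (MulOpposite.opLinearEquiv ℂ : A ≃ₗ[ℂ] Aᵐᵒᵖ).toLinearMap).flip)

/-- The left action `a ⊗ m ↦ a m`. -/
def leftAct : A ⊗[ℂ] M →ₗ[ℂ] M :=
  TensorProduct.lift (Algebra.lsmul ℂ ℂ M : A →ₐ[ℂ] Module.End ℂ M).toLinearMap

/-- The twisted left action, `m ⊗ a ↦ σ(a) m`: the left action of the bimodule `_σM`. -/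
def twistedAct (σ : A ≃ₐ[ℂ] A) : M ⊗[ℂ] A →ₗ[ℂ] M :=
  TensorProduct.lift
    (((Algebra.lsmul ℂ ℂ M : A →ₐ[ℂ] Module.End ℂ M).toLinearMap.comp σ.toLinearMap).flip)

/-- Hochschild boundary `C₁(A, _σM) → C₀(A, _σM)`. -/
def b₁ (σ : A ≃ₐ[ℂ] A) : M ⊗[ℂ] A →ₗ[ℂ] M :=
  rightAct M - twistedAct M σ

/-- Hochschild boundary `C₂(A, _σM) → C₁(A, _σM)`. -/
def b₂ (σ : A ≃ₐ[ℂ] A) : M ⊗[ℂ] A ⊗[ℂ] A →ₗ[ℂ] M ⊗[ℂ] A :=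
  (rightAct M).rTensor A
    - (LinearMap.mul' ℂ A).lTensor M ∘ₗ (TensorProduct.assoc ℂ M A A).toLinearMap
    + (twistedAct M σ).rTensor A ∘ₗ (TensorProduct.rightComm ℂ M A A).toLinearMap

/-- Hochschild boundary `C₃(A, _σM) → C₂(A, _σM)`. -/
def b₃ (σ : A ≃ₐ[ℂ] A) : M ⊗[ℂ] A ⊗[ℂ] A ⊗[ℂ] A →ₗ[ℂ] M ⊗[ℂ] A ⊗[ℂ] A :=
  ((rightAct M).rTensor A).rTensor A
    - ((LinearMap.mul' ℂ A).lTensor M ∘ₗ (TensorProduct.assoc ℂ M A A).toLinearMap).rTensor A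
    + (LinearMap.mul' ℂ A).lTensor (M ⊗[ℂ] A) ∘ₗ
        (TensorProduct.assoc ℂ (M ⊗[ℂ] A) A A).toLinearMap
    - ((twistedAct M σ).rTensor A ∘ₗ (TensorProduct.rightComm ℂ M A A).toLinearMap).rTensor A ∘ₗ
        (TensorProduct.rightComm ℂ (M ⊗[ℂ] A) A A).toLinearMap

theorem b₁_tmul (σ : A ≃ₐ[ℂ] A) (m : M) (a : A) :
    b₁ M σ (m ⊗ₜ a) = MulOpposite.op a • m - σ a • m := by
  simp [b₁, rightAct, twistedAct]

theorem b₂_tmul (σ : A ≃ₐ[ℂ] A) (m : M) (a b : A) :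
    b₂ M σ (m ⊗ₜ a ⊗ₜ b) =
      (MulOpposite.op a • m) ⊗ₜ b - m ⊗ₜ (a * b) + (σ b • m) ⊗ₜ a := by
  simp [b₂, rightAct, twistedAct]

theorem b₃_tmul (σ : A ≃ₐ[ℂ] A) (m : M) (a b c : A) :
    b₃ M σ (m ⊗ₜ a ⊗ₜ b ⊗ₜ c) =
      (MulOpposite.op a • m) ⊗ₜ b ⊗ₜ c - m ⊗ₜ (a * b) ⊗ₜ c + m ⊗ₜ a ⊗ₜ (b * c)
        - (σ c • m) ⊗ₜ a ⊗ₜ b := by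
  simp [b₃, rightAct, twistedAct]

variable {M}

/-- Hochschild 0-cocycles with values in `M`. -/
def IsCocycle₀ (m : M) : Prop := ∀ a : A, a • m - MulOpposite.op a • m = 0

/-- Hochschild 1-cocycles with values in `M`. -/
def IsCocycle₁ (f : A →ₗ[ℂ] M) : Prop :=
  ∀ a b : A, a • f b - f (a * b) + MulOpposite.op b • f a = 0

def IsCoboundary₁ (f : A →ₗ[ℂ] M) : Prop :=
  ∃ m : M, ∀ a : A, f a = a • m - MulOpposite.op a • m

/-- Hochschild 2-cocycles with values in `M`. -/
def IsCocycle₂ (f : A →ₗ[ℂ] A →ₗ[ℂ] M) : Prop :=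
  ∀ a b c : A, a • f b c - f (a * b) c + f a (b * c) - MulOpposite.op c • f a b = 0

def IsCoboundary₂ (f : A →ₗ[ℂ] A →ₗ[ℂ] M) : Prop :=
  ∃ g : A →ₗ[ℂ] M, ∀ a b : A, f a b = a • g b - g (a * b) + MulOpposite.op b • g a

/-- Hochschild 3-cocycles with values in `M`. -/
def IsCocycle₃ (f : A →ₗ[ℂ] A →ₗ[ℂ] A →ₗ[ℂ] M) : Prop :=
  ∀ a b c d : A, a • f b c d - f (a * b) c d + f a (b * c) d - f a b (c * d)
    + MulOpposite.op d • f a b c = 0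

def IsCoboundary₃ (f : A →ₗ[ℂ] A →ₗ[ℂ] A →ₗ[ℂ] M) : Prop :=
  ∃ g : A →ₗ[ℂ] A →ₗ[ℂ] M, ∀ a b c : A,
    f a b c = a • g b c - g (a * b) c + g a (b * c) - MulOpposite.op c • g a b

/-- Cap product of 2-chains over `_σA` with 0-cochains:
`(a₀ ⊗ a₁ ⊗ a₂) ∩ m = a₀ m ⊗ a₁ ⊗ a₂`. -/
def cap₀ (m : M) : A ⊗[ℂ] A ⊗[ℂ] A →ₗ[ℂ] M ⊗[ℂ] A ⊗[ℂ] A :=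
  (((Algebra.lsmul ℂ ℂ M : A →ₐ[ℂ] Module.End ℂ M).toLinearMap.flip m).rTensor A).rTensor A

/-- Cap product with 1-cochains: `(a₀ ⊗ a₁ ⊗ a₂) ∩ f = a₀ f(a₁) ⊗ a₂`. -/
def cap₁ (f : A →ₗ[ℂ] M) : A ⊗[ℂ] A ⊗[ℂ] A →ₗ[ℂ] M ⊗[ℂ] A :=
  (leftAct M ∘ₗ f.lTensor A).rTensor A

/-- Cap product with 2-cochains: `(a₀ ⊗ a₁ ⊗ a₂) ∩ f = a₀ f(a₁, a₂)`. -/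
def cap₂ (f : A →ₗ[ℂ] A →ₗ[ℂ] M) : A ⊗[ℂ] A ⊗[ℂ] A →ₗ[ℂ] M :=
  leftAct M ∘ₗ (TensorProduct.lift f).lTensor A ∘ₗ (TensorProduct.assoc ℂ A A A).toLinearMap

theorem cap₀_tmul (m : M) (a b c : A) :
    cap₀ m (a ⊗ₜ b ⊗ₜ c) = (a • m) ⊗ₜ[ℂ] b ⊗ₜ[ℂ] c := by
  simp [cap₀]

theorem cap₁_tmul (f : A →ₗ[ℂ] M) (a b c : A) :
    cap₁ f (a ⊗ₜ b ⊗ₜ c) = (a • f b) ⊗ₜ[ℂ] c := by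
  simp [cap₁, leftAct]

theorem cap₂_tmul (f : A →ₗ[ℂ] A →ₗ[ℂ] M) (a b c : A) :
    cap₂ f (a ⊗ₜ b ⊗ₜ c) = a • f b c := by
  simp [cap₂, leftAct]

variable (M)

/-- Poincaré duality in dimension 2 with coefficients in `M`: the cap product with the 2-cycle `c`
over `_σA` induces isomorphisms `Hⁱ(A, M) → H_{2-i}(A, _σM)` for `i = 0, 1, 2` (for each `i`,
injectivity and then surjectivity), and `H³(A, M) = 0`. (If `H³` vanishes for all bimodules, so
does `Hⁱ` for all `i > 2`, by dimension shifting.) -/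
structure PoincareDuality (σ : A ≃ₐ[ℂ] A) (c : A ⊗[ℂ] A ⊗[ℂ] A) : Prop where
  inj₀ : ∀ m : M, IsCocycle₀ (A := A) m → cap₀ m c ∈ LinearMap.range (b₃ M σ) → m = 0
  surj₀ : ∀ w : M ⊗[ℂ] A ⊗[ℂ] A, b₂ M σ w = 0 →
    ∃ m : M, IsCocycle₀ (A := A) m ∧ w - cap₀ m c ∈ LinearMap.range (b₃ M σ)
  inj₁ : ∀ f : A →ₗ[ℂ] M, IsCocycle₁ f → cap₁ f c ∈ LinearMap.range (b₂ M σ) → IsCoboundary₁ f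
  surj₁ : ∀ w : M ⊗[ℂ] A, b₁ M σ w = 0 →
    ∃ f : A →ₗ[ℂ] M, IsCocycle₁ f ∧ w - cap₁ f c ∈ LinearMap.range (b₂ M σ)
  inj₂ : ∀ f : A →ₗ[ℂ] A →ₗ[ℂ] M, IsCocycle₂ f → cap₂ f c ∈ LinearMap.range (b₁ M σ) →
    IsCoboundary₂ f
  surj₂ : ∀ w : M, ∃ f : A →ₗ[ℂ] A →ₗ[ℂ] M,
    IsCocycle₂ f ∧ w - cap₂ f c ∈ LinearMap.range (b₁ M σ)
  vanish₃ : ∀ f : A →ₗ[ℂ] A →ₗ[ℂ] A →ₗ[ℂ] M, IsCocycle₃ f → IsCoboundary₃ f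

end Bimodule

/-- `c` is a 2-cycle over `_σA` that represents the fundamental Hochschild homology class: the cap
product with `c` is the Poincaré duality isomorphism for all bimodules `M`. Under this isomorphism
for `M = A`, the unit `1 ∈ H⁰(A, A)` corresponds to the class of `c`. -/
def IsFundamentalCycle (σ : A ≃ₐ[ℂ] A) (c : A ⊗[ℂ] A ⊗[ℂ] A) : Prop :=
  b₂ A σ c = 0 ∧
  ∀ (M : Type) [AddCommGroup M] [Module ℂ M] [Module A M] [Module Aᵐᵒᵖ M]
    [SMulCommClass A Aᵐᵒᵖ M] [IsScalarTower ℂ A M] [IsScalarTower ℂ Aᵐᵒᵖ M],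
    PoincareDuality M σ c

/-- Twisted Hochschild 2-cocycles, that is, 2-cocycles on the complex `C_•(A, _σA)`. -/
def IsTwistedCocycle (σ : A ≃ₐ[ℂ] A) (φ : A →ₗ[ℂ] A →ₗ[ℂ] A →ₗ[ℂ] ℂ) : Prop :=
  ∀ a₀ a₁ a₂ a₃ : A,
    φ (a₀ * a₁) a₂ a₃ - φ a₀ (a₁ * a₂) a₃ + φ a₀ a₁ (a₂ * a₃) - φ (σ a₃ * a₀) a₁ a₂ = 0

/-- Two twisted 2-cochains differ by a twisted Hochschild coboundary. -/
def Cohomologous (σ : A ≃ₐ[ℂ] A) (φ φ' : A →ₗ[ℂ] A →ₗ[ℂ] A →ₗ[ℂ] ℂ) : Prop :=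
  ∃ ψ : A →ₗ[ℂ] A →ₗ[ℂ] ℂ, ∀ a₀ a₁ a₂ : A,
    φ a₀ a₁ a₂ - φ' a₀ a₁ a₂ = ψ (a₀ * a₁) a₂ - ψ a₀ (a₁ * a₂) + ψ (σ a₂ * a₀) a₁

/-- The value of a 2-cochain on a 2-chain. -/
def pairing (φ : A →ₗ[ℂ] A →ₗ[ℂ] A →ₗ[ℂ] ℂ) : A ⊗[ℂ] A ⊗[ℂ] A →ₗ[ℂ] ℂ :=
  TensorProduct.lift (TensorProduct.lift φ)

/-- The cocycle `φ` represents the fundamental Hochschild cohomology class (which is defined up to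
a nonzero scalar): the fundamental homology class `[c]` spans `H₂(A, _σA)`, and the functional on
`H₂(A, _σA)` induced by `φ` is a nonzero multiple of the one dual to `[c]`. -/
def RepresentsFundamentalClass (σ : A ≃ₐ[ℂ] A) (φ : A →ₗ[ℂ] A →ₗ[ℂ] A →ₗ[ℂ] ℂ) : Prop :=
  IsTwistedCocycle σ φ ∧
  ∃ c : A ⊗[ℂ] A ⊗[ℂ] A, IsFundamentalCycle σ c ∧
    (∀ w : A ⊗[ℂ] A ⊗[ℂ] A, b₂ A σ w = 0 →
      ∃ s : ℂ, w - s • c ∈ LinearMap.range (b₃ A σ)) ∧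
    pairing φ c ≠ 0

end Hochschild

/-! ## The coordinate algebras of the standard Podleś sphere and of quantum `SU(2)` -/

/-- Generators of the coordinate ring of the Podleś sphere; `Bs` stands for `B*`. -/
inductive SphereGen
  | A | B | Bs

open FreeAlgebra in
/-- `BA = q²AB`, `AB* = q²B*A`, `B*B = A - A²`, `BB* = q²A - q⁴A²`. -/
inductive SphereRel (q : ℝ) : FreeAlgebra ℂ SphereGen → FreeAlgebra ℂ SphereGen → Prop
  | BA : SphereRel q (ι ℂ .B * ι ℂ .A) ((q : ℂ) ^ 2 • (ι ℂ .A * ι ℂ .B))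
  | ABs : SphereRel q (ι ℂ .A * ι ℂ .Bs) ((q : ℂ) ^ 2 • (ι ℂ .Bs * ι ℂ .A))
  | BsB : SphereRel q (ι ℂ .Bs * ι ℂ .B) (ι ℂ .A - ι ℂ .A ^ 2)
  | BBs : SphereRel q (ι ℂ .B * ι ℂ .Bs) ((q : ℂ) ^ 2 • ι ℂ .A - (q : ℂ) ^ 4 • ι ℂ .A ^ 2)

/-- The coordinate ring of the standard Podleś sphere. -/
abbrev Sphere (q : ℝ) : Type := RingQuot (SphereRel q)

/-- The class of a generator. -/
def Sphere.gen (q : ℝ) (g : SphereGen) : Sphere q :=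
  RingQuot.mkAlgHom ℂ (SphereRel q) (FreeAlgebra.ι ℂ g)

/-- The matrix coefficients that generate the coordinate ring of quantum `SU(2)`. -/
inductive SUGen
  | a | b | c | d

open FreeAlgebra in
/-- `ab = qba`, `ac = qca`, `bd = qdb`, `cd = qdc`, `bc = cb`, `ad = 1 + qbc`, `da = 1 + q⁻¹bc`. -/
inductive SURel (q : ℝ) : FreeAlgebra ℂ SUGen → FreeAlgebra ℂ SUGen → Prop
  | ab : SURel q (ι ℂ .a * ι ℂ .b) ((q : ℂ) • (ι ℂ .b * ι ℂ .a))
  | ac : SURel q (ι ℂ .a * ι ℂ .c) ((q : ℂ) • (ι ℂ .c * ι ℂ .a))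
  | bd : SURel q (ι ℂ .b * ι ℂ .d) ((q : ℂ) • (ι ℂ .d * ι ℂ .b))
  | cd : SURel q (ι ℂ .c * ι ℂ .d) ((q : ℂ) • (ι ℂ .d * ι ℂ .c))
  | bc : SURel q (ι ℂ .b * ι ℂ .c) (ι ℂ .c * ι ℂ .b)
  | ad : SURel q (ι ℂ .a * ι ℂ .d) (1 + (q : ℂ) • (ι ℂ .b * ι ℂ .c))
  | da : SURel q (ι ℂ .d * ι ℂ .a) (1 + (q : ℂ)⁻¹ • (ι ℂ .b * ι ℂ .c))

/-- The coordinate ring of quantum `SU(2)`. -/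
abbrev SU (q : ℝ) : Type := RingQuot (SURel q)

/-- The class of a generator. -/
def SU.gen (q : ℝ) (g : SUGen) : SU q :=
  RingQuot.mkAlgHom ℂ (SURel q) (FreeAlgebra.ι ℂ g)

/-- The embedding of the Podleś sphere on generators: `A = -q⁻¹bc`, `B = ac`, and
`B* = c*a* = -q⁻¹bd` (recall `c = -q⁻¹b*`, `d = a*`). -/
def embedGen (q : ℝ) : SphereGen → SU q
  | .A => -(q : ℂ)⁻¹ • (SU.gen q .b * SU.gen q .c)
  | .B => SU.gen q .a * SU.gen q .c
  | .Bs => -(q : ℂ)⁻¹ • (SU.gen q .b * SU.gen q .d)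

theorem embedGen_rel {q : ℝ} (hq : 0 < q) ⦃x y : FreeAlgebra ℂ SphereGen⦄
    (h : SphereRel q x y) :
    FreeAlgebra.lift ℂ (embedGen q) x = FreeAlgebra.lift ℂ (embedGen q) y := by
  have hq' : (q : ℂ) ≠ 0 := by exact_mod_cast hq.ne'
  have hab : SU.gen q .a * SU.gen q .b = (q : ℂ) • (SU.gen q .b * SU.gen q .a) := by
    have h := RingQuot.mkAlgHom_rel ℂ (SURel.ab (q := q))
    simp only [map_mul, map_smul, map_add, map_one] at h
    exact h
  have hac : SU.gen q .a * SU.gen q .c = (q : ℂ) • (SU.gen q .c * SU.gen q .a) := by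
    have h := RingQuot.mkAlgHom_rel ℂ (SURel.ac (q := q))
    simp only [map_mul, map_smul, map_add, map_one] at h
    exact h
  have hbd : SU.gen q .b * SU.gen q .d = (q : ℂ) • (SU.gen q .d * SU.gen q .b) := by
    have h := RingQuot.mkAlgHom_rel ℂ (SURel.bd (q := q))
    simp only [map_mul, map_smul, map_add, map_one] at h
    exact h
  have hcd : SU.gen q .c * SU.gen q .d = (q : ℂ) • (SU.gen q .d * SU.gen q .c) := by
    have h := RingQuot.mkAlgHom_rel ℂ (SURel.cd (q := q))
    simp only [map_mul, map_smul, map_add, map_one] at h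
    exact h
  have hbc : SU.gen q .b * SU.gen q .c = SU.gen q .c * SU.gen q .b := by
    have h := RingQuot.mkAlgHom_rel ℂ (SURel.bc (q := q))
    simp only [map_mul, map_smul, map_add, map_one] at h
    exact h
  have had : SU.gen q .a * SU.gen q .d = 1 + (q : ℂ) • (SU.gen q .b * SU.gen q .c) := by
    have h := RingQuot.mkAlgHom_rel ℂ (SURel.ad (q := q))
    simp only [map_mul, map_smul, map_add, map_one] at h
    exact h
  have hda : SU.gen q .d * SU.gen q .a = 1 + (q : ℂ)⁻¹ • (SU.gen q .b * SU.gen q .c) := by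
    have h := RingQuot.mkAlgHom_rel ℂ (SURel.da (q := q))
    simp only [map_mul, map_smul, map_add, map_one] at h
    exact h
  have e₁ : ∀ x, SU.gen q .a * (SU.gen q .b * x) = (q : ℂ) • (SU.gen q .b * (SU.gen q .a * x)) := by
    intro x; rw [← mul_assoc, hab, smul_mul_assoc, mul_assoc]
  have e₂ : ∀ x, SU.gen q .a * (SU.gen q .c * x) = (q : ℂ) • (SU.gen q .c * (SU.gen q .a * x)) := by
    intro x; rw [← mul_assoc, hac, smul_mul_assoc, mul_assoc]
  have e₃ : ∀ x, SU.gen q .c * (SU.gen q .b * x) = SU.gen q .b * (SU.gen q .c * x) := by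
    intro x; rw [← mul_assoc, ← hbc, mul_assoc]
  have e₄ : ∀ x, SU.gen q .a * (SU.gen q .d * x) =
      x + (q : ℂ) • (SU.gen q .b * (SU.gen q .c * x)) := by
    intro x; rw [← mul_assoc, had, add_mul, one_mul, smul_mul_assoc, mul_assoc]
  have e₅ : ∀ x, SU.gen q .d * (SU.gen q .a * x) =
      x + (q : ℂ)⁻¹ • (SU.gen q .b * (SU.gen q .c * x)) := by
    intro x; rw [← mul_assoc, hda, add_mul, one_mul, smul_mul_assoc, mul_assoc]
  have hdb : SU.gen q .d * SU.gen q .b = (q : ℂ)⁻¹ • (SU.gen q .b * SU.gen q .d) := by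
    rw [hbd, smul_smul, inv_mul_cancel₀ hq', one_smul]
  have hdc : SU.gen q .d * SU.gen q .c = (q : ℂ)⁻¹ • (SU.gen q .c * SU.gen q .d) := by
    rw [hcd, smul_smul, inv_mul_cancel₀ hq', one_smul]
  have e₆ : ∀ x, SU.gen q .d * (SU.gen q .b * x) =
      (q : ℂ)⁻¹ • (SU.gen q .b * (SU.gen q .d * x)) := by
    intro x; rw [← mul_assoc, hdb, smul_mul_assoc, mul_assoc]
  cases h <;>
  simp only [map_mul, map_smul, map_sub, map_pow, FreeAlgebra.lift_ι_apply, embedGen, pow_two,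
    smul_mul_assoc, mul_smul_comm, mul_assoc, e₁, e₂, e₃, e₄, e₅, e₆, had, hda, ← hbc, hdc,
    mul_add, mul_one, smul_add, smul_smul] <;>
  match_scalars <;> field_simp

/-- The embedding of the coordinate ring of the Podleś sphere into that of quantum `SU(2)`. -/
def embed {q : ℝ} (hq : 0 < q) : Sphere q →ₐ[ℂ] SU q :=
  RingQuot.liftAlgHom ℂ ⟨FreeAlgebra.lift ℂ (embedGen q), embedGen_rel hq⟩

/-- The counit on generators. -/
def counitGen : SUGen → ℂ
  | .a => 1
  | .b => 0
  | .c => 0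
  | .d => 1

theorem counitGen_rel {q : ℝ} ⦃x y : FreeAlgebra ℂ SUGen⦄ (h : SURel q x y) :
    FreeAlgebra.lift ℂ counitGen x = FreeAlgebra.lift ℂ counitGen y := by
  cases h <;> simp only [map_mul, map_smul, map_add, map_one, FreeAlgebra.lift_ι_apply] <;>
    simp [counitGen]

/-- The counit `ε` of quantum `SU(2)`. -/
def counit (q : ℝ) : SU q →ₐ[ℂ] ℂ :=
  RingQuot.liftAlgHom ℂ ⟨FreeAlgebra.lift ℂ counitGen, counitGen_rel⟩

/-- `q^{1/2}` as a complex number. -/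
def rt (q : ℝ) : ℂ := ((q ^ (1 / 2 : ℝ) : ℝ) : ℂ)

/-- Since `Δ(E) = E ⊗ K + K⁻¹ ⊗ E`, the functional `E` satisfies
`E(xy) = E(x)K(y) + K⁻¹(x)E(y)`, that is, `x ↦ !![K⁻¹(x), E(x); 0, K(x)]` is multiplicative.
On generators, `K(a) = q^{-1/2}`, `K(d) = q^{1/2}`, `K(b) = K(c) = 0`, and
`E(c) = 1`, `E(a) = E(b) = E(d) = 0`. -/
def matE (q : ℝ) : SUGen → Matrix (Fin 2) (Fin 2) ℂ
  | .a => !![rt q, 0; 0, (rt q)⁻¹]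
  | .b => 0
  | .c => !![0, 1; 0, 0]
  | .d => !![(rt q)⁻¹, 0; 0, rt q]

/-- The same for `F`, where `F(b) = 1`, `F(a) = F(c) = F(d) = 0`. -/
def matF (q : ℝ) : SUGen → Matrix (Fin 2) (Fin 2) ℂ
  | .a => !![rt q, 0; 0, (rt q)⁻¹]
  | .b => !![0, 1; 0, 0]
  | .c => 0
  | .d => !![(rt q)⁻¹, 0; 0, rt q]

theorem rt_ne_zero {q : ℝ} (hq : 0 < q) : rt q ≠ 0 := by
  have := (Real.rpow_pos_of_pos hq (1 / 2 : ℝ)).ne'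
  unfold rt
  exact_mod_cast this

theorem rt_mul_self {q : ℝ} (hq : 0 < q) : rt q * rt q = q := by
  rw [rt, ← Complex.ofReal_mul, ← Real.rpow_add hq]; norm_num

theorem matE_rel {q : ℝ} (hq : 0 < q) ⦃x y : FreeAlgebra ℂ SUGen⦄ (h : SURel q x y) :
    FreeAlgebra.lift ℂ (matE q) x = FreeAlgebra.lift ℂ (matE q) y := by
  have h₁ := rt_ne_zero hq
  have h₂ := rt_mul_self hq
  cases h <;> ext i j <;> fin_cases i <;> fin_cases j <;>
    simp [matE, Matrix.mul_apply, Fin.sum_univ_two, h₁, ← h₂]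

theorem matF_rel {q : ℝ} (hq : 0 < q) ⦃x y : FreeAlgebra ℂ SUGen⦄ (h : SURel q x y) :
    FreeAlgebra.lift ℂ (matF q) x = FreeAlgebra.lift ℂ (matF q) y := by
  have h₁ := rt_ne_zero hq
  have h₂ := rt_mul_self hq
  cases h <;> ext i j <;> fin_cases i <;> fin_cases j <;>
    simp [matF, Matrix.mul_apply, Fin.sum_univ_two, h₁, ← h₂]

/-- The functional `E` on the coordinate ring of quantum `SU(2)`. -/
def funE {q : ℝ} (hq : 0 < q) : SU q →ₗ[ℂ] ℂ :=
  Matrix.entryLinearMap ℂ ℂ 0 1 ∘ₗ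
    (RingQuot.liftAlgHom ℂ ⟨FreeAlgebra.lift ℂ (matE q), matE_rel hq⟩ :
      SU q →ₐ[ℂ] Matrix (Fin 2) (Fin 2) ℂ).toLinearMap

/-- The functional `F` on the coordinate ring of quantum `SU(2)`. -/
def funF {q : ℝ} (hq : 0 < q) : SU q →ₗ[ℂ] ℂ :=
  Matrix.entryLinearMap ℂ ℂ 0 1 ∘ₗ
    (RingQuot.liftAlgHom ℂ ⟨FreeAlgebra.lift ℂ (matF q), matF_rel hq⟩ :
      SU q →ₐ[ℂ] Matrix (Fin 2) (Fin 2) ℂ).toLinearMap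

/-- The functional `(a₀, a₁, a₂) ↦ ε(a₀) E(a₁) F(a₂)` on the Podleś sphere. -/
def stdCocycle {q : ℝ} (hq : 0 < q) : Sphere q →ₗ[ℂ] Sphere q →ₗ[ℂ] Sphere q →ₗ[ℂ] ℂ :=
  let ε : Sphere q →ₗ[ℂ] ℂ := ((counit q).comp (embed hq)).toLinearMap
  let E : Sphere q →ₗ[ℂ] ℂ := funE hq ∘ₗ (embed hq).toLinearMap
  let F : Sphere q →ₗ[ℂ] ℂ := funF hq ∘ₗ (embed hq).toLinearMap
  ε.smulRight (E.smulRight F)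

theorem stdCocycle_apply {q : ℝ} (hq : 0 < q) (a₀ a₁ a₂ : Sphere q) :
    stdCocycle hq a₀ a₁ a₂ =
      counit q (embed hq a₀) * funE hq (embed hq a₁) * funF hq (embed hq a₂) := by
  simp [stdCocycle, mul_assoc]

/-! ## The spectral triple -/

/-- Labels of the orthonormal basis `v^l_{k,±}`: the triple `((L, m), s)` stands for `l = L/2`,
`k = m/2`, where `l ∈ {1/2, 3/2, …}` and `k ∈ {-l, -l+1, …, l}`, and for the sign `+` if `s` is
`true`, `-` if `s` is `false`. -/
abbrev Idx : Type :=
  {p : ℤ × ℤ // 0 < p.1 ∧ Odd p.1 ∧ Odd p.2 ∧ |p.2| ≤ p.1} × Bool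

/-- The number `l` of a label. -/
def Idx.l (i : Idx) : ℝ := (i.1.1.1 : ℝ) / 2

/-- The number `k` of a label. -/
def Idx.k (i : Idx) : ℝ := (i.1.1.2 : ℝ) / 2

/-- The sign of a label, as a real number. -/
def Idx.sgn (i : Idx) : ℝ := if i.2 then 1 else -1

/-- The common domain `Dom(D)`: the span of the basis vectors. -/
abbrev Dom : Type := Idx →₀ ℂ

/-- `v^{L/2}_{m/2,s}`, understood to be zero if the label is out of range. -/
def vec (L m : ℤ) (s : Bool) : Dom :=
  if h : 0 < L ∧ Odd L ∧ Odd m ∧ |m| ≤ L then Finsupp.single (⟨(L, m), h⟩, s) 1 else 0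

/-- The operator on `Dom(D)` with given values on the basis vectors. -/
def opOf (f : Idx → Dom) : Module.End ℂ Dom := Finsupp.linearCombination ℂ f

/-- The diagonal operator with given eigenvalues. -/
def diagOp (d : Idx → ℂ) : Module.End ℂ Dom := opOf fun i => d i • Finsupp.single i 1

/-- The `q`-number `[x]_q`. -/
def qnum (q x : ℝ) : ℝ := (q ^ x - q ^ (-x)) / (q - q⁻¹)

/-- `D v^l_{k,±} = [l+1/2] v^l_{k,∓}`. -/
def opD (q : ℝ) : Module.End ℂ Dom :=
  opOf fun i => (qnum q (i.l + 1 / 2) : ℂ) • Finsupp.single (i.1, !i.2) 1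

/-- `|D|^{-z} v^l_{k,±} = [l+1/2]^{-z} v^l_{k,±}`. -/
def absDPow (q : ℝ) (z : ℂ) : Module.End ℂ Dom :=
  diagOp fun i => (qnum q (i.l + 1 / 2) : ℂ) ^ (-z)

/-- The grading `γ v^l_{k,±} = ± v^l_{k,±}`. -/
def opγ : Module.End ℂ Dom := diagOp fun i => (i.sgn : ℂ)

/-- `K^δ v^l_{k,±} = q^{δk} v^l_{k,±}`. -/
def opK (q δ : ℝ) : Module.End ℂ Dom := diagOp fun i => ((q ^ (δ * i.k) : ℝ) : ℂ)

/-- `E v^l_{k,±} = ([l-k][l+k+1])^{1/2} v^l_{k+1,±}`. -/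
def opE (q : ℝ) : Module.End ℂ Dom :=
  opOf fun i => ((√(qnum q (i.l - i.k) * qnum q (i.l + i.k + 1)) : ℝ) : ℂ) •
    vec i.1.1.1 (i.1.1.2 + 2) i.2

/-- `F v^l_{k,±} = ([l-k+1][l+k])^{1/2} v^l_{k-1,±}`. -/
def opF (q : ℝ) : Module.End ℂ Dom :=
  opOf fun i => ((√(qnum q (i.l - i.k + 1) * qnum q (i.l + i.k)) : ℝ) : ℂ) •
    vec i.1.1.1 (i.1.1.2 - 2) i.2

/-- `α⁻₀(l,k)_±`; the sign `±1` is the argument `s`. -/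
def αMinus (q l k s : ℝ) : ℝ :=
  q ^ (k + s / 2) * qnum q 2 * √(qnum q (l - k)) * √(qnum q (l + k)) * √(qnum q (l - 1 / 2)) *
      √(qnum q (l + 1 / 2)) /
    (√(qnum q (2 * l - 1)) * qnum q (2 * l) * √(qnum q (2 * l + 1)))

/-- `β_±(l)`. -/
def βCoeff (q l s : ℝ) : ℝ :=
  (s * q ^ (-s) + (q - q⁻¹) * (qnum q (1 / 2) * qnum q (3 / 2) - qnum q l * qnum q (l + 1))) /
    (q * qnum q (2 * l + 2))

/-- `α⁰₀(l,k)_±`. -/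
def αZero (q l k s : ℝ) : ℝ :=
  (qnum q (2 * l))⁻¹ *
    (qnum q (l - k + 1) * qnum q (l + k) - q ^ 2 * qnum q (l - k) * qnum q (l + k + 1)) *
    βCoeff q l s

/-- The action of `x₀ = 1 - (1+q²)A`:
`x₀ v^l_k = α⁻₀(l,k) v^{l-1}_k + α⁰₀(l,k) v^l_k + α⁺₀(l,k) v^{l+1}_k`,
where `α⁺₀(l,k) = α⁻₀(l+1,k)`. -/
def opX₀ (q : ℝ) : Module.End ℂ Dom :=
  opOf fun i =>
    (αMinus q i.l i.k i.sgn : ℂ) • vec (i.1.1.1 - 2) i.1.1.2 i.2 +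
    (αZero q i.l i.k i.sgn : ℂ) • vec i.1.1.1 i.1.1.2 i.2 +
    (αMinus q (i.l + 1) i.k i.sgn : ℂ) • vec (i.1.1.1 + 2) i.1.1.2 i.2

/-- The action of `x₁`. It is determined by equivariance,
`E x₀ = (E ▷ x₀) K + (K⁻¹ ▷ x₀) E = [2]^{1/2} x₁ K + x₀ E`. -/
def opX₁ (q : ℝ) : Module.End ℂ Dom :=
  ((√(qnum q 2) : ℝ) : ℂ)⁻¹ • ((opE q * opX₀ q - opX₀ q * opE q) * opK q (-1))

/-- The action of `x₋₁`. It is determined by equivariance,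
`F x₀ = (F ▷ x₀) K + (K⁻¹ ▷ x₀) F = [2]^{1/2} x₋₁ K + x₀ F`. -/
def opXm₁ (q : ℝ) : Module.End ℂ Dom :=
  ((√(qnum q 2) : ℝ) : ℂ)⁻¹ • ((opF q * opX₀ q - opX₀ q * opF q) * opK q (-1))

/-- The representation of the Podleś sphere on `Dom(D)` in the Dąbrowski–Sitarz spectral triple, where
`x₀ = 1 - (1+q²)A`, `x₋₁ = (1+q⁻²)^{1/2} B`, `x₁ = -(1+q²)^{1/2} B*`. -/
structure IsSpinRep (q : ℝ) (π : Sphere q →ₐ[ℂ] Module.End ℂ Dom) : Prop where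
  map_A : opX₀ q = 1 - (1 + (q : ℂ) ^ 2) • π (Sphere.gen q .A)
  map_B : opXm₁ q = ((√(1 + q⁻¹ ^ 2) : ℝ) : ℂ) • π (Sphere.gen q .B)
  map_Bs : opX₁ q = -((√(1 + q ^ 2) : ℝ) : ℂ) • π (Sphere.gen q .Bs)

/-- The commutator `[D, a]`. -/
def commD {q : ℝ} (π : Sphere q →ₐ[ℂ] Module.End ℂ Dom) (a : Sphere q) : Module.End ℂ Dom :=
  opD q * π a - π a * opD q

/-- The operator `γ a₀ [D, a₁] [D, a₂] K⁻² |D|^{-z}`. -/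
def mainOp {q : ℝ} (π : Sphere q →ₐ[ℂ] Module.End ℂ Dom) (a₀ a₁ a₂ : Sphere q) (z : ℂ) :
    Module.End ℂ Dom :=
  opγ * π a₀ * commD π a₁ * commD π a₂ * opK q (-2) * absDPow q z

/-- The Hilbert space with orthonormal basis `v^l_{k,±}`. -/
abbrev HilbertH : Type := lp (fun _ : Idx => ℂ) 2

/-- The standard orthonormal basis. -/
def basisH : HilbertBasis Idx ℂ HilbertH := ⟨LinearIsometryEquiv.refl ℂ HilbertH⟩

/-- The inclusion of `Dom(D)` into the Hilbert space. -/
def toH : Dom →ₗ[ℂ] HilbertH := Finsupp.linearCombination ℂ basisH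

/-- A bounded operator `S` is of trace class if the sum of `⟨v, |S| v⟩`, `|S| = (S*S)^{1/2}`, over
an orthonormal basis is finite. (The sum is the same for all orthonormal bases.) -/
def IsTraceClassOp {ι H : Type} [NormedAddCommGroup H] [InnerProductSpace ℂ H] [CompleteSpace H]
    (e : HilbertBasis ι ℂ H) (S : H →L[ℂ] H) : Prop :=
  Summable fun i : ι => (inner ℂ (e i) (CFC.abs S (e i))).re

/-- The closure of the operator `T`, given on `Dom(D)`, is a bounded operator of trace class. -/
def IsTraceClass (T : Module.End ℂ Dom) : Prop :=
  ∃ S : HilbertH →L[ℂ] HilbertH, (∀ v : Dom, S (toH v) = toH (T v)) ∧ IsTraceClassOp basisH S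

/-- The trace of (the closure of) a trace class operator given on `Dom(D)`. -/
def trace (T : Module.End ℂ Dom) : ℂ :=
  ∑' i : Idx, inner ℂ (basisH i) (toH (T (Finsupp.single i 1)))

end Podles

end

noncomputable section

namespace Podles

open LinearMap (comp_apply coe_restrictScalars rTensor_surjective)
open TensorProduct (tmul_smul smul_tmul' add_tmul tmul_add sub_tmul tmul_sub induction_on
  curry_apply)
open Real (rpow_add rpow_pos_of_pos rpow_le_rpow_of_exponent_ge rpow_one rpow_neg rpow_natCast
  rpow_intCast rpow_mul rpow_neg_one log sq_sqrt mul_self_sqrt rpow_le_one)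
open LinearMap renaming congr_fun → lcongr_fun, sub_apply → lsub_apply,
  add_apply → ladd_apply, smul_apply → lsmul_apply

theorem ofReal_ne_zero {q : ℝ} (hq : 0 < q) : (q : ℂ) ≠ 0 := mod_cast hq.ne'

/-! ## Poincaré duality from a short bimodule resolution -/

section Duality

variable {A : Type} [Ring A] [Algebra ℂ A]

open MulOpposite

/-- The boundary `x ⊗ a ⊗ y ↦ xa ⊗ y - x ⊗ ay` of the bar resolution. -/
def barBoundary : A ⊗[ℂ] A ⊗[ℂ] A →ₗ[ℂ] A ⊗[ℂ] A :=
  (LinearMap.mul' ℂ A).rTensor A -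
    (LinearMap.mul' ℂ A).lTensor A ∘ₗ (TensorProduct.assoc ℂ A A A).toLinearMap

@[simp] theorem barBoundary_tmul (x a y : A) :
    barBoundary (x ⊗ₜ[ℂ] a ⊗ₜ[ℂ] y) = (x * a) ⊗ₜ y - x ⊗ₜ (a * y) := by
  simp [barBoundary]

/-- Left multiplication on `A ⊗ A`. -/
def outerLeft (a : A) : A ⊗[ℂ] A →ₗ[ℂ] A ⊗[ℂ] A := (LinearMap.mulLeft ℂ a).rTensor A

/-- Right multiplication on `A ⊗ A`. -/
def outerRight (a : A) : A ⊗[ℂ] A →ₗ[ℂ] A ⊗[ℂ] A := (LinearMap.mulRight ℂ a).lTensor A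

/-- Left multiplication on `A ⊗ A ⊗ A`. -/
def barLeft (a : A) : A ⊗[ℂ] A ⊗[ℂ] A →ₗ[ℂ] A ⊗[ℂ] A ⊗[ℂ] A := (outerLeft a).rTensor A

/-- Right multiplication on `A ⊗ A ⊗ A`. -/
def barRight (a : A) : A ⊗[ℂ] A ⊗[ℂ] A →ₗ[ℂ] A ⊗[ℂ] A ⊗[ℂ] A :=
  (LinearMap.mulRight ℂ a).lTensor (A ⊗[ℂ] A)

@[simp] theorem outerLeft_tmul (a x y : A) : outerLeft a (x ⊗ₜ[ℂ] y) = (a * x) ⊗ₜ y := by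
  simp [outerLeft]

@[simp] theorem outerRight_tmul (a x y : A) : outerRight a (x ⊗ₜ[ℂ] y) = x ⊗ₜ (y * a) := by
  simp [outerRight]

@[simp] theorem barLeft_tmul (a x b y : A) :
    barLeft a (x ⊗ₜ[ℂ] b ⊗ₜ[ℂ] y) = (a * x) ⊗ₜ b ⊗ₜ y := by
  simp [barLeft]

@[simp] theorem barRight_tmul (a x b y : A) :
    barRight a (x ⊗ₜ[ℂ] b ⊗ₜ[ℂ] y) = x ⊗ₜ b ⊗ₜ (y * a) := by
  simp [barRight]

theorem barBoundary_barLeft (a : A) (w : A ⊗[ℂ] A ⊗[ℂ] A) :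
    barBoundary (barLeft a w) = outerLeft a (barBoundary w) := by
  suffices h : barBoundary ∘ₗ barLeft a = outerLeft a ∘ₗ barBoundary from lcongr_fun h w
  ext x b y; simp [mul_assoc]

theorem barBoundary_barRight (a : A) (w : A ⊗[ℂ] A ⊗[ℂ] A) :
    barBoundary (barRight a w) = outerRight a (barBoundary w) := by
  suffices h : barBoundary ∘ₗ barRight a = outerRight a ∘ₗ barBoundary from lcongr_fun h w
  ext x b y; simp [mul_assoc]

theorem mul_barBoundary (w : A ⊗[ℂ] A ⊗[ℂ] A) : LinearMap.mul' ℂ A (barBoundary w) = 0 := by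
  suffices h : LinearMap.mul' ℂ A ∘ₗ barBoundary = 0 from lcongr_fun h w
  ext x b y; simp [mul_assoc]

/-- The 2-chain `σ(y) ⊗ x ⊗ a` obtained from an element `x ⊗ a ⊗ y` of the bar resolution. -/
def foldChain (σ : A ≃ₐ[ℂ] A) : A ⊗[ℂ] A ⊗[ℂ] A →ₗ[ℂ] A ⊗[ℂ] A ⊗[ℂ] A :=
  (TensorProduct.assoc ℂ A A A).symm.toLinearMap ∘ₗ (σ.toLinearMap).rTensor (A ⊗[ℂ] A) ∘ₗ
    (TensorProduct.comm ℂ (A ⊗[ℂ] A) A).toLinearMap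

@[simp] theorem foldChain_tmul (σ : A ≃ₐ[ℂ] A) (x a y : A) :
    foldChain σ (x ⊗ₜ[ℂ] a ⊗ₜ[ℂ] y) = σ y ⊗ₜ x ⊗ₜ a := by
  simp [foldChain]

/-- The bimodule `A ⊗ A`, with the actions `a (x ⊗ y) b = ax ⊗ yb`. -/
def Outer (A : Type) [Ring A] [Algebra ℂ A] : Type := A ⊗[ℂ] A

instance : AddCommGroup (Outer A) := inferInstanceAs (AddCommGroup (A ⊗[ℂ] A))

instance : Module ℂ (Outer A) := inferInstanceAs (Module ℂ (A ⊗[ℂ] A))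

/-- The identity map, as a map to the bimodule `A ⊗ A`. -/
def toOuter : A ⊗[ℂ] A ≃ₗ[ℂ] Outer A := LinearEquiv.refl ℂ _

theorem outerLeft_mul (a b : A) (w : A ⊗[ℂ] A) :
    outerLeft (a * b) w = outerLeft a (outerLeft b w) := by
  simp [outerLeft, LinearMap.rTensor_comp_apply]

theorem outerLeft_add (a b : A) (w : A ⊗[ℂ] A) :
    outerLeft (a + b) w = outerLeft a w + outerLeft b w := by
  suffices h : outerLeft (a + b) = outerLeft a + outerLeft b from lcongr_fun h w
  ext; simp [add_mul, add_tmul]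

theorem outerRight_mul (a b : A) (w : A ⊗[ℂ] A) :
    outerRight (a * b) w = outerRight b (outerRight a w) := by
  simp [outerRight, LinearMap.lTensor_comp_apply]

theorem outerRight_add (a b : A) (w : A ⊗[ℂ] A) :
    outerRight (a + b) w = outerRight a w + outerRight b w := by
  suffices h : outerRight (a + b) = outerRight a + outerRight b from lcongr_fun h w
  ext; simp [mul_add, tmul_add]

instance : Module A (Outer A) where
  smul a w := toOuter (outerLeft a (toOuter.symm w))
  one_smul w := by
    change toOuter (outerLeft 1 (toOuter.symm w)) = w
    simp [outerLeft]
  mul_smul a b w := congrArg toOuter (outerLeft_mul a b (toOuter.symm w))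
  smul_zero a := (outerLeft a).map_zero
  smul_add a := (outerLeft a).map_add
  zero_smul w := by
    change toOuter (outerLeft 0 (toOuter.symm w)) = 0
    simp [outerLeft]
  add_smul a b w := congrArg toOuter (outerLeft_add a b (toOuter.symm w))

instance : Module Aᵐᵒᵖ (Outer A) where
  smul a w := toOuter (outerRight (unop a) (toOuter.symm w))
  one_smul w := by
    change toOuter (outerRight 1 (toOuter.symm w)) = w
    simp [outerRight]
  mul_smul a b w := congrArg toOuter (outerRight_mul (unop b) (unop a) (toOuter.symm w))
  smul_zero a := (outerRight (unop a)).map_zero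
  smul_add a := (outerRight (unop a)).map_add
  zero_smul w := by
    change toOuter (outerRight 0 (toOuter.symm w)) = 0
    simp [outerRight]
  add_smul a b w := congrArg toOuter (outerRight_add (unop a) (unop b) (toOuter.symm w))

theorem smul_toOuter (a : A) (w : A ⊗[ℂ] A) : a • toOuter w = toOuter (outerLeft a w) := rfl

theorem op_smul_toOuter (a : A) (w : A ⊗[ℂ] A) : op a • toOuter w = toOuter (outerRight a w) := rfl

theorem outerLeft_outerRight (a b : A) (w : A ⊗[ℂ] A) :
    outerLeft a (outerRight b w) = outerRight b (outerLeft a w) := by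
  suffices h : outerLeft a ∘ₗ outerRight b = outerRight b ∘ₗ outerLeft a from
    lcongr_fun h w
  ext; simp

instance : SMulCommClass A Aᵐᵒᵖ (Outer A) where
  smul_comm a b w := congrArg toOuter (outerLeft_outerRight a (unop b) (toOuter.symm w))

instance : IsScalarTower ℂ A (Outer A) where
  smul_assoc s a w := by
    suffices h : outerLeft (s • a) = s • outerLeft a from
      congrArg toOuter (lcongr_fun h (toOuter.symm w))
    ext; simp [smul_tmul']

instance : IsScalarTower ℂ Aᵐᵒᵖ (Outer A) where
  smul_assoc s a w := by
    suffices h : outerRight (s • unop a) = s • outerRight (unop a) from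
      congrArg toOuter (lcongr_fun h (toOuter.symm w))
    ext; simp

section Eval

variable {M : Type} [AddCommGroup M] [Module ℂ M] [Module A M] [Module Aᵐᵒᵖ M]
  [SMulCommClass A Aᵐᵒᵖ M] [IsScalarTower ℂ A M] [IsScalarTower ℂ Aᵐᵒᵖ M]

@[simp] theorem rightAct_tmul (m : M) (a : A) : rightAct M (m ⊗ₜ[ℂ] a) = op a • m := by
  simp [rightAct]

/-- The right linear extension `x ⊗ y ↦ g(x) y`. -/
def evalRight (g : A →ₗ[ℂ] M) : A ⊗[ℂ] A →ₗ[ℂ] M := rightAct M ∘ₗ g.rTensor A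

/-- The right linear extension `x ⊗ a ⊗ y ↦ f(x, a) y`. -/
def evalRight₂ (f : A →ₗ[ℂ] A →ₗ[ℂ] M) : A ⊗[ℂ] A ⊗[ℂ] A →ₗ[ℂ] M :=
  rightAct M ∘ₗ (TensorProduct.lift f).rTensor A

/-- The bimodule map `x ⊗ y ↦ x m y`. -/
def sandwich (m : M) : A ⊗[ℂ] A →ₗ[ℂ] M :=
  evalRight ((Algebra.lsmul ℂ ℂ M : A →ₐ[ℂ] Module.End ℂ M).toLinearMap.flip m)

@[simp] theorem evalRight_tmul (g : A →ₗ[ℂ] M) (x y : A) :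
    evalRight g (x ⊗ₜ[ℂ] y) = op y • g x := by
  simp [evalRight]

@[simp] theorem evalRight₂_tmul (f : A →ₗ[ℂ] A →ₗ[ℂ] M) (x a y : A) :
    evalRight₂ f (x ⊗ₜ[ℂ] a ⊗ₜ[ℂ] y) = op y • f x a := by
  simp [evalRight₂]

@[simp] theorem sandwich_tmul (m : M) (x y : A) :
    sandwich m (x ⊗ₜ[ℂ] y) = op y • x • m := by
  simp [sandwich]

/-- The left action of `a` as a `ℂ`-linear map. -/
def leftMap (a : A) : M →ₗ[ℂ] M := (Algebra.lsmul ℂ ℂ M : A →ₐ[ℂ] Module.End ℂ M) a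

/-- The right action of `a` as a `ℂ`-linear map. -/
def rightMap (a : A) : M →ₗ[ℂ] M := (Algebra.lsmul ℂ ℂ M : Aᵐᵒᵖ →ₐ[ℂ] Module.End ℂ M) (op a)

@[simp] theorem leftMap_apply (a : A) (m : M) : leftMap a m = a • m := rfl

@[simp] theorem rightMap_apply (a : A) (m : M) : rightMap a m = op a • m := rfl

theorem sandwich_outerLeft (m : M) (a : A) (w : A ⊗[ℂ] A) :
    sandwich m (outerLeft a w) = a • sandwich m w := by
  suffices h : sandwich m ∘ₗ outerLeft a = leftMap a ∘ₗ sandwich m from lcongr_fun h w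
  ext x y; simp [mul_smul, smul_comm a (op y)]

theorem evalRight_outerRight (g : A →ₗ[ℂ] M) (a : A) (w : A ⊗[ℂ] A) :
    evalRight g (outerRight a w) = op a • evalRight g w := by
  suffices h : evalRight g ∘ₗ outerRight a = rightMap a ∘ₗ evalRight g from lcongr_fun h w
  ext x y; simp [mul_smul]

theorem sandwich_outerRight (m : M) (a : A) (w : A ⊗[ℂ] A) :
    sandwich m (outerRight a w) = op a • sandwich m w :=
  evalRight_outerRight _ a w

/-- `evalRight₂` depends linearly on the bilinear map. -/
def evalRightHom : (A →ₗ[ℂ] A →ₗ[ℂ] M) →ₗ[ℂ] A ⊗[ℂ] A ⊗[ℂ] A →ₗ[ℂ] M where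
  toFun := evalRight₂
  map_add' f g := by ext; simp
  map_smul' s f := by
    ext x a y
    simp [smul_comm s (op y)]

@[simp] theorem evalRightHom_apply (f : A →ₗ[ℂ] A →ₗ[ℂ] M) : evalRightHom f = evalRight₂ f := rfl

/-- The bimodule map `x ⊗ a ⊗ y ↦ x g(a) y`. -/
def evalMid (g : A →ₗ[ℂ] M) : A ⊗[ℂ] A ⊗[ℂ] A →ₗ[ℂ] M :=
  evalRight₂ ((Algebra.lsmul ℂ ℂ M : A →ₐ[ℂ] Module.End ℂ M).toLinearMap.compl₂ g)

@[simp] theorem evalMid_tmul (g : A →ₗ[ℂ] M) (x a y : A) :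
    evalMid g (x ⊗ₜ[ℂ] a ⊗ₜ[ℂ] y) = op y • x • g a := by
  simp [evalMid]

theorem evalRight₂_barRight (f : A →ₗ[ℂ] A →ₗ[ℂ] M) (a : A) (w : A ⊗[ℂ] A ⊗[ℂ] A) :
    evalRight₂ f (barRight a w) = op a • evalRight₂ f w := by
  suffices h : evalRight₂ f ∘ₗ barRight a = rightMap a ∘ₗ evalRight₂ f from lcongr_fun h w
  ext x b y; simp [mul_smul]

theorem evalMid_barRight (g : A →ₗ[ℂ] M) (a : A) (w : A ⊗[ℂ] A ⊗[ℂ] A) :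
    evalMid g (barRight a w) = op a • evalMid g w :=
  evalRight₂_barRight _ a w

theorem evalMid_barLeft (g : A →ₗ[ℂ] M) (a : A) (w : A ⊗[ℂ] A ⊗[ℂ] A) :
    evalMid g (barLeft a w) = a • evalMid g w := by
  suffices h : evalMid g ∘ₗ barLeft a = leftMap a ∘ₗ evalMid g from lcongr_fun h w
  ext x b y; simp [mul_smul, smul_comm a (op y)]

theorem evalRight₂_barLeft {f : A →ₗ[ℂ] A →ₗ[ℂ] M} (hf : IsCocycle₂ f) (a : A)
    (w : A ⊗[ℂ] A ⊗[ℂ] A) :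
    evalRight₂ f (barLeft a w) = a • evalRight₂ f w + evalRight (f a) (barBoundary w) := by
  suffices h : evalRight₂ f ∘ₗ barLeft a =
      leftMap a ∘ₗ evalRight₂ f + evalRight (f a) ∘ₗ barBoundary from lcongr_fun h w
  ext x b y
  have := congrArg (op y • ·) (hf a x b)
  simp only [smul_sub, smul_add, smul_zero] at this
  simp [mul_smul, smul_comm a (op y)]
  rw [← sub_eq_zero, ← neg_eq_zero, ← this]; abel

theorem smul_evalRight₂ {f : A →ₗ[ℂ] A →ₗ[ℂ] A →ₗ[ℂ] M} (hf : IsCocycle₃ f) (a b : A)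
    (w : A ⊗[ℂ] A ⊗[ℂ] A) :
    a • evalRight₂ (f b) w = evalRight₂ (f (a * b)) w - evalRight₂ (f a) (barLeft b w) +
      evalRight (f a b) (barBoundary w) := by
  suffices h : leftMap a ∘ₗ evalRight₂ (f b) =
      evalRight₂ (f (a * b)) - evalRight₂ (f a) ∘ₗ barLeft b + evalRight (f a b) ∘ₗ barBoundary from
    lcongr_fun h w
  ext x c y
  have := congrArg (op y • ·) (hf a b x c)
  simp only [smul_sub, smul_add, smul_zero] at this
  simp [mul_smul, smul_comm a (op y)]
  rw [← sub_eq_zero, ← this]; abel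

/-- Modulo twisted commutators, the cap product with a folded chain is right evaluation. -/
theorem evalRight₂_sub_cap₂ (σ : A ≃ₐ[ℂ] A) (f : A →ₗ[ℂ] A →ₗ[ℂ] M) (w : A ⊗[ℂ] A ⊗[ℂ] A) :
    evalRight₂ f w - cap₂ f (foldChain σ w) ∈ LinearMap.range (b₁ M σ) := by
  refine ⟨(TensorProduct.lift f).rTensor A w, ?_⟩
  suffices h : b₁ M σ ∘ₗ (TensorProduct.lift f).rTensor A =
      evalRight₂ f - cap₂ f ∘ₗ foldChain σ from lcongr_fun h w
  ext x a y; simp [b₁_tmul, cap₂_tmul]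

end Eval

variable (P : Type) [AddCommGroup P] [Module ℂ P] [Module A P] [Module Aᵐᵒᵖ P]
  [SMulCommClass A Aᵐᵒᵖ P] [IsScalarTower ℂ A P] [IsScalarTower ℂ Aᵐᵒᵖ P]

/-- A resolution `0 → A ⊗ A → Q → A ⊗ A → A → 0` by bimodules, where `Q ⊆ P` and the generator
`1 ⊗ 1` is sent to `ω ∈ Q`, with a comparison map `θ` to the bar resolution, and such that the
classes of `Hom(A ⊗ A, M) = M` modulo `Hom(P, M)` are those modulo `σ`-twisted commutators. -/
structure ShortResolution (σ : A ≃ₐ[ℂ] A) where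
  /-- The middle term. -/
  Q : Submodule ℂ P
  /-- The boundary to `A ⊗ A`. -/
  d : P →ₗ[ℂ] A ⊗[ℂ] A
  /-- The comparison map to the bar resolution. -/
  θ : P →ₗ[ℂ] A ⊗[ℂ] A ⊗[ℂ] A
  /-- The image of `1 ⊗ 1`. -/
  ω : P
  /-- A linear lift of the universal derivation. -/
  η : A →ₗ[ℂ] P
  left_mem : ∀ (a : A), ∀ p ∈ Q, a • p ∈ Q
  right_mem : ∀ (a : A), ∀ p ∈ Q, op a • p ∈ Q
  θ_left : ∀ (a : A) (p : P), θ (a • p) = barLeft a (θ p)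
  θ_right : ∀ (a : A) (p : P), θ (op a • p) = barRight a (θ p)
  boundary_θ : ∀ p : P, barBoundary (θ p) = d p
  d_ω : d ω = 0
  η_mem : ∀ a : A, η a ∈ Q
  d_η : ∀ a : A, d (η a) = a ⊗ₜ 1 - 1 ⊗ₜ a
  exact : ∀ p ∈ Q, d p = 0 → ∃ r : A ⊗[ℂ] A, sandwich ω r = p
  injective : Function.Injective (sandwich ω : A ⊗[ℂ] A →ₗ[ℂ] P)
  ω_twisted : ω ∈ Submodule.span ℂ {x : P | ∃ p ∈ Q, ∃ a : A, x = op a • p - σ a • p}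
  exists_hom : ∀ (M : Type) [AddCommGroup M] [Module ℂ M] [Module A M] [Module Aᵐᵒᵖ M]
    [SMulCommClass A Aᵐᵒᵖ M] [IsScalarTower ℂ A M] [IsScalarTower ℂ Aᵐᵒᵖ M] (m : M) (a : A),
    ∃ h : P →ₗ[ℂ] M, (∀ (x : A) (p : P), h (x • p) = x • h p) ∧
      (∀ (x : A) (p : P), h (op x • p) = op x • h p) ∧ h ω = op a • m - σ a • m

namespace ShortResolution

variable {P} {σ : A ≃ₐ[ℂ] A} (R : ShortResolution P σ)

theorem d_left (a : A) (p : P) : R.d (a • p) = outerLeft a (R.d p) := by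
  rw [← R.boundary_θ, R.θ_left, barBoundary_barLeft, R.boundary_θ]

theorem d_right (a : A) (p : P) : R.d (op a • p) = outerRight a (R.d p) := by
  rw [← R.boundary_θ, R.θ_right, barBoundary_barRight, R.boundary_θ]

/-- The candidate for the fundamental cycle. -/
def cycle : A ⊗[ℂ] A ⊗[ℂ] A := foldChain σ (R.θ R.ω)

theorem b₂_cycle : b₂ A σ R.cycle = 0 := by
  have h : b₂ A σ ∘ₗ foldChain σ = (LinearMap.mul' ℂ A).rTensor A ∘ₗ foldChain σ -
      (TensorProduct.comm ℂ A A).toLinearMap ∘ₗ (σ.toLinearMap).lTensor A ∘ₗ barBoundary := by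
    ext x a y
    simp [b₂_tmul]
    abel
  have h₁ := lcongr_fun h (R.θ R.ω)
  simp only [lsub_apply, comp_apply, R.boundary_θ, R.d_ω, map_zero, sub_zero]
    at h₁
  rw [cycle, h₁]
  have h₂ : ∀ x ∈ Submodule.span ℂ {x : P | ∃ p ∈ R.Q, ∃ a : A, x = op a • p - σ a • p},
      (LinearMap.mul' ℂ A).rTensor A (foldChain σ (R.θ x)) = 0 := by
    intro x hx
    induction hx using Submodule.span_induction with
    | mem x hx =>
      obtain ⟨p, -, a, rfl⟩ := hx
      rw [map_sub, R.θ_left, R.θ_right, map_sub, map_sub, sub_eq_zero]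
      have : (LinearMap.mul' ℂ A).rTensor A ∘ₗ foldChain σ ∘ₗ barRight a =
          (LinearMap.mul' ℂ A).rTensor A ∘ₗ foldChain σ ∘ₗ barLeft (σ a) := by
        ext x b y; simp [mul_assoc]
      exact lcongr_fun this (R.θ p)
    | zero => simp
    | add x y _ _ hx hy => simp [hx, hy]
    | smul s x _ hx => simp [hx]
  exact h₂ _ R.ω_twisted

/-- The 2-cocycle with values in `A ⊗ A` that measures the failure of `η` to be a derivation. -/
theorem exists_rel : ∃ r : A →ₗ[ℂ] A →ₗ[ℂ] A ⊗[ℂ] A,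
    ∀ a b, sandwich R.ω (r a b) = a • R.η b - R.η (a * b) + op b • R.η a := by
  obtain ⟨l, hl⟩ := (sandwich R.ω :
    A ⊗[ℂ] A →ₗ[ℂ] P).exists_leftInverse_of_injective (LinearMap.ker_eq_bot.2 R.injective)
  refine ⟨LinearMap.mk₂ ℂ (fun a b => l (a • R.η b - R.η (a * b) + op b • R.η a))
    ?_ ?_ ?_ ?_, ?_⟩
  · intro a a' b; rw [← l.map_add]; congr 1
    simp only [add_smul, add_mul, map_add, smul_add]; abel
  · intro s a b; rw [← l.map_smul]; congr 1
    simp only [smul_mul_assoc, map_smul, smul_add, smul_sub, smul_assoc, smul_comm _ s]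
  · intro a b b'; rw [← l.map_add]; congr 1
    simp only [add_smul, mul_add, map_add, smul_add, op_add]; abel
  · intro s a b; rw [← l.map_smul]; congr 1
    simp only [mul_smul_comm, map_smul, smul_add, smul_sub, smul_assoc, op_smul]
    rw [← algebraMap_smul A s (R.η b), ← algebraMap_smul A s (a • R.η b), smul_smul, smul_smul,
      Algebra.commutes]
  · intro a b
    obtain ⟨r, hr⟩ := R.exact (a • R.η b - R.η (a * b) + op b • R.η a)
      (R.Q.add_mem (R.Q.sub_mem (R.left_mem _ _ (R.η_mem _)) (R.η_mem _))
        (R.right_mem _ _ (R.η_mem _)))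
      (by simp [R.d_left, R.d_right, R.d_η])
    rw [LinearMap.mk₂_apply, ← hr]
    exact congrArg _ (lcongr_fun hl r)

theorem rel_cocycle {r : A →ₗ[ℂ] A →ₗ[ℂ] A ⊗[ℂ] A}
    (hr : ∀ a b, sandwich R.ω (r a b) = a • R.η b - R.η (a * b) + op b • R.η a) (a b c : A) :
    outerLeft a (r b c) - r (a * b) c + r a (b * c) - outerRight c (r a b) = 0 := by
  apply R.injective
  simp only [map_sub, map_add, sandwich_outerLeft, sandwich_outerRight, hr, smul_sub, smul_add,
    map_zero, mul_smul, op_mul, smul_comm a (op c), mul_assoc]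
  abel

section Coefficients

variable {M : Type} [AddCommGroup M] [Module ℂ M] [Module A M] [Module Aᵐᵒᵖ M]
  [SMulCommClass A Aᵐᵒᵖ M] [IsScalarTower ℂ A M] [IsScalarTower ℂ Aᵐᵒᵖ M]

theorem exists_hom_of_mem_range {m : M} (hm : m ∈ LinearMap.range (b₁ M σ)) :
    ∃ h : P →ₗ[ℂ] M, (∀ (x : A) (p : P), h (x • p) = x • h p) ∧
      (∀ (x : A) (p : P), h (op x • p) = op x • h p) ∧ h R.ω = m := by
  obtain ⟨w, rfl⟩ := hm
  induction w using induction_on with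
  | zero => exact ⟨0, by simp, by simp, by simp⟩
  | tmul m a => simpa only [b₁_tmul] using R.exists_hom M m a
  | add x y hx hy =>
    obtain ⟨h₁, h₁l, h₁r, h₁ω⟩ := hx
    obtain ⟨h₂, h₂l, h₂r, h₂ω⟩ := hy
    exact ⟨h₁ + h₂, by simp [h₁l, h₂l], by simp [h₁r, h₂r], by simp [h₁ω, h₂ω]⟩

theorem inj_cap₂ {f : A →ₗ[ℂ] A →ₗ[ℂ] M} (hf : IsCocycle₂ f)
    (hc : cap₂ f R.cycle ∈ LinearMap.range (b₁ M σ)) : IsCoboundary₂ f := by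
  have hm : evalRight₂ f (R.θ R.ω) ∈ LinearMap.range (b₁ M σ) := by
    have := Submodule.add_mem _ (evalRight₂_sub_cap₂ σ f (R.θ R.ω)) hc
    rwa [cycle, sub_add_cancel] at this
  obtain ⟨h, hl, hr, hω⟩ := R.exists_hom_of_mem_range hm
  obtain ⟨r, hrel⟩ := R.exists_rel
  have hz : ∀ w : A ⊗[ℂ] A, h (sandwich R.ω w) - evalRight₂ f (R.θ (sandwich R.ω w)) = 0 := by
    intro w
    induction w using induction_on with
    | zero => simp
    | tmul x y =>
      rw [sandwich_tmul, R.θ_right, evalRight₂_barRight, R.θ_left, evalRight₂_barLeft hf,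
        R.boundary_θ, R.d_ω, hr, hl, hω]
      simp
    | add x y hx hy =>
      rw [map_add, map_add, map_add, map_add, ← sub_eq_zero.1 hx, ← sub_eq_zero.1 hy, sub_self]
  refine ⟨h ∘ₗ R.η - evalRight₂ f ∘ₗ R.θ ∘ₗ R.η + f 1, fun a b => ?_⟩
  have e₁ := hz (r a b)
  rw [hrel] at e₁
  have e₂ := evalRight₂_barLeft hf a (R.θ (R.η b))
  rw [R.boundary_θ, R.d_η] at e₂
  have e₃ := hf a 1 b
  have e₄ := hf 1 a b
  simp only [map_sub, map_add, hl, hr, R.θ_left, R.θ_right, evalRight₂_barRight, e₂,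
    evalRight_tmul, mul_one, one_mul, one_smul, op_one, smul_sub, smul_add, lsub_apply,
    ladd_apply, comp_apply] at e₁ e₃ e₄ ⊢
  linear_combination (norm := abel) e₄ - e₁ - e₃

theorem vanish₃ (R : ShortResolution P σ) {f : A →ₗ[ℂ] A →ₗ[ℂ] A →ₗ[ℂ] M} (hf : IsCocycle₃ f) : IsCoboundary₃ f := by
  obtain ⟨r, hrel⟩ := R.exists_rel
  let K : A ⊗[ℂ] A →ₗ[ℂ] M := evalRight ((evalRightHom ∘ₗ f).flip (R.θ R.ω))
  have hθ : barBoundary (R.θ R.ω) = 0 := by rw [R.boundary_θ, R.d_ω]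
  have hK : ∀ (a : A) (w : A ⊗[ℂ] A),
      a • K w = K (outerLeft a w) - evalRight₂ (f a) (R.θ (sandwich R.ω w)) := by
    intro a w
    induction w using induction_on with
    | zero => simp
    | tmul x y =>
      simp only [K, evalRight_tmul, outerLeft_tmul, LinearMap.flip_apply, comp_apply,
        evalRightHom_apply, sandwich_tmul, R.θ_right, R.θ_left, evalRight₂_barRight]
      rw [smul_comm, smul_evalRight₂ hf, hθ, map_zero, add_zero, smul_sub]
    | add x y hx hy => simp only [map_add, smul_add, hx, hy]; abel
  have hK' : ∀ (a : A) (w : A ⊗[ℂ] A), K (outerRight a w) = op a • K w := fun a w =>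
    evalRight_outerRight _ a w
  refine ⟨(evalRightHom ∘ₗ f).compl₂ (R.θ ∘ₗ R.η) - r.compr₂ K -
    TensorProduct.curry (evalRight ((f.flip 1).flip 1)), fun a b c => ?_⟩
  have e₁ := smul_evalRight₂ hf a b (R.θ (R.η c))
  rw [R.boundary_θ, R.d_η] at e₁
  have e₂ := congrArg K (R.rel_cocycle hrel a b c)
  have e₃ := congrArg (op c • ·) (hf a b 1 1)
  have e₄ := congrArg (fun x => evalRight₂ (f a) (R.θ x)) (hrel b c)
  simp only [lsub_apply, LinearMap.compl₂_apply, comp_apply, smul_sub, e₁,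
    evalRightHom_apply, LinearMap.compr₂_apply, curry_apply, evalRight_tmul,
    LinearMap.flip_apply, op_one, one_smul, mul_one, smul_add, smul_zero, map_sub, map_add,
    map_zero, hK', R.θ_left, R.θ_right, evalRight₂_barRight, hK, op_mul, mul_smul,
    smul_comm a (op c)] at e₂ e₃ e₄ ⊢
  rw [← sub_eq_zero] at e₄
  linear_combination (norm := abel) e₂ + e₃ - e₄

theorem surj_cap₂ (w : M) : ∃ f : A →ₗ[ℂ] A →ₗ[ℂ] M,
    IsCocycle₂ f ∧ w - cap₂ f R.cycle ∈ LinearMap.range (b₁ M σ) := by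
  obtain ⟨r, hrel⟩ := R.exists_rel
  refine ⟨r.compr₂ (sandwich w), fun a b c => ?_, ?_⟩
  · have := congrArg (sandwich w) (R.rel_cocycle hrel a b c)
    simpa only [map_sub, map_add, sandwich_outerLeft, sandwich_outerRight, map_zero,
      LinearMap.compr₂_apply] using this
  have hcomp : ∀ {N : Type} [AddCommGroup N] [Module ℂ N] [Module A N] [Module Aᵐᵒᵖ N]
      [SMulCommClass A Aᵐᵒᵖ N] [IsScalarTower ℂ A N] [IsScalarTower ℂ Aᵐᵒᵖ N] (n : N)
      (z : A ⊗[ℂ] A ⊗[ℂ] A), evalRight₂ (r.compr₂ (sandwich n)) z =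
        sandwich n (toOuter.symm (evalRight₂ (r.compr₂ toOuter.toLinearMap) z)) := by
    intro N _ _ _ _ _ _ _ n z
    induction z using induction_on with
    | zero => simp
    | tmul z y =>
      induction z using induction_on with
      | zero => simp
      | tmul x a =>
        simp [op_smul_toOuter, sandwich_outerRight]
      | add x z hx hz => simp only [map_add, add_tmul, hx, hz]
    | add x z hx hz => simp only [map_add, hx, hz]
  have hω : evalRight₂ (r.compr₂ (sandwich R.ω)) (R.θ R.ω) = evalMid R.η (R.θ R.ω) := by
    have : evalRight₂ (r.compr₂ (sandwich R.ω)) =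
        evalMid R.η - evalRight R.η ∘ₗ barBoundary := by
      ext x a y
      simp [hrel, mul_smul, smul_sub, smul_add]
      abel
    rw [this, lsub_apply, comp_apply, R.boundary_θ, R.d_ω, map_zero, sub_zero]
  have hspan : ∀ x ∈ Submodule.span ℂ {x : P | ∃ p ∈ R.Q, ∃ a : A, x = op a • p - σ a • p},
      ∃ t ∈ LinearMap.range (b₁ (Outer A) σ),
        evalMid R.η (R.θ x) - x = sandwich R.ω (toOuter.symm t) := by
    intro x hx
    induction hx using Submodule.span_induction with
    | mem x hx =>
      obtain ⟨p, hp, a, rfl⟩ := hx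
      have hmem : ∀ z, evalMid R.η z ∈ R.Q := by
        intro z
        induction z using induction_on with
        | zero => simp
        | tmul z y =>
          induction z using induction_on with
          | zero => simp
          | tmul x a =>
            rw [evalMid_tmul]
            exact R.right_mem _ _ (R.left_mem _ _ (R.η_mem a))
          | add x z hx hz =>
            rw [add_tmul, map_add]; exact R.Q.add_mem hx hz
        | add x z hx hz => rw [map_add]; exact R.Q.add_mem hx hz
      have hd : R.d (evalMid R.η (R.θ p) - p) = 0 := by
        have : R.d ∘ₗ evalMid R.η = barBoundary := by
          ext x a y; simp [R.d_left, R.d_right, R.d_η]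
        rw [map_sub, ← comp_apply, this, R.boundary_θ, sub_self]
      obtain ⟨s, hs⟩ := R.exact _ (R.Q.sub_mem (hmem _) hp) hd
      refine ⟨_, ⟨toOuter s ⊗ₜ a, rfl⟩, ?_⟩
      rw [b₁_tmul, smul_toOuter, op_smul_toOuter, ← map_sub, LinearEquiv.symm_apply_apply,
        map_sub (sandwich R.ω), sandwich_outerLeft, sandwich_outerRight, hs, map_sub, map_sub, R.θ_left, R.θ_right,
        evalMid_barLeft, evalMid_barRight, smul_sub, smul_sub]
      abel
    | zero => exact ⟨0, Submodule.zero_mem _, by simp⟩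
    | add x y _ _ hx hy =>
      obtain ⟨t, ht, ht'⟩ := hx
      obtain ⟨u, hu, hu'⟩ := hy
      refine ⟨t + u, Submodule.add_mem _ ht hu, ?_⟩
      rw [map_add toOuter.symm, map_add (sandwich R.ω), ← ht', ← hu', map_add, map_add]; abel
    | smul s x _ hx =>
      obtain ⟨t, ht, ht'⟩ := hx
      refine ⟨s • t, Submodule.smul_mem _ _ ht, ?_⟩
      rw [map_smul toOuter.symm, map_smul (sandwich R.ω), ← ht', map_smul, map_smul, smul_sub]
  obtain ⟨t, ⟨u, rfl⟩, ht⟩ := hspan _ R.ω_twisted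
  rw [← hω, hcomp] at ht
  have h1 : toOuter.symm (evalRight₂ (r.compr₂ toOuter.toLinearMap) (R.θ R.ω)) =
      1 ⊗ₜ 1 + toOuter.symm (b₁ (Outer A) σ u) := by
    apply R.injective
    rw [map_add (sandwich R.ω), ← ht, sandwich_tmul, op_one, one_smul, one_smul, add_sub_cancel]
  have h2 : sandwich w (toOuter.symm (b₁ (Outer A) σ u)) ∈ LinearMap.range (b₁ M σ) := by
    refine ⟨(sandwich w ∘ₗ toOuter.symm.toLinearMap : Outer A →ₗ[ℂ] M).rTensor A u, ?_⟩
    clear ht h1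
    induction u using induction_on with
    | zero => simp
    | tmul s a =>
      obtain ⟨s, rfl⟩ := toOuter.surjective s
      simp [b₁_tmul, smul_toOuter, op_smul_toOuter, sandwich_outerLeft, sandwich_outerRight]
    | add x z hx hz => rw [map_add, map_add, hx, hz, map_add, map_add, map_add]
  have h3 := evalRight₂_sub_cap₂ σ (r.compr₂ (sandwich w)) (R.θ R.ω)
  rw [hcomp, h1, map_add, sandwich_tmul, op_one, one_smul, one_smul] at h3
  have := Submodule.sub_mem _ h3 h2
  rw [cycle]
  convert this using 1
  abel

end Coefficients

end ShortResolution
end Duality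

section Shift

variable {A : Type} [Ring A] [Algebra ℂ A]

open MulOpposite

section Exact

variable {N : Type} [AddCommGroup N] [Module ℂ N] [Module A N] [Module Aᵐᵒᵖ N]
  [SMulCommClass A Aᵐᵒᵖ N] [IsScalarTower ℂ A N] [IsScalarTower ℂ Aᵐᵒᵖ N]
variable {F : Type} [AddCommGroup F] [Module ℂ F] [Module A F] [Module Aᵐᵒᵖ F]
  [SMulCommClass A Aᵐᵒᵖ F] [IsScalarTower ℂ A F] [IsScalarTower ℂ Aᵐᵒᵖ F]
variable {M : Type} [AddCommGroup M] [Module ℂ M] [Module A M] [Module Aᵐᵒᵖ M]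
  [SMulCommClass A Aᵐᵒᵖ M] [IsScalarTower ℂ A M] [IsScalarTower ℂ Aᵐᵒᵖ M]

/-- A linear map that commutes with both actions. -/
structure IsBimoduleMap (h : N →ₗ[ℂ] F) : Prop where
  left : ∀ (a : A) (n : N), h (a • n) = a • h n
  right : ∀ (a : A) (n : N), h (op a • n) = op a • h n

variable {h : N →ₗ[ℂ] F}

namespace IsBimoduleMap

theorem b₁_rTensor (hh : IsBimoduleMap (A := A) h) (σ : A ≃ₐ[ℂ] A) (w : N ⊗[ℂ] A) : b₁ F σ (h.rTensor A w) = h (b₁ N σ w) := by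
  suffices e : b₁ F σ ∘ₗ h.rTensor A = h ∘ₗ b₁ N σ from lcongr_fun e w
  ext n a; simp [b₁_tmul, hh.left, hh.right]

theorem b₂_rTensor (hh : IsBimoduleMap (A := A) h) (σ : A ≃ₐ[ℂ] A) (w : N ⊗[ℂ] A ⊗[ℂ] A) :
    b₂ F σ ((h.rTensor A).rTensor A w) = h.rTensor A (b₂ N σ w) := by
  suffices e : b₂ F σ ∘ₗ (h.rTensor A).rTensor A = h.rTensor A ∘ₗ b₂ N σ from
    lcongr_fun e w
  ext n a b; simp [b₂_tmul, hh.left, hh.right]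

theorem b₃_rTensor (hh : IsBimoduleMap (A := A) h) (σ : A ≃ₐ[ℂ] A) (w : N ⊗[ℂ] A ⊗[ℂ] A ⊗[ℂ] A) :
    b₃ F σ (((h.rTensor A).rTensor A).rTensor A w) = (h.rTensor A).rTensor A (b₃ N σ w) := by
  suffices e : b₃ F σ ∘ₗ ((h.rTensor A).rTensor A).rTensor A =
      (h.rTensor A).rTensor A ∘ₗ b₃ N σ from lcongr_fun e w
  ext n a b c; simp [b₃_tmul, hh.left, hh.right]

theorem cap₀_map (hh : IsBimoduleMap (A := A) h) (n : N) (c : A ⊗[ℂ] A ⊗[ℂ] A) :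
    cap₀ (h n) c = (h.rTensor A).rTensor A (cap₀ n c) := by
  suffices e : cap₀ (h n) = (h.rTensor A).rTensor A ∘ₗ cap₀ n from lcongr_fun e c
  ext x a b; simp [cap₀_tmul, hh.left]

theorem cap₁_map (hh : IsBimoduleMap (A := A) h) (f : A →ₗ[ℂ] N) (c : A ⊗[ℂ] A ⊗[ℂ] A) :
    cap₁ (h ∘ₗ f) c = h.rTensor A (cap₁ f c) := by
  suffices e : cap₁ (h ∘ₗ f) = h.rTensor A ∘ₗ cap₁ f from lcongr_fun e c
  ext x a b; simp [cap₁_tmul, hh.left]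

theorem cap₂_map (hh : IsBimoduleMap (A := A) h) (f : A →ₗ[ℂ] A →ₗ[ℂ] N) (c : A ⊗[ℂ] A ⊗[ℂ] A) :
    cap₂ (f.compr₂ h) c = h (cap₂ f c) := by
  suffices e : cap₂ (f.compr₂ h) = h ∘ₗ cap₂ f from lcongr_fun e c
  ext x a b; simp [cap₂_tmul, hh.left]

end IsBimoduleMap

/-- The Hochschild coboundary of a 0-cochain. -/
def coboundary₀ (m : M) : A →ₗ[ℂ] M :=
  ((Algebra.lsmul ℂ ℂ M : A →ₐ[ℂ] Module.End ℂ M).toLinearMap.flip m) -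
    (TensorProduct.curry (rightAct M) m)

@[simp] theorem coboundary₀_apply (m : M) (a : A) : coboundary₀ m a = a • m - op a • m := by
  simp [coboundary₀]

/-- The Hochschild coboundary of a 1-cochain. -/
def coboundary₁ (f : A →ₗ[ℂ] M) : A →ₗ[ℂ] A →ₗ[ℂ] M :=
  ((Algebra.lsmul ℂ ℂ M : A →ₐ[ℂ] Module.End ℂ M).toLinearMap.compl₂ f) -
    (LinearMap.mul ℂ A).compr₂ f + TensorProduct.curry (evalRight f)

@[simp] theorem coboundary₁_apply (f : A →ₗ[ℂ] M) (a b : A) :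
    coboundary₁ f a b = a • f b - f (a * b) + op b • f a := by
  simp [coboundary₁]

theorem isCocycle₁_coboundary₀ (m : M) : IsCocycle₁ (coboundary₀ (A := A) m) := by
  intro a b
  simp only [coboundary₀_apply, smul_sub, mul_smul, op_mul, smul_comm a (op b)]
  abel

theorem isCocycle₂_coboundary₁ (f : A →ₗ[ℂ] M) : IsCocycle₂ (coboundary₁ f) := by
  intro a b c
  simp only [coboundary₁_apply, smul_sub, smul_add, mul_smul, op_mul, smul_comm a (op c), mul_assoc]
  abel

theorem b₂_cap₀ {σ : A ≃ₐ[ℂ] A} {c : A ⊗[ℂ] A ⊗[ℂ] A} (hc : b₂ A σ c = 0) (m : M) :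
    b₂ M σ (cap₀ m c) = -cap₁ (coboundary₀ m) c := by
  have e : b₂ M σ ∘ₗ cap₀ m = -cap₁ (coboundary₀ m) +
      ((Algebra.lsmul ℂ ℂ M : A →ₐ[ℂ] Module.End ℂ M).toLinearMap.flip m).rTensor A ∘ₗ
        b₂ A σ := by
    ext x a b
    simp [b₂_tmul, cap₀_tmul, cap₁_tmul, mul_smul, sub_tmul, smul_sub,
      smul_comm x (op a)]
    abel
  have := lcongr_fun e c
  simpa [hc] using this

theorem b₁_cap₁ {σ : A ≃ₐ[ℂ] A} {c : A ⊗[ℂ] A ⊗[ℂ] A} (hc : b₂ A σ c = 0) (f : A →ₗ[ℂ] M) :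
    b₁ M σ (cap₁ f c) = cap₂ (coboundary₁ f) c := by
  have e : b₁ M σ ∘ₗ cap₁ f = cap₂ (coboundary₁ f) - (leftAct M ∘ₗ f.lTensor A) ∘ₗ b₂ A σ := by
    ext x a b
    simp [b₁_tmul, cap₁_tmul, cap₂_tmul, b₂_tmul, mul_smul, smul_sub, smul_add, leftAct,
      smul_comm x (op b)]
  have := lcongr_fun e c
  simpa [hc] using this

/-- A bimodule induced from the right: there is a right and left linear section of the right
action. Its homology vanishes in positive degrees. -/
def IsInduced (A F : Type) [Ring A] [Algebra ℂ A] [AddCommGroup F] [Module ℂ F] [Module A F]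
    [Module Aᵐᵒᵖ F] [IsScalarTower ℂ A F] [IsScalarTower ℂ Aᵐᵒᵖ F] : Prop :=
  ∃ κ : F →ₗ[ℂ] F ⊗[ℂ] A, (∀ f, rightAct F (κ f) = f) ∧
    (∀ (a : A) f, κ (op a • f) = (LinearMap.mulRight ℂ a).lTensor F (κ f)) ∧
    ∀ (a : A) f, κ (a • f) =
      ((Algebra.lsmul ℂ ℂ F : A →ₐ[ℂ] Module.End ℂ F) a).rTensor A (κ f)

theorem IsInduced.mem_range_b₂ (hF : IsInduced A F) (σ : A ≃ₐ[ℂ] A) {w : F ⊗[ℂ] A}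
    (hw : b₁ F σ w = 0) : w ∈ LinearMap.range (b₂ F σ) := by
  obtain ⟨κ, h₁, h₂, h₃⟩ := hF
  refine ⟨κ.rTensor A w, ?_⟩
  have e : b₂ F σ ∘ₗ κ.rTensor A + κ ∘ₗ b₁ F σ = LinearMap.id := by
    ext f a
    have (z : F ⊗[ℂ] A) : b₂ F σ (z ⊗ₜ a) = rightAct F z ⊗ₜ a -
        (LinearMap.mulRight ℂ a).lTensor F z +
        ((Algebra.lsmul ℂ ℂ F : A →ₐ[ℂ] Module.End ℂ F) (σ a)).rTensor A z := by
      induction z using induction_on with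
      | zero => simp
      | tmul x y => simp [b₂_tmul]
      | add x y hx hy => simp only [add_tmul, map_add, hx, hy]; abel
    simp [this, h₁, b₁_tmul, h₂, h₃]
  have := lcongr_fun e w
  simpa [hw] using this

theorem IsInduced.mem_range_b₃ (hF : IsInduced A F) (σ : A ≃ₐ[ℂ] A) {w : F ⊗[ℂ] A ⊗[ℂ] A}
    (hw : b₂ F σ w = 0) : w ∈ LinearMap.range (b₃ F σ) := by
  obtain ⟨κ, h₁, h₂, h₃⟩ := hF
  refine ⟨(κ.rTensor A).rTensor A w, ?_⟩
  have e : b₃ F σ ∘ₗ (κ.rTensor A).rTensor A + κ.rTensor A ∘ₗ b₂ F σ = LinearMap.id := by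
    ext f a b
    have (z : F ⊗[ℂ] A) : b₃ F σ (z ⊗ₜ a ⊗ₜ b) = rightAct F z ⊗ₜ a ⊗ₜ b -
        (LinearMap.mulRight ℂ a).lTensor F z ⊗ₜ b + z ⊗ₜ (a * b) -
        ((Algebra.lsmul ℂ ℂ F : A →ₐ[ℂ] Module.End ℂ F) (σ b)).rTensor A z ⊗ₜ a := by
      induction z using induction_on with
      | zero => simp
      | tmul x y => simp [b₃_tmul]
      | add x y hx hy => simp only [add_tmul, map_add, hx, hy]; abel
    simp [this, h₁, b₂_tmul, h₂, h₃]
  have := lcongr_fun e w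
  simpa [hw] using this

variable {i : N →ₗ[ℂ] F} {p : F →ₗ[ℂ] M} {σ : A ≃ₐ[ℂ] A} {c : A ⊗[ℂ] A ⊗[ℂ] A}

theorem exists_comp_eq (hinj : Function.Injective i) {V : Type} [AddCommGroup V] [Module ℂ V]
    (f : V →ₗ[ℂ] F) (hf : ∀ v, ∃ n, i n = f v) : ∃ g : V →ₗ[ℂ] N, i ∘ₗ g = f := by
  obtain ⟨l, hl⟩ := i.exists_leftInverse_of_injective (LinearMap.ker_eq_bot.2 hinj)
  refine ⟨l ∘ₗ f, LinearMap.ext fun v => ?_⟩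
  obtain ⟨n, hn⟩ := hf v
  have := lcongr_fun hl n
  simp only [comp_apply, LinearMap.id_apply] at this
  simp [← hn, this]

theorem exists_lift (hp : Function.Surjective p) {V : Type} [AddCommGroup V] [Module ℂ V]
    (f : V →ₗ[ℂ] M) : ∃ g : V →ₗ[ℂ] F, p ∘ₗ g = f := by
  obtain ⟨s, hs⟩ := p.exists_rightInverse_of_surjective (LinearMap.range_eq_top.2 hp)
  exact ⟨s ∘ₗ f, by rw [← LinearMap.comp_assoc, hs, LinearMap.id_comp]⟩

theorem inj_cap₁_of_exact (hc : b₂ A σ c = 0) (hi : IsBimoduleMap (A := A) i)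
    (hp : IsBimoduleMap (A := A) p)
    (hinj : Function.Injective i) (hsurj : Function.Surjective p) (hex : Function.Exact i p)
    (hF : ∀ f : A →ₗ[ℂ] F, IsCocycle₁ f → IsCoboundary₁ f)
    (hN : ∀ f : A →ₗ[ℂ] A →ₗ[ℂ] N, IsCocycle₂ f → cap₂ f c ∈ LinearMap.range (b₁ N σ) →
      IsCoboundary₂ f)
    {f : A →ₗ[ℂ] M} (hf : IsCocycle₁ f) (hfc : cap₁ f c ∈ LinearMap.range (b₂ M σ)) :
    IsCoboundary₁ f := by
  obtain ⟨f', rfl⟩ := exists_lift hsurj f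
  obtain ⟨g, hg⟩ := exists_comp_eq hinj (TensorProduct.lift (coboundary₁ f')) (by
    intro v
    refine (hex _).1 ?_
    induction v using induction_on with
    | zero => simp
    | tmul a b => simpa [hp.left, hp.right] using hf a b
    | add x y hx hy => rw [map_add, map_add, hx, hy, add_zero])
  have hg' : ∀ a b, i (g (a ⊗ₜ b)) = coboundary₁ f' a b := fun a b =>
    lcongr_fun hg (a ⊗ₜ b)
  have hgf : (TensorProduct.curry g).compr₂ i = coboundary₁ f' := by
    ext a b; simpa using hg' a b
  have hgc : IsCocycle₂ (TensorProduct.curry g) := by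
    intro a b d
    apply hinj
    have := isCocycle₂_coboundary₁ f' a b d
    simpa only [← hgf, LinearMap.compr₂_apply, map_sub, map_add, hi.left, hi.right, map_zero]
      using this
  obtain ⟨u, hu⟩ := hfc
  obtain ⟨u', rfl⟩ := rTensor_surjective A (rTensor_surjective A hsurj) u
  obtain ⟨n, hn⟩ := (rTensor_exact A hex hsurj (cap₁ f' c - b₂ F σ u')).1 (by
    rw [map_sub, ← hp.cap₁_map, ← hp.b₂_rTensor, hu, sub_self])
  obtain ⟨k, hk⟩ := hN _ hgc ⟨n, by
    apply hinj
    rw [← hi.b₁_rTensor, hn, ← hi.cap₂_map, hgf, map_sub, b₁_cap₁ hc]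
    have : b₁ F σ ∘ₗ b₂ F σ = 0 := by
      ext f a b
      simp [b₁_tmul, b₂_tmul, mul_smul, smul_comm (σ b) (op a)]
    rw [show b₁ F σ (b₂ F σ u') = 0 from lcongr_fun this u', sub_zero]⟩
  obtain ⟨m, hm⟩ := hF (f' - i ∘ₗ k) (by
    intro a b
    have h₁ := congrArg i (hk a b)
    rw [curry_apply, hg'] at h₁
    simp only [coboundary₁_apply, map_sub, map_add, hi.left, hi.right] at h₁
    simp only [lsub_apply, comp_apply, smul_sub]
    linear_combination (norm := abel) h₁)
  refine ⟨p m, fun a => ?_⟩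
  have h₁ := congrArg p (hm a)
  simpa [hp.left, hp.right, (hex _).2 ⟨_, rfl⟩] using h₁

theorem surj_cap₁_of_exact (hc : b₂ A σ c = 0) (hi : IsBimoduleMap (A := A) i)
    (hp : IsBimoduleMap (A := A) p)
    (hsurj : Function.Surjective p) (hex : Function.Exact i p)
    (hF : IsInduced A F)
    (hF₂ : ∀ f : A →ₗ[ℂ] A →ₗ[ℂ] F, IsCocycle₂ f → cap₂ f c ∈ LinearMap.range (b₁ F σ) →
      IsCoboundary₂ f)
    (hN : ∀ w : N, ∃ f : A →ₗ[ℂ] A →ₗ[ℂ] N, IsCocycle₂ f ∧ w - cap₂ f c ∈ LinearMap.range (b₁ N σ))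
    {w : M ⊗[ℂ] A} (hw : b₁ M σ w = 0) :
    ∃ f : A →ₗ[ℂ] M, IsCocycle₁ f ∧ w - cap₁ f c ∈ LinearMap.range (b₂ M σ) := by
  obtain ⟨w', rfl⟩ := rTensor_surjective A hsurj w
  rw [hp.b₁_rTensor] at hw
  obtain ⟨n, hn⟩ := (hex _).1 hw
  obtain ⟨g, hg, v, hv⟩ := hN n
  obtain ⟨f, hf⟩ := hF₂ (g.compr₂ i) (by
    intro a b d
    have := congrArg i (hg a b d)
    simpa only [LinearMap.compr₂_apply, map_sub, map_add, hi.left, hi.right, map_zero] using this)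
    ⟨w' - i.rTensor A v, by
      rw [map_sub, hi.b₁_rTensor, hv, hi.cap₂_map, map_sub, hn]; abel⟩
  have hgf : g.compr₂ i = coboundary₁ f := by
    ext a b; rw [hf, coboundary₁_apply]
  refine ⟨p ∘ₗ f, fun a b => ?_, ?_⟩
  · have := congrArg p (hf a b)
    simpa only [LinearMap.compr₂_apply, map_sub, map_add, hp.left, hp.right,
      (hex _).2 ⟨_, rfl⟩, comp_apply] using this.symm
  · obtain ⟨u, hu⟩ := hF.mem_range_b₂ σ (w := w' - i.rTensor A v - cap₁ f c) (by
      rw [map_sub, map_sub, b₁_cap₁ hc, ← hgf, hi.b₁_rTensor, hv, hi.cap₂_map, map_sub, hn]; abel)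
    refine ⟨(p.rTensor A).rTensor A u, ?_⟩
    rw [hp.b₂_rTensor, hu, map_sub, map_sub, hp.cap₁_map,
      (rTensor_exact A hex hsurj _).2 ⟨_, rfl⟩, sub_zero]

theorem inj_cap₀_of_exact (hc : b₂ A σ c = 0) (hi : IsBimoduleMap (A := A) i)
    (hp : IsBimoduleMap (A := A) p)
    (hinj : Function.Injective i) (hsurj : Function.Surjective p) (hex : Function.Exact i p)
    (hF : ∀ m : F, IsCocycle₀ (A := A) m → m = 0)
    (hN : ∀ f : A →ₗ[ℂ] N, IsCocycle₁ f → cap₁ f c ∈ LinearMap.range (b₂ N σ) →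
      IsCoboundary₁ f)
    {m : M} (hm : IsCocycle₀ (A := A) m) (hmc : cap₀ m c ∈ LinearMap.range (b₃ M σ)) : m = 0 := by
  obtain ⟨m', rfl⟩ := hsurj m
  obtain ⟨g, hg⟩ := exists_comp_eq hinj (coboundary₀ (A := A) m') (by
    intro a
    refine (hex _).1 ?_
    simpa [hp.left, hp.right] using hm a)
  have hgc : IsCocycle₁ g := by
    intro a b
    apply hinj
    have := isCocycle₁_coboundary₀ (A := A) m' a b
    simpa only [← hg, comp_apply, map_sub, map_add, hi.left, hi.right, map_zero]
      using this
  obtain ⟨u, hu⟩ := hmc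
  obtain ⟨u', rfl⟩ := rTensor_surjective A (rTensor_surjective A
    (rTensor_surjective A hsurj)) u
  obtain ⟨n, hn⟩ := (rTensor_exact A (rTensor_exact A hex hsurj)
    (rTensor_surjective A hsurj) (cap₀ m' c - b₃ F σ u')).1 (by
    rw [map_sub, ← hp.cap₀_map, ← hp.b₃_rTensor, hu, sub_self])
  have hinj' : Function.Injective (i.rTensor A) :=
    Module.Flat.rTensor_preserves_injective_linearMap i hinj
  obtain ⟨k, hk⟩ := hN g hgc ⟨-n, by
    apply hinj'
    have : b₂ F σ ∘ₗ b₃ F σ = 0 := by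
      ext f a b d
      simp [b₂_tmul, b₃_tmul, mul_smul, smul_comm (σ d) (op a), mul_assoc]
      abel
    rw [map_neg, map_neg, ← hi.b₂_rTensor, hn, ← hi.cap₁_map, hg, map_sub, b₂_cap₀ hc,
      show b₂ F σ (b₃ F σ u') = 0 from lcongr_fun this u', sub_zero, neg_neg]⟩
  have := hF (m' - i k) (by
    intro a
    have h₁ := congrArg i (hk a)
    rw [← comp_apply, hg] at h₁
    simp only [coboundary₀_apply, map_sub, hi.left, hi.right] at h₁
    simp only [smul_sub]
    linear_combination (norm := abel) h₁)
  rw [sub_eq_zero.1 this, (hex _).2 ⟨_, rfl⟩]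

theorem surj_cap₀_of_exact (hc : b₂ A σ c = 0) (hi : IsBimoduleMap (A := A) i)
    (hp : IsBimoduleMap (A := A) p)
    (hinj : Function.Injective i) (hsurj : Function.Surjective p) (hex : Function.Exact i p)
    (hF : IsInduced A F)
    (hF₁ : ∀ f : A →ₗ[ℂ] F, IsCocycle₁ f → IsCoboundary₁ f)
    (hN : ∀ w : N ⊗[ℂ] A, b₁ N σ w = 0 →
      ∃ f : A →ₗ[ℂ] N, IsCocycle₁ f ∧ w - cap₁ f c ∈ LinearMap.range (b₂ N σ))
    {w : M ⊗[ℂ] A ⊗[ℂ] A} (hw : b₂ M σ w = 0) :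
    ∃ m : M, IsCocycle₀ (A := A) m ∧ w - cap₀ m c ∈ LinearMap.range (b₃ M σ) := by
  obtain ⟨w', rfl⟩ := rTensor_surjective A (rTensor_surjective A hsurj) w
  rw [hp.b₂_rTensor] at hw
  obtain ⟨n, hn⟩ := (rTensor_exact A hex hsurj _).1 hw
  obtain ⟨g, hg, v, hv⟩ := hN n (by
    apply hinj
    have : b₁ F σ ∘ₗ b₂ F σ = 0 := by
      ext f a b
      simp [b₁_tmul, b₂_tmul, mul_smul, smul_comm (σ b) (op a)]
    rw [← hi.b₁_rTensor, hn, map_zero]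
    exact lcongr_fun this w')
  obtain ⟨m, hm⟩ := hF₁ (i ∘ₗ g) (by
    intro a b
    have := congrArg i (hg a b)
    simpa only [comp_apply, map_sub, map_add, hi.left, hi.right, map_zero] using this)
  have hgm : i ∘ₗ g = coboundary₀ m := by
    ext a; rw [hm, coboundary₀_apply]
  refine ⟨-p m, fun a => ?_, ?_⟩
  · have := congrArg p (hm a)
    rw [comp_apply, (hex _).2 ⟨_, rfl⟩, map_sub, hp.left, hp.right] at this
    rw [smul_neg, smul_neg, neg_sub_neg, ← neg_sub, ← this, neg_zero]
  · obtain ⟨u, hu⟩ := hF.mem_range_b₃ σ (w := w' - (i.rTensor A).rTensor A v + cap₀ m c) (by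
      rw [map_add, map_sub, b₂_cap₀ hc, ← hgm, hi.b₂_rTensor, hv, hi.cap₁_map, map_sub, hn]; abel)
    refine ⟨((p.rTensor A).rTensor A).rTensor A u, ?_⟩
    rw [hp.b₃_rTensor, hu, map_add, map_sub, ← hp.cap₀_map,
      (rTensor_exact A (rTensor_exact A hex hsurj) (rTensor_surjective A hsurj) _).2
        ⟨_, rfl⟩, sub_zero, ← map_neg p, hp.cap₀_map, hp.cap₀_map, ← sub_neg_eq_add]
    congr 1
    rw [← map_neg]
    congr 1
    have : cap₀ (A := A) (-m) = -cap₀ m := by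
      ext; simp [cap₀_tmul, TensorProduct.neg_tmul]
    rw [this]; rfl

end Exact

/-- A sub-bimodule, as a type. -/
def SubBimodule {F : Type} [AddCommGroup F] [Module ℂ F] [Module A F] [Module Aᵐᵒᵖ F]
    (N : Submodule ℂ F) (_ : ∀ (a : A), ∀ x ∈ N, a • x ∈ N)
    (_ : ∀ (a : A), ∀ x ∈ N, op a • x ∈ N) : Type := N

section SubBimodule

variable {F : Type} [AddCommGroup F] [Module ℂ F] [Module A F] [Module Aᵐᵒᵖ F]
  [SMulCommClass A Aᵐᵒᵖ F] [IsScalarTower ℂ A F] [IsScalarTower ℂ Aᵐᵒᵖ F]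
  {N : Submodule ℂ F} {hl : ∀ (a : A), ∀ x ∈ N, a • x ∈ N} {hr : ∀ (a : A), ∀ x ∈ N, op a • x ∈ N}

instance : AddCommGroup (SubBimodule N hl hr) := inferInstanceAs (AddCommGroup N)

instance : Module ℂ (SubBimodule N hl hr) := inferInstanceAs (Module ℂ N)

instance : Module A (SubBimodule N hl hr) where
  smul a x := ⟨a • x.1, hl a _ x.2⟩
  one_smul x := Subtype.ext (one_smul A x.1)
  mul_smul a b x := Subtype.ext (mul_smul a b x.1)
  smul_zero a := Subtype.ext (smul_zero a)
  smul_add a x y := Subtype.ext (smul_add a x.1 y.1)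
  zero_smul x := Subtype.ext (zero_smul A x.1)
  add_smul a b x := Subtype.ext (add_smul a b x.1)

instance : Module Aᵐᵒᵖ (SubBimodule N hl hr) where
  smul a x := ⟨a • x.1, hr (unop a) _ x.2⟩
  one_smul x := Subtype.ext (one_smul Aᵐᵒᵖ x.1)
  mul_smul a b x := Subtype.ext (mul_smul a b x.1)
  smul_zero a := Subtype.ext (smul_zero a)
  smul_add a x y := Subtype.ext (smul_add a x.1 y.1)
  zero_smul x := Subtype.ext (zero_smul Aᵐᵒᵖ x.1)
  add_smul a b x := Subtype.ext (add_smul a b x.1)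

instance : SMulCommClass A Aᵐᵒᵖ (SubBimodule N hl hr) :=
  ⟨fun a b x => Subtype.ext (smul_comm a b x.1)⟩

instance : IsScalarTower ℂ A (SubBimodule N hl hr) :=
  ⟨fun s a x => Subtype.ext (smul_assoc s a x.1)⟩

instance : IsScalarTower ℂ Aᵐᵒᵖ (SubBimodule N hl hr) :=
  ⟨fun s a x => Subtype.ext (smul_assoc s a x.1)⟩

/-- The inclusion of a sub-bimodule. -/
def SubBimodule.incl : SubBimodule N hl hr →ₗ[ℂ] F := N.subtype

theorem SubBimodule.isBimoduleMap_incl :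
    IsBimoduleMap (A := A) (SubBimodule.incl : SubBimodule N hl hr →ₗ[ℂ] F) :=
  ⟨fun _ _ => rfl, fun _ _ => rfl⟩

end SubBimodule

section Free

variable (ι : Type)

theorem isInduced_outer : IsInduced A (Outer A) := by
  let κ : Outer A →ₗ[ℂ] Outer A ⊗[ℂ] A :=
    (toOuter.toLinearMap ∘ₗ (TensorProduct.mk ℂ A A).flip 1).rTensor A ∘ₗ toOuter.symm.toLinearMap
  have hκ : ∀ x y : A, κ (toOuter (x ⊗ₜ y)) = toOuter (x ⊗ₜ 1) ⊗ₜ y := fun x y => by simp [κ]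
  refine ⟨κ, fun f => ?_, fun a f => ?_, fun a f => ?_⟩
  all_goals
    obtain ⟨f, rfl⟩ := toOuter.surjective f
    induction f using induction_on with
    | zero => simp
    | tmul x y => simp [hκ, op_smul_toOuter, smul_toOuter]
    | add x y hx hy => simp only [map_add, smul_add, hx, hy]

theorem isInduced_free : IsInduced A (ι →₀ Outer A) := by
  obtain ⟨κ, h₁, h₂, h₃⟩ := isInduced_outer (A := A)
  have nat₁ : ∀ (j : ι) (z : Outer A ⊗[ℂ] A), rightAct (ι →₀ Outer A)
      ((Finsupp.lsingle j : Outer A →ₗ[ℂ] ι →₀ Outer A).rTensor A z) =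
        Finsupp.single j (rightAct (Outer A) z) := by
    intro j z
    induction z using induction_on with
    | zero => simp
    | tmul x y => simp
    | add x y hx hy => simp only [map_add, hx, hy, Finsupp.single_add]
  refine ⟨Finsupp.lsum ℂ fun j => (Finsupp.lsingle j).rTensor A ∘ₗ κ, fun f => ?_,
    fun a f => ?_, fun a f => ?_⟩
  all_goals
    induction f using Finsupp.induction_linear with
    | zero => simp
    | add x y hx hy => simp only [map_add, smul_add, hx, hy]
    | single j x => ?_
  · simp [nat₁, h₁]
  · simp only [Finsupp.smul_single, Finsupp.lsum_single, comp_apply, h₂]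
    exact lcongr_fun ((LinearMap.rTensor_comp_lTensor ..).trans
      (LinearMap.lTensor_comp_rTensor ..).symm) (κ x)
  · simp only [Finsupp.smul_single, Finsupp.lsum_single, comp_apply, h₃]
    rw [← LinearMap.rTensor_comp_apply, ← LinearMap.rTensor_comp_apply]
    congr 2
    ext x; simp

theorem eq_zero_of_isCocycle₀_free (h₀ : ∀ k : Outer A, IsCocycle₀ (A := A) k → k = 0)
    (m : ι →₀ Outer A) (hm : IsCocycle₀ (A := A) m) : m = 0 := by
  ext j
  refine h₀ _ fun a => ?_
  simpa using DFunLike.congr_fun (hm a) j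

theorem isCoboundary₁_free (hfg : ∃ S : Finset A, Algebra.adjoin ℂ (S : Set A) = ⊤)
    (h₀ : ∀ k : Outer A, IsCocycle₀ (A := A) k → k = 0)
    (h₁ : ∀ f : A →ₗ[ℂ] Outer A, IsCocycle₁ f → IsCoboundary₁ f)
    (f : A →ₗ[ℂ] ι →₀ Outer A) (hf : IsCocycle₁ f) : IsCoboundary₁ f := by
  classical
  obtain ⟨S, hS⟩ := hfg
  have hfj : ∀ j, IsCocycle₁ (Finsupp.lapply j ∘ₗ f : A →ₗ[ℂ] Outer A) := fun j a b => by
    simpa using DFunLike.congr_fun (hf a b) j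
  choose k hk using fun j => h₁ _ (hfj j)
  have hsupp : ∀ j, k j ≠ 0 → j ∈ S.biUnion fun s => (f s).support := by
    intro j hj
    by_contra hcon
    apply hj
    refine h₀ _ fun a => ?_
    rw [← hk j a]
    have ha : a ∈ Algebra.adjoin ℂ (S : Set A) := hS ▸ Algebra.mem_top
    have hmul := hfj j
    have h1 : (Finsupp.lapply j ∘ₗ f : A →ₗ[ℂ] Outer A) 1 = 0 := by
      simpa using hmul 1 1
    induction ha using Algebra.adjoin_induction with
    | mem x hx =>
      by_contra hne
      exact hcon (Finset.mem_biUnion.2 ⟨x, hx, Finsupp.mem_support_iff.2 hne⟩)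
    | algebraMap r => rw [Algebra.algebraMap_eq_smul_one, map_smul, h1, smul_zero]
    | add x y _ _ hx hy => rw [map_add, hx, hy, add_zero]
    | mul x y _ _ hx hy => simpa [hx, hy] using hmul x y
  refine ⟨Finsupp.onFinset _ k hsupp, fun a => ?_⟩
  ext j
  simpa using hk j a

end Free

/-- A finitely generated algebra with a short resolution satisfies Poincaré duality. -/
theorem ShortResolution.isFundamentalCycle {P : Type} [AddCommGroup P] [Module ℂ P] [Module A P]
    [Module Aᵐᵒᵖ P] [SMulCommClass A Aᵐᵒᵖ P] [IsScalarTower ℂ A P] [IsScalarTower ℂ Aᵐᵒᵖ P]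
    {σ : A ≃ₐ[ℂ] A} (R : ShortResolution P σ)
    (hfg : ∃ S : Finset A, Algebra.adjoin ℂ (S : Set A) = ⊤)
    (h₀ : ∀ k : Outer A, IsCocycle₀ (A := A) k → k = 0)
    (h₁ : ∀ f : A →ₗ[ℂ] Outer A, IsCocycle₁ f → IsCoboundary₁ f) :
    IsFundamentalCycle σ R.cycle := by
  have cover : ∀ (M : Type) [AddCommGroup M] [Module ℂ M] [Module A M] [Module Aᵐᵒᵖ M]
      [SMulCommClass A Aᵐᵒᵖ M] [IsScalarTower ℂ A M] [IsScalarTower ℂ Aᵐᵒᵖ M],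
      ∃ p : (M →₀ Outer A) →ₗ[ℂ] M, IsBimoduleMap (A := A) p ∧ Function.Surjective p := by
    intro M _ _ _ _ _ _ _
    refine ⟨Finsupp.lsum ℂ fun m => sandwich m ∘ₗ toOuter.symm.toLinearMap,
      ⟨fun a n => ?_, fun a n => ?_⟩, fun m => ⟨Finsupp.single m (toOuter (1 ⊗ₜ 1)), by simp⟩⟩
    all_goals
      induction n using Finsupp.induction_linear with
      | zero => simp
      | add x y hx hy => simp only [map_add, smul_add, hx, hy]
      | single j x =>
        obtain ⟨x, rfl⟩ := toOuter.surjective x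
        simp [smul_toOuter, op_smul_toOuter, sandwich_outerLeft, sandwich_outerRight]
  have seq : ∀ (M : Type) [AddCommGroup M] [Module ℂ M] [Module A M] [Module Aᵐᵒᵖ M]
      [SMulCommClass A Aᵐᵒᵖ M] [IsScalarTower ℂ A M] [IsScalarTower ℂ Aᵐᵒᵖ M],
      ∃ (N : Submodule ℂ (M →₀ Outer A)) (hl : ∀ (a : A), ∀ x ∈ N, a • x ∈ N)
        (hr : ∀ (a : A), ∀ x ∈ N, op a • x ∈ N) (p : (M →₀ Outer A) →ₗ[ℂ] M),
        IsBimoduleMap (A := A) p ∧ Function.Surjective p ∧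
        Function.Exact (SubBimodule.incl : SubBimodule N hl hr →ₗ[ℂ] _) p := by
    intro M _ _ _ _ _ _ _
    obtain ⟨p, hp, hsurj⟩ := cover M
    refine ⟨LinearMap.ker p, fun a x hx => ?_, fun a x hx => ?_, p, hp, hsurj, fun x => ?_⟩
    · rw [LinearMap.mem_ker] at hx ⊢; rw [hp.left, hx, smul_zero]
    · rw [LinearMap.mem_ker] at hx ⊢; rw [hp.right, hx, smul_zero]
    · exact ⟨fun hx => ⟨⟨x, hx⟩, rfl⟩, fun ⟨y, hy⟩ => hy ▸ y.2⟩
  have incl_inj : ∀ {F : Type} [AddCommGroup F] [Module ℂ F] [Module A F] [Module Aᵐᵒᵖ F]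
      {N : Submodule ℂ F} {hl : ∀ (a : A), ∀ x ∈ N, a • x ∈ N}
      {hr : ∀ (a : A), ∀ x ∈ N, op a • x ∈ N},
      Function.Injective (SubBimodule.incl : SubBimodule N hl hr →ₗ[ℂ] F) :=
    fun h => Subtype.ext h
  have hF₀ := fun ι : Type => eq_zero_of_isCocycle₀_free (A := A) ι h₀
  have hF₁ := fun ι : Type => isCoboundary₁_free (A := A) ι hfg h₀ h₁
  have inj₁ : ∀ (M : Type) [AddCommGroup M] [Module ℂ M] [Module A M] [Module Aᵐᵒᵖ M]
      [SMulCommClass A Aᵐᵒᵖ M] [IsScalarTower ℂ A M] [IsScalarTower ℂ Aᵐᵒᵖ M] (f : A →ₗ[ℂ] M),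
      IsCocycle₁ f → cap₁ f R.cycle ∈ LinearMap.range (b₂ M σ) → IsCoboundary₁ f := by
    intro M _ _ _ _ _ _ _ f hf hc
    obtain ⟨N, hl, hr, p, hp, hsurj, hex⟩ := seq M
    exact inj_cap₁_of_exact R.b₂_cycle SubBimodule.isBimoduleMap_incl hp incl_inj hsurj hex
      (hF₁ M) (fun f => R.inj_cap₂) hf hc
  have surj₁ : ∀ (M : Type) [AddCommGroup M] [Module ℂ M] [Module A M] [Module Aᵐᵒᵖ M]
      [SMulCommClass A Aᵐᵒᵖ M] [IsScalarTower ℂ A M] [IsScalarTower ℂ Aᵐᵒᵖ M] (w : M ⊗[ℂ] A),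
      b₁ M σ w = 0 →
        ∃ f : A →ₗ[ℂ] M, IsCocycle₁ f ∧ w - cap₁ f R.cycle ∈ LinearMap.range (b₂ M σ) := by
    intro M _ _ _ _ _ _ _ w hw
    obtain ⟨N, hl, hr, p, hp, hsurj, hex⟩ := seq M
    exact surj_cap₁_of_exact R.b₂_cycle SubBimodule.isBimoduleMap_incl hp hsurj hex
      (isInduced_free M) (fun f => R.inj_cap₂) (fun w => R.surj_cap₂ w) hw
  refine ⟨R.b₂_cycle, fun M _ _ _ _ _ _ _ => ?_⟩
  obtain ⟨N, hl, hr, p, hp, hsurj, hex⟩ := seq M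
  exact
    { inj₀ := fun m hm hmc => inj_cap₀_of_exact R.b₂_cycle SubBimodule.isBimoduleMap_incl hp
        incl_inj hsurj hex (hF₀ M) (inj₁ _) hm hmc
      surj₀ := fun w hw => surj_cap₀_of_exact R.b₂_cycle SubBimodule.isBimoduleMap_incl hp
        incl_inj hsurj hex (isInduced_free M) (hF₁ M) (surj₁ _) hw
      inj₁ := inj₁ M
      surj₁ := surj₁ M
      inj₂ := fun f => R.inj_cap₂
      surj₂ := R.surj_cap₂
      vanish₃ := fun f => R.vanish₃ }

end Shift

/-! ## The coordinate ring of quantum `SU(2)` -/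

variable {q : ℝ}

local notation "𝐚" => SU.gen q SUGen.a
local notation "𝐛" => SU.gen q SUGen.b
local notation "𝐜" => SU.gen q SUGen.c
local notation "𝐝" => SU.gen q SUGen.d
local notation "𝐪" => (q : ℂ)

namespace SU

variable (q)

theorem gen_ab : 𝐚 * 𝐛 = 𝐪 • (𝐛 * 𝐚) := by
  have h := RingQuot.mkAlgHom_rel ℂ (SURel.ab (q := q))
  simp only [map_mul, map_smul, map_add, map_one] at h
  exact h

theorem gen_ac : 𝐚 * 𝐜 = 𝐪 • (𝐜 * 𝐚) := by
  have h := RingQuot.mkAlgHom_rel ℂ (SURel.ac (q := q))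
  simp only [map_mul, map_smul, map_add, map_one] at h
  exact h

theorem gen_bd : 𝐛 * 𝐝 = 𝐪 • (𝐝 * 𝐛) := by
  have h := RingQuot.mkAlgHom_rel ℂ (SURel.bd (q := q))
  simp only [map_mul, map_smul, map_add, map_one] at h
  exact h

theorem gen_cd : 𝐜 * 𝐝 = 𝐪 • (𝐝 * 𝐜) := by
  have h := RingQuot.mkAlgHom_rel ℂ (SURel.cd (q := q))
  simp only [map_mul, map_smul, map_add, map_one] at h
  exact h

theorem gen_bc : 𝐛 * 𝐜 = 𝐜 * 𝐛 := by
  have h := RingQuot.mkAlgHom_rel ℂ (SURel.bc (q := q))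
  simp only [map_mul, map_smul, map_add, map_one] at h
  exact h

theorem gen_ad : 𝐚 * 𝐝 = 1 + 𝐪 • (𝐛 * 𝐜) := by
  have h := RingQuot.mkAlgHom_rel ℂ (SURel.ad (q := q))
  simp only [map_mul, map_smul, map_add, map_one] at h
  exact h

theorem gen_da : 𝐝 * 𝐚 = 1 + 𝐪⁻¹ • (𝐛 * 𝐜) := by
  have h := RingQuot.mkAlgHom_rel ℂ (SURel.da (q := q))
  simp only [map_mul, map_smul, map_add, map_one] at h
  exact h

/-- Homomorphisms out of `SU q` are given by four elements that satisfy the relations. -/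
theorem exists_hom {B : Type} [Semiring B] [Algebra ℂ B] (f : SUGen → B)
    (hab : f .a * f .b = 𝐪 • (f .b * f .a)) (hac : f .a * f .c = 𝐪 • (f .c * f .a))
    (hbd : f .b * f .d = 𝐪 • (f .d * f .b)) (hcd : f .c * f .d = 𝐪 • (f .d * f .c))
    (hbc : f .b * f .c = f .c * f .b) (had : f .a * f .d = 1 + 𝐪 • (f .b * f .c))
    (hda : f .d * f .a = 1 + 𝐪⁻¹ • (f .b * f .c)) :
    ∃ φ : SU q →ₐ[ℂ] B, ∀ g, φ (gen q g) = f g := by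
  refine ⟨RingQuot.liftAlgHom ℂ ⟨FreeAlgebra.lift ℂ f, ?_⟩, fun g => ?_⟩
  · intro x y h
    cases h <;> simpa only [map_mul, map_smul, map_add, map_one, FreeAlgebra.lift_ι_apply]
  · rw [gen, RingQuot.liftAlgHom_mkAlgHom_apply, FreeAlgebra.lift_ι_apply]

/-- Induction over words in the generators, extended on the left. -/
theorem induction_left {p : SU q → Prop} (one : p 1) (add : ∀ x y, p x → p y → p (x + y))
    (smul : ∀ (s : ℂ) x, p x → p (s • x)) (mul : ∀ g x, p x → p (gen q g * x)) (x : SU q) : p x := by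
  obtain ⟨x, rfl⟩ := RingQuot.mkAlgHom_surjective ℂ (SURel q) x
  suffices h : ∀ y, p y → p (RingQuot.mkAlgHom ℂ (SURel q) x * y) by
    simpa using h 1 one
  induction x using FreeAlgebra.induction with
  | grade0 r =>
    intro y hy
    rw [AlgHom.commutes, ← Algebra.smul_def]; exact smul r y hy
  | grade1 g => exact fun y hy => mul g y hy
  | mul a b ha hb => intro y hy; rw [map_mul, mul_assoc]; exact ha _ (hb _ hy)
  | add a b ha hb => intro y hy; rw [map_add, add_mul]; exact add _ _ (ha _ hy) (hb _ hy)

/-- Induction over words in the generators, extended on the right. -/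
theorem induction_right {p : SU q → Prop} (one : p 1) (add : ∀ x y, p x → p y → p (x + y))
    (smul : ∀ (s : ℂ) x, p x → p (s • x)) (mul : ∀ g x, p x → p (x * gen q g)) (x : SU q) :
    p x := by
  obtain ⟨x, rfl⟩ := RingQuot.mkAlgHom_surjective ℂ (SURel q) x
  suffices h : ∀ y, p y → p (y * RingQuot.mkAlgHom ℂ (SURel q) x) by
    simpa using h 1 one
  induction x using FreeAlgebra.induction with
  | grade0 r =>
    intro y hy
    rw [AlgHom.commutes, ← Algebra.commutes, ← Algebra.smul_def]; exact smul r y hy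
  | grade1 g => exact fun y hy => mul g y hy
  | mul a b ha hb => intro y hy; rw [map_mul, ← mul_assoc]; exact hb _ (ha _ hy)
  | add a b ha hb => intro y hy; rw [map_add, mul_add]; exact add _ _ (ha _ hy) (hb _ hy)

/-! ### A linear basis -/

/-- The space with basis `a^n b^j c^k` (`n ≥ 0`) and `d^{-n} b^j c^k` (`n < 0`). -/
abbrev PBW : Type := (ℤ × ℕ × ℕ) →₀ ℂ

/-- A basis vector. -/
abbrev pbwVec (n : ℤ) (j k : ℕ) : PBW := Finsupp.single (n, j, k) 1

/-- Left multiplication by the generators, in the basis. -/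
def pbwGen : SUGen → Module.End ℂ PBW
  | .a => Finsupp.linearCombination ℂ fun i => pbwVec (i.1 + 1) i.2.1 i.2.2 +
      if i.1 < 0 then 𝐪 ^ (-i.1 - i.1 - 1) • pbwVec (i.1 + 1) (i.2.1 + 1) (i.2.2 + 1) else 0
  | .b => Finsupp.linearCombination ℂ fun i => 𝐪 ^ (-i.1) • pbwVec i.1 (i.2.1 + 1) i.2.2
  | .c => Finsupp.linearCombination ℂ fun i => 𝐪 ^ (-i.1) • pbwVec i.1 i.2.1 (i.2.2 + 1)
  | .d => Finsupp.linearCombination ℂ fun i => pbwVec (i.1 - 1) i.2.1 i.2.2 +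
      if 0 < i.1 then 𝐪 ^ (1 - i.1 - i.1) • pbwVec (i.1 - 1) (i.2.1 + 1) (i.2.2 + 1) else 0

theorem pbwGen_a (n : ℤ) (j k : ℕ) : pbwGen q .a (pbwVec n j k) = pbwVec (n + 1) j k +
    if n < 0 then 𝐪 ^ (-n - n - 1) • pbwVec (n + 1) (j + 1) (k + 1) else 0 := by
  rw [pbwGen, Finsupp.linearCombination_single, one_smul]

theorem pbwGen_b (n : ℤ) (j k : ℕ) :
    pbwGen q .b (pbwVec n j k) = 𝐪 ^ (-n) • pbwVec n (j + 1) k := by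
  rw [pbwGen, Finsupp.linearCombination_single, one_smul]

theorem pbwGen_c (n : ℤ) (j k : ℕ) :
    pbwGen q .c (pbwVec n j k) = 𝐪 ^ (-n) • pbwVec n j (k + 1) := by
  rw [pbwGen, Finsupp.linearCombination_single, one_smul]

theorem pbwGen_d (n : ℤ) (j k : ℕ) : pbwGen q .d (pbwVec n j k) = pbwVec (n - 1) j k +
    if 0 < n then 𝐪 ^ (1 - n - n) • pbwVec (n - 1) (j + 1) (k + 1) else 0 := by
  rw [pbwGen, Finsupp.linearCombination_single, one_smul]

theorem pbw_ext {f g : Module.End ℂ PBW} (h : ∀ n j k, f (pbwVec n j k) = g (pbwVec n j k)) :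
    f = g := by
  refine Finsupp.lhom_ext' fun i => LinearMap.ext_ring (h i.1 i.2.1 i.2.2)

variable {q}

theorem exists_pbwRep (hq : 0 < q) :
    ∃ φ : SU q →ₐ[ℂ] Module.End ℂ PBW, ∀ g, φ (gen q g) = pbwGen q g := by
  have hq' := ofReal_ne_zero hq
  have hz : ∀ (n : ℤ), 𝐪 ^ n ≠ 0 := fun n => zpow_ne_zero n hq'
  apply exists_hom <;> refine pbw_ext fun n j k => ?_ <;>
    simp only [Module.End.mul_apply, pbwGen_a, pbwGen_b, pbwGen_c, pbwGen_d, map_add, map_smul,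
      lsmul_apply, ladd_apply, Module.End.one_apply, smul_add, smul_smul,
      smul_ite, smul_zero, apply_ite (pbwGen q _), map_zero, sub_add_cancel, add_sub_cancel_right]
  · split_ifs <;> match_scalars <;>
      simp only [zpow_add₀ hq', zpow_sub₀ hq', zpow_neg, zpow_one, neg_add] <;> field_simp
  · split_ifs <;> match_scalars <;>
      simp only [zpow_add₀ hq', zpow_sub₀ hq', zpow_neg, zpow_one, neg_add] <;> field_simp
  · split_ifs <;> match_scalars <;>
      simp only [zpow_add₀ hq', zpow_sub₀ hq', zpow_neg, zpow_one, neg_add] <;> field_simp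
  · split_ifs <;> match_scalars <;>
      simp only [zpow_add₀ hq', zpow_sub₀ hq', zpow_neg, zpow_one, neg_add] <;> field_simp
  · split_ifs <;> first | (exfalso; omega) | (match_scalars <;>
      simp only [zpow_add₀ hq', zpow_sub₀ hq', zpow_neg, zpow_one, neg_add] <;> field_simp)
  · split_ifs <;> first | (exfalso; omega) | (match_scalars <;>
      simp only [zpow_add₀ hq', zpow_sub₀ hq', zpow_neg, zpow_one, neg_add] <;> field_simp)

/-- The left regular representation, in the basis. -/
def pbwRep (hq : 0 < q) : SU q →ₐ[ℂ] Module.End ℂ PBW := (exists_pbwRep hq).choose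

@[simp] theorem pbwRep_gen (hq : 0 < q) (g : SUGen) : pbwRep hq (gen q g) = pbwGen q g :=
  (exists_pbwRep hq).choose_spec g

variable (q) in
/-- `a^n` for `n ≥ 0`, and `d^{-n}` for `n < 0`. -/
def adPow : ℤ → SU q
  | .ofNat n => 𝐚 ^ n
  | .negSucc n => 𝐝 ^ (n + 1)

theorem gen_b_mul_adPow (hq : 0 < q) (n : ℤ) :
    𝐛 * adPow q n = 𝐪 ^ (-n) • (adPow q n * 𝐛) := by
  have hq' := ofReal_ne_zero hq
  cases n with
  | ofNat n =>
    simp only [adPow, Int.ofNat_eq_natCast, zpow_neg, zpow_natCast]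
    induction n with
    | zero => simp
    | succ n ih =>
      rw [pow_succ, ← mul_assoc, ih, smul_mul_assoc, mul_assoc, mul_assoc, gen_ab, mul_smul_comm,
        smul_smul, pow_succ, mul_inv, mul_assoc, inv_mul_cancel₀ hq', mul_one]
  | negSucc n =>
    simp only [adPow, Int.negSucc_eq, neg_neg]
    rw [show ((n : ℤ) + 1) = ((n + 1 : ℕ) : ℤ) by simp, zpow_natCast]
    generalize n + 1 = m
    induction m with
    | zero => simp
    | succ n ih =>
      rw [pow_succ, ← mul_assoc, ih, smul_mul_assoc, mul_assoc, mul_assoc, gen_bd, mul_smul_comm,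
        smul_smul, pow_succ]

theorem gen_c_mul_adPow (hq : 0 < q) (n : ℤ) :
    𝐜 * adPow q n = 𝐪 ^ (-n) • (adPow q n * 𝐜) := by
  have hq' := ofReal_ne_zero hq
  cases n with
  | ofNat n =>
    simp only [adPow, Int.ofNat_eq_natCast, zpow_neg, zpow_natCast]
    induction n with
    | zero => simp
    | succ n ih =>
      rw [pow_succ, ← mul_assoc, ih, smul_mul_assoc, mul_assoc, mul_assoc, gen_ac, mul_smul_comm,
        smul_smul, pow_succ, mul_inv, mul_assoc, inv_mul_cancel₀ hq', mul_one]
  | negSucc n =>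
    simp only [adPow, Int.negSucc_eq, neg_neg]
    rw [show ((n : ℤ) + 1) = ((n + 1 : ℕ) : ℤ) by simp, zpow_natCast]
    generalize n + 1 = m
    induction m with
    | zero => simp
    | succ n ih =>
      rw [pow_succ, ← mul_assoc, ih, smul_mul_assoc, mul_assoc, mul_assoc, gen_cd, mul_smul_comm,
        smul_smul, pow_succ]

theorem gen_bc_mul_adPow (hq : 0 < q) (n : ℤ) :
    𝐛 * 𝐜 * adPow q n =
      𝐪 ^ (-n - n) • (adPow q n * (𝐛 * 𝐜)) := by
  have hq' := ofReal_ne_zero hq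
  rw [mul_assoc, gen_c_mul_adPow hq, mul_smul_comm, ← mul_assoc, gen_b_mul_adPow hq,
    smul_mul_assoc, smul_smul, mul_assoc, ← zpow_add₀ hq', sub_eq_add_neg]

theorem gen_a_mul_adPow (hq : 0 < q) (n : ℤ) : 𝐚 * adPow q n = adPow q (n + 1) +
    if n < 0 then 𝐪 ^ (-n - n - 1) • (adPow q (n + 1) * (𝐛 * 𝐜)) else 0 := by
  have hq' := ofReal_ne_zero hq
  cases n with
  | ofNat n =>
    have : ¬ (n : ℤ) < 0 := by omega
    simp only [Int.ofNat_eq_natCast, this, if_false, add_zero]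
    exact (pow_succ' _ n).symm
  | negSucc n =>
    have h1 : adPow q (Int.negSucc n + 1) = 𝐝 ^ n := by
      cases n with
      | zero => simp [adPow, show Int.negSucc 0 + 1 = Int.ofNat 0 from rfl]
      | succ n => rfl
    rw [if_pos (Int.negSucc_lt_zero n), adPow, pow_succ', ← mul_assoc, gen_ad, add_mul, one_mul,
      smul_mul_assoc, ← h1, gen_bc_mul_adPow hq, smul_smul, ← zpow_one_add₀ hq']
    congr 3
    ring

theorem gen_d_mul_adPow (hq : 0 < q) (n : ℤ) : 𝐝 * adPow q n = adPow q (n - 1) +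
    if 0 < n then 𝐪 ^ (1 - n - n) • (adPow q (n - 1) * (𝐛 * 𝐜)) else 0 := by
  have hq' := ofReal_ne_zero hq
  cases n with
  | ofNat n =>
    cases n with
    | zero =>
      rw [if_neg (by simp), add_zero]
      change 𝐝 * 𝐚 ^ 0 = 𝐝 ^ (0 + 1)
      simp
    | succ n =>
      have h1 : adPow q (Int.ofNat (n + 1) - 1) = 𝐚 ^ n := by
        rw [show Int.ofNat (n + 1) - 1 = Int.ofNat n by simp]; rfl
      rw [if_pos (by simp), adPow, pow_succ', ← mul_assoc, gen_da, add_mul,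
        one_mul, smul_mul_assoc, ← h1, gen_bc_mul_adPow hq, smul_smul, ← zpow_neg_one,
        ← zpow_add₀ hq']
      congr 3
      ring
  | negSucc n =>
    rw [if_neg (by simp), add_zero]
    exact (pow_succ' _ (n + 1)).symm

variable (q) in
/-- The basis elements of `SU q`. -/
def monomial (n : ℤ) (j k : ℕ) : SU q := adPow q n * 𝐛 ^ j * 𝐜 ^ k

variable (q) in
/-- The linear map from the model to `SU q`. -/
def ofPBW : PBW →ₗ[ℂ] SU q := Finsupp.linearCombination ℂ fun i => monomial q i.1 i.2.1 i.2.2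

@[simp] theorem ofPBW_vec (n : ℤ) (j k : ℕ) : ofPBW q (pbwVec n j k) = monomial q n j k := by
  simp [ofPBW]

theorem monomial_zero : monomial q 0 0 0 = 1 := by
  change 𝐚 ^ 0 * 𝐛 ^ 0 * 𝐜 ^ 0 = 1
  simp

theorem monomial_mul_b (n : ℤ) (j k : ℕ) :
    monomial q n j k * 𝐛 = monomial q n (j + 1) k := by
  have : Commute (𝐜 ^ k) 𝐛 := Commute.pow_left (gen_bc q).symm k
  rw [monomial, monomial, mul_assoc, this.eq, pow_succ]
  simp only [mul_assoc]

theorem monomial_mul_c (n : ℤ) (j k : ℕ) :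
    monomial q n j k * 𝐜 = monomial q n j (k + 1) := by
  rw [monomial, monomial, mul_assoc, pow_succ]

theorem adPow_bc_mul (n : ℤ) (j k : ℕ) :
    adPow q n * (𝐛 * 𝐜) * 𝐛 ^ j * 𝐜 ^ k =
      monomial q n (j + 1) (k + 1) := by
  have : Commute 𝐜 (𝐛 ^ j) := Commute.pow_right (gen_bc q).symm j
  rw [monomial, pow_succ', pow_succ']
  simp only [mul_assoc]
  congr 2
  rw [← mul_assoc, this.eq, mul_assoc]

theorem ofPBW_gen (hq : 0 < q) (g : SUGen) (v : PBW) :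
    ofPBW q (pbwGen q g v) = gen q g * ofPBW q v := by
  suffices h : ofPBW q ∘ₗ pbwGen q g = LinearMap.mulLeft ℂ (gen q g) ∘ₗ ofPBW q from
    lcongr_fun h v
  refine Finsupp.lhom_ext' fun i => LinearMap.ext_ring ?_
  obtain ⟨n, j, k⟩ := i
  change ofPBW q (pbwGen q g (pbwVec n j k)) = gen q g * ofPBW q (pbwVec n j k)
  cases g
  · rw [pbwGen_a, map_add, ofPBW_vec, ofPBW_vec, monomial, monomial, ← mul_assoc, ← mul_assoc,
      gen_a_mul_adPow hq, apply_ite (ofPBW q), map_smul, ofPBW_vec, map_zero]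
    split_ifs
    · rw [add_mul, add_mul, smul_mul_assoc, smul_mul_assoc, adPow_bc_mul]
    · simp
  · have : Commute 𝐛 (𝐛 ^ j) := Commute.self_pow _ j
    rw [pbwGen_b, map_smul, ofPBW_vec, ofPBW_vec, monomial, monomial, ← mul_assoc, ← mul_assoc,
      gen_b_mul_adPow hq, smul_mul_assoc, smul_mul_assoc, pow_succ']
    simp only [mul_assoc]
  · have : Commute 𝐜 (𝐛 ^ j) := Commute.pow_right (gen_bc q).symm j
    rw [pbwGen_c, map_smul, ofPBW_vec, ofPBW_vec, monomial, monomial, ← mul_assoc, ← mul_assoc,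
      gen_c_mul_adPow hq, smul_mul_assoc, smul_mul_assoc, pow_succ']
    simp only [mul_assoc]
    rw [← mul_assoc 𝐜 (𝐛 ^ j), this.eq, mul_assoc]
  · rw [pbwGen_d, map_add, ofPBW_vec, ofPBW_vec, monomial, monomial, ← mul_assoc, ← mul_assoc,
      gen_d_mul_adPow hq, apply_ite (ofPBW q), map_smul, ofPBW_vec, map_zero]
    split_ifs
    · rw [add_mul, add_mul, smul_mul_assoc, smul_mul_assoc, adPow_bc_mul]
    · simp

/-- The coordinates of an element in the basis. -/
def toPBW (hq : 0 < q) : SU q →ₗ[ℂ] PBW :=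
  (LinearMap.applyₗ (pbwVec 0 0 0)) ∘ₗ (pbwRep hq).toLinearMap

theorem toPBW_apply (hq : 0 < q) (x : SU q) : toPBW hq x = pbwRep hq x (pbwVec 0 0 0) := rfl

theorem toPBW_gen_mul (hq : 0 < q) (g : SUGen) (x : SU q) :
    toPBW hq (gen q g * x) = pbwGen q g (toPBW hq x) := by
  rw [toPBW_apply, map_mul, pbwRep_gen]; rfl

theorem ofPBW_toPBW (hq : 0 < q) (x : SU q) : ofPBW q (toPBW hq x) = x := by
  induction x using induction_left with
  | one => rw [toPBW_apply, map_one, Module.End.one_apply, ofPBW_vec, monomial_zero]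
  | add x y hx hy => rw [map_add, map_add, hx, hy]
  | smul s x hx => rw [map_smul, map_smul, hx]
  | mul g x hx => rw [toPBW_gen_mul, ofPBW_gen hq, hx]

theorem toPBW_monomial (hq : 0 < q) (n : ℤ) (j k : ℕ) :
    toPBW hq (monomial q n j k) = pbwVec n j k := by
  have hc : ∀ k, (pbwGen q .c ^ k) (pbwVec 0 0 0) = pbwVec 0 0 k := by
    intro k
    induction k with
    | zero => rfl
    | succ k ih => rw [pow_succ', Module.End.mul_apply, ih, pbwGen_c]; simp
  have hb : ∀ j, (pbwGen q .b ^ j) (pbwVec 0 0 k) = pbwVec 0 j k := by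
    intro j
    induction j with
    | zero => rfl
    | succ k ih => rw [pow_succ', Module.End.mul_apply, ih, pbwGen_b]; simp
  rw [toPBW_apply, monomial, map_mul, map_mul, map_pow, map_pow, pbwRep_gen, pbwRep_gen,
    Module.End.mul_apply, hc, Module.End.mul_apply, hb]
  cases n with
  | ofNat n =>
    rw [adPow, map_pow, pbwRep_gen]
    induction n with
    | zero => rfl
    | succ n ih =>
      rw [pow_succ', Module.End.mul_apply, ih, pbwGen_a, if_neg (by simp)]; simp
  | negSucc n =>
    rw [adPow, map_pow, pbwRep_gen]
    induction n with
    | zero => rw [zero_add, pow_one, pbwGen_d, if_neg (by simp), add_zero]; rfl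
    | succ n ih =>
      rw [pow_succ', Module.End.mul_apply, ih, pbwGen_d, if_neg (by simp), add_zero]; rfl

theorem toPBW_ofPBW (hq : 0 < q) (v : PBW) : toPBW hq (ofPBW q v) = v := by
  suffices h : toPBW hq ∘ₗ ofPBW q = LinearMap.id from lcongr_fun h v
  refine pbw_ext fun n j k => ?_
  rw [comp_apply, ofPBW_vec, toPBW_monomial]; rfl

/-- Every element is a linear combination of basis elements. -/
theorem induction_monomial (hq : 0 < q) {p : SU q → Prop} (zero : p 0)
    (add : ∀ x y, p x → p y → p (x + y))
    (smul : ∀ (s : ℂ) x, p x → p (s • x)) (mono : ∀ n j k, p (monomial q n j k)) (x : SU q) :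
    p x := by
  rw [← ofPBW_toPBW hq x]
  induction toPBW hq x using Finsupp.induction_linear with
  | zero => simpa using zero
  | add f g hf hg => rw [map_add]; exact add _ _ hf hg
  | single i r =>
    rw [show (Finsupp.single i r : PBW) = r • pbwVec i.1 i.2.1 i.2.2 by simp, map_smul, ofPBW_vec]
    exact smul _ _ (mono _ _ _)

/-- Right multiplication by `b` has a left inverse that commutes with right multiplication
by `c`. -/
theorem exists_div_b (hq : 0 < q) : ∃ l : SU q →ₗ[ℂ] SU q, (∀ x, l (x * 𝐛) = x) ∧
    ∀ x, l (x * 𝐜) = l x * 𝐜 := by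
  let l : PBW →ₗ[ℂ] SU q := Finsupp.linearCombination ℂ fun i =>
    match i with
    | (_, 0, _) => 0
    | (n, j + 1, k) => monomial q n j k
  have hl0 : ∀ n k, (l ∘ₗ toPBW hq) (monomial q n 0 k) = 0 := fun n k => by
    simp [toPBW_monomial, l]
  have hl1 : ∀ n j k, (l ∘ₗ toPBW hq) (monomial q n (j + 1) k) = monomial q n j k :=
    fun n j k => by simp [toPBW_monomial, l]
  refine ⟨l ∘ₗ toPBW hq, fun x => ?_, fun x => ?_⟩
  · induction x using induction_monomial hq with
    | zero => simp
    | add x y hx hy => rw [add_mul, map_add, hx, hy]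
    | smul s x hx => rw [smul_mul_assoc, map_smul, hx]
    | mono n j k => rw [monomial_mul_b, hl1]
  · induction x using induction_monomial hq with
    | zero => simp
    | add x y hx hy => rw [add_mul, map_add, hx, hy, map_add, add_mul]
    | smul s x hx => rw [smul_mul_assoc, map_smul, hx, map_smul, smul_mul_assoc]
    | mono n j k =>
      rw [monomial_mul_c]
      cases j with
      | zero => rw [hl0, hl0, zero_mul]
      | succ j => rw [hl1, hl1, monomial_mul_c]

/-- Right multiplication by `c` has a left inverse. -/
theorem exists_div_c (hq : 0 < q) : ∃ l : SU q →ₗ[ℂ] SU q, ∀ x, l (x * 𝐜) = x := by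
  let l : PBW →ₗ[ℂ] SU q := Finsupp.linearCombination ℂ fun i =>
    match i with
    | (_, _, 0) => 0
    | (n, j, k + 1) => monomial q n j k
  have hl1 : ∀ n j k, (l ∘ₗ toPBW hq) (monomial q n j (k + 1)) = monomial q n j k :=
    fun n j k => by simp [toPBW_monomial, l]
  refine ⟨l ∘ₗ toPBW hq, fun x => ?_⟩
  induction x using induction_monomial hq with
  | zero => simp
  | add x y hx hy => rw [add_mul, map_add, hx, hy]
  | smul s x hx => rw [smul_mul_assoc, map_smul, hx]
  | mono n j k => rw [monomial_mul_c, hl1]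

/-! ### The row grading -/

/-- The row degree of a generator. -/
def rowDeg : SUGen → ℤ
  | .a => 1
  | .b => 1
  | .c => -1
  | .d => -1

/-- The projection of the model to row degree `m`. -/
def pbwRow (m : ℤ) : PBW →ₗ[ℂ] PBW := Finsupp.linearCombination ℂ fun i =>
  if i.1 + i.2.1 - i.2.2 = m then pbwVec i.1 i.2.1 i.2.2 else 0

theorem pbwRow_vec (m n : ℤ) (j k : ℕ) :
    pbwRow m (pbwVec n j k) = if n + j - k = m then pbwVec n j k else 0 := by
  simp [pbwRow]

theorem pbwRow_gen (m : ℤ) (g : SUGen) (v : PBW) :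
    pbwRow (m + rowDeg g) (pbwGen q g v) = pbwGen q g (pbwRow m v) := by
  suffices h : pbwRow (m + rowDeg g) ∘ₗ pbwGen q g = pbwGen q g ∘ₗ pbwRow m from
    lcongr_fun h v
  refine pbw_ext fun n j k => ?_
  rw [comp_apply, comp_apply, pbwRow_vec]
  by_cases h : n + j - k = m
  · rw [if_pos h]
    cases g <;> simp only [pbwGen_a, pbwGen_b, pbwGen_c, pbwGen_d, map_add, map_smul,
      apply_ite (pbwRow _), map_zero, pbwRow_vec, rowDeg]
    · rw [if_pos (by omega), if_pos (c := n + 1 + ((j + 1 : ℕ) : ℤ) - ((k + 1 : ℕ) : ℤ) = m + 1)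
        (by push_cast; omega)]
    · rw [if_pos (by push_cast; omega)]
    · rw [if_pos (by push_cast; omega)]
    · rw [if_pos (by omega), if_pos (c := n - 1 + ((j + 1 : ℕ) : ℤ) - ((k + 1 : ℕ) : ℤ) = m + -1)
        (by push_cast; omega)]
  · rw [if_neg h, map_zero]
    cases g <;> simp only [pbwGen_a, pbwGen_b, pbwGen_c, pbwGen_d, map_add, map_smul,
      apply_ite (pbwRow _), map_zero, pbwRow_vec, rowDeg]
    · rw [if_neg (by omega), if_neg (c := n + 1 + ((j + 1 : ℕ) : ℤ) - ((k + 1 : ℕ) : ℤ) = m + 1)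
        (by push_cast; omega)]; simp
    · rw [if_neg (by push_cast; omega), smul_zero]
    · rw [if_neg (by push_cast; omega), smul_zero]
    · rw [if_neg (by omega), if_neg (c := n - 1 + ((j + 1 : ℕ) : ℤ) - ((k + 1 : ℕ) : ℤ) = m + -1)
        (by push_cast; omega)]; simp

/-- The component of row degree `m`. -/
def row (hq : 0 < q) (m : ℤ) : SU q →ₗ[ℂ] SU q := ofPBW q ∘ₗ pbwRow m ∘ₗ toPBW hq

theorem row_gen_mul (hq : 0 < q) (m : ℤ) (g : SUGen) (x : SU q) :
    row hq (m + rowDeg g) (gen q g * x) = gen q g * row hq m x := by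
  simp only [row, comp_apply, toPBW_gen_mul, pbwRow_gen, ofPBW_gen hq]

theorem row_monomial (hq : 0 < q) (m n : ℤ) (j k : ℕ) :
    row hq m (monomial q n j k) = if n + j - k = m then monomial q n j k else 0 := by
  simp only [row, comp_apply, toPBW_monomial, pbwRow_vec]
  split_ifs <;> simp

theorem row_one (hq : 0 < q) (m : ℤ) : row hq m 1 = if m = 0 then 1 else 0 := by
  rw [← monomial_zero, row_monomial]
  simp [eq_comm]

theorem row_mul_gen (hq : 0 < q) (m : ℤ) (g : SUGen) (x : SU q) :
    row hq (m + rowDeg g) (x * gen q g) = row hq m x * gen q g := by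
  induction x using induction_left generalizing m with
  | one =>
    rw [one_mul, ← mul_one (gen q g), row_gen_mul, row_one]
    split_ifs <;> simp
  | add x y hx hy => rw [add_mul, map_add, hx, hy, map_add, add_mul]
  | smul s x hx => rw [smul_mul_assoc, map_smul, hx, map_smul, smul_mul_assoc]
  | mul g' x hx =>
    have e : m + rowDeg g = (m - rowDeg g' + rowDeg g) + rowDeg g' := by ring
    have e' : m = m - rowDeg g' + rowDeg g' := by ring
    rw [e, mul_assoc, row_gen_mul, hx, ← mul_assoc, ← row_gen_mul, ← e']

end SU

section Resolution

set_option maxSynthPendingDepth 3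

open MulOpposite

namespace SU

/-! ### The Koszul complex of the diagonal -/

variable (q) in
/-- The coproduct on generators. -/
def comulGen : SUGen → SU q ⊗[ℂ] SU q
  | .a => 𝐚 ⊗ₜ 𝐚 + 𝐛 ⊗ₜ 𝐜
  | .b => 𝐚 ⊗ₜ 𝐛 + 𝐛 ⊗ₜ 𝐝
  | .c => 𝐜 ⊗ₜ 𝐚 + 𝐝 ⊗ₜ 𝐜
  | .d => 𝐜 ⊗ₜ 𝐛 + 𝐝 ⊗ₜ 𝐝

variable (q) in
/-- `(1 ⊗ S) Δ` on generators, where `S` is the antipode. -/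
def coactGen : SUGen → SU q ⊗[ℂ] (SU q)ᵐᵒᵖ
  | .a => 𝐚 ⊗ₜ op 𝐝 + (-𝐪) • (𝐛 ⊗ₜ op 𝐜)
  | .b => (-𝐪⁻¹) • (𝐚 ⊗ₜ op 𝐛) + 𝐛 ⊗ₜ op 𝐚
  | .c => 𝐜 ⊗ₜ op 𝐝 + (-𝐪) • (𝐝 ⊗ₜ op 𝐜)
  | .d => (-𝐪⁻¹) • (𝐜 ⊗ₜ op 𝐛) + 𝐝 ⊗ₜ op 𝐚

theorem exists_comul (hq : 0 < q) :
    ∃ φ : SU q →ₐ[ℂ] SU q ⊗[ℂ] SU q, ∀ g, φ (gen q g) = comulGen q g := by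
  have hq' := ofReal_ne_zero hq
  have hdb : 𝐝 * 𝐛 = 𝐪⁻¹ • (𝐛 * 𝐝) := by
    rw [gen_bd, smul_smul, inv_mul_cancel₀ hq', one_smul]
  have hdc : 𝐝 * 𝐜 = 𝐪⁻¹ • (𝐜 * 𝐝) := by
    rw [gen_cd, smul_smul, inv_mul_cancel₀ hq', one_smul]
  apply exists_hom <;>
    simp only [comulGen, mul_add, add_mul, Algebra.TensorProduct.tmul_mul_tmul, gen_ab, gen_ac,
      hdb, hdc, gen_ad, gen_da, ← gen_bc, tmul_smul, ← smul_tmul',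
      tmul_add, add_tmul, smul_add, smul_smul,
      Algebra.TensorProduct.one_def] <;>
    match_scalars <;> first | ring1 | (field_simp; done) | (field_simp; ring1)

theorem exists_coact (hq : 0 < q) :
    ∃ φ : SU q →ₐ[ℂ] SU q ⊗[ℂ] (SU q)ᵐᵒᵖ, ∀ g, φ (gen q g) = coactGen q g := by
  have hq' := ofReal_ne_zero hq
  have hdb : 𝐝 * 𝐛 = 𝐪⁻¹ • (𝐛 * 𝐝) := by
    rw [gen_bd, smul_smul, inv_mul_cancel₀ hq', one_smul]
  have hdc : 𝐝 * 𝐜 = 𝐪⁻¹ • (𝐜 * 𝐝) := by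
    rw [gen_cd, smul_smul, inv_mul_cancel₀ hq', one_smul]
  apply exists_hom <;>
    simp only [coactGen, mul_add, add_mul, Algebra.TensorProduct.tmul_mul_tmul, gen_ab, gen_ac,
      hdb, hdc, gen_ad, gen_da, ← gen_bc, tmul_smul, ← smul_tmul',
      tmul_add, add_tmul, smul_add, smul_smul, ← op_mul, op_smul,
      op_add, op_one, smul_mul_assoc, mul_smul_comm,
      Algebra.TensorProduct.one_def] <;>
    match_scalars <;> first | ring1 | (field_simp; done) | (field_simp; ring1)

/-- The coproduct. -/
def comul (hq : 0 < q) : SU q →ₐ[ℂ] SU q ⊗[ℂ] SU q := (exists_comul hq).choose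

@[simp] theorem comul_gen (hq : 0 < q) (g : SUGen) : comul hq (gen q g) = comulGen q g :=
  (exists_comul hq).choose_spec g

/-- The homomorphism `(1 ⊗ S) Δ`. -/
def coact (hq : 0 < q) : SU q →ₐ[ℂ] SU q ⊗[ℂ] (SU q)ᵐᵒᵖ := (exists_coact hq).choose

@[simp] theorem coact_gen (hq : 0 < q) (g : SUGen) : coact hq (gen q g) = coactGen q g :=
  (exists_coact hq).choose_spec g

/-- `x ⊗ y ↦ x g ⊗ h y`. -/
def inner₂ (g h : SU q) : SU q ⊗[ℂ] SU q →ₗ[ℂ] SU q ⊗[ℂ] SU q :=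
  TensorProduct.map (LinearMap.mulRight ℂ g) (LinearMap.mulLeft ℂ h)

@[simp] theorem inner₂_tmul (g h x y : SU q) :
    inner₂ g h (x ⊗ₜ[ℂ] y) = (x * g) ⊗ₜ (h * y) := by
  simp [inner₂]

/-- The action of `SU q ⊗ (SU q)ᵐᵒᵖ` by inner multiplications. -/
def innerHom : SU q ⊗[ℂ] (SU q)ᵐᵒᵖ →ₗ[ℂ] Module.End ℂ (SU q ⊗[ℂ] SU q) :=
  TensorProduct.lift (LinearMap.mk₂ ℂ (fun g h => inner₂ g (unop h))
    (fun g g' h => by ext; simp [mul_add, add_tmul])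
    (fun s g h => by ext; simp [smul_tmul'])
    (fun g h h' => by ext; simp [add_mul, tmul_add])
    (fun s g h => by ext; simp))

@[simp] theorem innerHom_tmul (g : SU q) (h : (SU q)ᵐᵒᵖ) :
    innerHom (g ⊗ₜ h) = inner₂ g (unop h) := by
  simp [innerHom]

theorem innerHom_mul (v w : SU q ⊗[ℂ] (SU q)ᵐᵒᵖ) : innerHom (v * w) = innerHom w * innerHom v := by
  induction v using induction_on with
  | zero => simp
  | add x y hx hy => rw [add_mul, map_add, hx, hy, map_add, mul_add]
  | tmul g h =>
    induction w using induction_on with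
    | zero => simp
    | add x y hx hy => rw [mul_add, map_add, hx, hy, map_add, add_mul]
    | tmul g' h' =>
      rw [Algebra.TensorProduct.tmul_mul_tmul]
      ext x y
      simp [mul_assoc]

theorem innerHom_one : innerHom (1 : SU q ⊗[ℂ] (SU q)ᵐᵒᵖ) = 1 := by
  rw [Algebra.TensorProduct.one_def]
  ext x y
  simp

/-- The map `x ⊗ y ↦ x₁ ⊗ x₂ y`. -/
def canon (hq : 0 < q) : SU q ⊗[ℂ] SU q →ₗ[ℂ] SU q ⊗[ℂ] SU q :=
  LinearMap.mul' ℂ _ ∘ₗ TensorProduct.map (comul hq).toLinearMap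
    (Algebra.TensorProduct.includeRight : SU q →ₐ[ℂ] SU q ⊗[ℂ] SU q).toLinearMap

theorem canon_tmul (hq : 0 < q) (x y : SU q) :
    canon hq (x ⊗ₜ y) = comul hq x * (1 ⊗ₜ y) := by
  simp [canon]

/-- The map `x ⊗ y ↦ x₁ ⊗ S(x₂) y`. -/
def canonInv (hq : 0 < q) : SU q ⊗[ℂ] SU q →ₗ[ℂ] SU q ⊗[ℂ] SU q :=
  TensorProduct.lift (((innerHom ∘ₗ (coact hq).toLinearMap).flip).comp
    (TensorProduct.mk ℂ (SU q) (SU q) 1)).flip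

theorem canonInv_tmul (hq : 0 < q) (x y : SU q) :
    canonInv hq (x ⊗ₜ y) = innerHom (coact hq x) (1 ⊗ₜ y) := by
  simp [canonInv]

/-- `R_g ⊗ 1`. -/
theorem canonInv_mul_gen (hq : 0 < q) (g : SUGen) (w : SU q ⊗[ℂ] SU q) :
    canonInv hq (inner₂ (gen q g) 1 w) = innerHom (coactGen q g) (canonInv hq w) := by
  suffices h : canonInv hq ∘ₗ inner₂ (gen q g) 1 = innerHom (coactGen q g) ∘ₗ canonInv hq from
    lcongr_fun h w
  ext x y
  simp [canonInv_tmul, innerHom_mul]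

theorem canonInv_canon (hq : 0 < q) (w : SU q ⊗[ℂ] SU q) : canonInv hq (canon hq w) = w := by
  have hq' := ofReal_ne_zero hq
  induction w using induction_on with
  | zero => simp
  | add x y hx hy => rw [map_add, map_add, hx, hy]
  | tmul x y =>
    induction x using induction_right generalizing y with
    | one =>
      rw [canon_tmul, map_one, one_mul, canonInv_tmul, map_one, innerHom_one]; rfl
    | add x x' hx hx' => rw [add_tmul, map_add, map_add, hx, hx']
    | smul s x hx => rw [← smul_tmul', map_smul, map_smul, hx]
    | mul g x hx =>
      have key : ∀ (v : SU q ⊗[ℂ] SU q) (g h y : SU q),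
          v * (g ⊗ₜ h) * (1 ⊗ₜ y) = inner₂ g 1 (v * (1 ⊗ₜ (h * y))) := by
        intro v g h y
        induction v using induction_on with
        | zero => simp
        | add x y hx hy => rw [add_mul, add_mul, hx, hy, add_mul, map_add]
        | tmul x z => simp [mul_assoc]
      have hsd : 𝐝 * 𝐛 = 𝐪⁻¹ • (𝐛 * 𝐝) := by
        rw [gen_bd, smul_smul, inv_mul_cancel₀ hq', one_smul]
      have hdc : 𝐝 * 𝐜 = 𝐪⁻¹ • (𝐜 * 𝐝) := by
        rw [gen_cd, smul_smul, inv_mul_cancel₀ hq', one_smul]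
      rw [canon_tmul, map_mul (comul hq), comul_gen]
      cases g <;>
      · simp only [comulGen, mul_add, add_mul, key, map_add, canonInv_mul_gen, ← canon_tmul, hx,
          coactGen, map_smul, ladd_apply, lsmul_apply, innerHom_tmul,
          inner₂_tmul, unop_op, ← mul_assoc, gen_ab, gen_ac, hsd, hdc, gen_ad, gen_da, ← gen_bc,
          smul_mul_assoc, one_mul, tmul_add, tmul_smul,
          ← smul_tmul', smul_add, smul_smul]
        match_scalars <;> ring1

variable (q) in
/-- `x ⊗ y ↦ x b ⊗ a y - q⁻¹ x a ⊗ b y`. -/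
def koszulB : SU q ⊗[ℂ] SU q →ₗ[ℂ] SU q ⊗[ℂ] SU q :=
  inner₂ 𝐛 𝐚 - 𝐪⁻¹ • inner₂ 𝐚 𝐛

variable (q) in
/-- `x ⊗ y ↦ x c ⊗ d y - q x d ⊗ c y`. -/
def koszulC : SU q ⊗[ℂ] SU q →ₗ[ℂ] SU q ⊗[ℂ] SU q :=
  inner₂ 𝐜 𝐝 - 𝐪 • inner₂ 𝐝 𝐜

theorem koszulB_tmul (x y : SU q) : koszulB q (x ⊗ₜ y) =
    (x * 𝐛) ⊗ₜ (𝐚 * y) - 𝐪⁻¹ • ((x * 𝐚) ⊗ₜ (𝐛 * y)) := by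
  simp [koszulB]

theorem koszulC_tmul (x y : SU q) : koszulC q (x ⊗ₜ y) =
    (x * 𝐜) ⊗ₜ (𝐝 * y) - 𝐪 • ((x * 𝐝) ⊗ₜ (𝐜 * y)) := by
  simp [koszulC]

theorem canonInv_b (hq : 0 < q) (w : SU q ⊗[ℂ] SU q) :
    canonInv hq (inner₂ 𝐛 1 w) = koszulB q (canonInv hq w) := by
  rw [canonInv_mul_gen]
  simp [coactGen, koszulB]
  abel

theorem canonInv_c (hq : 0 < q) (w : SU q ⊗[ℂ] SU q) :
    canonInv hq (inner₂ 𝐜 1 w) = koszulC q (canonInv hq w) := by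
  rw [canonInv_mul_gen]
  simp [coactGen, koszulC]
  abel

theorem canon_koszulB (hq : 0 < q) (w : SU q ⊗[ℂ] SU q) :
    canon hq (koszulB q w) = inner₂ 𝐛 1 (canon hq w) := by
  have hq' := ofReal_ne_zero hq
  suffices h : canon hq ∘ₗ koszulB q = inner₂ 𝐛 1 ∘ₗ canon hq from
    lcongr_fun h w
  ext x y
  have h₁ : 𝐛 * (𝐚 * y) = 𝐪⁻¹ • (𝐚 * (𝐛 * y)) := by
    rw [← mul_assoc, ← mul_assoc, gen_ab, smul_mul_assoc, smul_smul, inv_mul_cancel₀ hq', one_smul]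
  have h₂ : 𝐝 * (𝐚 * y) = y + 𝐪⁻¹ • (𝐛 * (𝐜 * y)) := by
    rw [← mul_assoc, gen_da, add_mul, one_mul, smul_mul_assoc, mul_assoc]
  have h₃ : 𝐜 * (𝐛 * y) = 𝐛 * (𝐜 * y) := by
    rw [← mul_assoc, ← gen_bc, mul_assoc]
  have key : ∀ (v : SU q ⊗[ℂ] SU q),
      v * comulGen q .b * (1 ⊗ₜ (𝐚 * y)) -
        𝐪⁻¹ • (v * comulGen q .a * (1 ⊗ₜ (𝐛 * y))) =
      inner₂ 𝐛 1 (v * (1 ⊗ₜ y)) := by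
    intro v
    induction v using induction_on with
    | zero => simp
    | add x y hx hy =>
      simp only [add_mul, map_add, smul_add, ← hx, ← hy]; abel
    | tmul u v =>
      simp only [comulGen, mul_add, add_mul, Algebra.TensorProduct.tmul_mul_tmul, inner₂_tmul,
        mul_one, one_mul, mul_assoc, h₁, h₂, h₃, mul_smul_comm, tmul_smul, tmul_add,
        smul_add, smul_smul]
      match_scalars <;> first | ring1 | (field_simp; done) | (field_simp; ring1)
  simp only [TensorProduct.AlgebraTensorModule.curry_apply, curry_apply,
    coe_restrictScalars, comp_apply, koszulB_tmul, canon_tmul, map_sub,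
    map_smul, map_mul (comul hq), comul_gen, key]

theorem canon_koszulC (hq : 0 < q) (w : SU q ⊗[ℂ] SU q) :
    canon hq (koszulC q w) = inner₂ 𝐜 1 (canon hq w) := by
  have hq' := ofReal_ne_zero hq
  suffices h : canon hq ∘ₗ koszulC q = inner₂ 𝐜 1 ∘ₗ canon hq from
    lcongr_fun h w
  ext x y
  have h₁ : 𝐜 * (𝐝 * y) = 𝐪 • (𝐝 * (𝐜 * y)) := by
    rw [← mul_assoc, ← mul_assoc, gen_cd, smul_mul_assoc]
  have h₂ : 𝐚 * (𝐝 * y) = y + 𝐪 • (𝐛 * (𝐜 * y)) := by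
    rw [← mul_assoc, gen_ad, add_mul, one_mul, smul_mul_assoc, mul_assoc]
  have h₃ : 𝐛 * (𝐜 * y) = 𝐜 * (𝐛 * y) := by
    rw [← mul_assoc, gen_bc, mul_assoc]
  have key : ∀ (v : SU q ⊗[ℂ] SU q),
      v * comulGen q .c * (1 ⊗ₜ (𝐝 * y)) -
        𝐪 • (v * comulGen q .d * (1 ⊗ₜ (𝐜 * y))) =
      inner₂ 𝐜 1 (v * (1 ⊗ₜ y)) := by
    intro v
    induction v using induction_on with
    | zero => simp
    | add x y hx hy =>
      simp only [add_mul, map_add, smul_add, ← hx, ← hy]; abel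
    | tmul u v =>
      simp only [comulGen, mul_add, add_mul, Algebra.TensorProduct.tmul_mul_tmul, inner₂_tmul,
        mul_one, one_mul, mul_assoc, h₁, h₂, h₃, mul_smul_comm, tmul_smul, tmul_add,
        smul_add, smul_smul]
      match_scalars <;> first | ring1 | (field_simp; done) | (field_simp; ring1)
  simp only [TensorProduct.AlgebraTensorModule.curry_apply, curry_apply,
    coe_restrictScalars, comp_apply, koszulC_tmul, canon_tmul, map_sub,
    map_smul, map_mul (comul hq), comul_gen, key]

theorem inner₂_b_c (z : SU q ⊗[ℂ] SU q) : inner₂ 𝐛 1 (inner₂ 𝐜 1 z) =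
    inner₂ 𝐜 1 (inner₂ 𝐛 1 z) := by
  suffices e : inner₂ 𝐛 1 ∘ₗ inner₂ 𝐜 1 =
      inner₂ 𝐜 1 ∘ₗ inner₂ 𝐛 1 from lcongr_fun e z
  ext x y
  simp [mul_assoc, gen_bc]

theorem koszulB_koszulC (hq : 0 < q) (w : SU q ⊗[ℂ] SU q) :
    koszulB q (koszulC q w) = koszulC q (koszulB q w) := by
  rw [← canonInv_canon hq (koszulB q (koszulC q w)), ← canonInv_canon hq (koszulC q (koszulB q w))]
  congr 1
  rw [canon_koszulB, canon_koszulC, canon_koszulC, canon_koszulB, inner₂_b_c]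

theorem koszulB_injective (hq : 0 < q) : Function.Injective (koszulB q) := by
  obtain ⟨l, hl, -⟩ := exists_div_b hq
  intro w w' h
  have h' := congrArg (fun z => canonInv hq (l.rTensor (SU q) (canon hq z))) h
  have e : l.rTensor (SU q) ∘ₗ inner₂ 𝐛 1 = LinearMap.id := by
    ext x y; simp [hl]
  have e' := fun z => lcongr_fun e z
  simp only [comp_apply, LinearMap.id_apply] at e'
  simpa only [canon_koszulB, e', canonInv_canon] using h'

theorem koszul_exact (hq : 0 < q) {u v : SU q ⊗[ℂ] SU q} (h : koszulB q u + koszulC q v = 0) :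
    ∃ w, koszulC q w = u ∧ -koszulB q w = v := by
  obtain ⟨l, hl, hlc⟩ := exists_div_b hq
  obtain ⟨m, hm⟩ := exists_div_c hq
  have e₁ : ∀ z, l.rTensor (SU q) (inner₂ 𝐛 1 z) = z := fun z => by
    suffices e : l.rTensor (SU q) ∘ₗ inner₂ 𝐛 1 = LinearMap.id from
      lcongr_fun e z
    ext x y; simp [hl]
  have e₂ : ∀ z, l.rTensor (SU q) (inner₂ 𝐜 1 z) =
      inner₂ 𝐜 1 (l.rTensor (SU q) z) := fun z => by
    suffices e : l.rTensor (SU q) ∘ₗ inner₂ 𝐜 1 =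
        inner₂ 𝐜 1 ∘ₗ l.rTensor (SU q) from lcongr_fun e z
    ext x y; simp [hlc]
  have e₃ : ∀ z, m.rTensor (SU q) (inner₂ 𝐜 1 z) = z := fun z => by
    suffices e : m.rTensor (SU q) ∘ₗ inner₂ 𝐜 1 = LinearMap.id from
      lcongr_fun e z
    ext x y; simp [hm]
  have h' := congrArg (canon hq) h
  rw [map_add, map_zero, canon_koszulB, canon_koszulC] at h'
  set U := canon hq u with hU
  set V := canon hq v with hV
  have hu : U = inner₂ 𝐜 1 (-l.rTensor (SU q) V) := by
    have := congrArg (l.rTensor (SU q)) h'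
    rw [map_add, map_zero, e₁, e₂] at this
    rw [map_neg]; exact eq_neg_of_add_eq_zero_left this
  have hv : V = -inner₂ 𝐛 1 (-l.rTensor (SU q) V) := by
    rw [hu, inner₂_b_c, ← map_add] at h'
    have := congrArg (m.rTensor (SU q)) h'
    rw [map_zero, e₃] at this
    exact eq_neg_of_add_eq_zero_right this
  refine ⟨canonInv hq (-l.rTensor (SU q) V), ?_, ?_⟩
  · rw [← canonInv_c, ← hu, hU, canonInv_canon]
  · rw [← canonInv_b, ← map_neg, ← hv, hV, canonInv_canon]

end SU

namespace Sphere

/-! ### The Podleś sphere: basis, and embedding into quantum `SU(2)` -/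

section Relations

variable (q)

theorem gen_BA : gen q .B * gen q .A = 𝐪 ^ 2 • (gen q .A * gen q .B) := by
  have h := RingQuot.mkAlgHom_rel ℂ (SphereRel.BA (q := q))
  simp only [map_mul, map_smul, map_sub, map_pow] at h
  exact h

theorem gen_ABs : gen q .A * gen q .Bs = 𝐪 ^ 2 • (gen q .Bs * gen q .A) := by
  have h := RingQuot.mkAlgHom_rel ℂ (SphereRel.ABs (q := q))
  simp only [map_mul, map_smul, map_sub, map_pow] at h
  exact h

theorem gen_BsB : gen q .Bs * gen q .B = gen q .A - gen q .A ^ 2 := by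
  have h := RingQuot.mkAlgHom_rel ℂ (SphereRel.BsB (q := q))
  simp only [map_mul, map_smul, map_sub, map_pow] at h
  exact h

theorem gen_BBs : gen q .B * gen q .Bs =
    𝐪 ^ 2 • gen q .A - 𝐪 ^ 4 • gen q .A ^ 2 := by
  have h := RingQuot.mkAlgHom_rel ℂ (SphereRel.BBs (q := q))
  simp only [map_mul, map_smul, map_sub, map_pow] at h
  exact h

end Relations

/-- Homomorphisms out of `Sphere q` are given by three elements that satisfy the relations. -/
theorem exists_hom {B : Type} [Ring B] [Algebra ℂ B] (f : SphereGen → B)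
    (hBA : f .B * f .A = 𝐪 ^ 2 • (f .A * f .B))
    (hABs : f .A * f .Bs = 𝐪 ^ 2 • (f .Bs * f .A))
    (hBsB : f .Bs * f .B = f .A - f .A ^ 2)
    (hBBs : f .B * f .Bs = 𝐪 ^ 2 • f .A - 𝐪 ^ 4 • f .A ^ 2) :
    ∃ φ : Sphere q →ₐ[ℂ] B, ∀ g, φ (gen q g) = f g := by
  refine ⟨RingQuot.liftAlgHom ℂ ⟨FreeAlgebra.lift ℂ f, ?_⟩, fun g => ?_⟩
  · intro x y h
    cases h <;> simpa only [map_mul, map_smul, map_sub, map_pow, FreeAlgebra.lift_ι_apply]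
  · rw [gen, RingQuot.liftAlgHom_mkAlgHom_apply, FreeAlgebra.lift_ι_apply]

theorem hom_ext {B : Type} [Semiring B] [Algebra ℂ B] {φ ψ : Sphere q →ₐ[ℂ] B}
    (h : ∀ g, φ (gen q g) = ψ (gen q g)) : φ = ψ := by
  apply RingQuot.ringQuot_ext'
  apply FreeAlgebra.hom_ext
  funext g
  exact h g

theorem induction_left {p : Sphere q → Prop} (one : p 1) (add : ∀ x y, p x → p y → p (x + y))
    (smul : ∀ (s : ℂ) x, p x → p (s • x)) (mul : ∀ g x, p x → p (gen q g * x)) (x : Sphere q) :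
    p x := by
  obtain ⟨x, rfl⟩ := RingQuot.mkAlgHom_surjective ℂ (SphereRel q) x
  suffices h : ∀ y, p y → p (RingQuot.mkAlgHom ℂ (SphereRel q) x * y) by
    simpa using h 1 one
  induction x using FreeAlgebra.induction with
  | grade0 r =>
    intro y hy
    rw [AlgHom.commutes, ← Algebra.smul_def]; exact smul r y hy
  | grade1 g => intro y hy; exact mul g y hy
  | mul a b ha hb => intro y hy; rw [map_mul, mul_assoc]; exact ha _ (hb _ hy)
  | add a b ha hb => intro y hy; rw [map_add, add_mul]; exact add _ _ (ha _ hy) (hb _ hy)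

theorem adjoin_gen : Algebra.adjoin ℂ (Set.range (gen q)) = ⊤ := by
  rw [eq_top_iff]
  rintro x -
  induction x using induction_left with
  | one => exact one_mem _
  | add x y hx hy => exact add_mem hx hy
  | smul s x hx => exact Subalgebra.smul_mem _ hx s
  | mul g x hx => exact mul_mem (Algebra.subset_adjoin ⟨g, rfl⟩) hx

@[simp] theorem embed_gen (hq : 0 < q) (g : SphereGen) : embed hq (gen q g) = embedGen q g := by
  rw [gen, embed, RingQuot.liftAlgHom_mkAlgHom_apply, FreeAlgebra.lift_ι_apply]

variable (q) in
/-- `A^i B^n` for `n ≥ 0`, and `A^i (B*)^{-n}` for `n < 0`. -/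
def mono (n : ℤ) (i : ℕ) : Sphere q :=
  gen q .A ^ i * match n with
    | .ofNat n => gen q .B ^ n
    | .negSucc n => gen q .Bs ^ (n + 1)

theorem mono_natCast (n i : ℕ) : mono q n i = gen q .A ^ i * gen q .B ^ n := rfl

theorem mono_neg_natCast (n i : ℕ) : mono q (-n) i = gen q .A ^ i * gen q .Bs ^ n := by
  cases n with
  | zero => simp [mono]
  | succ n => rfl

theorem gen_A_mul_mono (n : ℤ) (i : ℕ) : gen q .A * mono q n i = mono q n (i + 1) := by
  simp only [mono]
  rw [← mul_assoc, ← pow_succ']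

theorem gen_B_mul_pow (i : ℕ) :
    gen q .B * gen q .A ^ i = 𝐪 ^ (2 * i) • (gen q .A ^ i * gen q .B) := by
  induction i with
  | zero => simp
  | succ i ih =>
    rw [pow_succ, ← mul_assoc, ih, smul_mul_assoc, mul_assoc, gen_BA, mul_smul_comm, smul_smul,
      mul_assoc, ← pow_add]
    congr 1

theorem gen_Bs_mul_pow (hq : 0 < q) (i : ℕ) :
    gen q .Bs * gen q .A ^ i = (𝐪 ^ (2 * i))⁻¹ • (gen q .A ^ i * gen q .Bs) := by
  have hq' := ofReal_ne_zero hq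
  have h : gen q .Bs * gen q .A = (𝐪 ^ 2)⁻¹ • (gen q .A * gen q .Bs) := by
    rw [gen_ABs, smul_smul, inv_mul_cancel₀ (pow_ne_zero 2 hq'), one_smul]
  induction i with
  | zero => simp
  | succ i ih =>
    rw [pow_succ, ← mul_assoc, ih, smul_mul_assoc, mul_assoc, h, mul_smul_comm, smul_smul,
      mul_assoc, ← mul_inv, ← pow_add]
    congr 1

/-- The linear span of the basis is everything. -/
theorem induction_mono (hq : 0 < q) {p : Sphere q → Prop} (zero : p 0)
    (add : ∀ x y, p x → p y → p (x + y))
    (smul : ∀ (s : ℂ) x, p x → p (s • x)) (mono : ∀ n i, p (mono q n i)) (x : Sphere q) : p x := by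
  let S : Submodule ℂ (Sphere q) := Submodule.span ℂ (Set.range fun i : ℤ × ℕ => Sphere.mono q i.1 i.2)
  have hS : ∀ n i, Sphere.mono q n i ∈ S := fun n i => Submodule.subset_span ⟨(n, i), rfl⟩
  suffices hx : x ∈ S by
    induction hx using Submodule.span_induction with
    | mem x h => obtain ⟨i, rfl⟩ := h; exact mono i.1 i.2
    | zero => exact zero
    | add x y _ _ hx hy => exact add x y hx hy
    | smul s x _ hx => exact smul s x hx
  have hA : ∀ y ∈ S, gen q .A * y ∈ S := by
    intro y hy
    induction hy using Submodule.span_induction with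
    | mem x h => obtain ⟨i, rfl⟩ := h; rw [gen_A_mul_mono]; exact hS _ _
    | zero => simp
    | add x y _ _ hx hy => rw [mul_add]; exact S.add_mem hx hy
    | smul s x _ hx => rw [mul_smul_comm]; exact S.smul_mem s hx
  have hA' : ∀ (i : ℕ), ∀ y ∈ S, gen q .A ^ i * y ∈ S := by
    intro i
    induction i with
    | zero => intro y hy; simpa using hy
    | succ i ih => intro y hy; rw [pow_succ, mul_assoc]; exact ih _ (hA y hy)
  have hB : ∀ n, gen q .B * Sphere.mono q n 0 ∈ S := by
    intro n
    cases n with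
    | ofNat n =>
      have := hS (n + 1 : ℕ) 0
      rw [mono_natCast, pow_succ'] at this
      simpa [Sphere.mono] using this
    | negSucc n =>
      have := hS (-(n : ℤ)) 0
      rw [mono_neg_natCast] at this
      simp only [Sphere.mono, pow_zero, one_mul, pow_succ', ← mul_assoc, gen_BBs] at this ⊢
      rw [sub_mul, smul_mul_assoc, smul_mul_assoc]
      exact S.sub_mem (S.smul_mem _ (hA _ this))
        (S.smul_mem _ (by rw [mul_assoc, one_mul, mul_assoc]; exact hA _ (hA _ this)))
  have hBs : ∀ n, gen q .Bs * Sphere.mono q n 0 ∈ S := by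
    intro n
    cases n with
    | ofNat n =>
      cases n with
      | zero => simpa [Sphere.mono] using hS (.negSucc 0) 0
      | succ n =>
        have := hS n 0
        rw [mono_natCast] at this
        simp only [Sphere.mono, pow_zero, one_mul, pow_succ', ← mul_assoc, gen_BsB] at this ⊢
        rw [sub_mul]
        exact S.sub_mem (hA _ this) (by rw [mul_assoc, one_mul, mul_assoc]; exact hA _ (hA _ this))
    | negSucc n =>
      have := hS (.negSucc (n + 1)) 0
      simpa [Sphere.mono, pow_succ'] using this
  have hm : ∀ n i, Sphere.mono q n i = gen q .A ^ i * Sphere.mono q n 0 := by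
    intro n i; simp [Sphere.mono]
  induction x using induction_left with
  | one => simpa [Sphere.mono] using hS 0 0
  | add x y hx hy => exact S.add_mem hx hy
  | smul s x hx => exact S.smul_mem s hx
  | mul g x hx =>
    induction hx using Submodule.span_induction with
    | zero => simp
    | add x y _ _ hx hy => rw [mul_add]; exact S.add_mem hx hy
    | smul s x _ hx => rw [mul_smul_comm]; exact S.smul_mem s hx
    | mem x h =>
      obtain ⟨⟨n, i⟩, rfl⟩ := h
      simp only
      rw [hm]
      cases g with
      | A => exact hA _ (hA' _ _ (hS _ _))
      | B =>
        rw [← mul_assoc, gen_B_mul_pow, smul_mul_assoc, mul_assoc]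
        exact S.smul_mem _ (hA' _ _ (hB n))
      | Bs =>
        rw [← mul_assoc, gen_Bs_mul_pow hq, smul_mul_assoc, mul_assoc]
        exact S.smul_mem _ (hA' _ _ (hBs n))

open SU in
theorem exists_embed_mono (hq : 0 < q) (n : ℤ) (i : ℕ) :
    ∃ s : ℂ, s ≠ 0 ∧ embed hq (mono q n i) =
      s • monomial q n (i + (-n).toNat) (i + n.toNat) := by
  have hq' := ofReal_ne_zero hq
  suffices h : ∃ s : ℂ, s ≠ 0 ∧ toPBW hq (embed hq (mono q n i)) =
      s • pbwVec n (i + (-n).toNat) (i + n.toNat) by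
    obtain ⟨s, hs, h⟩ := h
    refine ⟨s, hs, ?_⟩
    rw [← ofPBW_toPBW hq (embed hq (mono q n i)), h, map_smul, ofPBW_vec]
  induction i with
  | zero =>
    have hp : ∀ n : ℕ, ∃ s : ℂ, s ≠ 0 ∧ toPBW hq (embed hq (gen q .B ^ n)) = s • pbwVec n 0 n := by
      intro n
      induction n with
      | zero => exact ⟨1, one_ne_zero, by simp [← monomial_zero, toPBW_monomial]⟩
      | succ n ih =>
        obtain ⟨s, hs, h⟩ := ih
        refine ⟨s * 𝐪 ^ (-(n : ℤ)), mul_ne_zero hs (zpow_ne_zero _ hq'), ?_⟩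
        rw [pow_succ', map_mul, embed_gen, embedGen, mul_assoc, toPBW_gen_mul, toPBW_gen_mul, h,
          map_smul, pbwGen_c, map_smul, map_smul, pbwGen_a, if_neg (by omega), add_zero, smul_smul]
        push_cast
        rfl
    have hn : ∀ n : ℕ, ∃ s : ℂ, s ≠ 0 ∧
        toPBW hq (embed hq (gen q .Bs ^ n)) = s • pbwVec (-n) n 0 := by
      intro n
      induction n with
      | zero => exact ⟨1, one_ne_zero, by simp [← monomial_zero, toPBW_monomial]⟩
      | succ n ih =>
        obtain ⟨s, hs, h⟩ := ih
        refine ⟨-𝐪⁻¹ * (s * 𝐪 ^ (-(-(n : ℤ) - 1))), mul_ne_zero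
          (neg_ne_zero.2 (inv_ne_zero hq')) (mul_ne_zero hs (zpow_ne_zero _ hq')), ?_⟩
        rw [pow_succ', map_mul, embed_gen, embedGen, smul_mul_assoc, map_smul, mul_assoc,
          toPBW_gen_mul, toPBW_gen_mul, h,
          map_smul, pbwGen_d, if_neg (by omega), add_zero, map_smul, pbwGen_b, smul_smul,
          smul_smul]
        congr 1
        · ring
        · congr 2
          push_cast; ring
    cases n with
    | ofNat n =>
      obtain ⟨s, hs, h⟩ := hp n
      exact ⟨s, hs, by simpa [mono] using h⟩
    | negSucc n =>
      obtain ⟨s, hs, h⟩ := hn (n + 1)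
      refine ⟨s, hs, ?_⟩
      simp only [mono, pow_zero, one_mul, zero_add]
      rw [h]
      rfl
  | succ i ih =>
    obtain ⟨s, hs, h⟩ := ih
    refine ⟨-𝐪⁻¹ * (s * (𝐪 ^ (-n) * 𝐪 ^ (-n))), mul_ne_zero
      (neg_ne_zero.2 (inv_ne_zero hq')) (mul_ne_zero hs (mul_ne_zero (zpow_ne_zero _ hq')
        (zpow_ne_zero _ hq'))), ?_⟩
    rw [← gen_A_mul_mono, map_mul, embed_gen, embedGen, smul_mul_assoc, map_smul, mul_assoc,
      toPBW_gen_mul, toPBW_gen_mul, h, map_smul, pbwGen_c, map_smul, map_smul, pbwGen_b, smul_smul,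
      smul_smul, smul_smul]
    congr 1
    · ring
    · rw [add_right_comm i 1, add_right_comm i 1]

open SU in
/-- The projection of quantum `SU(2)` to the Podleś sphere. -/
theorem exists_proj (hq : 0 < q) : ∃ p : SU q →ₗ[ℂ] Sphere q,
    (∀ a, p (embed hq a) = a) ∧ ∀ x, embed hq (p x) = row hq 0 x := by
  choose s hs h using exists_embed_mono (q := q) hq
  let p : PBW →ₗ[ℂ] Sphere q := Finsupp.linearCombination ℂ fun i =>
    if i.1 + i.2.1 - i.2.2 = 0 then
      (s i.1 (min i.2.1 i.2.2))⁻¹ • mono q i.1 (min i.2.1 i.2.2) else 0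
  have hp : ∀ n j k, p (pbwVec n j k) = if n + j - k = 0 then
      (s n (min j k))⁻¹ • mono q n (min j k) else 0 := fun n j k => by simp [p]
  refine ⟨p ∘ₗ toPBW hq, fun a => ?_, fun x => ?_⟩
  · induction a using induction_mono hq with
    | zero => simp
    | add x y hx hy => rw [map_add, map_add, hx, hy]
    | smul t x hx => rw [map_smul, map_smul, hx]
    | mono n i =>
      have e : min (i + (-n).toNat) (i + n.toNat) = i := by omega
      rw [h, map_smul, comp_apply, toPBW_monomial, hp, if_pos (by omega), e, smul_smul,
        mul_inv_cancel₀ (hs n i), one_smul]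
  · induction x using induction_monomial hq with
    | zero => simp
    | add x y hx hy => rw [map_add, map_add, hx, hy, map_add]
    | smul t x hx => rw [map_smul, map_smul, hx, map_smul]
    | mono n j k =>
      rw [comp_apply, toPBW_monomial, hp, row_monomial]
      split_ifs with hh
      · have e₁ : min j k + (-n).toNat = j := by omega
        have e₂ : min j k + n.toNat = k := by omega
        rw [map_smul, h, smul_smul, inv_mul_cancel₀ (hs _ _), one_smul, e₁, e₂]
      · simp

/-- The projection of quantum `SU(2)` to the Podleś sphere. -/
def proj (hq : 0 < q) : SU q →ₗ[ℂ] Sphere q := (exists_proj hq).choose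

@[simp] theorem proj_embed (hq : 0 < q) (a : Sphere q) : proj hq (embed hq a) = a :=
  (exists_proj hq).choose_spec.1 a

theorem embed_proj (hq : 0 < q) (x : SU q) : embed hq (proj hq x) = SU.row hq 0 x :=
  (exists_proj hq).choose_spec.2 x

theorem embed_injective (hq : 0 < q) : Function.Injective (embed hq) :=
  Function.LeftInverse.injective (proj_embed hq)

theorem row_embed_mul (hq : 0 < q) (m : ℤ) (a : Sphere q) (x : SU q) :
    SU.row hq m (embed hq a * x) = embed hq a * SU.row hq m x := by
  have key : ∀ (m : ℤ) (g h : SUGen) (x : SU q), SU.rowDeg g + SU.rowDeg h = 0 →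
      SU.row hq m (SU.gen q g * (SU.gen q h * x)) = SU.gen q g * (SU.gen q h * SU.row hq m x) := by
    intro m g h x hgh
    rw [← SU.row_gen_mul, ← SU.row_gen_mul, add_assoc, add_comm (SU.rowDeg h), hgh, add_zero]
  induction a using induction_left generalizing x with
  | one => simp
  | add a b ha hb => rw [map_add, add_mul, map_add, ha, hb, add_mul]
  | smul s a ha => rw [map_smul, smul_mul_assoc, map_smul, ha, smul_mul_assoc]
  | mul g a ha =>
    rw [map_mul (embed hq), embed_gen]
    cases g <;> simp only [embedGen, smul_mul_assoc, mul_assoc, map_smul] <;> rw [key _ _ _ _ rfl, ha]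

theorem row_mul_embed (hq : 0 < q) (m : ℤ) (x : SU q) (a : Sphere q) :
    SU.row hq m (x * embed hq a) = SU.row hq m x * embed hq a := by
  have key : ∀ (m : ℤ) (g h : SUGen) (x : SU q), SU.rowDeg g + SU.rowDeg h = 0 →
      SU.row hq m (x * SU.gen q g * SU.gen q h) = SU.row hq m x * SU.gen q g * SU.gen q h := by
    intro m g h x hgh
    rw [← SU.row_mul_gen, ← SU.row_mul_gen, add_assoc, hgh, add_zero]
  induction a using induction_left generalizing x with
  | one => simp
  | add a b ha hb => rw [map_add, mul_add, map_add, ha, hb, mul_add]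
  | smul s a ha => rw [map_smul, mul_smul_comm, map_smul, ha, mul_smul_comm]
  | mul g a ha =>
    rw [map_mul (embed hq), ← mul_assoc, ha, embed_gen, ← mul_assoc]
    congr 1
    cases g <;> simp only [embedGen, mul_smul_comm, ← mul_assoc, map_smul] <;> rw [key _ _ _ _ rfl]

theorem proj_embed_mul (hq : 0 < q) (a : Sphere q) (x : SU q) :
    proj hq (embed hq a * x) = a * proj hq x :=
  embed_injective hq (by rw [embed_proj, row_embed_mul, map_mul, embed_proj])

theorem proj_mul_embed (hq : 0 < q) (x : SU q) (a : Sphere q) :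
    proj hq (x * embed hq a) = proj hq x * a :=
  embed_injective hq (by rw [embed_proj, row_mul_embed, map_mul, embed_proj])

theorem embed_proj_of_row (hq : 0 < q) {x : SU q} (h : SU.row hq 0 x = x) :
    embed hq (proj hq x) = x := by rw [embed_proj, h]

open SU in
/-- The centre of the Podleś sphere is trivial. -/
theorem exists_eq_smul_one (hq : 0 < q) (hq₁ : q < 1) {z : Sphere q}
    (hz : ∀ a, a * z = z * a) : ∃ s : ℂ, z = s • 1 := by
  have hq' := ofReal_ne_zero hq
  have hpow : ∀ n : ℤ, n ≠ 0 → 𝐪 ^ n ≠ 1 := by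
    intro n hn h
    have h' : q ^ n = 1 := by exact_mod_cast h
    exact hn (zpow_eq_one_iff_right₀ hq.le hq₁.ne |>.1 h')
  have hl : ∀ (x : SU q) n j k, toPBW hq (𝐛 * (𝐜 * x)) (n, j + 1, k + 1) =
      𝐪 ^ (-n - n) * toPBW hq x (n, j, k) := by
    intro x n j k
    induction x using induction_monomial hq with
    | zero => simp
    | add x y hx hy => simp only [mul_add, map_add, Finsupp.add_apply, hx, hy]
    | smul s x hx =>
      simp only [mul_smul_comm, map_smul, Finsupp.smul_apply, hx, smul_eq_mul]; ring
    | mono n' j' k' =>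
      rw [toPBW_gen_mul, toPBW_gen_mul, toPBW_monomial, pbwGen_c, map_smul, pbwGen_b, smul_smul,
        Finsupp.smul_apply, ← zpow_add₀ hq', ← sub_eq_add_neg]
      by_cases h : (n', j', k') = (n, j, k)
      · obtain ⟨rfl, rfl, rfl⟩ := by simpa using h
        simp
      · rw [pbwVec, Finsupp.single_eq_of_ne (by simpa [eq_comm] using h), pbwVec,
          Finsupp.single_eq_of_ne (by simpa [eq_comm] using h)]
        simp
  have hr : ∀ (x : SU q) n j k, toPBW hq (x * (𝐛 * 𝐜)) (n, j + 1, k + 1) =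
      toPBW hq x (n, j, k) := by
    intro x n j k
    induction x using induction_monomial hq with
    | zero => simp
    | add x y hx hy => simp only [add_mul, map_add, Finsupp.add_apply, hx, hy]
    | smul s x hx => simp only [smul_mul_assoc, map_smul, Finsupp.smul_apply, hx]
    | mono n' j' k' =>
      rw [← mul_assoc, monomial_mul_b, monomial_mul_c, toPBW_monomial, toPBW_monomial]
      by_cases h : (n', j', k') = (n, j, k)
      · obtain ⟨rfl, rfl, rfl⟩ := by simpa using h
        simp
      · rw [pbwVec, Finsupp.single_eq_of_ne (by simpa [eq_comm] using h), pbwVec,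
          Finsupp.single_eq_of_ne (by simpa [eq_comm] using h)]
  have hA : ∀ n j k, n ≠ 0 → toPBW hq (embed hq z) (n, j, k) = 0 := by
    intro n j k hn
    have h := congrArg (fun x => toPBW hq (embed hq x) (n, j + 1, k + 1)) (hz (gen q .A))
    simp only [map_mul (embed hq), embed_gen, embedGen, smul_mul_assoc, mul_smul_comm, map_smul,
      Finsupp.smul_apply, mul_assoc, hl, hr, smul_eq_mul] at h
    have h' := mul_left_cancel₀ (neg_ne_zero.2 (inv_ne_zero hq')) h
    by_contra h0
    exact hpow (-n - n) (by omega) (mul_right_cancel₀ h0 (h'.trans (one_mul _).symm))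
  have hrow : ∀ n (j k : ℕ), n + (j : ℤ) - k ≠ 0 → toPBW hq (embed hq z) (n, j, k) = 0 := by
    intro n j k hn
    have h : row hq 0 (embed hq z) = embed hq z := by
      rw [← embed_proj, proj_embed]
    rw [← h]
    generalize embed hq z = x
    induction x using induction_monomial hq with
    | zero => simp
    | add x y hx hy => simp only [map_add, Finsupp.add_apply, hx, hy, add_zero]
    | smul s x hx => simp only [map_smul, Finsupp.smul_apply, hx, smul_zero]
    | mono n' j' k' =>
      rw [row_monomial]
      split_ifs with h'
      · rw [toPBW_monomial, pbwVec, Finsupp.single_eq_of_ne]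
        rintro ⟨⟩; exact hn h'
      · simp
  choose s hs hmono using exists_embed_mono (q := q) hq
  have hspan : z ∈ Submodule.span ℂ (Set.range fun i : ℕ => mono q 0 i) := by
    have h : z = (toPBW hq (embed hq z)).sum fun i t => t • proj hq (monomial q i.1 i.2.1 i.2.2) := by
      conv_lhs => rw [← proj_embed hq z, ← ofPBW_toPBW hq (embed hq z)]
      rw [ofPBW, Finsupp.linearCombination_apply, Finsupp.sum, Finsupp.sum, map_sum]
      simp only [map_smul]
    rw [h]
    refine Submodule.sum_mem _ fun i hi => Submodule.smul_mem _ _ ?_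
    obtain ⟨n, j, k⟩ := i
    have hn : n = 0 := by
      by_contra hn; exact Finsupp.mem_support_iff.1 hi (hA n j k hn)
    subst hn
    have hjk : j = k := by
      by_contra hjk; exact Finsupp.mem_support_iff.1 hi (hrow 0 j k (by omega))
    subst hjk
    have e : monomial q 0 j j = (s 0 j)⁻¹ • embed hq (mono q 0 j) := by
      rw [hmono, smul_smul, inv_mul_cancel₀ (hs _ _), one_smul]; rfl
    rw [e, map_smul, proj_embed]
    exact Submodule.smul_mem _ _ (Submodule.subset_span ⟨j, rfl⟩)
  have hmono' : ∀ n j, toPBW hq (embed hq (mono q n j)) =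
      s n j • pbwVec n (j + (-n).toNat) (j + n.toNat) := by
    intro n j; rw [hmono, map_smul, toPBW_monomial]
  have hBl : ∀ i : ℕ, ∀ x ∈ Submodule.span ℂ (Set.range fun i : ℕ => mono q 0 i),
      s 0 i * toPBW hq (embed hq (gen q .B * x)) (1, i, i + 1) =
        𝐪 ^ (2 * i) * (s 1 i * toPBW hq (embed hq x) (0, i, i)) ∧
      s 0 i * toPBW hq (embed hq (x * gen q .B)) (1, i, i + 1) =
        s 1 i * toPBW hq (embed hq x) (0, i, i) := by
    intro i x hx
    induction hx using Submodule.span_induction with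
    | zero => simp
    | add x y _ _ hx hy =>
      simp only [mul_add, add_mul, map_add, Finsupp.add_apply, hx.1, hy.1, hx.2, hy.2, and_self]
    | smul t x _ hx =>
      simp only [mul_smul_comm, smul_mul_assoc, map_smul, Finsupp.smul_apply, hx.1, hx.2, and_self]
    | mem x h =>
      obtain ⟨j, rfl⟩ := h
      have e₁ : mono q 0 j * gen q .B = mono q 1 j := by
        have h₀ := mono_natCast (q := q) 0 j
        have h₁ := mono_natCast (q := q) 1 j
        rw [pow_zero, mul_one] at h₀
        rw [pow_one] at h₁
        exact (congrArg (· * gen q .B) h₀).trans h₁.symm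
      have e₂ : gen q .B * mono q 0 j = 𝐪 ^ (2 * j) • mono q 1 j := by
        have h₀ := mono_natCast (q := q) 0 j
        rw [pow_zero, mul_one] at h₀
        rw [← e₁]
        exact (congrArg (gen q .B * ·) h₀).trans ((gen_B_mul_pow j).trans
          (congrArg (fun t => 𝐪 ^ (2 * j) • (t * gen q .B)) h₀.symm))
      simp only [e₁, e₂, map_smul, hmono']
      by_cases hij : j = i
      · subst hij; simp; constructor <;> ring
      · rw [pbwVec, pbwVec]
        simp [Finsupp.single_apply, hij]
  have hzero : ∀ i : ℕ, i ≠ 0 → toPBW hq (embed hq z) (0, i, i) = 0 := by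
    intro i hi
    obtain ⟨h₁, h₂⟩ := hBl i z hspan
    rw [hz, h₂] at h₁
    by_contra h0
    refine hpow (2 * i : ℕ) (by omega) (mul_right_cancel₀ (mul_ne_zero (hs 1 i) h0) ?_)
    rw [zpow_natCast, one_mul]
    exact h₁.symm
  refine ⟨toPBW hq (embed hq z) (0, 0, 0), embed_injective hq ?_⟩
  rw [map_smul, map_one, ← ofPBW_toPBW hq (embed hq z), ← monomial_zero, ← ofPBW_vec, ← map_smul,
    toPBW_ofPBW]
  congr 1
  ext ⟨n, j, k⟩
  by_cases hn : n = 0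
  · subst hn
    by_cases hjk : j = k
    · subst hjk
      by_cases hj : j = 0
      · subst hj; simp
      · rw [hzero j hj]; simp [Finsupp.single_apply, Ne.symm hj]
    · rw [hrow 0 j k (by omega)]
      have : ¬ (0 = j ∧ 0 = k) := by omega
      simp [Finsupp.single_apply, this]
  · rw [hA n j k hn]; simp [Finsupp.single_apply, Ne.symm hn]

theorem exists_scale (s t : ℂ) (h : s * t = 1) : ∃ φ : Sphere q →ₐ[ℂ] Sphere q,
    φ (gen q .A) = gen q .A ∧ φ (gen q .B) = s • gen q .B ∧ φ (gen q .Bs) = t • gen q .Bs := by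
  obtain ⟨φ, hφ⟩ := exists_hom (q := q) (B := Sphere q) (fun g => match g with
    | .A => gen q .A
    | .B => s • gen q .B
    | .Bs => t • gen q .Bs)
    (by simp only [smul_mul_assoc, mul_smul_comm, gen_BA, smul_smul]; rw [mul_comm s])
    (by simp only [smul_mul_assoc, mul_smul_comm, gen_ABs, smul_smul]; rw [mul_comm t])
    (by simp only [smul_mul_assoc, mul_smul_comm, gen_BsB, smul_smul]; rw [h, one_smul])
    (by simp only [smul_mul_assoc, mul_smul_comm, gen_BBs, smul_smul]
        rw [mul_comm t, h, one_smul])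
  exact ⟨φ, hφ .A, hφ .B, hφ .Bs⟩

theorem exists_modular (hq : 0 < q) : ∃ σ : Sphere q ≃ₐ[ℂ] Sphere q,
    σ (gen q .A) = gen q .A ∧ σ (gen q .B) = (𝐪 ^ 2)⁻¹ • gen q .B ∧
      σ (gen q .Bs) = 𝐪 ^ 2 • gen q .Bs := by
  have hq' : 𝐪 ^ 2 ≠ 0 := pow_ne_zero 2 (by exact_mod_cast hq.ne')
  obtain ⟨φ, h₁, h₂, h₃⟩ := exists_scale (q := q) _ _ (inv_mul_cancel₀ hq')
  obtain ⟨ψ, k₁, k₂, k₃⟩ := exists_scale (q := q) _ _ (mul_inv_cancel₀ hq')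
  refine ⟨AlgEquiv.ofAlgHom φ ψ (hom_ext fun g => ?_) (hom_ext fun g => ?_), h₁, h₂, h₃⟩
  · cases g <;> simp only [AlgHom.comp_apply, h₁, h₂, h₃, k₁, k₂, k₃, map_smul, smul_smul,
      inv_mul_cancel₀ hq', mul_inv_cancel₀ hq', one_smul, AlgHom.id_apply]
  · cases g <;> simp only [AlgHom.comp_apply, h₁, h₂, h₃, k₁, k₂, k₃, map_smul, smul_smul,
      inv_mul_cancel₀ hq', mul_inv_cancel₀ hq', one_smul, AlgHom.id_apply]

/-- The twist of the fundamental class. -/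
def modular (hq : 0 < q) : Sphere q ≃ₐ[ℂ] Sphere q := (exists_modular hq).choose

theorem modular_A (hq : 0 < q) : modular hq (gen q .A) = gen q .A :=
  (exists_modular hq).choose_spec.1

theorem modular_B (hq : 0 < q) : modular hq (gen q .B) = (𝐪 ^ 2)⁻¹ • gen q .B :=
  (exists_modular hq).choose_spec.2.1

theorem modular_Bs (hq : 0 < q) : modular hq (gen q .Bs) = 𝐪 ^ 2 • gen q .Bs :=
  (exists_modular hq).choose_spec.2.2

end Sphere

/-! ### A resolution of the Podleś sphere -/

section Via

variable {A G : Type} [Ring A] [Algebra ℂ A] [Ring G] [Algebra ℂ G]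

/-- The `A`-bimodule `G ⊗ G`, for an algebra homomorphism `A → G`. -/
def OuterVia (_ι : A →ₐ[ℂ] G) : Type := Outer G

variable (ι : A →ₐ[ℂ] G)

instance : AddCommGroup (OuterVia ι) := inferInstanceAs (AddCommGroup (Outer G))

instance : Module ℂ (OuterVia ι) := inferInstanceAs (Module ℂ (Outer G))

instance : Module A (OuterVia ι) := Module.compHom (Outer G) (ι : A →+* G)

instance : Module Aᵐᵒᵖ (OuterVia ι) := Module.compHom (Outer G) (AlgHom.op ι : Aᵐᵒᵖ →+* Gᵐᵒᵖ)

/-- The identity map, as a map to the bimodule `G ⊗ G`. -/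
def toVia : G ⊗[ℂ] G ≃ₗ[ℂ] OuterVia ι := LinearEquiv.refl ℂ _

theorem smul_toVia (a : A) (w : G ⊗[ℂ] G) : a • toVia ι w = toVia ι (outerLeft (ι a) w) := rfl

theorem op_smul_toVia (a : A) (w : G ⊗[ℂ] G) :
    op a • toVia ι w = toVia ι (outerRight (ι a) w) := rfl

instance : SMulCommClass A Aᵐᵒᵖ (OuterVia ι) where
  smul_comm a b w := congrArg (toVia ι) (outerLeft_outerRight (ι a) (ι (unop b)) ((toVia ι).symm w))

instance : IsScalarTower ℂ A (OuterVia ι) where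
  smul_assoc s a w := by
    have h : (ι (s • a)) • (show Outer G from w) = s • (ι a) • (show Outer G from w) := by
      rw [map_smul, smul_assoc]
    exact h

instance : IsScalarTower ℂ Aᵐᵒᵖ (OuterVia ι) where
  smul_assoc s a w := by
    have h : (op (ι (s • unop a))) • (show Outer G from w) =
        s • (op (ι (unop a))) • (show Outer G from w) := by
      rw [map_smul, op_smul, smul_assoc]
    exact h

end Via

namespace Sphere

open SU (inner₂ koszulB koszulC row)

theorem embed_ad (hq : 0 < q) :
    embed hq (1 - 𝐪 ^ 2 • gen q .A) = 𝐚 * 𝐝 := by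
  have hq' := ofReal_ne_zero hq
  rw [map_sub, map_one, map_smul, embed_gen, embedGen, SU.gen_ad, smul_smul]
  match_scalars <;> field_simp

theorem embed_da (hq : 0 < q) : embed hq (1 - gen q .A) = 𝐝 * 𝐚 := by
  rw [map_sub, map_one, embed_gen, embedGen, SU.gen_da]
  match_scalars <;> ring

theorem embed_bc (hq : 0 < q) : embed hq (-𝐪 • gen q .A) = 𝐛 * 𝐜 := by
  have hq' := ofReal_ne_zero hq
  rw [map_smul, embed_gen, embedGen, smul_smul]
  match_scalars; field_simp

theorem embed_cb (hq : 0 < q) : embed hq (-𝐪 • gen q .A) = 𝐜 * 𝐛 := by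
  rw [embed_bc, SU.gen_bc]

theorem embed_ac (hq : 0 < q) : embed hq (gen q .B) = 𝐚 * 𝐜 := by
  rw [embed_gen, embedGen]

theorem embed_ca (hq : 0 < q) :
    embed hq (𝐪⁻¹ • gen q .B) = 𝐜 * 𝐚 := by
  have hq' := ofReal_ne_zero hq
  rw [map_smul, embed_ac, SU.gen_ac, smul_smul, inv_mul_cancel₀ hq', one_smul]

theorem embed_bd (hq : 0 < q) : embed hq (-𝐪 • gen q .Bs) = 𝐛 * 𝐝 := by
  have hq' := ofReal_ne_zero hq
  rw [map_smul, embed_gen, embedGen, smul_smul]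
  match_scalars; field_simp

theorem embed_db (hq : 0 < q) : embed hq (-gen q .Bs) = 𝐝 * 𝐛 := by
  have hq' := ofReal_ne_zero hq
  rw [map_neg, embed_gen, embedGen, SU.gen_bd, smul_smul]
  match_scalars; field_simp

theorem row_gen (hq : 0 < q) {m : ℤ} {g : SUGen} (h : m = SU.rowDeg g) :
    row hq m (SU.gen q g) = SU.gen q g := by
  have h₁ := SU.row_gen_mul hq 0 g 1
  rwa [SU.row_one, if_pos rfl, mul_one, zero_add, ← h] at h₁

theorem row_gen_mul_gen (hq : 0 < q) {g h : SUGen} (hgh : SU.rowDeg g + SU.rowDeg h = 0) :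
    row hq 0 (SU.gen q g * SU.gen q h) = SU.gen q g * SU.gen q h := by
  rw [← hgh, add_comm, SU.row_gen_mul, row_gen hq rfl]

/-- A product of row degree zero may be moved through the projection. -/
theorem proj_mul_proj (hq : 0 < q) (x : SU q) {g h : SUGen} (hgh : SU.rowDeg g + SU.rowDeg h = 0) :
    proj hq x * proj hq (SU.gen q g * SU.gen q h) = proj hq (x * SU.gen q g * SU.gen q h) := by
  have e := row_gen_mul_gen hq hgh
  rw [← proj_mul_embed, embed_proj_of_row hq e, mul_assoc]

theorem proj_proj_mul (hq : 0 < q) (x : SU q) {g h : SUGen} (hgh : SU.rowDeg g + SU.rowDeg h = 0) :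
    proj hq (SU.gen q g * SU.gen q h) * proj hq x = proj hq (SU.gen q g * (SU.gen q h * x)) := by
  have e := row_gen_mul_gen hq hgh
  rw [← proj_embed_mul, embed_proj_of_row hq e, mul_assoc]

/-- The projection applied to both factors. -/
def proj₂ (hq : 0 < q) : SU q ⊗[ℂ] SU q →ₗ[ℂ] Sphere q ⊗[ℂ] Sphere q :=
  TensorProduct.map (proj hq) (proj hq)

@[simp] theorem proj₂_tmul (hq : 0 < q) (x y : SU q) :
    proj₂ hq (x ⊗ₜ y) = proj hq x ⊗ₜ proj hq y := rfl

/-- The embedding applied to both factors. -/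
def embed₂ (hq : 0 < q) : Sphere q ⊗[ℂ] Sphere q →ₗ[ℂ] SU q ⊗[ℂ] SU q :=
  TensorProduct.map (embed hq).toLinearMap (embed hq).toLinearMap

@[simp] theorem embed₂_tmul (hq : 0 < q) (x y : Sphere q) :
    embed₂ hq (x ⊗ₜ y) = embed hq x ⊗ₜ embed hq y := rfl

@[simp] theorem proj₂_embed₂ (hq : 0 < q) (w : Sphere q ⊗[ℂ] Sphere q) :
    proj₂ hq (embed₂ hq w) = w := by
  suffices h : proj₂ hq ∘ₗ embed₂ hq = LinearMap.id from lcongr_fun h w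
  ext x y
  simp

theorem embed₂_injective (hq : 0 < q) : Function.Injective (embed₂ hq) :=
  Function.LeftInverse.injective (proj₂_embed₂ hq)

/-- The projection of both factors to row degree `m`. -/
def row₂ (hq : 0 < q) (m : ℤ) : SU q ⊗[ℂ] SU q →ₗ[ℂ] SU q ⊗[ℂ] SU q :=
  TensorProduct.map (row hq m) (row hq m)

@[simp] theorem row₂_tmul (hq : 0 < q) (m : ℤ) (x y : SU q) :
    row₂ hq m (x ⊗ₜ y) = row hq m x ⊗ₜ row hq m y := rfl

theorem embed₂_proj₂ (hq : 0 < q) (w : SU q ⊗[ℂ] SU q) : embed₂ hq (proj₂ hq w) = row₂ hq 0 w := by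
  suffices h : embed₂ hq ∘ₗ proj₂ hq = row₂ hq 0 from lcongr_fun h w
  ext x y
  simp [embed_proj]

theorem row₂_outerLeft (hq : 0 < q) (m : ℤ) (a : Sphere q) (w : SU q ⊗[ℂ] SU q) :
    row₂ hq m (outerLeft (embed hq a) w) = outerLeft (embed hq a) (row₂ hq m w) := by
  suffices h : row₂ hq m ∘ₗ outerLeft (embed hq a) = outerLeft (embed hq a) ∘ₗ row₂ hq m from
    lcongr_fun h w
  ext x y
  simp [row_embed_mul]

theorem row₂_outerRight (hq : 0 < q) (m : ℤ) (a : Sphere q) (w : SU q ⊗[ℂ] SU q) :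
    row₂ hq m (outerRight (embed hq a) w) = outerRight (embed hq a) (row₂ hq m w) := by
  suffices h : row₂ hq m ∘ₗ outerRight (embed hq a) = outerRight (embed hq a) ∘ₗ row₂ hq m from
    lcongr_fun h w
  ext x y
  simp [row_mul_embed]

theorem row₂_inner₂ (hq : 0 < q) (m : ℤ) {g h : SUGen} (hgh : SU.rowDeg g = SU.rowDeg h)
    (w : SU q ⊗[ℂ] SU q) :
    row₂ hq (m + SU.rowDeg g) (inner₂ (SU.gen q g) (SU.gen q h) w) =
      inner₂ (SU.gen q g) (SU.gen q h) (row₂ hq m w) := by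
  suffices h : row₂ hq (m + SU.rowDeg g) ∘ₗ inner₂ (SU.gen q g) (SU.gen q h) =
      inner₂ (SU.gen q g) (SU.gen q h) ∘ₗ row₂ hq m from lcongr_fun h w
  ext x y
  have h₁ := SU.row_mul_gen hq m g x
  have h₂ := SU.row_gen_mul hq m h y
  rw [← hgh] at h₂
  simp [h₁, h₂]

theorem row₂_koszulB (hq : 0 < q) (m : ℤ) (w : SU q ⊗[ℂ] SU q) :
    row₂ hq (m + 1) (koszulB q w) = koszulB q (row₂ hq m w) := by
  simp only [koszulB, lsub_apply, lsmul_apply, map_sub, map_smul]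
  congr 1
  · exact row₂_inner₂ hq m (g := .b) (h := .a) rfl w
  · congr 1
    exact row₂_inner₂ hq m (g := .a) (h := .b) rfl w

theorem row₂_koszulC (hq : 0 < q) (m : ℤ) (w : SU q ⊗[ℂ] SU q) :
    row₂ hq (m + -1) (koszulC q w) = koszulC q (row₂ hq m w) := by
  simp only [koszulC, lsub_apply, lsmul_apply, map_sub, map_smul]
  congr 1
  · exact row₂_inner₂ hq m (g := .c) (h := .d) rfl w
  · congr 1
    exact row₂_inner₂ hq m (g := .d) (h := .c) rfl w

theorem inner₂_outerLeft (x y g : SU q) (w : SU q ⊗[ℂ] SU q) :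
    inner₂ x y (outerLeft g w) = outerLeft g (inner₂ x y w) := by
  suffices h : inner₂ x y ∘ₗ outerLeft g = outerLeft g ∘ₗ inner₂ x y from lcongr_fun h w
  ext u v
  simp [mul_assoc]

theorem inner₂_outerRight (x y g : SU q) (w : SU q ⊗[ℂ] SU q) :
    inner₂ x y (outerRight g w) = outerRight g (inner₂ x y w) := by
  suffices h : inner₂ x y ∘ₗ outerRight g = outerRight g ∘ₗ inner₂ x y from lcongr_fun h w
  ext u v
  simp [mul_assoc]

theorem proj₂_outerLeft (hq : 0 < q) (a : Sphere q) (w : SU q ⊗[ℂ] SU q) :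
    proj₂ hq (outerLeft (embed hq a) w) = outerLeft a (proj₂ hq w) := by
  suffices h : proj₂ hq ∘ₗ outerLeft (embed hq a) = outerLeft a ∘ₗ proj₂ hq from
    lcongr_fun h w
  ext u v
  simp [proj_embed_mul]

theorem proj₂_outerRight (hq : 0 < q) (a : Sphere q) (w : SU q ⊗[ℂ] SU q) :
    proj₂ hq (outerRight (embed hq a) w) = outerRight a (proj₂ hq w) := by
  suffices h : proj₂ hq ∘ₗ outerRight (embed hq a) = outerRight a ∘ₗ proj₂ hq from
    lcongr_fun h w
  ext u v
  simp [proj_mul_embed]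

/-- The bimodule that carries the resolution. -/
abbrev KoszulModule (hq : 0 < q) : Type := OuterVia (embed hq) × OuterVia (embed hq)

/-- The element of `KoszulModule` with given components. -/
def koszulPair (hq : 0 < q) (u v : SU q ⊗[ℂ] SU q) : KoszulModule hq :=
  (toVia (embed hq) u, toVia (embed hq) v)

/-- The first component. -/
def fstPart (hq : 0 < q) : KoszulModule hq →ₗ[ℂ] SU q ⊗[ℂ] SU q :=
  (toVia (embed hq)).symm.toLinearMap ∘ₗ LinearMap.fst ℂ _ _

/-- The second component. -/
def sndPart (hq : 0 < q) : KoszulModule hq →ₗ[ℂ] SU q ⊗[ℂ] SU q :=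
  (toVia (embed hq)).symm.toLinearMap ∘ₗ LinearMap.snd ℂ _ _

section Parts

variable (hq : 0 < q)

@[simp] theorem fstPart_pair (u v : SU q ⊗[ℂ] SU q) : fstPart hq (koszulPair hq u v) = u := rfl

@[simp] theorem sndPart_pair (u v : SU q ⊗[ℂ] SU q) : sndPart hq (koszulPair hq u v) = v := rfl

@[simp] theorem fstPart_smul (a : Sphere q) (p : KoszulModule hq) :
    fstPart hq (a • p) = outerLeft (embed hq a) (fstPart hq p) := rfl

@[simp] theorem sndPart_smul (a : Sphere q) (p : KoszulModule hq) :
    sndPart hq (a • p) = outerLeft (embed hq a) (sndPart hq p) := rfl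

@[simp] theorem fstPart_op_smul (a : Sphere q) (p : KoszulModule hq) :
    fstPart hq (op a • p) = outerRight (embed hq a) (fstPart hq p) := rfl

@[simp] theorem sndPart_op_smul (a : Sphere q) (p : KoszulModule hq) :
    sndPart hq (op a • p) = outerRight (embed hq a) (sndPart hq p) := rfl

theorem part_ext {p p' : KoszulModule hq} (h₁ : fstPart hq p = fstPart hq p')
    (h₂ : sndPart hq p = sndPart hq p') : p = p' :=
  Prod.ext ((toVia (embed hq)).symm.injective h₁) ((toVia (embed hq)).symm.injective h₂)

end Parts

/-- The middle term of the resolution. -/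
def koszulSub (hq : 0 < q) : Submodule ℂ (KoszulModule hq) where
  carrier := {p | row₂ hq (-1) (fstPart hq p) = fstPart hq p ∧
    row₂ hq 1 (sndPart hq p) = sndPart hq p}
  zero_mem' := by simp
  add_mem' := by
    rintro p p' ⟨h₁, h₂⟩ ⟨h₃, h₄⟩
    simp only [Set.mem_ofPred_eq, map_add, h₁, h₂, h₃, h₄, and_self]
  smul_mem' := by
    rintro s p ⟨h₁, h₂⟩
    simp only [Set.mem_ofPred_eq, map_smul, h₁, h₂, and_self]

theorem mem_koszulSub (hq : 0 < q) {p : KoszulModule hq} : p ∈ koszulSub hq ↔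
    row₂ hq (-1) (fstPart hq p) = fstPart hq p ∧ row₂ hq 1 (sndPart hq p) = sndPart hq p :=
  Iff.rfl

/-- `u ↦ βu + γv`. -/
def koszulTotal (hq : 0 < q) : KoszulModule hq →ₗ[ℂ] SU q ⊗[ℂ] SU q :=
  koszulB q ∘ₗ fstPart hq + koszulC q ∘ₗ sndPart hq

/-- The boundary of the resolution. -/
def koszulD (hq : 0 < q) : KoszulModule hq →ₗ[ℂ] Sphere q ⊗[ℂ] Sphere q :=
  proj₂ hq ∘ₗ koszulTotal hq

theorem embed₂_koszulD (hq : 0 < q) {p : KoszulModule hq} (hp : p ∈ koszulSub hq) :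
    embed₂ hq (koszulD hq p) = koszulB q (fstPart hq p) + koszulC q (sndPart hq p) := by
  rw [koszulD, comp_apply, embed₂_proj₂, koszulTotal, ladd_apply,
    comp_apply, comp_apply, map_add]
  have h₁ := row₂_koszulB hq (-1) (fstPart hq p)
  have h₂ := row₂_koszulC hq 1 (sndPart hq p)
  rw [hp.1] at h₁
  rw [hp.2] at h₂
  exact congrArg₂ (· + ·) h₁ h₂

/-- The map `u ⊗ v ↦ pr(u x) ⊗ pr(y g) ⊗ pr(h v)`. -/
def barTerm (hq : 0 < q) (x y g h : SUGen) :
    SU q ⊗[ℂ] SU q →ₗ[ℂ] Sphere q ⊗[ℂ] Sphere q ⊗[ℂ] Sphere q :=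
  TensorProduct.map
    ((TensorProduct.mk ℂ (Sphere q) (Sphere q)).flip (proj hq (SU.gen q y * SU.gen q g)) ∘ₗ
      proj hq ∘ₗ LinearMap.mulRight ℂ (SU.gen q x))
    (proj hq ∘ₗ LinearMap.mulLeft ℂ (SU.gen q h))

@[simp] theorem barTerm_tmul (hq : 0 < q) (x y g h : SUGen) (u v : SU q) :
    barTerm hq x y g h (u ⊗ₜ v) = proj hq (u * SU.gen q x) ⊗ₜ
      proj hq (SU.gen q y * SU.gen q g) ⊗ₜ proj hq (SU.gen q h * v) := rfl

theorem barTerm_outerLeft (hq : 0 < q) (x y g h : SUGen) (a : Sphere q) (w : SU q ⊗[ℂ] SU q) :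
    barTerm hq x y g h (outerLeft (embed hq a) w) = barLeft a (barTerm hq x y g h w) := by
  suffices e : barTerm hq x y g h ∘ₗ outerLeft (embed hq a) =
      barLeft a ∘ₗ barTerm hq x y g h from lcongr_fun e w
  ext u v
  simp [mul_assoc, proj_embed_mul]

theorem barTerm_outerRight (hq : 0 < q) (x y g h : SUGen) (a : Sphere q) (w : SU q ⊗[ℂ] SU q) :
    barTerm hq x y g h (outerRight (embed hq a) w) = barRight a (barTerm hq x y g h w) := by
  suffices e : barTerm hq x y g h ∘ₗ outerRight (embed hq a) =
      barRight a ∘ₗ barTerm hq x y g h from lcongr_fun e w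
  ext u v
  simp [← mul_assoc, proj_mul_embed]

/-- The comparison map on the first component. -/
def barFst (hq : 0 < q) : SU q ⊗[ℂ] SU q →ₗ[ℂ] Sphere q ⊗[ℂ] Sphere q ⊗[ℂ] Sphere q :=
  barTerm hq .a .d .b .a - 𝐪⁻¹ • barTerm hq .a .d .a .b - 𝐪 • barTerm hq .b .c .b .a +
    barTerm hq .b .c .a .b

/-- The comparison map on the second component. -/
def barSnd (hq : 0 < q) : SU q ⊗[ℂ] SU q →ₗ[ℂ] Sphere q ⊗[ℂ] Sphere q ⊗[ℂ] Sphere q :=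
  barTerm hq .d .a .c .d - 𝐪 • barTerm hq .d .a .d .c - 𝐪⁻¹ • barTerm hq .c .b .c .d +
    barTerm hq .c .b .d .c

theorem barBoundary_barTerm (hq : 0 < q) {x y g h : SUGen} (hyg : SU.rowDeg y + SU.rowDeg g = 0)
    (u v : SU q) : barBoundary (barTerm hq x y g h (u ⊗ₜ v)) =
      proj hq (u * SU.gen q x * SU.gen q y * SU.gen q g) ⊗ₜ proj hq (SU.gen q h * v) -
      proj hq (u * SU.gen q x) ⊗ₜ proj hq (SU.gen q y * (SU.gen q g * (SU.gen q h * v))) := by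
  rw [barTerm_tmul, barBoundary_tmul, proj_mul_proj hq _ hyg, proj_proj_mul hq _ hyg]

theorem barBoundary_barFst (hq : 0 < q) (w : SU q ⊗[ℂ] SU q) :
    barBoundary (barFst hq w) = proj₂ hq (koszulB q w) := by
  have hq' := ofReal_ne_zero hq
  suffices e : barBoundary ∘ₗ barFst hq = proj₂ hq ∘ₗ koszulB q from lcongr_fun e w
  ext u v
  have h₁ : ∀ x, u * 𝐚 * 𝐝 * x =
      u * x + 𝐪 • (u * 𝐛 * 𝐜 * x) := by
    intro x
    rw [mul_assoc u, SU.gen_ad]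
    simp only [mul_add, add_mul, mul_one, mul_smul_comm, smul_mul_assoc, mul_assoc]
  have h₂ : ∀ y, SU.gen q y * (𝐚 * (𝐛 * v)) =
      𝐪 • (SU.gen q y * (𝐛 * (𝐚 * v))) := by
    intro y
    rw [← mul_assoc 𝐚, SU.gen_ab, smul_mul_assoc, mul_smul_comm, mul_assoc]
  simp only [TensorProduct.AlgebraTensorModule.curry_apply, curry_apply,
    coe_restrictScalars, comp_apply, barFst, ladd_apply,
    lsub_apply, lsmul_apply, map_add, map_sub, map_smul]
  rw [barBoundary_barTerm hq rfl, barBoundary_barTerm hq rfl, barBoundary_barTerm hq rfl,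
    barBoundary_barTerm hq rfl, SU.koszulB_tmul]
  simp only [h₁, h₂, map_add, map_smul, add_tmul, tmul_smul,
    ← smul_tmul', map_sub, proj₂_tmul, smul_sub, smul_add, smul_smul]
  match_scalars <;> first | ring1 | (field_simp; try ring1)

theorem barBoundary_barSnd (hq : 0 < q) (w : SU q ⊗[ℂ] SU q) :
    barBoundary (barSnd hq w) = proj₂ hq (koszulC q w) := by
  have hq' := ofReal_ne_zero hq
  suffices e : barBoundary ∘ₗ barSnd hq = proj₂ hq ∘ₗ koszulC q from lcongr_fun e w
  ext u v
  have h₁ : ∀ x, u * 𝐝 * 𝐚 * x =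
      u * x + 𝐪⁻¹ • (u * 𝐜 * 𝐛 * x) := by
    intro x
    rw [mul_assoc u, SU.gen_da, SU.gen_bc]
    simp only [mul_add, add_mul, mul_one, mul_smul_comm, smul_mul_assoc, mul_assoc]
  have h₂ : ∀ y, SU.gen q y * (𝐜 * (𝐝 * v)) =
      𝐪 • (SU.gen q y * (𝐝 * (𝐜 * v))) := by
    intro y
    rw [← mul_assoc 𝐜, SU.gen_cd, smul_mul_assoc, mul_smul_comm, mul_assoc]
  simp only [TensorProduct.AlgebraTensorModule.curry_apply, curry_apply,
    coe_restrictScalars, comp_apply, barSnd, ladd_apply,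
    lsub_apply, lsmul_apply, map_add, map_sub, map_smul]
  rw [barBoundary_barTerm hq rfl, barBoundary_barTerm hq rfl, barBoundary_barTerm hq rfl,
    barBoundary_barTerm hq rfl, SU.koszulC_tmul]
  simp only [h₁, h₂, map_add, map_smul, add_tmul, tmul_smul,
    ← smul_tmul', map_sub, proj₂_tmul, smul_sub, smul_add, smul_smul]
  match_scalars <;> first | ring1 | (field_simp; try ring1)

/-- The comparison map to the bar resolution. -/
def koszulBar (hq : 0 < q) : KoszulModule hq →ₗ[ℂ] Sphere q ⊗[ℂ] Sphere q ⊗[ℂ] Sphere q :=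
  barFst hq ∘ₗ fstPart hq + barSnd hq ∘ₗ sndPart hq

theorem barBoundary_koszulBar (hq : 0 < q) (p : KoszulModule hq) :
    barBoundary (koszulBar hq p) = koszulD hq p := by
  simp only [koszulBar, koszulD, koszulTotal, ladd_apply, comp_apply, map_add,
    barBoundary_barFst, barBoundary_barSnd]

theorem koszulBar_smul (hq : 0 < q) (a : Sphere q) (p : KoszulModule hq) :
    koszulBar hq (a • p) = barLeft a (koszulBar hq p) := by
  simp only [koszulBar, ladd_apply, comp_apply, fstPart_smul, sndPart_smul,
    barFst, barSnd, lsub_apply, lsmul_apply, barTerm_outerLeft, map_add, map_sub,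
    map_smul]

theorem koszulBar_op_smul (hq : 0 < q) (a : Sphere q) (p : KoszulModule hq) :
    koszulBar hq (op a • p) = barRight a (koszulBar hq p) := by
  simp only [koszulBar, ladd_apply, comp_apply, fstPart_op_smul,
    sndPart_op_smul, barFst, barSnd, lsub_apply, lsmul_apply,
    barTerm_outerRight, map_add, map_sub, map_smul]

theorem koszulD_smul (hq : 0 < q) (a : Sphere q) (p : KoszulModule hq) :
    koszulD hq (a • p) = outerLeft a (koszulD hq p) := by
  rw [← barBoundary_koszulBar, koszulBar_smul, barBoundary_barLeft, barBoundary_koszulBar]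

theorem koszulD_op_smul (hq : 0 < q) (a : Sphere q) (p : KoszulModule hq) :
    koszulD hq (op a • p) = outerRight a (koszulD hq p) := by
  rw [← barBoundary_koszulBar, koszulBar_op_smul, barBoundary_barRight, barBoundary_koszulBar]

theorem smul_mem_koszulSub (hq : 0 < q) (a : Sphere q) {p : KoszulModule hq}
    (hp : p ∈ koszulSub hq) : a • p ∈ koszulSub hq := by
  rw [mem_koszulSub] at hp ⊢
  simp only [fstPart_smul, sndPart_smul, row₂_outerLeft, hp.1, hp.2, and_self]

theorem op_smul_mem_koszulSub (hq : 0 < q) (a : Sphere q) {p : KoszulModule hq}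
    (hp : p ∈ koszulSub hq) : op a • p ∈ koszulSub hq := by
  rw [mem_koszulSub] at hp ⊢
  simp only [fstPart_op_smul, sndPart_op_smul, row₂_outerRight, hp.1, hp.2, and_self]

theorem pair_mem (hq : 0 < q) {u v : SU q ⊗[ℂ] SU q} (hu : row₂ hq (-1) u = u)
    (hv : row₂ hq 1 v = v) : koszulPair hq u v ∈ koszulSub hq := ⟨hu, hv⟩

theorem row₂_gen_tmul (hq : 0 < q) {m : ℤ} {g h : SUGen} (hg : m = SU.rowDeg g)
    (hh : m = SU.rowDeg h) :
    row₂ hq m (SU.gen q g ⊗ₜ SU.gen q h) = SU.gen q g ⊗ₜ SU.gen q h := by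
  rw [row₂_tmul, row_gen hq hg, row_gen hq hh]

/-- The generator of the kernel. -/
def koszulΩ (hq : 0 < q) : KoszulModule hq :=
  koszulPair hq (koszulC q (1 ⊗ₜ 1)) (-koszulB q (1 ⊗ₜ 1))

theorem row₂_one (hq : 0 < q) : row₂ hq 0 (1 ⊗ₜ 1) = 1 ⊗ₜ 1 := by
  simp [SU.row_one]

theorem koszulΩ_mem (hq : 0 < q) : koszulΩ hq ∈ koszulSub hq := by
  refine pair_mem hq ?_ ?_
  · have := row₂_koszulC hq 0 (1 ⊗ₜ 1)
    rwa [row₂_one] at this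
  · have := row₂_koszulB hq 0 (1 ⊗ₜ 1)
    rw [row₂_one] at this
    rw [map_neg]
    exact congrArg (-·) this

theorem koszulD_koszulΩ (hq : 0 < q) : koszulD hq (koszulΩ hq) = 0 := by
  apply embed₂_injective hq
  rw [embed₂_koszulD hq (koszulΩ_mem hq), koszulΩ, fstPart_pair, sndPart_pair, map_neg,
    SU.koszulB_koszulC hq, map_zero, add_neg_cancel]

theorem koszulB_outer (x y : SU q) (w : SU q ⊗[ℂ] SU q) :
    koszulB q (outerLeft x (outerRight y w)) = outerLeft x (outerRight y (koszulB q w)) := by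
  simp only [koszulB, lsub_apply, lsmul_apply, inner₂_outerLeft,
    inner₂_outerRight, map_sub, map_smul]

theorem koszulC_outer (x y : SU q) (w : SU q ⊗[ℂ] SU q) :
    koszulC q (outerLeft x (outerRight y w)) = outerLeft x (outerRight y (koszulC q w)) := by
  simp only [koszulC, lsub_apply, lsmul_apply, inner₂_outerLeft,
    inner₂_outerRight, map_sub, map_smul]

theorem sandwich_koszulΩ (hq : 0 < q) (r : Sphere q ⊗[ℂ] Sphere q) :
    sandwich (koszulΩ hq) r =
      koszulPair hq (koszulC q (embed₂ hq r)) (-koszulB q (embed₂ hq r)) := by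
  induction r using induction_on with
  | zero => exact part_ext hq (by simp) (by simp)
  | add r r' h h' =>
    rw [map_add, h, h']
    exact part_ext hq (by simp) (by simp [add_comm])
  | tmul x y =>
    rw [sandwich_tmul]
    have e : (embed hq x ⊗ₜ[ℂ] embed hq y) =
        outerLeft (embed hq x) (outerRight (embed hq y) (1 ⊗ₜ[ℂ] 1)) := by simp
    refine part_ext hq ?_ ?_
    · simp only [fstPart_smul, fstPart_op_smul, koszulΩ, fstPart_pair, embed₂_tmul, e,
        koszulC_outer]
      rw [outerLeft_outerRight]
    · simp only [sndPart_smul, sndPart_op_smul, koszulΩ, sndPart_pair, embed₂_tmul, e,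
        koszulB_outer, map_neg]
      rw [outerLeft_outerRight]

theorem koszul_resolves (hq : 0 < q) {p : KoszulModule hq} (hp : p ∈ koszulSub hq)
    (h : koszulD hq p = 0) : ∃ r : Sphere q ⊗[ℂ] Sphere q, sandwich (koszulΩ hq) r = p := by
  have h' := embed₂_koszulD hq hp
  rw [h, map_zero] at h'
  obtain ⟨w, h₁, h₂⟩ := SU.koszul_exact hq h'.symm
  refine ⟨proj₂ hq w, ?_⟩
  rw [sandwich_koszulΩ, embed₂_proj₂]
  refine part_ext hq ?_ ?_
  · have := row₂_koszulC hq 0 w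
    rw [h₁] at this
    exact this.symm.trans hp.1
  · have := row₂_koszulB hq 0 w
    rw [neg_eq_iff_eq_neg.1 h₂, map_neg] at this
    rw [sndPart_pair, ← this, neg_neg]
    exact hp.2

theorem sandwich_koszulΩ_injective (hq : 0 < q) :
    Function.Injective (sandwich (koszulΩ hq) : Sphere q ⊗[ℂ] Sphere q →ₗ[ℂ] KoszulModule hq) := by
  intro r r' h
  rw [sandwich_koszulΩ, sandwich_koszulΩ] at h
  have h' := congrArg (sndPart hq) h
  exact embed₂_injective hq (SU.koszulB_injective hq (neg_injective h'))

end Sphere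

namespace Sphere

open SU (inner₂ koszulB koszulC row)

theorem exists_koszulD_eq (hq : 0 < q) (a : Sphere q) :
    ∃ p ∈ koszulSub hq, koszulD hq p = a ⊗ₜ 1 - 1 ⊗ₜ a := by
  have hq' := ofReal_ne_zero hq
  have hdb : 𝐝 * 𝐛 = 𝐪⁻¹ • (𝐛 * 𝐝) := by
    rw [SU.gen_bd, smul_smul, inv_mul_cancel₀ hq', one_smul]
  have key : ∀ (a : Sphere q) (u v : SU q ⊗[ℂ] SU q), row₂ hq (-1) u = u → row₂ hq 1 v = v →
      koszulB q u + koszulC q v = embed hq a ⊗ₜ 1 - 1 ⊗ₜ embed hq a →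
      ∃ p ∈ koszulSub hq, koszulD hq p = a ⊗ₜ 1 - 1 ⊗ₜ a := by
    intro a u v hu hv h
    refine ⟨koszulPair hq u v, pair_mem hq hu hv, embed₂_injective hq ?_⟩
    rw [embed₂_koszulD hq (pair_mem hq hu hv), fstPart_pair, sndPart_pair, h, map_sub, embed₂_tmul,
      embed₂_tmul, map_one]
  induction a using induction_left with
  | one => exact ⟨0, zero_mem _, by simp⟩
  | add x y hx hy =>
    obtain ⟨p, hp, h⟩ := hx
    obtain ⟨p', hp', h'⟩ := hy
    refine ⟨p + p', add_mem hp hp', ?_⟩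
    rw [map_add, h, h', add_tmul, tmul_add]
    abel
  | smul s x hx =>
    obtain ⟨p, hp, h⟩ := hx
    refine ⟨s • p, Submodule.smul_mem _ s hp, ?_⟩
    rw [map_smul, h, smul_sub, ← smul_tmul', tmul_smul]
  | mul g x hx =>
    obtain ⟨p, hp, h⟩ := hx
    suffices hg : ∃ p ∈ koszulSub hq, koszulD hq p = gen q g ⊗ₜ 1 - 1 ⊗ₜ gen q g by
      obtain ⟨p', hp', h'⟩ := hg
      refine ⟨op x • p' + gen q g • p,
        add_mem (op_smul_mem_koszulSub hq x hp') (smul_mem_koszulSub hq _ hp), ?_⟩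
      rw [map_add, koszulD_op_smul, koszulD_smul, h, h']
      simp
    cases g with
    | A =>
      refine key _ ((-𝐪⁻¹) • (𝐜 ⊗ₜ 𝐝))
        ((-𝐪⁻¹ * 𝐪⁻¹) • (𝐚 ⊗ₜ 𝐛)) ?_ ?_ ?_
      · rw [map_smul]; exact congrArg _ (row₂_gen_tmul hq (by rfl) (by rfl))
      · rw [map_smul]; exact congrArg _ (row₂_gen_tmul hq (by rfl) (by rfl))
      · rw [map_smul, map_smul, SU.koszulB_tmul, SU.koszulC_tmul, embed_gen, embedGen,
          SU.gen_ac, SU.gen_ad, ← SU.gen_bc, hdb]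
        simp only [tmul_smul, ← smul_tmul', tmul_add,
          add_tmul, smul_add, smul_sub, smul_smul]
        match_scalars <;> first | ring1 | (field_simp; try ring1)
    | B =>
      refine key _ (𝐪 • (𝐜 ⊗ₜ 𝐜)) (𝐚 ⊗ₜ 𝐚) ?_ ?_ ?_
      · rw [map_smul]; exact congrArg _ (row₂_gen_tmul hq (by rfl) (by rfl))
      · exact row₂_gen_tmul hq (by rfl) (by rfl)
      · rw [map_smul, SU.koszulB_tmul, SU.koszulC_tmul, embed_gen, embedGen,
          SU.gen_ac, SU.gen_ad, SU.gen_da, ← SU.gen_bc]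
        simp only [tmul_smul, ← smul_tmul', tmul_add,
          add_tmul, smul_add, smul_sub, smul_smul]
        match_scalars <;> first | ring1 | (field_simp; try ring1)
    | Bs =>
      refine key _ (-(𝐝 ⊗ₜ 𝐝))
        ((-𝐪⁻¹) • (𝐛 ⊗ₜ 𝐛)) ?_ ?_ ?_
      · rw [map_neg]; exact congrArg _ (row₂_gen_tmul hq (by rfl) (by rfl))
      · rw [map_smul]; exact congrArg _ (row₂_gen_tmul hq (by rfl) (by rfl))
      · rw [map_neg, map_smul, SU.koszulB_tmul, SU.koszulC_tmul, embed_gen, embedGen,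
          SU.gen_ad, SU.gen_da, ← SU.gen_bc, hdb]
        simp only [tmul_smul, ← smul_tmul', tmul_add,
          add_tmul, smul_add, smul_sub, smul_smul]
        match_scalars <;> first | ring1 | (field_simp; try ring1)

theorem exists_koszulLift (hq : 0 < q) : ∃ η : Sphere q →ₗ[ℂ] KoszulModule hq,
    (∀ a, η a ∈ koszulSub hq) ∧ ∀ a, koszulD hq (η a) = a ⊗ₜ 1 - 1 ⊗ₜ a := by
  let f : Sphere q →ₗ[ℂ] Sphere q ⊗[ℂ] Sphere q :=
    (TensorProduct.mk ℂ (Sphere q) (Sphere q)).flip 1 - TensorProduct.mk ℂ (Sphere q) (Sphere q) 1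
  let g : koszulSub hq →ₗ[ℂ] Sphere q ⊗[ℂ] Sphere q := koszulD hq ∘ₗ (koszulSub hq).subtype
  have hf : ∀ a, f a ∈ LinearMap.range g := by
    intro a
    obtain ⟨p, hp, h⟩ := exists_koszulD_eq hq a
    exact ⟨⟨p, hp⟩, h⟩
  obtain ⟨η, hη⟩ := Module.projective_lifting_property g.rangeRestrict (f.codRestrict _ hf)
    g.surjective_rangeRestrict
  refine ⟨(koszulSub hq).subtype ∘ₗ η, fun a => (η a).2, fun a => ?_⟩
  exact congrArg Subtype.val (lcongr_fun hη a)

theorem koszulΩ_twisted (hq : 0 < q) : koszulΩ hq ∈ Submodule.span ℂ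
    {x : KoszulModule hq | ∃ p ∈ koszulSub hq, ∃ a : Sphere q,
      x = op a • p - modular hq a • p} := by
  have hq' := ofReal_ne_zero hq
  set S := Submodule.span ℂ {x : KoszulModule hq | ∃ p ∈ koszulSub hq, ∃ a : Sphere q,
      x = op a • p - modular hq a • p} with hS
  have hmem : ∀ p ∈ koszulSub hq, ∀ a : Sphere q, op a • p - modular hq a • p ∈ S :=
    fun p hp a => Submodule.subset_span ⟨p, hp, a, rfl⟩
  have hfst : ∀ g h : SUGen, -1 = SU.rowDeg g → -1 = SU.rowDeg h →
      koszulPair hq (SU.gen q g ⊗ₜ SU.gen q h) 0 ∈ koszulSub hq := fun g h hg hh =>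
    pair_mem hq (row₂_gen_tmul hq hg hh) (map_zero _)
  have hsnd : ∀ g h : SUGen, 1 = SU.rowDeg g → 1 = SU.rowDeg h →
      koszulPair hq 0 (SU.gen q g ⊗ₜ SU.gen q h) ∈ koszulSub hq := fun g h hg hh =>
    pair_mem hq (map_zero _) (row₂_gen_tmul hq hg hh)
  have e₁ := hmem _ (hfst .c .d rfl rfl) (1 - 𝐪 ^ 2 • gen q .A)
  have e₂ := hmem _ (hfst .c .c rfl rfl) (-𝐪 • gen q .Bs)
  have e₃ := hmem _ (hfst .d .d rfl rfl) (gen q .B)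
  have e₄ := hmem _ (hfst .d .c rfl rfl) (-𝐪 • gen q .A)
  have e₅ := hmem _ (hsnd .b .a rfl rfl) (1 - gen q .A)
  have e₆ := hmem _ (hsnd .b .b rfl rfl) (𝐪⁻¹ • gen q .B)
  have e₇ := hmem _ (hsnd .a .a rfl rfl) (-gen q .Bs)
  have e₈ := hmem _ (hsnd .a .b rfl rfl) (-𝐪 • gen q .A)
  have s₁ : modular hq (1 - 𝐪 ^ 2 • gen q .A) = 1 - 𝐪 ^ 2 • gen q .A := by
    rw [map_sub, map_one, map_smul, modular_A]
  have s₂ : modular hq (-𝐪 • gen q .Bs) = 𝐪 ^ 2 • (-𝐪 • gen q .Bs) := by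
    rw [map_smul, modular_Bs, smul_comm]
  have s₄ : modular hq (-𝐪 • gen q .A) = -𝐪 • gen q .A := by
    rw [map_smul, modular_A]
  have s₅ : modular hq (1 - gen q .A) = 1 - gen q .A := by
    rw [map_sub, map_one, modular_A]
  have s₆ : modular hq (𝐪⁻¹ • gen q .B) =
      (𝐪 ^ 2)⁻¹ • (𝐪⁻¹ • gen q .B) := by
    rw [map_smul, modular_B, smul_comm]
  have s₇ : modular hq (-gen q .Bs) = 𝐪 ^ 2 • (-gen q .Bs) := by
    rw [map_neg, modular_Bs, smul_neg]
  have := S.add_mem (S.add_mem (S.sub_mem e₁ (S.smul_mem 𝐪⁻¹ e₂))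
    (S.add_mem (S.smul_mem (-𝐪) e₃) e₄))
    (S.add_mem (S.sub_mem (S.smul_mem 𝐪 e₆) e₅)
      (S.sub_mem (S.smul_mem 𝐪⁻¹ e₇) e₈))
  convert this using 1
  have hdb : 𝐝 * 𝐛 = 𝐪⁻¹ • (𝐛 * 𝐝) := by
    rw [SU.gen_bd, smul_smul, inv_mul_cancel₀ hq', one_smul]
  have hdc : 𝐝 * 𝐜 = 𝐪⁻¹ • (𝐜 * 𝐝) := by
    rw [SU.gen_cd, smul_smul, inv_mul_cancel₀ hq', one_smul]
  have hcb := (SU.gen_bc q).symm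
  have r₁ : ∀ x, 𝐚 * (𝐛 * x) = 𝐪 • (𝐛 * (𝐚 * x)) := by
    intro x; rw [← mul_assoc, SU.gen_ab, smul_mul_assoc, mul_assoc]
  have r₂ : ∀ x, 𝐚 * (𝐜 * x) = 𝐪 • (𝐜 * (𝐚 * x)) := by
    intro x; rw [← mul_assoc, SU.gen_ac, smul_mul_assoc, mul_assoc]
  have r₃ : ∀ x, 𝐜 * (𝐛 * x) = 𝐛 * (𝐜 * x) := by
    intro x; rw [← mul_assoc, hcb, mul_assoc]
  have r₄ : ∀ x, 𝐝 * (𝐛 * x) =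
      𝐪⁻¹ • (𝐛 * (𝐝 * x)) := by
    intro x; rw [← mul_assoc, hdb, smul_mul_assoc, mul_assoc]
  have r₅ : ∀ x, 𝐝 * (𝐜 * x) =
      𝐪⁻¹ • (𝐜 * (𝐝 * x)) := by
    intro x; rw [← mul_assoc, hdc, smul_mul_assoc, mul_assoc]
  refine part_ext hq ?_ ?_
  · simp only [koszulΩ, fstPart_pair, map_add, map_sub (fstPart hq),
      map_smul (fstPart hq), fstPart_smul,
      fstPart_op_smul, s₁, s₂, s₄, modular_B, map_zero, sub_zero, smul_zero, add_zero,
      SU.koszulC_tmul, mul_one, one_mul]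
    simp only [map_smul (embed hq) (𝐪 ^ 2), map_smul (embed hq) (𝐪 ^ 2)⁻¹, embed_ad,
      embed_bd, embed_ac, embed_bc]
    simp only [outerLeft_tmul, outerRight_tmul, smul_mul_assoc, mul_assoc,
      SU.gen_ad, SU.gen_da, SU.gen_ab, SU.gen_ac, hdb, hdc, hcb, r₁, r₂, r₃, r₄, r₅,
      mul_smul_comm, mul_add, add_mul, one_mul, mul_one,
      tmul_smul, ← smul_tmul', tmul_add,
      add_tmul, smul_add, smul_sub, smul_smul]
    match_scalars <;> first | ring1 | (field_simp; try ring1)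
  · simp only [koszulΩ, sndPart_pair, map_add, map_sub (sndPart hq),
      map_smul (sndPart hq), sndPart_smul,
      sndPart_op_smul, s₄, s₅, s₆, s₇, map_zero, sub_zero, smul_zero, zero_add,
      SU.koszulB_tmul, mul_one, one_mul]
    simp only [map_smul (embed hq) (𝐪 ^ 2), map_smul (embed hq) (𝐪 ^ 2)⁻¹, embed_da,
      embed_db, embed_ca, embed_bc]
    simp only [outerLeft_tmul, outerRight_tmul, smul_mul_assoc, mul_assoc,
      SU.gen_ad, SU.gen_da, SU.gen_ab, SU.gen_ac, hdb, hdc, hcb, r₁, r₂, r₃, r₄, r₅,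
      mul_smul_comm, mul_add, add_mul, one_mul, mul_one,
      tmul_smul, ← smul_tmul', tmul_add,
      add_tmul, smul_add, smul_sub, smul_smul]
    match_scalars <;> first | ring1 | (field_simp; try ring1)

section Hom

variable {M : Type} [AddCommGroup M] [Module ℂ M] [Module (Sphere q) M] [Module (Sphere q)ᵐᵒᵖ M]
  [SMulCommClass (Sphere q) (Sphere q)ᵐᵒᵖ M] [IsScalarTower ℂ (Sphere q) M]
  [IsScalarTower ℂ (Sphere q)ᵐᵒᵖ M]

/-- The bimodule map with components `u ⊗ v ↦ pr(u x) m pr(y v)`. -/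
def koszulHom (hq : 0 < q) (m : M) (s t : ℂ) (x y x' y' : SU q) : KoszulModule hq →ₗ[ℂ] M :=
  sandwich m ∘ₗ proj₂ hq ∘ₗ
    (s • inner₂ x y ∘ₗ fstPart hq + t • inner₂ x' y' ∘ₗ sndPart hq)

theorem koszulHom_smul (hq : 0 < q) (m : M) (s t : ℂ) (x y x' y' : SU q) (a : Sphere q)
    (p : KoszulModule hq) :
    koszulHom hq m s t x y x' y' (a • p) = a • koszulHom hq m s t x y x' y' p := by
  simp only [koszulHom, comp_apply, ladd_apply, lsmul_apply,
    fstPart_smul, sndPart_smul, inner₂_outerLeft, ← map_smul, ← map_add, proj₂_outerLeft,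
    sandwich_outerLeft]

theorem koszulHom_op_smul (hq : 0 < q) (m : M) (s t : ℂ) (x y x' y' : SU q) (a : Sphere q)
    (p : KoszulModule hq) :
    koszulHom hq m s t x y x' y' (op a • p) = op a • koszulHom hq m s t x y x' y' p := by
  simp only [koszulHom, comp_apply, ladd_apply, lsmul_apply,
    fstPart_op_smul, sndPart_op_smul, inner₂_outerRight, ← map_smul, ← map_add, proj₂_outerRight,
    sandwich_outerRight]

theorem koszulHom_koszulΩ (hq : 0 < q) (m : M) {s t : ℂ} {x y x' y' : SU q}
    {w : Sphere q ⊗[ℂ] Sphere q}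
    (h : s • inner₂ x y (koszulC q (1 ⊗ₜ 1)) - t • inner₂ x' y' (koszulB q (1 ⊗ₜ 1)) =
      embed₂ hq w) :
    koszulHom hq m s t x y x' y' (koszulΩ hq) = sandwich m w := by
  simp only [koszulHom, comp_apply, ladd_apply, lsmul_apply, koszulΩ,
    fstPart_pair, sndPart_pair]
  rw [map_neg, smul_neg, ← sub_eq_add_neg, h, proj₂_embed₂]

theorem exists_koszulHom (hq : 0 < q) (m : M) (a : Sphere q) : ∃ h : KoszulModule hq →ₗ[ℂ] M,
    (∀ (x : Sphere q) p, h (x • p) = x • h p) ∧ (∀ (x : Sphere q) p, h (op x • p) = op x • h p) ∧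
      h (koszulΩ hq) = op a • m - modular hq a • m := by
  have hq' := ofReal_ne_zero hq
  have hdb : 𝐝 * 𝐛 = 𝐪⁻¹ • (𝐛 * 𝐝) := by
    rw [SU.gen_bd, smul_smul, inv_mul_cancel₀ hq', one_smul]
  induction a using induction_left generalizing m with
  | one => exact ⟨0, by simp, by simp, by simp⟩
  | add a b ha hb =>
    obtain ⟨h, h₁, h₂, h₃⟩ := ha m
    obtain ⟨h', h₁', h₂', h₃'⟩ := hb m
    refine ⟨h + h', ?_, ?_, ?_⟩
    · intro x p; simp only [ladd_apply, h₁, h₁', smul_add]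
    · intro x p; simp only [ladd_apply, h₂, h₂', smul_add]
    · simp only [ladd_apply, h₃, h₃', op_add, map_add, add_smul]; abel
  | smul s a ha =>
    obtain ⟨h, h₁, h₂, h₃⟩ := ha m
    refine ⟨s • h, ?_, ?_, ?_⟩
    · intro x p; simp only [lsmul_apply, h₁, smul_comm s x]
    · intro x p; simp only [lsmul_apply, h₂, smul_comm s (op x)]
    · simp only [lsmul_apply, h₃, op_smul, map_smul, smul_assoc, smul_sub]
  | mul g a ha =>
    suffices hg : ∀ m : M, ∃ h : KoszulModule hq →ₗ[ℂ] M,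
        (∀ (x : Sphere q) p, h (x • p) = x • h p) ∧
        (∀ (x : Sphere q) p, h (op x • p) = op x • h p) ∧
          h (koszulΩ hq) = op (gen q g) • m - modular hq (gen q g) • m by
      obtain ⟨h, h₁, h₂, h₃⟩ := ha (op (gen q g) • m)
      obtain ⟨h', h₁', h₂', h₃'⟩ := hg (modular hq a • m)
      refine ⟨h + h', ?_, ?_, ?_⟩
      · intro x p; simp only [ladd_apply, h₁, h₁', smul_add]
      · intro x p; simp only [ladd_apply, h₂, h₂', smul_add]
      · simp only [ladd_apply, h₃, h₃', op_mul, map_mul, mul_smul,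
          smul_comm (modular hq a) (op (gen q g))]
        abel
    intro m
    have fin : ∀ (s t : ℂ) (x y x' y' : SU q) (z : ℂ),
        modular hq (gen q g) = z • gen q g →
        s • inner₂ x y (koszulC q (1 ⊗ₜ 1)) - t • inner₂ x' y' (koszulB q (1 ⊗ₜ 1)) =
          1 ⊗ₜ embed hq (gen q g) - z • embed hq (gen q g) ⊗ₜ 1 →
        ∃ h : KoszulModule hq →ₗ[ℂ] M,
        (∀ (x : Sphere q) p, h (x • p) = x • h p) ∧
        (∀ (x : Sphere q) p, h (op x • p) = op x • h p) ∧
          h (koszulΩ hq) = op (gen q g) • m - modular hq (gen q g) • m := by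
      intro s t x y x' y' z hz h
      refine ⟨koszulHom hq m s t x y x' y', fun a p => koszulHom_smul hq m s t x y x' y' a p,
        fun a p => koszulHom_op_smul hq m s t x y x' y' a p, ?_⟩
      rw [koszulHom_koszulΩ hq m (w := 1 ⊗ₜ gen q g - z • gen q g ⊗ₜ 1), map_sub, map_smul,
        sandwich_tmul, sandwich_tmul, hz, one_smul, op_one, one_smul, smul_assoc]
      rw [h, map_sub, map_smul, embed₂_tmul, embed₂_tmul, map_one]
    cases g with
    | A =>
      refine fin (𝐪⁻¹ * 𝐪⁻¹) (-𝐪⁻¹) 𝐚 𝐛 𝐜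
        𝐝 1 (by rw [modular_A, one_smul]) ?_
      simp only [SU.koszulB_tmul, SU.koszulC_tmul, one_mul, mul_one, map_sub, map_smul,
        SU.inner₂_tmul, embed_gen, embedGen, SU.gen_ac, SU.gen_ad, SU.gen_da, ← SU.gen_bc, hdb,
        tmul_smul, ← smul_tmul', tmul_add,
        add_tmul, smul_add, smul_sub, smul_smul]
      match_scalars <;> first | ring1 | (field_simp; try ring1)
    | B =>
      refine fin (-𝐪⁻¹) 1 𝐚 𝐚 𝐜
        𝐜 _ (modular_B hq) ?_
      simp only [SU.koszulB_tmul, SU.koszulC_tmul, one_mul, mul_one, map_sub, map_smul,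
        SU.inner₂_tmul, embed_gen, embedGen, SU.gen_ac, SU.gen_ad, SU.gen_da, ← SU.gen_bc, hdb,
        tmul_smul, ← smul_tmul', tmul_add,
        add_tmul, smul_add, smul_sub, smul_smul]
      match_scalars <;> first | ring1 | (field_simp; try ring1)
    | Bs =>
      refine fin 1 (-𝐪) 𝐛 𝐛 𝐝
        𝐝 _ (modular_Bs hq) ?_
      simp only [SU.koszulB_tmul, SU.koszulC_tmul, one_mul, mul_one, map_sub, map_smul,
        SU.inner₂_tmul, embed_gen, embedGen, SU.gen_ac, SU.gen_ad, SU.gen_da, ← SU.gen_bc, hdb,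
        tmul_smul, ← smul_tmul', tmul_add,
        add_tmul, smul_add, smul_sub, smul_smul]
      match_scalars <;> first | ring1 | (field_simp; try ring1)

end Hom

/-- The resolution of the Podleś sphere. -/
def resolution (hq : 0 < q) : ShortResolution (KoszulModule hq) (modular hq) where
  Q := koszulSub hq
  d := koszulD hq
  θ := koszulBar hq
  ω := koszulΩ hq
  η := (exists_koszulLift hq).choose
  left_mem a _ hp := smul_mem_koszulSub hq a hp
  right_mem a _ hp := op_smul_mem_koszulSub hq a hp
  θ_left := koszulBar_smul hq
  θ_right := koszulBar_op_smul hq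
  boundary_θ := barBoundary_koszulBar hq
  d_ω := koszulD_koszulΩ hq
  η_mem := (exists_koszulLift hq).choose_spec.1
  d_η := (exists_koszulLift hq).choose_spec.2
  exact _ hp h := koszul_resolves hq hp h
  injective := sandwich_koszulΩ_injective hq
  ω_twisted := koszulΩ_twisted hq
  exists_hom _ _ _ _ _ _ _ _ m a := exists_koszulHom hq m a

end Sphere

namespace SU

/-! ### Cohomology with coefficients in the outer bimodule -/

/-- `x ⊗ y ↦ g x ⊗ y h`. -/
def outer₂ (g h : SU q) : SU q ⊗[ℂ] SU q →ₗ[ℂ] SU q ⊗[ℂ] SU q := outerLeft g ∘ₗ outerRight h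

@[simp] theorem outer₂_tmul (g h x y : SU q) : outer₂ g h (x ⊗ₜ[ℂ] y) = (g * x) ⊗ₜ (y * h) := by
  simp [outer₂]

variable (q) in
/-- `x ⊗ y ↦ b x ⊗ y a - q⁻¹ a x ⊗ y b`. -/
def dualB : SU q ⊗[ℂ] SU q →ₗ[ℂ] SU q ⊗[ℂ] SU q :=
  outer₂ 𝐛 𝐚 - 𝐪⁻¹ • outer₂ 𝐚 𝐛

variable (q) in
/-- `x ⊗ y ↦ c x ⊗ y d - q d x ⊗ y c`. -/
def dualC : SU q ⊗[ℂ] SU q →ₗ[ℂ] SU q ⊗[ℂ] SU q :=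
  outer₂ 𝐜 𝐝 - 𝐪 • outer₂ 𝐝 𝐜

theorem exists_scale (s t : ℂ) (h : s * t = 1) : ∃ φ : SU q →ₐ[ℂ] SU q,
    φ 𝐚 = 𝐚 ∧ φ 𝐛 = s • 𝐛 ∧ φ 𝐜 = t • 𝐜 ∧
      φ 𝐝 = 𝐝 := by
  obtain ⟨φ, hφ⟩ := exists_hom (q := q) (B := SU q) (fun g => match g with
    | .a => 𝐚
    | .b => s • 𝐛
    | .c => t • 𝐜
    | .d => 𝐝)
    (by simp only [smul_mul_assoc, mul_smul_comm, gen_ab, smul_smul]; rw [mul_comm s])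
    (by simp only [smul_mul_assoc, mul_smul_comm, gen_ac, smul_smul]; rw [mul_comm t])
    (by simp only [smul_mul_assoc, mul_smul_comm, gen_bd, smul_smul]; rw [mul_comm s])
    (by simp only [smul_mul_assoc, mul_smul_comm, gen_cd, smul_smul]; rw [mul_comm t])
    (by simp only [smul_mul_assoc, mul_smul_comm, gen_bc, smul_smul]; rw [mul_comm s])
    (by simp only [smul_mul_assoc, mul_smul_comm, gen_ad, smul_smul]; rw [mul_comm t, h, mul_one])
    (by simp only [smul_mul_assoc, mul_smul_comm, gen_da, smul_smul]; rw [mul_comm t, h, mul_one])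
  exact ⟨φ, hφ .a, hφ .b, hφ .c, hφ .d⟩

/-- A flip that exchanges inner and outer multiplications. -/
theorem exists_flip (hq : 0 < q) : ∃ τ : SU q ⊗[ℂ] SU q ≃ₗ[ℂ] SU q ⊗[ℂ] SU q,
    (∀ w, τ (dualB q w) = (-𝐪⁻¹) • koszulB q (τ w)) ∧
      ∀ w, τ (dualC q w) = (-𝐪) • koszulC q (τ w) := by
  have hq' := ofReal_ne_zero hq
  have hq2 : 𝐪 ^ 2 ≠ 0 := pow_ne_zero 2 hq'
  obtain ⟨φ, h₁, h₂, h₃, h₄⟩ := exists_scale (q := q) _ _ (inv_mul_cancel₀ hq2)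
  obtain ⟨ψ, k₁, k₂, k₃, k₄⟩ := exists_scale (q := q) _ _ (mul_inv_cancel₀ hq2)
  have hφψ : ∀ x, φ (ψ x) = x := by
    intro x
    induction x using induction_left with
    | one => simp
    | add x y hx hy => rw [map_add, map_add, hx, hy]
    | smul s x hx => rw [map_smul, map_smul, hx]
    | mul g x hx =>
      rw [map_mul, map_mul, hx]
      congr 1
      cases g <;> simp only [h₁, h₂, h₃, h₄, k₁, k₂, k₃, k₄, map_smul, smul_smul,
        inv_mul_cancel₀ hq2, mul_inv_cancel₀ hq2, one_smul]
  have hψφ : ∀ x, ψ (φ x) = x := by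
    intro x
    induction x using induction_left with
    | one => simp
    | add x y hx hy => rw [map_add, map_add, hx, hy]
    | smul s x hx => rw [map_smul, map_smul, hx]
    | mul g x hx =>
      rw [map_mul, map_mul, hx]
      congr 1
      cases g <;> simp only [h₁, h₂, h₃, h₄, k₁, k₂, k₃, k₄, map_smul, smul_smul,
        inv_mul_cancel₀ hq2, mul_inv_cancel₀ hq2, one_smul]
  let ς : SU q ≃ₗ[ℂ] SU q := LinearEquiv.ofLinearMap φ.toLinearMap ψ.toLinearMap
    (LinearMap.ext hφψ) (LinearMap.ext hψφ)
  let τ : SU q ⊗[ℂ] SU q ≃ₗ[ℂ] SU q ⊗[ℂ] SU q :=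
    TensorProduct.comm ℂ (SU q) (SU q) ≪≫ₗ TensorProduct.congr (LinearEquiv.refl ℂ (SU q)) ς
  have hτ : ∀ x y, τ (x ⊗ₜ y) = y ⊗ₜ φ x := fun x y => rfl
  refine ⟨τ, fun w => ?_, fun w => ?_⟩
  · suffices e : τ.toLinearMap ∘ₗ dualB q = (-𝐪⁻¹) • koszulB q ∘ₗ τ.toLinearMap from
      lcongr_fun e w
    ext x y
    simp only [TensorProduct.AlgebraTensorModule.curry_apply, curry_apply,
      coe_restrictScalars, comp_apply, dualB, lsub_apply,
      lsmul_apply, outer₂_tmul, map_sub, map_smul, LinearEquiv.coe_coe, hτ, koszulB_tmul,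
      map_mul, h₁, h₂, smul_mul_assoc, tmul_smul, smul_sub, smul_smul]
    match_scalars <;> ring1
  · suffices e : τ.toLinearMap ∘ₗ dualC q = (-𝐪) • koszulC q ∘ₗ τ.toLinearMap from
      lcongr_fun e w
    ext x y
    simp only [TensorProduct.AlgebraTensorModule.curry_apply, curry_apply,
      coe_restrictScalars, comp_apply, dualC, lsub_apply,
      lsmul_apply, outer₂_tmul, map_sub, map_smul, LinearEquiv.coe_coe, hτ, koszulC_tmul,
      map_mul, h₃, h₄, smul_mul_assoc, tmul_smul, smul_sub, smul_smul]
    match_scalars <;> ring1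

theorem dualB_injective (hq : 0 < q) {w : SU q ⊗[ℂ] SU q} (h : dualB q w = 0) : w = 0 := by
  have hq' := ofReal_ne_zero hq
  obtain ⟨τ, hB, -⟩ := exists_flip hq
  have h' := hB w
  rw [h, map_zero] at h'
  have h₀ := (smul_eq_zero.1 h'.symm).resolve_left (neg_ne_zero.2 (inv_ne_zero hq'))
  have h₁ := koszulB_injective hq (h₀.trans (map_zero _).symm)
  exact (LinearEquiv.map_eq_zero_iff τ).1 h₁

theorem dual_exact (hq : 0 < q) {U V : SU q ⊗[ℂ] SU q} (h : dualC q U - dualB q V = 0) :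
    ∃ k, dualB q k = U ∧ dualC q k = V := by
  have hq' := ofReal_ne_zero hq
  obtain ⟨τ, hB, hC⟩ := exists_flip hq
  have h' := congrArg τ h
  rw [map_sub, hB, hC, map_zero] at h'
  have h'' : koszulB q (𝐪⁻¹ • τ V) + koszulC q ((-𝐪) • τ U) = 0 := by
    rw [map_smul, map_smul, ← h']
    module
  obtain ⟨w, h₁, h₂⟩ := koszul_exact hq h''
  refine ⟨τ.symm (-w), τ.injective ?_, τ.injective ?_⟩
  · rw [hB, LinearEquiv.apply_symm_apply, map_neg, h₂, smul_smul]
    match_scalars; field_simp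
  · rw [hC, LinearEquiv.apply_symm_apply, map_neg, h₁]
    match_scalars; field_simp

end SU

namespace Sphere

open SU (inner₂ koszulB koszulC row outer₂ dualB dualC)

theorem embed₂_outerLeft (hq : 0 < q) (a : Sphere q) (w : Sphere q ⊗[ℂ] Sphere q) :
    embed₂ hq (outerLeft a w) = outerLeft (embed hq a) (embed₂ hq w) := by
  suffices h : embed₂ hq ∘ₗ outerLeft a = outerLeft (embed hq a) ∘ₗ embed₂ hq from
    lcongr_fun h w
  ext u v
  simp

theorem embed₂_outerRight (hq : 0 < q) (a : Sphere q) (w : Sphere q ⊗[ℂ] Sphere q) :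
    embed₂ hq (outerRight a w) = outerRight (embed hq a) (embed₂ hq w) := by
  suffices h : embed₂ hq ∘ₗ outerRight a = outerRight (embed hq a) ∘ₗ embed₂ hq from
    lcongr_fun h w
  ext u v
  simp

/-- `H⁰` of the outer bimodule vanishes. -/
theorem cocycle₀_outer (hq : 0 < q) (k : Outer (Sphere q)) (hk : IsCocycle₀ (A := Sphere q) k) :
    k = 0 := by
  have hq' := ofReal_ne_zero hq
  obtain ⟨k, rfl⟩ := toOuter.surjective k
  have hk' : ∀ a, outerRight (embed hq a) (embed₂ hq k) = outerLeft (embed hq a) (embed₂ hq k) := by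
    intro a
    have h := sub_eq_zero.1 (hk a)
    rw [smul_toOuter, op_smul_toOuter] at h
    rw [← embed₂_outerLeft, ← embed₂_outerRight, toOuter.injective h]
  obtain ⟨w, key⟩ : ∃ w, ∀ x : SU q, row hq 1 x = x →
      outerRight x (embed₂ hq k) = outerLeft x w := by
    refine ⟨outer₂ 𝐝 𝐚 (embed₂ hq k) -
      𝐪⁻¹ • outer₂ 𝐜 𝐛 (embed₂ hq k), fun x hx => ?_⟩
    have e₁ : embed hq (proj hq (x * 𝐝)) = x * 𝐝 := by
      apply embed_proj_of_row
      have := SU.row_mul_gen hq 1 .d x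
      rwa [hx] at this
    have e₂ : embed hq (proj hq (x * 𝐜)) = x * 𝐜 := by
      apply embed_proj_of_row
      have := SU.row_mul_gen hq 1 .c x
      rwa [hx] at this
    have e₃ : x = x * 𝐝 * 𝐚 - 𝐪⁻¹ • (x * 𝐜 * 𝐛) := by
      rw [mul_assoc, SU.gen_da, SU.gen_bc, mul_add, mul_one, mul_smul_comm, mul_assoc]
      abel
    have h₁ := hk' (proj hq (x * 𝐝))
    have h₂ := hk' (proj hq (x * 𝐜))
    rw [e₁] at h₁
    rw [e₂] at h₂
    have e₄ : outerRight x (embed₂ hq k) = outerRight 𝐚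
        (outerRight (x * 𝐝) (embed₂ hq k)) -
        𝐪⁻¹ • outerRight 𝐛 (outerRight (x * 𝐜) (embed₂ hq k)) := by
      rw [← outerRight_mul, ← outerRight_mul]
      generalize embed₂ hq k = w
      suffices h : outerRight x = outerRight (x * 𝐝 * 𝐚) -
        𝐪⁻¹ • outerRight (x * 𝐜 * 𝐛) from lcongr_fun h w
      ext u v
      simp only [TensorProduct.AlgebraTensorModule.curry_apply, curry_apply,
        coe_restrictScalars, lsub_apply, lsmul_apply, outerRight_tmul]
      rw [← tmul_smul, ← tmul_sub, ← mul_smul_comm, ← mul_sub, ← e₃]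
    rw [e₄, h₁, h₂, map_sub, map_smul]
    simp only [outer₂, comp_apply, outerLeft_mul, outerLeft_outerRight]
  have h0 : dualB q (embed₂ hq k) = 0 := by
    have ha := key _ (row_gen hq (g := .a) rfl)
    have hb := key _ (row_gen hq (g := .b) rfl)
    simp only [dualB, lsub_apply, lsmul_apply, outer₂, comp_apply]
    rw [ha, hb, ← outerLeft_mul, ← outerLeft_mul, SU.gen_ab]
    have : outerLeft (𝐪 • (𝐛 * 𝐚)) w =
        𝐪 • outerLeft (𝐛 * 𝐚) w := by
      suffices h : outerLeft (𝐪 • (𝐛 * 𝐚)) =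
        𝐪 • outerLeft (𝐛 * 𝐚) from lcongr_fun h w
      ext u v
      simp only [TensorProduct.AlgebraTensorModule.curry_apply, curry_apply,
        coe_restrictScalars, lsmul_apply, outerLeft_tmul, smul_mul_assoc,
        ← smul_tmul']
    rw [this, smul_smul, inv_mul_cancel₀ hq', one_smul, sub_self]
  rw [embed₂_injective hq ((SU.dualB_injective hq h0).trans (map_zero _).symm), map_zero]

/-- A bimodule map from the middle term of the resolution to the outer bimodule that vanishes on
the kernel of the boundary is a multiple of the boundary. -/
theorem exists_eq_sandwich (hq : 0 < q) (H : KoszulModule hq →ₗ[ℂ] Sphere q ⊗[ℂ] Sphere q)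
    (hl : ∀ a p, H (a • p) = outerLeft a (H p)) (hr : ∀ a p, H (op a • p) = outerRight a (H p))
    (hΩ : H (koszulΩ hq) = 0) :
    ∃ k : Outer (Sphere q), ∀ p ∈ koszulSub hq, toOuter (H p) = sandwich k (koszulD hq p) := by
  have hq' := ofReal_ne_zero hq
  let h₁ (g h : SUGen) := embed₂ hq (H (koszulPair hq (SU.gen q g ⊗ₜ SU.gen q h) 0))
  let h₂ (g h : SUGen) := embed₂ hq (H (koszulPair hq 0 (SU.gen q g ⊗ₜ SU.gen q h)))
  let U := outer₂ 𝐚 𝐚 (h₁ .d .d) -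
    𝐪⁻¹ • outer₂ 𝐚 𝐛 (h₁ .d .c) -
    𝐪 • outer₂ 𝐛 𝐚 (h₁ .c .d) +
    outer₂ 𝐛 𝐛 (h₁ .c .c)
  let V := outer₂ 𝐝 𝐝 (h₂ .a .a) -
    𝐪 • outer₂ 𝐝 𝐜 (h₂ .a .b) -
    𝐪⁻¹ • outer₂ 𝐜 𝐝 (h₂ .b .a) +
    outer₂ 𝐜 𝐜 (h₂ .b .b)
  have outer_mul : ∀ (x y g h : SU q) w, outer₂ x y (outer₂ g h w) = outer₂ (x * g) (h * y) w := by
    intro x y g h w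
    simp only [outer₂, comp_apply, outerLeft_mul, outerRight_mul, outerLeft_outerRight]
  have hHl : ∀ (a b : Sphere q) p, embed₂ hq (H (a • op b • p)) =
      outer₂ (embed hq a) (embed hq b) (embed₂ hq (H p)) := by
    intro a b p
    rw [hl, hr, embed₂_outerLeft, embed₂_outerRight]; rfl
  have hsand : ∀ (x y : SU q) w, toOuter.symm (sandwich (toOuter w) (x ⊗ₜ y)) = outer₂ x y w := by
    intro x y w
    rw [sandwich_tmul, smul_toOuter, op_smul_toOuter, LinearEquiv.symm_apply_apply,
      ← outerLeft_outerRight]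
    rfl
  have hrow : ∀ (m : ℤ) x, row hq m (row hq m x) = row hq m x := by
    intro m x
    induction x using SU.induction_monomial hq with
    | zero => simp
    | add x y hx hy => simp only [map_add, hx, hy]
    | smul s x hx => simp only [map_smul, hx]
    | mono n j k =>
      rw [SU.row_monomial]
      split_ifs with h
      · rw [SU.row_monomial, if_pos h]
      · simp
  have hU : ∀ w, embed₂ hq (H (koszulPair hq (row₂ hq (-1) w) 0)) =
      toOuter.symm (sandwich (toOuter U) (row₂ hq (-1) w)) := by
    intro w
    induction w using induction_on with
    | zero =>
      have : koszulPair hq (row₂ hq (-1) 0) 0 = 0 := part_ext hq (by simp) (by simp)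
      rw [this]; simp
    | add w w' h h' =>
      have : koszulPair hq (row₂ hq (-1) (w + w')) 0 =
          koszulPair hq (row₂ hq (-1) w) 0 + koszulPair hq (row₂ hq (-1) w') 0 :=
        part_ext hq (by simp) (by simp)
      rw [this, map_add, map_add, h, h']; simp
    | tmul u v =>
      rw [row₂_tmul, hsand]
      set u' := row hq (-1) u with hu'
      set v' := row hq (-1) v with hv'
      have e₁ : embed hq (proj hq (u' * 𝐚)) = u' * 𝐚 :=
        embed_proj_of_row hq (by rw [hu', ← SU.row_mul_gen]; exact hrow _ _)
      have e₂ : embed hq (proj hq (u' * 𝐛)) = u' * 𝐛 :=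
        embed_proj_of_row hq (by rw [hu', ← SU.row_mul_gen]; exact hrow _ _)
      have e₃ : embed hq (proj hq (𝐚 * v')) = 𝐚 * v' :=
        embed_proj_of_row hq (by rw [hv', ← SU.row_gen_mul]; exact hrow _ _)
      have e₄ : embed hq (proj hq (𝐛 * v')) = 𝐛 * v' :=
        embed_proj_of_row hq (by rw [hv', ← SU.row_gen_mul]; exact hrow _ _)
      have eu : u' = u' * 𝐚 * 𝐝 - 𝐪 • (u' * 𝐛 * 𝐜) := by
        rw [mul_assoc, SU.gen_ad, mul_add, mul_one, mul_smul_comm, mul_assoc]; abel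
      have ev : v' = 𝐝 * (𝐚 * v') -
          𝐪⁻¹ • (𝐜 * (𝐛 * v')) := by
        rw [← mul_assoc, SU.gen_da, ← mul_assoc, ← SU.gen_bc, add_mul, one_mul, smul_mul_assoc]; abel
      have hexp : koszulPair hq (u' ⊗ₜ v') 0 =
          proj hq (u' * 𝐚) • op (proj hq (𝐚 * v')) •
            koszulPair hq (𝐝 ⊗ₜ 𝐝) 0 -
          𝐪⁻¹ • proj hq (u' * 𝐚) • op (proj hq (𝐛 * v')) •
            koszulPair hq (𝐝 ⊗ₜ 𝐜) 0 -
          𝐪 • proj hq (u' * 𝐛) • op (proj hq (𝐚 * v')) •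
            koszulPair hq (𝐜 ⊗ₜ 𝐝) 0 +
          proj hq (u' * 𝐛) • op (proj hq (𝐛 * v')) •
            koszulPair hq (𝐜 ⊗ₜ 𝐜) 0 := by
        refine part_ext hq ?_ ?_
        · simp only [map_add, map_sub, map_smul, fstPart_smul, fstPart_op_smul, fstPart_pair,
            outerLeft_tmul, outerRight_tmul, e₁, e₂, e₃, e₄]
          calc u' ⊗ₜ[ℂ] v' = (u' * 𝐚 * 𝐝 -
                𝐪 • (u' * 𝐛 * 𝐜)) ⊗ₜ[ℂ] (𝐝 * (𝐚 * v') -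
                  𝐪⁻¹ • (𝐜 * (𝐛 * v'))) := by rw [← eu, ← ev]
            _ = _ := by
              simp only [sub_tmul, tmul_sub, tmul_smul,
                ← smul_tmul', smul_sub, smul_smul]
              match_scalars <;> first | ring1 | (field_simp; try ring1)
        · simp only [map_add, map_sub, map_smul, sndPart_smul, sndPart_op_smul, sndPart_pair,
            map_zero, smul_zero, sub_zero, add_zero]
      rw [hexp]
      simp only [map_add, map_sub, map_smul, hHl, e₁, e₂, e₃, e₄, U, outer_mul, h₁]
  have hV : ∀ w, embed₂ hq (H (koszulPair hq 0 (row₂ hq 1 w))) =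
      toOuter.symm (sandwich (toOuter V) (row₂ hq 1 w)) := by
    intro w
    induction w using induction_on with
    | zero =>
      have : koszulPair hq 0 (row₂ hq 1 0) = 0 := part_ext hq (by simp) (by simp)
      rw [this]; simp
    | add w w' h h' =>
      have : koszulPair hq 0 (row₂ hq 1 (w + w')) =
          koszulPair hq 0 (row₂ hq 1 w) + koszulPair hq 0 (row₂ hq 1 w') :=
        part_ext hq (by simp) (by simp)
      rw [this, map_add, map_add, h, h']; simp
    | tmul u v =>
      rw [row₂_tmul, hsand]
      set u' := row hq 1 u with hu'
      set v' := row hq 1 v with hv'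
      have e₁ : embed hq (proj hq (u' * 𝐝)) = u' * 𝐝 :=
        embed_proj_of_row hq (by rw [hu', ← SU.row_mul_gen]; exact hrow _ _)
      have e₂ : embed hq (proj hq (u' * 𝐜)) = u' * 𝐜 :=
        embed_proj_of_row hq (by rw [hu', ← SU.row_mul_gen]; exact hrow _ _)
      have e₃ : embed hq (proj hq (𝐝 * v')) = 𝐝 * v' :=
        embed_proj_of_row hq (by rw [hv', ← SU.row_gen_mul]; exact hrow _ _)
      have e₄ : embed hq (proj hq (𝐜 * v')) = 𝐜 * v' :=
        embed_proj_of_row hq (by rw [hv', ← SU.row_gen_mul]; exact hrow _ _)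
      have eu : u' = u' * 𝐝 * 𝐚 -
          𝐪⁻¹ • (u' * 𝐜 * 𝐛) := by
        rw [mul_assoc, SU.gen_da, mul_assoc u' 𝐜, ← SU.gen_bc, mul_add, mul_one,
          mul_smul_comm]
        abel
      have ev : v' = 𝐚 * (𝐝 * v') -
          𝐪 • (𝐛 * (𝐜 * v')) := by
        rw [← mul_assoc, SU.gen_ad, ← mul_assoc, add_mul, one_mul, smul_mul_assoc]; abel
      have hexp : koszulPair hq 0 (u' ⊗ₜ v') =
          proj hq (u' * 𝐝) • op (proj hq (𝐝 * v')) •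
            koszulPair hq 0 (𝐚 ⊗ₜ 𝐚) -
          𝐪 • proj hq (u' * 𝐝) • op (proj hq (𝐜 * v')) •
            koszulPair hq 0 (𝐚 ⊗ₜ 𝐛) -
          𝐪⁻¹ • proj hq (u' * 𝐜) • op (proj hq (𝐝 * v')) •
            koszulPair hq 0 (𝐛 ⊗ₜ 𝐚) +
          proj hq (u' * 𝐜) • op (proj hq (𝐜 * v')) •
            koszulPair hq 0 (𝐛 ⊗ₜ 𝐛) := by
        refine part_ext hq ?_ ?_
        · simp only [map_add, map_sub, map_smul, fstPart_smul, fstPart_op_smul, fstPart_pair,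
            map_zero, smul_zero, sub_zero, add_zero]
        · simp only [map_add, map_sub, map_smul, sndPart_smul, sndPart_op_smul, sndPart_pair,
            outerLeft_tmul, outerRight_tmul, e₁, e₂, e₃, e₄]
          calc u' ⊗ₜ[ℂ] v' = (u' * 𝐝 * 𝐚 -
                𝐪⁻¹ • (u' * 𝐜 * 𝐛)) ⊗ₜ[ℂ]
                  (𝐚 * (𝐝 * v') -
                  𝐪 • (𝐛 * (𝐜 * v'))) := by rw [← eu, ← ev]
            _ = _ := by
              simp only [sub_tmul, tmul_sub, tmul_smul,
                ← smul_tmul', smul_sub, smul_smul]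
              match_scalars <;> first | ring1 | (field_simp; try ring1)
      rw [hexp]
      simp only [map_add, map_sub, map_smul, hHl, e₁, e₂, e₃, e₄, V, outer_mul, h₂]
  have hsplit : ∀ p ∈ koszulSub hq, embed₂ hq (H p) =
      toOuter.symm (sandwich (toOuter U) (fstPart hq p) + sandwich (toOuter V) (sndPart hq p)) := by
    intro p hp
    have e : p = koszulPair hq (row₂ hq (-1) (fstPart hq p)) 0 +
        koszulPair hq 0 (row₂ hq 1 (sndPart hq p)) := by
      rw [hp.1, hp.2]
      exact part_ext hq (by simp) (by simp)
    conv_lhs => rw [e]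
    rw [map_add, map_add, hU, hV, hp.1, hp.2]
    exact (map_add toOuter.symm _ _).symm
  have hUV : dualC q U - dualB q V = 0 := by
    have h := hsplit _ (koszulΩ_mem hq)
    rw [hΩ, map_zero, koszulΩ, fstPart_pair, sndPart_pair, SU.koszulB_tmul, SU.koszulC_tmul] at h
    simp only [one_mul, mul_one, map_add, map_neg, map_sub, map_smul, hsand] at h
    rw [h, sub_eq_add_neg]
    rfl
  obtain ⟨k, hkU, hkV⟩ := SU.dual_exact hq hUV
  refine ⟨toOuter (proj₂ hq k), fun p hp => ?_⟩
  have hB : ∀ w, toOuter.symm (sandwich (toOuter (dualB q k)) w) =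
      toOuter.symm (sandwich (toOuter k) (koszulB q w)) := by
    intro w
    induction w using induction_on with
    | zero => simp
    | add w w' h h' => simp only [map_add, h, h']
    | tmul u v =>
      rw [hsand]
      simp only [SU.koszulB_tmul, map_sub, map_smul, hsand, dualB, lsub_apply,
        lsmul_apply, outer_mul]
  have hC : ∀ w, toOuter.symm (sandwich (toOuter (dualC q k)) w) =
      toOuter.symm (sandwich (toOuter k) (koszulC q w)) := by
    intro w
    induction w using induction_on with
    | zero => simp
    | add w w' h h' => simp only [map_add, h, h']
    | tmul u v =>
      rw [hsand]
      simp only [SU.koszulC_tmul, map_sub, map_smul, hsand, dualC, lsub_apply,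
        lsmul_apply, outer_mul]
  have hP : ∀ r, proj₂ hq (toOuter.symm (sandwich (toOuter k) (embed₂ hq r))) =
      toOuter.symm (sandwich (toOuter (proj₂ hq k)) r) := by
    intro r
    induction r using induction_on with
    | zero => simp
    | add w w' h h' => simp only [map_add, h, h']
    | tmul u v =>
      rw [embed₂_tmul, hsand, SU.outer₂, comp_apply, proj₂_outerLeft, proj₂_outerRight,
        sandwich_tmul, smul_toOuter, op_smul_toOuter, LinearEquiv.symm_apply_apply,
        outerLeft_outerRight]
  apply toOuter.symm.injective
  rw [LinearEquiv.symm_apply_apply, ← hP, ← proj₂_embed₂ hq (H p), hsplit p hp,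
    embed₂_koszulD hq hp, ← hkU, ← hkV, map_add, map_add, map_add, hB, hC, map_add, map_add]

/-- `H¹` of the outer bimodule vanishes. -/
theorem cocycle₁_outer (hq : 0 < q) (f : Sphere q →ₗ[ℂ] Outer (Sphere q)) (hf : IsCocycle₁ f) :
    IsCoboundary₁ f := by
  have hone : f 1 = 0 := by
    have := hf 1 1
    simpa using this
  have hleft : ∀ (a : Sphere q) (w : Sphere q ⊗[ℂ] Sphere q), evalRight f (outerLeft a w) =
      a • evalRight f w + op (LinearMap.mul' ℂ (Sphere q) w) • f a := by
    intro a w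
    induction w using induction_on with
    | zero => simp
    | add w w' h h' => simp only [map_add, h, h', smul_add, op_add, add_smul]; abel
    | tmul x y =>
      have h := hf a x
      have h' : f (a * x) = a • f x + op x • f a := by
        rw [← sub_eq_zero, ← neg_eq_zero, ← h]; abel
      simp only [outerLeft_tmul, evalRight_tmul, h', smul_add, smul_comm a (op y),
        LinearMap.mul'_apply, op_mul, mul_smul]
  let H : KoszulModule hq →ₗ[ℂ] Sphere q ⊗[ℂ] Sphere q :=
    toOuter.symm.toLinearMap ∘ₗ evalRight f ∘ₗ koszulD hq
  have hH : ∀ p, toOuter (H p) = evalRight f (koszulD hq p) := fun p => rfl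
  obtain ⟨k, hk⟩ := exists_eq_sandwich hq H
    (fun a p => toOuter.injective (by
      rw [hH, koszulD_smul, hleft, ← barBoundary_koszulBar, mul_barBoundary, op_zero, zero_smul,
        add_zero, ← smul_toOuter, hH, barBoundary_koszulBar]))
    (fun a p => toOuter.injective (by
      rw [hH, koszulD_op_smul, evalRight_outerRight, ← op_smul_toOuter, hH]))
    (toOuter.injective (by rw [hH, koszulD_koszulΩ, map_zero, map_zero]))
  refine ⟨k, fun a => ?_⟩
  obtain ⟨p, hp, h⟩ := exists_koszulD_eq hq a
  have := hk p hp
  rw [hH, h, map_sub, map_sub, evalRight_tmul, evalRight_tmul, sandwich_tmul, sandwich_tmul, hone]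
    at this
  simpa using this

end Sphere

section Generic

variable {A : Type} [Ring A] [Algebra ℂ A]

@[simp] theorem pairing_tmul (φ : A →ₗ[ℂ] A →ₗ[ℂ] A →ₗ[ℂ] ℂ) (a₀ a₁ a₂ : A) :
    pairing φ (a₀ ⊗ₜ a₁ ⊗ₜ a₂) = φ a₀ a₁ a₂ := by
  simp [pairing]

theorem pairing_b₃ {σ : A ≃ₐ[ℂ] A} {φ : A →ₗ[ℂ] A →ₗ[ℂ] A →ₗ[ℂ] ℂ} (h : IsTwistedCocycle σ φ)
    (w : A ⊗[ℂ] A ⊗[ℂ] A ⊗[ℂ] A) : pairing φ (b₃ A σ w) = 0 := by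
  suffices e : pairing φ ∘ₗ b₃ A σ = 0 from lcongr_fun e w
  ext a₀ a₁ a₂ a₃
  simpa [b₃_tmul] using h a₀ a₁ a₂ a₃

/-- If the second homology is spanned by one class, then cocycles that are nonzero on this class
are cohomologous up to a factor. -/
theorem exists_cohomologous {σ : A ≃ₐ[ℂ] A} {c : A ⊗[ℂ] A ⊗[ℂ] A}
    (hc : ∀ w : A ⊗[ℂ] A ⊗[ℂ] A, b₂ A σ w = 0 → ∃ s : ℂ, w - s • c ∈ LinearMap.range (b₃ A σ))
    {φ φ' : A →ₗ[ℂ] A →ₗ[ℂ] A →ₗ[ℂ] ℂ} (hφ : IsTwistedCocycle σ φ) (hφ' : IsTwistedCocycle σ φ')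
    (h : pairing φ c ≠ 0) (h' : pairing φ' c ≠ 0) :
    ∃ κ : ℂ, κ ≠ 0 ∧ Cohomologous σ φ (κ • φ') := by
  refine ⟨pairing φ c / pairing φ' c, div_ne_zero h h', ?_⟩
  set κ := pairing φ c / pairing φ' c
  have hmem : pairing φ - κ • pairing φ' ∈ (LinearMap.ker (b₂ A σ)).dualAnnihilator := by
    rw [Submodule.mem_dualAnnihilator]
    intro w hw
    obtain ⟨s, v, hv⟩ := hc w hw
    have e : w = b₃ A σ v + s • c := by rw [hv]; abel
    rw [e]
    simp only [lsub_apply, lsmul_apply, map_add, map_smul, pairing_b₃ hφ,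
      pairing_b₃ hφ', zero_add, smul_eq_mul, κ]
    field_simp
    ring
  rw [← LinearMap.range_dualMap_eq_dualAnnihilator_ker] at hmem
  obtain ⟨ψ, hψ⟩ := hmem
  refine ⟨TensorProduct.curry ψ, fun a₀ a₁ a₂ => ?_⟩
  have := lcongr_fun hψ (a₀ ⊗ₜ a₁ ⊗ₜ a₂)
  simp only [LinearMap.dualMap_apply, b₂_tmul, lsub_apply, lsmul_apply,
    pairing_tmul, map_sub, map_add] at this
  simpa using this.symm

theorem IsFundamentalCycle.exists_smul {σ : A ≃ₐ[ℂ] A} {c : A ⊗[ℂ] A ⊗[ℂ] A}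
    (hc : IsFundamentalCycle σ c)
    (hA : ∀ m : A, (∀ a : A, a * m = m * a) → ∃ s : ℂ, m = s • (1 : A))
    (w : A ⊗[ℂ] A ⊗[ℂ] A) (hw : b₂ A σ w = 0) :
    ∃ s : ℂ, w - s • c ∈ LinearMap.range (b₃ A σ) := by
  obtain ⟨m, hm, h⟩ := (hc.2 A).surj₀ w hw
  obtain ⟨s, rfl⟩ := hA m fun a => by
    have := hm a
    rwa [smul_eq_mul, op_smul_eq_mul, sub_eq_zero] at this
  refine ⟨s, ?_⟩
  have e : cap₀ (s • (1 : A)) = s • LinearMap.id (M := A ⊗[ℂ] A ⊗[ℂ] A) := by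
    ext x y z
    simp [cap₀_tmul, smul_tmul']
  rwa [e] at h

end Generic

namespace Sphere

theorem isFundamentalCycle (hq : 0 < q) :
    IsFundamentalCycle (modular hq) (resolution hq).cycle := by
  classical
  refine (resolution hq).isFundamentalCycle ⟨{gen q .A, gen q .B, gen q .Bs}, ?_⟩
    (cocycle₀_outer hq) (cocycle₁_outer hq)
  rw [← adjoin_gen]
  congr 1
  ext x
  simp only [Finset.coe_insert, Finset.coe_singleton, Set.mem_insert_iff, Set.mem_singleton_iff,
    Set.mem_range]
  constructor
  · rintro (rfl | rfl | rfl)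
    exacts [⟨_, rfl⟩, ⟨_, rfl⟩, ⟨_, rfl⟩]
  · rintro ⟨g, rfl⟩
    cases g <;> simp

theorem exists_smul_cycle (hq : 0 < q) (hq₁ : q < 1) (w : Sphere q ⊗[ℂ] Sphere q ⊗[ℂ] Sphere q)
    (hw : b₂ (Sphere q) (modular hq) w = 0) :
    ∃ s : ℂ, w - s • (resolution hq).cycle ∈ LinearMap.range (b₃ (Sphere q) (modular hq)) :=
  (isFundamentalCycle hq).exists_smul (fun _ h => exists_eq_smul_one hq hq₁ h) w hw

/-! ### The standard cocycle -/

/-- The counit on the Podleś sphere. -/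
def aug (hq : 0 < q) : Sphere q →ₐ[ℂ] ℂ := (counit q).comp (embed hq)

/-- The functional `E` on the Podleś sphere. -/
def derE (hq : 0 < q) : Sphere q →ₗ[ℂ] ℂ := funE hq ∘ₗ (embed hq).toLinearMap

/-- The functional `F` on the Podleś sphere. -/
def derF (hq : 0 < q) : Sphere q →ₗ[ℂ] ℂ := funF hq ∘ₗ (embed hq).toLinearMap

@[simp] theorem counit_gen (g : SUGen) : counit q (SU.gen q g) = counitGen g := by
  rw [SU.gen, counit, RingQuot.liftAlgHom_mkAlgHom_apply, FreeAlgebra.lift_ι_apply]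

@[simp] theorem aug_gen (hq : 0 < q) (g : SphereGen) : aug hq (gen q g) = 0 := by
  cases g <;> simp [aug, embedGen, counitGen]

theorem aug_modular (hq : 0 < q) (a : Sphere q) : aug hq (modular hq a) = aug hq a := by
  have h : (aug hq).comp (modular hq : Sphere q →ₐ[ℂ] Sphere q) = aug hq := by
    refine hom_ext fun g => ?_
    cases g <;> simp [modular_A, modular_B, modular_Bs]
  exact DFunLike.congr_fun h a

/-- The representation whose matrix coefficients are `K⁻¹`, `E` and `K`. -/
def homE (hq : 0 < q) : SU q →ₐ[ℂ] Matrix (Fin 2) (Fin 2) ℂ :=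
  RingQuot.liftAlgHom ℂ ⟨FreeAlgebra.lift ℂ (matE q), matE_rel hq⟩

/-- The representation whose matrix coefficients are `K⁻¹`, `F` and `K`. -/
def homF (hq : 0 < q) : SU q →ₐ[ℂ] Matrix (Fin 2) (Fin 2) ℂ :=
  RingQuot.liftAlgHom ℂ ⟨FreeAlgebra.lift ℂ (matF q), matF_rel hq⟩

theorem homE_gen (hq : 0 < q) (g : SUGen) : homE hq (SU.gen q g) = matE q g := by
  rw [SU.gen, homE, RingQuot.liftAlgHom_mkAlgHom_apply, FreeAlgebra.lift_ι_apply]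

theorem homF_gen (hq : 0 < q) (g : SUGen) : homF hq (SU.gen q g) = matF q g := by
  rw [SU.gen, homF, RingQuot.liftAlgHom_mkAlgHom_apply, FreeAlgebra.lift_ι_apply]

theorem derE_apply (hq : 0 < q) (a : Sphere q) : derE hq a = homE hq (embed hq a) 0 1 := rfl

theorem derF_apply (hq : 0 < q) (a : Sphere q) : derF hq a = homF hq (embed hq a) 0 1 := rfl

theorem mat_embed (hq : 0 < q) {f : SU q →ₐ[ℂ] Matrix (Fin 2) (Fin 2) ℂ}
    (hf : ∀ g, ∃ t : ℂ, f (embedGen q g) = !![0, t; 0, 0]) (a : Sphere q) :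
    ∃ t : ℂ, f (embed hq a) = !![aug hq a, t; 0, aug hq a] := by
  induction a using induction_left with
  | one => exact ⟨0, by simp [Matrix.one_fin_two]⟩
  | add x y hx hy =>
    obtain ⟨t, ht⟩ := hx
    obtain ⟨t', ht'⟩ := hy
    exact ⟨t + t', by rw [map_add, map_add, ht, ht']; simp⟩
  | smul s x hx =>
    obtain ⟨t, ht⟩ := hx
    exact ⟨s * t, by rw [map_smul, map_smul, ht]; simp⟩
  | mul g x hx =>
    obtain ⟨t, ht⟩ := hx
    obtain ⟨t', ht'⟩ := hf g
    refine ⟨t' * aug hq x, ?_⟩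
    rw [map_mul, map_mul, embed_gen, ht, ht']
    ext i j
    fin_cases i <;> fin_cases j <;> simp [Matrix.mul_apply, Fin.sum_univ_two]

theorem homE_embedGen (hq : 0 < q) (g : SphereGen) :
    homE hq (embedGen q g) = !![0, derE hq (gen q g); 0, 0] := by
  rw [derE_apply, embed_gen]
  cases g <;> simp only [embedGen, map_smul, map_mul, homE_gen] <;> ext i j <;>
    fin_cases i <;> fin_cases j <;> simp [matE, Matrix.mul_apply, Fin.sum_univ_two]

theorem homF_embedGen (hq : 0 < q) (g : SphereGen) :
    homF hq (embedGen q g) = !![0, derF hq (gen q g); 0, 0] := by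
  rw [derF_apply, embed_gen]
  cases g <;> simp only [embedGen, map_smul, map_mul, homF_gen] <;> ext i j <;>
    fin_cases i <;> fin_cases j <;> simp [matF, Matrix.mul_apply, Fin.sum_univ_two]

theorem derE_mul (hq : 0 < q) (a b : Sphere q) :
    derE hq (a * b) = derE hq a * aug hq b + aug hq a * derE hq b := by
  obtain ⟨s, hs⟩ := mat_embed hq (fun g => ⟨_, homE_embedGen hq g⟩) a
  obtain ⟨t, ht⟩ := mat_embed hq (fun g => ⟨_, homE_embedGen hq g⟩) b
  rw [derE_apply, derE_apply, derE_apply, map_mul, map_mul, hs, ht]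
  simp [Matrix.mul_apply, Fin.sum_univ_two, add_comm]

theorem derF_mul (hq : 0 < q) (a b : Sphere q) :
    derF hq (a * b) = derF hq a * aug hq b + aug hq a * derF hq b := by
  obtain ⟨s, hs⟩ := mat_embed hq (fun g => ⟨_, homF_embedGen hq g⟩) a
  obtain ⟨t, ht⟩ := mat_embed hq (fun g => ⟨_, homF_embedGen hq g⟩) b
  rw [derF_apply, derF_apply, derF_apply, map_mul, map_mul, hs, ht]
  simp [Matrix.mul_apply, Fin.sum_univ_two, add_comm]

theorem derE_one (hq : 0 < q) : derE hq 1 = 0 := by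
  have := derE_mul hq 1 1
  simpa using this

theorem derF_one (hq : 0 < q) : derF hq 1 = 0 := by
  have := derF_mul hq 1 1
  simpa using this

@[simp] theorem derE_A (hq : 0 < q) : derE hq (gen q .A) = 0 := by
  rw [derE_apply, embed_gen]
  simp only [embedGen, map_smul, map_mul, homE_gen]
  simp [matE, Matrix.mul_apply, Fin.sum_univ_two]

@[simp] theorem derE_B (hq : 0 < q) : derE hq (gen q .B) = rt q := by
  rw [derE_apply, embed_gen]
  simp only [embedGen, map_smul, map_mul, homE_gen]
  simp [matE, Matrix.mul_apply, Fin.sum_univ_two]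

@[simp] theorem derE_Bs (hq : 0 < q) : derE hq (gen q .Bs) = 0 := by
  rw [derE_apply, embed_gen]
  simp only [embedGen, map_smul, map_mul, homE_gen]
  simp [matE, Matrix.mul_apply, Fin.sum_univ_two]

@[simp] theorem derF_A (hq : 0 < q) : derF hq (gen q .A) = 0 := by
  rw [derF_apply, embed_gen]
  simp only [embedGen, map_smul, map_mul, homF_gen]
  simp [matF, Matrix.mul_apply, Fin.sum_univ_two]

@[simp] theorem derF_B (hq : 0 < q) : derF hq (gen q .B) = 0 := by
  rw [derF_apply, embed_gen]
  simp only [embedGen, map_smul, map_mul, homF_gen]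
  simp [matF, Matrix.mul_apply, Fin.sum_univ_two]

@[simp] theorem derF_Bs (hq : 0 < q) : derF hq (gen q .Bs) = -(𝐪⁻¹ * rt q) := by
  rw [derF_apply, embed_gen]
  simp only [embedGen, map_smul, map_mul, homF_gen]
  simp [matF, Matrix.mul_apply, Fin.sum_univ_two]

/-- The functionals `(a₀, a₁, a₂) ↦ ε(a₀) (s E(a₁) F(a₂) + t F(a₁) E(a₂))`. -/
def form (hq : 0 < q) (s t : ℂ) : Sphere q →ₗ[ℂ] Sphere q →ₗ[ℂ] Sphere q →ₗ[ℂ] ℂ :=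
  (aug hq).toLinearMap.smulRight
    (s • (derE hq).smulRight (derF hq) + t • (derF hq).smulRight (derE hq))

theorem form_apply (hq : 0 < q) (s t : ℂ) (a₀ a₁ a₂ : Sphere q) :
    form hq s t a₀ a₁ a₂ =
      aug hq a₀ * (s * (derE hq a₁ * derF hq a₂) + t * (derF hq a₁ * derE hq a₂)) := by
  simp only [form, LinearMap.smulRight_apply, lsmul_apply, ladd_apply,
    AlgHom.toLinearMap_apply, smul_eq_mul]

theorem stdCocycle_eq_form (hq : 0 < q) : stdCocycle hq = form hq 1 0 := by
  ext a₀ a₁ a₂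
  rw [stdCocycle_apply, form_apply]
  simp [aug, derE, derF, mul_assoc]

theorem form_isTwistedCocycle (hq : 0 < q) (s t : ℂ) :
    IsTwistedCocycle (modular hq) (form hq s t) := by
  intro a₀ a₁ a₂ a₃
  simp only [form_apply, map_mul, derE_mul, derF_mul, aug_modular]
  ring

theorem pairing_form (hq : 0 < q) (s t : ℂ) :
    pairing (form hq s t) (resolution hq).cycle = 𝐪⁻¹ * (s - 𝐪 ^ 2 * t) := by
  have hq' := ofReal_ne_zero hq
  have hrt := rt_mul_self hq
  have p₁ : proj hq (𝐚 * 𝐝) = 1 - 𝐪 ^ 2 • gen q .A := by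
    rw [← embed_ad hq, proj_embed]
  have p₂ : proj hq (𝐝 * 𝐚) = 1 - gen q .A := by
    rw [← embed_da hq, proj_embed]
  have p₃ : proj hq (𝐛 * 𝐜) = -𝐪 • gen q .A := by
    rw [← embed_bc hq, proj_embed]
  have p₄ : proj hq (𝐜 * 𝐛) = -𝐪 • gen q .A := by
    rw [← embed_cb hq, proj_embed]
  have p₅ : proj hq (𝐚 * 𝐜) = gen q .B := by
    rw [← embed_ac hq, proj_embed]
  have p₆ : proj hq (𝐜 * 𝐚) = 𝐪⁻¹ • gen q .B := by
    rw [← embed_ca hq, proj_embed]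
  have p₇ : proj hq (𝐛 * 𝐝) = -𝐪 • gen q .Bs := by
    rw [← embed_bd hq, proj_embed]
  have p₈ : proj hq (𝐝 * 𝐛) = -gen q .Bs := by
    rw [← embed_db hq, proj_embed]
  have hc : (resolution hq).cycle = foldChain (modular hq) (koszulBar hq (koszulΩ hq)) := rfl
  simp only [hc, koszulBar, ladd_apply, comp_apply, koszulΩ, fstPart_pair,
    sndPart_pair, SU.koszulB_tmul, SU.koszulC_tmul, one_mul, mul_one, barFst, barSnd, map_neg,
    map_sub, map_smul, lsub_apply, lsmul_apply, LinearMap.neg_apply, barTerm_tmul, map_add,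
    foldChain_tmul, pairing_tmul, form_apply, aug_modular, p₁, p₂, p₃, p₄, p₅, p₆, p₇, p₈,
    derE_A, derE_B, derE_Bs, derF_A, derF_B, derF_Bs, aug_gen, derE_one, derF_one, map_one,
    smul_eq_mul]
  field_simp
  linear_combination (s - q ^ 2 * t) * hrt

end Sphere

end Resolution

namespace Spin

local notation "ℓ(" p "," r ")" => (((p + r : ℤ) : ℝ) / 2)

/-- The `q`-number `[p]` as a function of `x = q ^ p`. -/
def br (q x : ℝ) : ℝ := (x - x⁻¹) / (q - q⁻¹)

def gSq (q t : ℝ) : ℝ := (q + q⁻¹) ^ 2 / (br q t ^ 2 * (t + t⁻¹ + q + q⁻¹))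

def bb (q v t : ℝ) : ℝ :=
  (1 + v ^ 2 - q * t - (q * t)⁻¹) / ((q - q⁻¹) ^ 2 * q * br q t * br q (q ^ 2 * t))

theorem br_eq {q x : ℝ} (hq : q ≠ 0) (hx : x ≠ 0) :
    br q x = q * (x ^ 2 - 1) / (x * (q ^ 2 - 1)) := by
  have e : q - q⁻¹ = (q ^ 2 - 1) / q := by field_simp
  rw [br, e]
  rcases eq_or_ne (q ^ 2 - 1) 0 with h | h
  · simp [h]
  · field_simp

theorem gSq_eq {q t : ℝ} (hq : 0 < q) (ht : 0 < t) (h : q ^ 2 - 1 ≠ 0) :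
    gSq q t = (q ^ 2 + 1) ^ 2 * (q ^ 2 - 1) ^ 2 * t ^ 3 /
      (q ^ 3 * (t ^ 2 - 1) ^ 2 * ((t + q) * (q * t + 1))) := by
  have e : t + t⁻¹ + q + q⁻¹ = (t + q) * (q * t + 1) / (q * t) := by field_simp; ring
  rw [gSq, br_eq hq.ne' ht.ne', e]
  rcases eq_or_ne (t ^ 2 - 1) 0 with h₁ | h₁
  · simp [h₁]
  · field_simp

theorem bb_eq {q v t : ℝ} (hq : 0 < q) (ht : 0 < t) (h : q ^ 2 - 1 ≠ 0)  :
    bb q v t = ((1 + v ^ 2) * (q * t) - (q * t) ^ 2 - 1) * t /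
      ((t ^ 2 - 1) * ((q ^ 2 * t) ^ 2 - 1)) := by
  have e : q - q⁻¹ = (q ^ 2 - 1) / q := by field_simp
  rw [bb, br_eq hq.ne' ht.ne', br_eq hq.ne' (by positivity), e]
  rcases eq_or_ne (t ^ 2 - 1) 0 with h₁ | h₁
  · simp [h₁]
  rcases eq_or_ne ((q ^ 2 * t) ^ 2 - 1) 0 with h₂ | h₂
  · simp [h₂]
  field_simp

/-- The coefficients of an operator that sends `w_{p,r}` to a combination of `w_{p+d+j,r-d+j}`,
`j = -1, 0, 1`, as functions of `q ^ p` and `q ^ r`. -/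
structure Band where
  d : ℤ
  lo : ℝ → ℝ → ℝ
  mid : ℝ → ℝ → ℝ
  up : ℝ → ℝ → ℝ

structure Band.Commutes (q κ : ℝ) (S T S' T' : Band) (u w : ℝ) : Prop where
  deg : T.d + S.d = T'.d + S'.d
  lolo : S.lo (q ^ (T.d - 1) * u) (q ^ (-T.d - 1) * w) * T.lo u w =
    κ * (S'.lo (q ^ (T'.d - 1) * u) (q ^ (-T'.d - 1) * w) * T'.lo u w)
  lomid : S.mid (q ^ (T.d - 1) * u) (q ^ (-T.d - 1) * w) * T.lo u w +
      S.lo (q ^ T.d * u) (q ^ (-T.d) * w) * T.mid u w =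
    κ * (S'.mid (q ^ (T'.d - 1) * u) (q ^ (-T'.d - 1) * w) * T'.lo u w +
      S'.lo (q ^ T'.d * u) (q ^ (-T'.d) * w) * T'.mid u w)
  midmid : S.up (q ^ (T.d - 1) * u) (q ^ (-T.d - 1) * w) * T.lo u w +
      S.mid (q ^ T.d * u) (q ^ (-T.d) * w) * T.mid u w +
      S.lo (q ^ (T.d + 1) * u) (q ^ (-T.d + 1) * w) * T.up u w =
    κ * (S'.up (q ^ (T'.d - 1) * u) (q ^ (-T'.d - 1) * w) * T'.lo u w +
      S'.mid (q ^ T'.d * u) (q ^ (-T'.d) * w) * T'.mid u w +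
      S'.lo (q ^ (T'.d + 1) * u) (q ^ (-T'.d + 1) * w) * T'.up u w)
  upmid : S.up (q ^ T.d * u) (q ^ (-T.d) * w) * T.mid u w +
      S.mid (q ^ (T.d + 1) * u) (q ^ (-T.d + 1) * w) * T.up u w =
    κ * (S'.up (q ^ T'.d * u) (q ^ (-T'.d) * w) * T'.mid u w +
      S'.mid (q ^ (T'.d + 1) * u) (q ^ (-T'.d + 1) * w) * T'.up u w)
  upup : S.up (q ^ (T.d + 1) * u) (q ^ (-T.d + 1) * w) * T.up u w =
    κ * (S'.up (q ^ (T'.d + 1) * u) (q ^ (-T'.d + 1) * w) * T'.up u w)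

def bandX (q v : ℝ) : Band where
  d := 0
  lo _ _ := 1
  mid u w := ((q ^ 2 + 1) * (w / u) - q ^ 2 * (u * w) - (u * w)⁻¹) * bb q v (u * w)
  up u w := w / u * v * br q (q * u) * br q (q * w) * gSq q (q ^ 2 * (u * w))

def bandE (q v : ℝ) : Band where
  d := -1
  lo u w := -(u * w)
  mid u w := w * br q (q * w) * (1 + q ^ 2) * (1 - q ^ 2) * bb q v (u * w)
  up u w := q * (w / u) * v * br q (q * w) * br q (q ^ 2 * w) * gSq q (q ^ 2 * (u * w))

def bandF (q v : ℝ) : Band where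
  d := 1
  lo u w := -(u * w)⁻¹
  mid u w := u⁻¹ * br q (q * u) * (1 + q ^ 2) * (1 - q⁻¹ ^ 2) * bb q v (u * w)
  up u w := q⁻¹ * (w / u) * v * br q (q * u) * br q (q ^ 2 * u) * gSq q (q ^ 2 * (u * w))

/-- The coefficients of `s + t T`. -/
def Band.affine (s t : ℝ) (T : Band) : Band where
  d := T.d
  lo u w := t * T.lo u w
  mid u w := s + t * T.mid u w
  up u w := t * T.up u w

variable {q u w v : ℝ}

structure Regular (q u w : ℝ) : Prop where
  q0 : 0 < q
  u0 : 0 < u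
  w0 : 0 < w
  h : q ^ 2 - 1 ≠ 0
  hm : (u * w) ^ 2 - q ^ 4 ≠ 0
  h0 : (u * w) ^ 2 - 1 ≠ 0
  h1 : q ^ 4 * (u * w) ^ 2 - 1 ≠ 0
  h2 : q ^ 8 * (u * w) ^ 2 - 1 ≠ 0

theorem Regular.bb_mid (R : Regular q u w) : bb q v (u * w) =
    ((1 + v ^ 2) * (q * (u * w)) - (q * (u * w)) ^ 2 - 1) * (u * w) /
      (((u * w) ^ 2 - 1) * (q ^ 4 * (u * w) ^ 2 - 1)) := by
  rw [bb_eq R.q0 (mul_pos R.u0 R.w0) R.h]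
  congr 2; ring

theorem Regular.bb_lo (R : Regular q u w) : bb q v (u * w / q ^ 2) =
    ((1 + v ^ 2) * (q * (u * w)) - (u * w) ^ 2 - q ^ 2) * (u * w) /
      (((u * w) ^ 2 - q ^ 4) * ((u * w) ^ 2 - 1)) := by
  have := mul_pos R.u0 R.w0
  have := R.q0
  have e : (u * w / q ^ 2) ^ 2 - 1 = ((u * w) ^ 2 - q ^ 4) / q ^ 4 := by field_simp
  have e' : q ^ 2 * (u * w / q ^ 2) = u * w := by field_simp
  rw [bb_eq R.q0 (by positivity) R.h, e', e]
  generalize u * w = t at *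
  have := R.q0
  field_simp

theorem Regular.bb_up (R : Regular q u w) : bb q v (q ^ 2 * (u * w)) =
    ((1 + v ^ 2) * (q ^ 3 * (u * w)) - (q ^ 3 * (u * w)) ^ 2 - 1) * (q ^ 2 * (u * w)) /
      ((q ^ 4 * (u * w) ^ 2 - 1) * (q ^ 8 * (u * w) ^ 2 - 1)) := by
  have := mul_pos R.u0 R.w0
  have := R.q0
  rw [bb_eq R.q0 (by positivity) R.h]
  congr 1 <;> ring

theorem Regular.gSq_mid (R : Regular q u w) : gSq q (u * w) =
    (q ^ 2 + 1) ^ 2 * (q ^ 2 - 1) ^ 2 * (u * w) ^ 3 /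
      (q ^ 3 * ((u * w) ^ 2 - 1) ^ 2 * ((u * w + q) * (q * (u * w) + 1))) :=
  gSq_eq R.q0 (mul_pos R.u0 R.w0) R.h

theorem Regular.gSq_up (R : Regular q u w) : gSq q (q ^ 2 * (u * w)) =
    (q ^ 2 + 1) ^ 2 * (q ^ 2 - 1) ^ 2 * (u * w) ^ 3 * q ^ 2 /
      ((q ^ 4 * (u * w) ^ 2 - 1) ^ 2 * ((q * (u * w) + 1) * (q ^ 3 * (u * w) + 1))) := by
  have := mul_pos R.u0 R.w0
  have := R.q0
  have e : (q ^ 2 * (u * w)) ^ 2 - 1 = q ^ 4 * (u * w) ^ 2 - 1 := by ring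
  have e' : (q ^ 2 * (u * w) + q) * (q * (q ^ 2 * (u * w)) + 1) =
    q * ((q * (u * w) + 1) * (q ^ 3 * (u * w) + 1)) := by ring
  have h := R.h1
  rw [gSq_eq R.q0 (by positivity) R.h, e, e']
  generalize u * w = t at *
  field_simp

set_option maxHeartbeats 2000000 in
set_option maxRecDepth 8000 in
theorem Regular.commutes (R : Regular q u w) (hv : v = q ∨ v = q⁻¹) :
    Band.Commutes q (q ^ 2) (bandF q v) ((bandX q v).affine 1 (-1)) ((bandX q v).affine 1 (-1))
      (bandF q v) u w ∧
    Band.Commutes q (q ^ 2) ((bandX q v).affine 1 (-1)) (bandE q v) (bandE q v)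
      ((bandX q v).affine 1 (-1)) u w ∧
    Band.Commutes q (-(q ^ 2)⁻¹) (bandE q v) (bandF q v) ((bandX q v).affine 1 (-1))
      ((bandX q v).affine (q ^ 2) 1) u w ∧
    Band.Commutes q (-1) (bandF q v) (bandE q v) ((bandX q v).affine 1 (-1))
      ((bandX q v).affine 1 (q ^ 2)) u w := by
  have q0 := R.q0
  have u0 := R.u0
  have w0 := R.w0
  have ht := mul_pos u0 w0
  have hq := R.h
  have hm := R.hm
  have h0 := R.h0
  have h1 := R.h1
  have h2 := R.h2
  have br' : ∀ x, 0 < x → br q x = q * (x ^ 2 - 1) / (x * (q ^ 2 - 1)) :=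
    fun x hx => br_eq q0.ne' hx.ne'
  have t₁ : q⁻¹ * u * (q⁻¹ * w) = u * w / q ^ 2 := by field_simp
  have t₂ : u * ((q ^ 2)⁻¹ * w) = u * w / q ^ 2 := by field_simp
  have t₃ : (q ^ 2)⁻¹ * u * w = u * w / q ^ 2 := by field_simp
  have t₄ : q * u * (q * w) = q ^ 2 * (u * w) := by ring
  have t₅ : u * (q ^ 2 * w) = q ^ 2 * (u * w) := by ring
  have t₆ : q ^ 2 * u * w = q ^ 2 * (u * w) := by ring
  have t₇ : q * u * (q⁻¹ * w) = u * w := by field_simp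
  have t₈ : q⁻¹ * u * (q * w) = u * w := by field_simp
  have t₉ : q ^ 2 * (u * w / q ^ 2) = u * w := by field_simp
  have z : q ^ (-2 : ℤ) = (q ^ 2)⁻¹ := by simp
  refine ⟨⟨rfl, ?_, ?_, ?_, ?_, ?_⟩, ⟨rfl, ?_, ?_, ?_, ?_, ?_⟩, ⟨rfl, ?_, ?_, ?_, ?_, ?_⟩,
    ⟨rfl, ?_, ?_, ?_, ?_, ?_⟩⟩ <;>
  simp only [bandF, bandX, bandE, Band.affine, neg_neg, neg_zero, Int.reduceSub,
    Int.reduceAdd, Int.reduceNeg, zpow_zero, zpow_one, one_mul, zpow_neg_one, zpow_ofNat, pow_one,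
    pow_zero, z, t₁, t₂, t₃, t₄, t₅, t₆, t₇, t₈, t₉] <;>
  (try simp (discharger := positivity) only [br', R.bb_mid, R.bb_lo, R.bb_up, R.gSq_mid, R.gSq_up]) <;>
  (have hw : w = (u * w) / u := by field_simp
   generalize u * w = t at *
   subst hw
   generalize e₀ : t ^ 2 - 1 = N₀ at *
   generalize e₁ : q ^ 4 * t ^ 2 - 1 = N₁ at *
   generalize e₂ : q ^ 8 * t ^ 2 - 1 = N₂ at *
   generalize e₃ : t ^ 2 - q ^ 4 = N₃ at *
   rcases hv with rfl | rfl <;> field_simp <;> subst e₀ e₁ e₂ e₃ <;> ring1)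

/-! ### A basis in which the representation is rational -/

theorem br_pos {q x : ℝ} (hq : 0 < q) (hq₁ : q < 1) (hx : 0 < x) (hx₁ : x < 1) : 0 < br q x := by
  have h₁ : q < q⁻¹ := hq₁.trans ((one_lt_inv₀ hq).2 hq₁)
  have h₂ : x < x⁻¹ := hx₁.trans ((one_lt_inv₀ hx).2 hx₁)
  exact div_pos_of_neg_of_neg (by linarith) (by linarith)

@[simp] theorem br_one (q : ℝ) : br q 1 = 0 := by simp [br]

theorem qnum_eq_br {q : ℝ} (hq : 0 < q) (x : ℝ) : qnum q x = br q (q ^ x) := by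
  rw [qnum, br, rpow_neg hq.le]

theorem qnum_intCast {q : ℝ} (hq : 0 < q) (n : ℤ) : qnum q n = br q (q ^ n) := by
  rw [qnum_eq_br hq, rpow_intCast]

theorem qnum_pos {q x : ℝ} (hq : 0 < q) (hq₁ : q < 1) (hx : 0 < x) : 0 < qnum q x := by
  rw [qnum_eq_br hq]
  exact br_pos hq hq₁ (by positivity) (Real.rpow_lt_one hq.le hq₁ hx)

theorem qnum_nonneg {q x : ℝ} (hq : 0 < q) (hq₁ : q < 1) (hx : 0 ≤ x) : 0 ≤ qnum q x := by
  rcases hx.eq_or_lt with rfl | hx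
  · simp [qnum]
  · exact (qnum_pos hq hq₁ hx).le

theorem qnum_two_mul {q : ℝ} (hq : 0 < q) (x : ℝ) :
    qnum q (2 * x) = qnum q x * (q ^ x + q ^ (-x)) := by
  rw [qnum, qnum, neg_mul_eq_mul_neg, two_mul, two_mul, rpow_add hq, rpow_add hq]
  ring

/-- `g(l)`. -/
def gCoeff (q l : ℝ) : ℝ :=
  qnum q 2 * √(qnum q (l - 1 / 2)) * √(qnum q (l + 1 / 2)) /
    (√(qnum q (2 * l - 1)) * qnum q (2 * l) * √(qnum q (2 * l + 1)))

theorem αMinus_eq (q l k s : ℝ) :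
    αMinus q l k s = q ^ (k + s / 2) * √(qnum q (l - k)) * √(qnum q (l + k)) * gCoeff q l := by
  rw [αMinus, gCoeff]
  ring

theorem gCoeff_pos {q l : ℝ} (hq : 0 < q) (hq₁ : q < 1) (hl : 1 / 2 < l) : 0 < gCoeff q l := by
  have h₀ := qnum_pos hq hq₁ (x := 2) (by norm_num)
  have h₁ := qnum_pos hq hq₁ (x := l - 1 / 2) (by linarith)
  have h₂ := qnum_pos hq hq₁ (x := l + 1 / 2) (by linarith)
  have h₃ := qnum_pos hq hq₁ (x := 2 * l - 1) (by linarith)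
  have h₄ := qnum_pos hq hq₁ (x := 2 * l) (by linarith)
  have h₅ := qnum_pos hq hq₁ (x := 2 * l + 1) (by linarith)
  rw [gCoeff]
  positivity

theorem gCoeff_sq {q l : ℝ} (hq : 0 < q) (hq₁ : q < 1) (hl : 1 / 2 < l) :
    gCoeff q l ^ 2 = gSq q (q ^ (2 * l)) := by
  have h₁ := qnum_pos hq hq₁ (x := l - 1 / 2) (by linarith)
  have h₂ := qnum_pos hq hq₁ (x := l + 1 / 2) (by linarith)
  have h₃ := qnum_pos hq hq₁ (x := 2 * l - 1) (by linarith)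
  have h₄ := qnum_pos hq hq₁ (x := 2 * l) (by linarith)
  have h₅ := qnum_pos hq hq₁ (x := 2 * l + 1) (by linarith)
  have e₁ : qnum q (2 * l - 1) = qnum q (l - 1 / 2) * (q ^ (l - 1 / 2) + q ^ (-(l - 1 / 2))) := by
    rw [← qnum_two_mul hq]; congr 1; ring
  have e₂ : qnum q (2 * l + 1) = qnum q (l + 1 / 2) * (q ^ (l + 1 / 2) + q ^ (-(l + 1 / 2))) := by
    rw [← qnum_two_mul hq]; congr 1; ring
  have e₃ : (q ^ (l - 1 / 2) + q ^ (-(l - 1 / 2))) * (q ^ (l + 1 / 2) + q ^ (-(l + 1 / 2))) =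
      q ^ (2 * l) + (q ^ (2 * l))⁻¹ + q + q⁻¹ := by
    rw [add_mul, mul_add, mul_add, ← rpow_add hq, ← rpow_add hq, ← rpow_add hq,
      ← rpow_add hq, ← rpow_neg hq.le, ← rpow_neg_one q]
    nth_rw 7 [← rpow_one q]
    ring_nf
  have e₄ : qnum q 2 = q + q⁻¹ := by
    have : q - q⁻¹ ≠ 0 := by
      have := (one_lt_inv₀ hq).2 hq₁
      intro h; linarith
    have e := qnum_two_mul hq 1
    rw [mul_one] at e
    rw [e, qnum, rpow_neg_one, rpow_one, div_self this, one_mul]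
  have hs : ∀ x : ℝ, 0 < q ^ x := fun x => rpow_pos_of_pos hq x
  have p₁ : q ^ (l - 1 / 2) + q ^ (-(l - 1 / 2)) ≠ 0 := (add_pos (hs _) (hs _)).ne'
  have p₂ : q ^ (l + 1 / 2) + q ^ (-(l + 1 / 2)) ≠ 0 := (add_pos (hs _) (hs _)).ne'
  rw [gSq, ← qnum_eq_br hq, ← e₃, gCoeff, div_pow, mul_pow, mul_pow, mul_pow, mul_pow,
    sq_sqrt h₁.le, sq_sqrt h₂.le, sq_sqrt h₃.le, sq_sqrt h₅.le, e₁, e₂, e₄]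
  generalize qnum q (l - 1 / 2) = x₁ at *
  generalize qnum q (l + 1 / 2) = x₂ at *
  generalize qnum q (2 * l) = x₃ at *
  field_simp

/-- `([p]!)^{1/2}`. -/
def rootFact (q : ℝ) (p : ℤ) : ℝ := ∏ i ∈ Finset.range p.toNat, √(qnum q (i + 1))

/-- `g(3/2) g(5/2) ⋯ g(L/2)`. -/
def gProd (q : ℝ) (L : ℤ) : ℝ := ∏ i ∈ Finset.range (L / 2).toNat, gCoeff q (i + 3 / 2)

variable {q : ℝ}

theorem rootFact_pos (hq : 0 < q) (hq₁ : q < 1) (p : ℤ) : 0 < rootFact q p :=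
  Finset.prod_pos fun i _ => Real.sqrt_pos.2 (qnum_pos hq hq₁ (by positivity))

theorem gProd_pos (hq : 0 < q) (hq₁ : q < 1) (L : ℤ) : 0 < gProd q L :=
  Finset.prod_pos fun i _ => gCoeff_pos hq hq₁ (by
    have : (0 : ℝ) ≤ i := by positivity
    linarith)

theorem rootFact_succ {p : ℤ} (hp : 0 ≤ p) :
    rootFact q (p + 1) = √(qnum q (p + 1)) * rootFact q p := by
  lift p to ℕ using hp
  rw [rootFact, rootFact, Int.toNat_natCast_add_one, Finset.prod_range_succ, mul_comm,
    Int.toNat_natCast, Int.cast_natCast]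

theorem gProd_add_two {L : ℤ} (hL : 0 < L) (ho : Odd L) :
    gProd q (L + 2) = gCoeff q (L / 2 + 1) * gProd q L := by
  obtain ⟨i, rfl⟩ := ho
  have hi : 0 ≤ i := by omega
  lift i to ℕ using hi
  have e₁ : ((2 * (i : ℤ) + 1 + 2) / 2).toNat = i + 1 := by omega
  have e₂ : ((2 * (i : ℤ) + 1) / 2).toNat = i := by omega
  rw [gProd, gProd, e₁, e₂, Finset.prod_range_succ, mul_comm]
  congr 2
  push_cast
  ring

/-- The sign `±1` as a real number. -/
def sg (s : Bool) : ℝ := if s then 1 else -1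

/-- The normalization of the vectors `w_{p,r}`. -/
def norma (q : ℝ) (s : Bool) (p r : ℤ) : ℝ :=
  q ^ (((r : ℝ) ^ 2 - p ^ 2 + sg s * (p + r)) / 4) * rootFact q p * rootFact q r * gProd q (p + r)

theorem norma_pos (hq : 0 < q) (hq₁ : q < 1) (s : Bool) (p r : ℤ) : 0 < norma q s p r := by
  have := rootFact_pos hq hq₁
  have := gProd_pos hq hq₁
  exact mul_pos (mul_pos (mul_pos (rpow_pos_of_pos hq _) (rootFact_pos hq hq₁ _))
    (rootFact_pos hq hq₁ _)) (gProd_pos hq hq₁ _)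

theorem norma_diag (hq : 0 < q) {s : Bool} {p r : ℤ} (hp : 0 ≤ p) (hr : 0 ≤ r) (ho : Odd (p + r)) :
    norma q s (p + 1) (r + 1) =
      αMinus q ((p + r : ℤ) / 2 + 1) ((r - p : ℤ) / 2) (sg s) * norma q s p r := by
  have e₁ : (ℓ(p, r) + 1 - (r - p : ℤ) / 2) = p + 1 := by push_cast; ring
  have e₂ : (ℓ(p, r) + 1 + (r - p : ℤ) / 2) = r + 1 := by push_cast; ring
  have e₃ : p + 1 + (r + 1) = p + r + 2 := by ring
  have hL : 0 < p + r := by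
    rcases ho with ⟨m, hm⟩
    omega
  rw [αMinus_eq, e₁, e₂, norma, norma, rootFact_succ hp, rootFact_succ hr, e₃,
    gProd_add_two hL ho]
  have e₄ : ((((r + 1 : ℤ) : ℝ)) ^ 2 - (p + 1 : ℤ) ^ 2 + sg s * ((p + 1 : ℤ) + (r + 1 : ℤ))) / 4 =
      ((r - p : ℤ) / 2 + sg s / 2) + ((r : ℝ) ^ 2 - p ^ 2 + sg s * (p + r)) / 4 := by
    push_cast; ring
  rw [e₄, rpow_add hq]
  ring

theorem norma_cross (hq : 0 < q) (hq₁ : q < 1) {s : Bool} {p r : ℤ} (hp : 0 ≤ p) (hr : 0 ≤ r) :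
    √(qnum q (p + 1)) * norma q s p (r + 1) =
      q ^ (((p + r + 1 : ℤ) : ℝ) / 2) * √(qnum q (r + 1)) * norma q s (p + 1) r := by
  have e₁ : p + (r + 1) = p + r + 1 := by ring
  have e₂ : p + 1 + r = p + r + 1 := by ring
  have e₄ : ((((r + 1 : ℤ) : ℝ)) ^ 2 - (p : ℤ) ^ 2 + sg s * (p + (r + 1 : ℤ))) / 4 =
      ((p + r + 1 : ℤ) : ℝ) / 2 + ((r : ℝ) ^ 2 - (p + 1 : ℤ) ^ 2 + sg s * ((p + 1 : ℤ) + r)) / 4 := by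
    push_cast; ring
  rw [norma, norma, rootFact_succ hp, rootFact_succ hr, e₁, e₂, e₄, rpow_add hq]
  ring

/-- The vectors `w_{p,r}`, multiples of `v^l_k` with `p = l - k` and `r = l + k`. -/
def W (q : ℝ) (s : Bool) (p r : ℤ) : Dom := ((norma q s p r : ℝ) : ℂ)⁻¹ • vec (p + r) (r - p) s

theorem vec_eq (hq : 0 < q) (hq₁ : q < 1) (s : Bool) (p r : ℤ) :
    vec (p + r) (r - p) s = ((norma q s p r : ℝ) : ℂ) • W q s p r := by
  have : ((norma q s p r : ℝ) : ℂ) ≠ 0 := by exact_mod_cast (norma_pos hq hq₁ s p r).ne'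
  rw [W, smul_smul, mul_inv_cancel₀ this, one_smul]

theorem inRange_iff {p r : ℤ} (ho : Odd (p + r)) :
    (0 < p + r ∧ Odd (p + r) ∧ Odd (r - p) ∧ |r - p| ≤ p + r) ↔ 0 ≤ p ∧ 0 ≤ r := by
  have h : Odd (r - p) := by grind
  rw [abs_le]
  constructor
  · rintro ⟨_, _, _, _, _⟩
    constructor <;> linarith
  · rintro ⟨h₁, h₂⟩
    refine ⟨?_, ho, h, by linarith, by linarith⟩
    obtain ⟨m, hm⟩ := ho
    omega

theorem W_eq_zero {s : Bool} {p r : ℤ} (h : p < 0 ∨ r < 0) : W q s p r = 0 := by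
  have : ¬(0 < p + r ∧ Odd (p + r) ∧ Odd (r - p) ∧ |r - p| ≤ p + r) := by
    rintro ⟨_, _, _, h'⟩
    rw [abs_le] at h'
    omega
  rw [W, vec, dif_neg this, smul_zero]

/-- The label of `w_{p,r}`. -/
def idx {p r : ℤ} (ho : Odd (p + r)) (hp : 0 ≤ p) (hr : 0 ≤ r) (s : Bool) : Idx :=
  (⟨(p + r, r - p), (inRange_iff ho).2 ⟨hp, hr⟩⟩, s)

theorem W_eq {s : Bool} {p r : ℤ} (ho : Odd (p + r)) (hp : 0 ≤ p) (hr : 0 ≤ r) :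
    W q s p r = ((norma q s p r : ℝ) : ℂ)⁻¹ • Finsupp.single (idx ho hp hr s) 1 := by
  rw [W, vec, dif_pos ((inRange_iff ho).2 ⟨hp, hr⟩)]
  rfl

@[simp] theorem opOf_single (f : Idx → Dom) (i : Idx) : opOf f (Finsupp.single i 1) = f i := by
  simp [opOf]

theorem exists_idx (i : Idx) : ∃ (p r : ℤ) (ho : Odd (p + r)) (hp : 0 ≤ p) (hr : 0 ≤ r),
    i = idx ho hp hr i.2 := by
  obtain ⟨⟨⟨L, m⟩, h₀, ⟨a, h₁⟩, ⟨b, h₂⟩, h₃⟩, s⟩ := i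
  dsimp only at h₀ h₁ h₂ h₃
  rw [abs_le] at h₃
  refine ⟨a - b, a + b + 1, ⟨a, by ring⟩, by omega, by omega, ?_⟩
  refine Prod.ext (Subtype.ext (Prod.ext ?_ ?_)) rfl <;> simp only [idx] <;> omega

theorem ext_W (hq : 0 < q) (hq₁ : q < 1) {S T : Module.End ℂ Dom}
    (h : ∀ s p r, Odd (p + r) → S (W q s p r) = T (W q s p r)) : S = T := by
  refine Finsupp.lhom_ext' fun i => LinearMap.ext_ring ?_
  obtain ⟨p, r, ho, hp, hr, e⟩ := exists_idx i
  have h' := h i.2 p r ho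
  have h₀ : ((norma q i.2 p r : ℝ) : ℂ) ≠ 0 := by exact_mod_cast (norma_pos hq hq₁ i.2 p r).ne'
  rw [W_eq ho hp hr, map_smul, map_smul, ← e] at h'
  exact smul_right_injective _ (inv_ne_zero h₀) h'

/-- `T` acts on the vectors `w_{p,r}` with sign `s` by the coefficients `b`. -/
def Band.Acts (q : ℝ) (s : Bool) (b : Band) (T : Module.End ℂ Dom) : Prop :=
  ∀ p r : ℤ, Odd (p + r) → T (W q s p r) =
    ((b.lo (q ^ p) (q ^ r) : ℝ) : ℂ) • W q s (p + b.d - 1) (r - b.d - 1) +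
    ((b.mid (q ^ p) (q ^ r) : ℝ) : ℂ) • W q s (p + b.d) (r - b.d) +
    ((b.up (q ^ p) (q ^ r) : ℝ) : ℂ) • W q s (p + b.d + 1) (r - b.d + 1)

theorem Band.Acts.affine {s : Bool} {b : Band} {T : Module.End ℂ Dom} (h : b.Acts q s T)
    (hd : b.d = 0) (x y : ℝ) :
    (b.affine x y).Acts q s ((x : ℂ) • 1 + (y : ℂ) • T) := by
  intro p r ho
  rw [ladd_apply, lsmul_apply, lsmul_apply, h p r ho]
  simp only [Band.affine, hd, Module.End.one_apply, add_zero, sub_zero]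
  push_cast
  module

theorem Band.Acts.mul_apply (hq : 0 < q) {s : Bool} {b c : Band} {S T : Module.End ℂ Dom}
    (hS : b.Acts q s S) (hT : c.Acts q s T) {p r : ℤ} (ho : Odd (p + r)) :
    (S * T) (W q s p r) =
      ((b.lo (q ^ (c.d - 1) * q ^ p) (q ^ (-c.d - 1) * q ^ r) * c.lo (q ^ p) (q ^ r) : ℝ) : ℂ) •
        W q s (p + (c.d + b.d) - 2) (r - (c.d + b.d) - 2) +
      ((b.mid (q ^ (c.d - 1) * q ^ p) (q ^ (-c.d - 1) * q ^ r) * c.lo (q ^ p) (q ^ r) +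
        b.lo (q ^ c.d * q ^ p) (q ^ (-c.d) * q ^ r) * c.mid (q ^ p) (q ^ r) : ℝ) : ℂ) •
        W q s (p + (c.d + b.d) - 1) (r - (c.d + b.d) - 1) +
      ((b.up (q ^ (c.d - 1) * q ^ p) (q ^ (-c.d - 1) * q ^ r) * c.lo (q ^ p) (q ^ r) +
        b.mid (q ^ c.d * q ^ p) (q ^ (-c.d) * q ^ r) * c.mid (q ^ p) (q ^ r) +
        b.lo (q ^ (c.d + 1) * q ^ p) (q ^ (-c.d + 1) * q ^ r) * c.up (q ^ p) (q ^ r) : ℝ) : ℂ) •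
        W q s (p + (c.d + b.d)) (r - (c.d + b.d)) +
      ((b.up (q ^ c.d * q ^ p) (q ^ (-c.d) * q ^ r) * c.mid (q ^ p) (q ^ r) +
        b.mid (q ^ (c.d + 1) * q ^ p) (q ^ (-c.d + 1) * q ^ r) * c.up (q ^ p) (q ^ r) : ℝ) : ℂ) •
        W q s (p + (c.d + b.d) + 1) (r - (c.d + b.d) + 1) +
      ((b.up (q ^ (c.d + 1) * q ^ p) (q ^ (-c.d + 1) * q ^ r) * c.up (q ^ p) (q ^ r) : ℝ) : ℂ) •
        W q s (p + (c.d + b.d) + 2) (r - (c.d + b.d) + 2) := by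
  have ho₁ : Odd (p + c.d - 1 + (r - c.d - 1)) := by grind
  have ho₂ : Odd (p + c.d + (r - c.d)) := by grind
  have ho₃ : Odd (p + c.d + 1 + (r - c.d + 1)) := by grind
  have z : ∀ a b c : ℤ, a = b + c → q ^ a = q ^ b * q ^ c := fun a b c h => by
    rw [h, zpow_add₀ hq.ne']
  rw [Module.End.mul_apply, hT p r ho, map_add, map_add, map_smul, map_smul, map_smul,
    hS _ _ ho₁, hS _ _ ho₂, hS _ _ ho₃,
    z (p + c.d - 1) (c.d - 1) p (by ring), z (r - c.d - 1) (-c.d - 1) r (by ring),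
    z (p + c.d) c.d p (by ring), z (r - c.d) (-c.d) r (by ring),
    z (p + c.d + 1) (c.d + 1) p (by ring), z (r - c.d + 1) (-c.d + 1) r (by ring),
    show p + c.d - 1 + b.d - 1 = p + (c.d + b.d) - 2 by ring,
    show r - c.d - 1 - b.d - 1 = r - (c.d + b.d) - 2 by ring,
    show p + c.d - 1 + b.d = p + (c.d + b.d) - 1 by ring,
    show r - c.d - 1 - b.d = r - (c.d + b.d) - 1 by ring,
    show p + c.d + b.d - 1 = p + (c.d + b.d) - 1 by ring,
    show r - c.d - b.d - 1 = r - (c.d + b.d) - 1 by ring,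
    show p + (c.d + b.d) - 1 + 1 = p + (c.d + b.d) by ring,
    show r - (c.d + b.d) - 1 + 1 = r - (c.d + b.d) by ring,
    show p + c.d + b.d = p + (c.d + b.d) by ring,
    show r - c.d - b.d = r - (c.d + b.d) by ring,
    show p + c.d + 1 + b.d = p + (c.d + b.d) + 1 by ring,
    show r - c.d + 1 - b.d = r - (c.d + b.d) + 1 by ring,
    show p + (c.d + b.d) + 1 - 1 = p + (c.d + b.d) by ring,
    show r - (c.d + b.d) + 1 - 1 = r - (c.d + b.d) by ring,
    show p + (c.d + b.d) + 1 + 1 = p + (c.d + b.d) + 2 by ring,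
    show r - (c.d + b.d) + 1 + 1 = r - (c.d + b.d) + 2 by ring]
  push_cast
  module

theorem Band.Commutes.mul_apply (hq : 0 < q) {κ : ℝ} {s : Bool} {b c b' c' : Band}
    {S T S' T' : Module.End ℂ Dom} {p r : ℤ} (H : Band.Commutes q κ b c b' c' (q ^ p) (q ^ r))
    (hS : b.Acts q s S) (hT : c.Acts q s T) (hS' : b'.Acts q s S') (hT' : c'.Acts q s T')
    (ho : Odd (p + r)) : (S * T) (W q s p r) = ((κ : ℂ) • (S' * T')) (W q s p r) := by
  rw [lsmul_apply, hS.mul_apply hq hT ho, hS'.mul_apply hq hT' ho, H.deg, H.lolo, H.lomid,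
    H.midmid, H.upmid, H.upup]
  push_cast
  module

theorem zpow_sq_mul_ne_one (hq : 0 < q) (hq₁ : q < 1) {L : ℤ} (ho : Odd L) (m : ℤ) :
    q ^ (4 * m) * (q ^ L) ^ 2 ≠ 1 := by
  rw [← zpow_natCast, ← zpow_mul, ← zpow_add₀ hq.ne']
  intro h
  rw [zpow_eq_one_iff_right₀ hq.le hq₁.ne] at h
  obtain ⟨a, rfl⟩ := ho
  push_cast at h
  omega

theorem regular (hq : 0 < q) (hq₁ : q < 1) {p r : ℤ} (ho : Odd (p + r)) :
    Regular q (q ^ p) (q ^ r) := by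
  have h := zpow_sq_mul_ne_one hq hq₁ ho
  refine ⟨hq, by positivity, by positivity, ?_, ?_, ?_, ?_, ?_⟩ <;>
    rw [Ne, sub_eq_zero] <;> try rw [← zpow_add₀ hq.ne']
  · exact (pow_lt_one₀ hq.le hq₁ two_ne_zero).ne
  · intro e
    apply h (-1)
    rw [e, show (4 : ℤ) * -1 = -(4 : ℕ) by norm_num, zpow_neg, zpow_natCast]
    field_simp
  · intro e
    apply h 0
    simpa using e
  · exact h 1
  · exact h 2

/-! ### The action of the generators -/

theorem idx_l {p r : ℤ} (ho : Odd (p + r)) (hp : 0 ≤ p) (hr : 0 ≤ r) (s : Bool) :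
    (idx ho hp hr s).l = ℓ(p, r) := rfl

theorem idx_k {p r : ℤ} (ho : Odd (p + r)) (hp : 0 ≤ p) (hr : 0 ≤ r) (s : Bool) :
    (idx ho hp hr s).k = ((r - p : ℤ) : ℝ) / 2 := rfl

theorem idx_sgn {p r : ℤ} (ho : Odd (p + r)) (hp : 0 ≤ p) (hr : 0 ≤ r) (s : Bool) :
    (idx ho hp hr s).sgn = sg s := rfl

theorem zpow_eq_rpow (q : ℝ) (p : ℤ) : q ^ p = q ^ (p : ℝ) := (rpow_intCast q p).symm

theorem αMinus_sq (hq : 0 < q) (hq₁ : q < 1) (s : Bool) {p r : ℤ} (hp : 0 ≤ p) (hr : 0 ≤ r) :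
    αMinus q ((p + r : ℤ) / 2 + 1) ((r - p : ℤ) / 2) (sg s) ^ 2 =
      (bandX q (q ^ sg s)).up (q ^ p) (q ^ r) := by
  have hp' : (0 : ℝ) ≤ p := by exact_mod_cast hp
  have hr' : (0 : ℝ) ≤ r := by exact_mod_cast hr
  have e₁ : (ℓ(p, r) + 1 - (r - p : ℤ) / 2) = p + 1 := by push_cast; ring
  have e₂ : (ℓ(p, r) + 1 + (r - p : ℤ) / 2) = r + 1 := by push_cast; ring
  have e₃ : q * q ^ p = q ^ ((p : ℝ) + 1) := by
    rw [zpow_eq_rpow, rpow_add hq, rpow_one, mul_comm]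
  have e₄ : q * q ^ r = q ^ ((r : ℝ) + 1) := by
    rw [zpow_eq_rpow, rpow_add hq, rpow_one, mul_comm]
  have e₅ : q ^ 2 * (q ^ p * q ^ r) = q ^ (2 * (ℓ(p, r) + 1)) := by
    rw [zpow_eq_rpow, zpow_eq_rpow, ← rpow_natCast, ← rpow_add hq, ← rpow_add hq]
    congr 1; push_cast; ring
  have e₆ : (q ^ ((((r - p : ℤ) : ℝ)) / 2 + sg s / 2)) ^ 2 = q ^ r / q ^ p * q ^ sg s := by
    rw [zpow_eq_rpow, zpow_eq_rpow, ← rpow_natCast, ← rpow_mul hq.le,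
      ← Real.rpow_sub hq, ← rpow_add hq]
    congr 1; push_cast; ring
  rw [αMinus_eq, e₁, e₂, mul_pow, mul_pow, mul_pow, e₆,
    sq_sqrt (qnum_nonneg hq hq₁ (by positivity)),
    sq_sqrt (qnum_nonneg hq hq₁ (by positivity)),
    gCoeff_sq hq hq₁ (by push_cast; linarith), qnum_eq_br hq, qnum_eq_br hq]
  simp only [bandX, e₃, e₄, e₅]

theorem αZero_eq (hq : 0 < q) (hq₁ : q < 1) (s : Bool) {p r : ℤ} (ho : Odd (p + r)) :
    αZero q ((p + r : ℤ) / 2) ((r - p : ℤ) / 2) (sg s) =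
      (bandX q (q ^ sg s)).mid (q ^ p) (q ^ r) := by
  have R := regular hq hq₁ ho
  have b₁ : ∀ n : ℤ, ∀ x : ℝ, x = n → qnum q x = br q (q ^ n) := fun n x h => by
    rw [h, qnum_intCast hq]
  have z₁ : ∀ n : ℤ, q ^ (n + 1) = q ^ n * q := fun n => zpow_add_one₀ hq.ne' n
  have z₂ : q ^ (p + r + 2) = q ^ 2 * (q ^ p * q ^ r) := by
    rw [zpow_add₀ hq.ne', zpow_add₀ hq.ne', mul_comm]; rfl
  have z₃ : q ^ (p + r) = q ^ p * q ^ r := zpow_add₀ hq.ne' _ _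
  have hq₂ := R.h
  have hd : q - q⁻¹ ≠ 0 := by
    have := (one_lt_inv₀ hq).2 hq₁
    intro h; linarith
  have mm : ∀ x : ℝ, qnum q x * qnum q (x + 1) =
      (q * (q ^ (2 * x)) + (q * q ^ (2 * x))⁻¹ - q - q⁻¹) / (q - q⁻¹) ^ 2 := fun x => by
    have : 0 < q ^ x := rpow_pos_of_pos hq x
    rw [qnum_eq_br hq, qnum_eq_br hq, two_mul, rpow_add hq, rpow_add hq, rpow_one]
    simp only [br]
    field_simp
    ring
  have e₀ : q ^ (2 * ℓ(p, r)) = q ^ p * q ^ r := by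
    rw [mul_div_cancel₀ _ two_ne_zero, rpow_intCast, z₃]
  have e₁ : q ^ (2 * (1 / 2 : ℝ)) = q := by norm_num
  have m₁ := mm (1 / 2)
  have m₂ := mm ℓ(p, r)
  rw [e₁, show (1 / 2 + 1 : ℝ) = 3 / 2 by norm_num] at m₁
  rw [e₀] at m₂
  have hs : sg s * q ^ (-sg s) * (q - q⁻¹) + q ^ 2 + (q ^ 2)⁻¹ = 1 + (q ^ sg s) ^ 2 := by
    cases s <;> simp [sg, rpow_neg_one] <;> field_simp <;> ring
  have hβ : βCoeff q ((p + r : ℤ) / 2) (sg s) = (1 + (q ^ sg s) ^ 2 - q * (q ^ p * q ^ r)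
      - (q * (q ^ p * q ^ r))⁻¹) / ((q - q⁻¹) * (q * br q (q ^ 2 * (q ^ p * q ^ r)))) := by
    rw [βCoeff, m₁, m₂, b₁ (p + r + 2) _ (by push_cast; ring), z₂, ← hs]
    generalize br q _ = x
    generalize sg s * q ^ (-sg s) = y
    have := R.u0
    have := R.w0
    rw [← div_div (_ : ℝ) (q - q⁻¹)]
    congr 1
    field_simp
    ring
  rw [αZero, hβ, b₁ (p + r) _ (by push_cast; ring), b₁ (p + 1) _ (by push_cast; ring),
    b₁ r _ (by push_cast; ring), b₁ p _ (by push_cast; ring), b₁ (r + 1) _ (by push_cast; ring),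
    z₁, z₁, z₃]
  simp only [bandX, bb]
  have hu := R.u0
  have hw := R.w0
  generalize q ^ sg s = v at *
  generalize q ^ p = u at *
  generalize q ^ r = w at *
  have key : br q (u * q) * br q w - q ^ 2 * br q u * br q (w * q) =
      ((q ^ 2 + 1) * (w / u) - q ^ 2 * (u * w) - (u * w)⁻¹) / (q - q⁻¹) := by
    simp only [br]
    field_simp
    ring
  rw [key]
  generalize br q (u * w) = x
  generalize br q (q ^ 2 * (u * w)) = y
  generalize (q ^ 2 + 1) * (w / u) - q ^ 2 * (u * w) - (u * w)⁻¹ = A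
  generalize 1 + v ^ 2 - q * (u * w) - (q * (u * w))⁻¹ = B
  field_simp

theorem acts_opX₀ (hq : 0 < q) (hq₁ : q < 1) (s : Bool) :
    (bandX q (q ^ sg s)).Acts q s (opX₀ q) := by
  intro p r ho
  by_cases h : 0 ≤ p ∧ 0 ≤ r
  · obtain ⟨hp, hr⟩ := h
    have hn : ((norma q s p r : ℝ) : ℂ) ≠ 0 := by exact_mod_cast (norma_pos hq hq₁ s p r).ne'
    have hlo : ((norma q s p r : ℝ) : ℂ)⁻¹ • ((αMinus q ((p + r : ℤ) / 2) ((r - p : ℤ) / 2) (sg s) :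
        ℝ) : ℂ) • vec (p + r - 2) (r - p) s = W q s (p - 1) (r - 1) := by
      rw [show p + r - 2 = p - 1 + (r - 1) by ring, show r - p = r - 1 - (p - 1) by ring,
        vec_eq hq hq₁, smul_smul, smul_smul]
      by_cases h' : 0 ≤ p - 1 ∧ 0 ≤ r - 1
      · have ho' : Odd (p - 1 + (r - 1)) := by grind
        have e := norma_diag (s := s) hq h'.1 h'.2 ho'
        rw [sub_add_cancel, sub_add_cancel, show (((p - 1 + (r - 1) : ℤ) : ℝ) / 2 + 1) =
          ℓ(p, r) by push_cast; ring] at e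
        rw [mul_assoc, ← Complex.ofReal_mul, ← e, inv_mul_cancel₀ hn, one_smul]
      · rw [W_eq_zero (by omega), smul_zero]
    have hup : ((norma q s p r : ℝ) : ℂ)⁻¹ • ((αMinus q ((p + r : ℤ) / 2 + 1) ((r - p : ℤ) / 2)
        (sg s) : ℝ) : ℂ) • vec (p + r + 2) (r - p) s =
        (((bandX q (q ^ sg s)).up (q ^ p) (q ^ r) : ℝ) : ℂ) • W q s (p + 1) (r + 1) := by
      rw [show p + r + 2 = p + 1 + (r + 1) by ring, show r - p = r + 1 - (p + 1) by ring,
        vec_eq hq hq₁, smul_smul, smul_smul, norma_diag hq hp hr ho, ← αMinus_sq hq hq₁ s hp hr,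
        show r + 1 - (p + 1) = r - p by ring]
      congr 1
      push_cast
      field_simp
    rw [W_eq ho hp hr, map_smul, opX₀, opOf_single, smul_add, smul_add, idx_l, idx_k, idx_sgn]
    dsimp only [idx]
    rw [hlo, hup, αZero_eq hq hq₁ s ho, vec_eq hq hq₁, smul_comm, smul_smul _ _ (W q s p r),
      inv_mul_cancel₀ hn, one_smul]
    simp [bandX]
  · have h' : p < 0 ∨ r < 0 := by omega
    have hd : (bandX q (q ^ sg s)).d = 0 := rfl
    rw [W_eq_zero h', map_zero, hd, add_zero, sub_zero, W_eq_zero h', W_eq_zero (by omega),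
      smul_zero, smul_zero, zero_add, zero_add, eq_comm]
    by_cases h₁ : p = -1
    · subst h₁
      simp [bandX, hq.ne']
    by_cases h₂ : r = -1
    · subst h₂
      simp [bandX, hq.ne']
    · rw [W_eq_zero (by omega), smul_zero]

theorem opK_W (q δ : ℝ) (s : Bool) {p r : ℤ} (ho : Odd (p + r)) :
    opK q δ (W q s p r) = ((q ^ (δ * ((r - p : ℤ) / 2)) : ℝ) : ℂ) • W q s p r := by
  by_cases h : 0 ≤ p ∧ 0 ≤ r
  · rw [W_eq ho h.1 h.2, map_smul, opK, diagOp, opOf_single, idx_k, smul_comm]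
  · rw [W_eq_zero (by omega), map_zero, smul_zero]

theorem opE_opK_W (hq : 0 < q) (hq₁ : q < 1) (s : Bool) {p r : ℤ} (ho : Odd (p + r)) :
    (opE q * opK q (-1)) (W q s p r) =
      ((q ^ p * br q (q * q ^ r) : ℝ) : ℂ) • W q s (p - 1) (r + 1) := by
  rw [Module.End.mul_apply, opK_W _ _ _ ho, map_smul]
  by_cases h : 0 ≤ p ∧ 0 ≤ r
  · obtain ⟨hp, hr⟩ := h
    have hr' : (0 : ℝ) ≤ r := by exact_mod_cast hr
    have hp' : (0 : ℝ) ≤ p := by exact_mod_cast hp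
    rw [W_eq ho hp hr, map_smul, opE, opOf_single, idx_l, idx_k]
    dsimp only [idx]
    rw [show p + r = p - 1 + (r + 1) by ring, show r - p + 2 = r + 1 - (p - 1) by ring,
      vec_eq hq hq₁, smul_smul, smul_smul, smul_smul, show p - 1 + (r + 1) = p + r by ring,
      show (ℓ(p, r) - (r - p : ℤ) / 2) = p by push_cast; ring,
      show (ℓ(p, r) + (r - p : ℤ) / 2 + 1) = r + 1 by push_cast; ring]
    by_cases h : 0 ≤ p - 1
    · have e := norma_cross (s := s) hq hq₁ h hr
      rw [sub_add_cancel, show p - 1 + r + 1 = p + r by ring,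
        show (((p - 1 : ℤ) : ℝ) + 1) = p by push_cast; ring] at e
      have hn := (norma_pos hq hq₁ s p r).ne'
      have z : q ^ (-1 * (((r - p : ℤ) : ℝ) / 2)) * q ^ ℓ(p, r) = q ^ p := by
        rw [← rpow_add hq, zpow_eq_rpow]
        congr 1; push_cast; ring
      have b : br q (q * q ^ r) = √(qnum q (r + 1)) * √(qnum q (r + 1)) := by
        rw [mul_self_sqrt (qnum_nonneg hq hq₁ (by positivity)), qnum_eq_br hq,
          rpow_add hq, rpow_one, mul_comm, zpow_eq_rpow]
      congr 1
      rw [Real.sqrt_mul (qnum_nonneg hq hq₁ hp'), b, ← z]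
      simp only [← Complex.ofReal_inv, ← Complex.ofReal_mul]
      congr 1
      field_simp
      linear_combination √(qnum q (r + 1)) * e
    · rw [W_eq_zero (by omega), smul_zero, smul_zero]
  · rw [W_eq_zero (by omega), map_zero, smul_zero, eq_comm]
    by_cases h₂ : r = -1
    · subst h₂
      simp [hq.ne']
    · rw [W_eq_zero (by omega), smul_zero]

theorem opF_opK_W (hq : 0 < q) (hq₁ : q < 1) (s : Bool) {p r : ℤ} (ho : Odd (p + r)) :
    (opF q * opK q (-1)) (W q s p r) =
      (((q ^ r)⁻¹ * br q (q * q ^ p) : ℝ) : ℂ) • W q s (p + 1) (r - 1) := by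
  rw [Module.End.mul_apply, opK_W _ _ _ ho, map_smul]
  by_cases h : 0 ≤ p ∧ 0 ≤ r
  · obtain ⟨hp, hr⟩ := h
    have hr' : (0 : ℝ) ≤ r := by exact_mod_cast hr
    have hp' : (0 : ℝ) ≤ p := by exact_mod_cast hp
    rw [W_eq ho hp hr, map_smul, opF, opOf_single, idx_l, idx_k]
    dsimp only [idx]
    rw [show p + r = p + 1 + (r - 1) by ring, show r - p - 2 = r - 1 - (p + 1) by ring,
      vec_eq hq hq₁, smul_smul, smul_smul, smul_smul, show p + 1 + (r - 1) = p + r by ring,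
      show (ℓ(p, r) - (r - p : ℤ) / 2 + 1) = p + 1 by push_cast; ring,
      show (ℓ(p, r) + (r - p : ℤ) / 2) = r by push_cast; ring]
    by_cases h : 0 ≤ r - 1
    · have e := norma_cross (s := s) hq hq₁ hp h
      rw [sub_add_cancel, show p + (r - 1) + 1 = p + r by ring,
        show (((r - 1 : ℤ) : ℝ) + 1) = r by push_cast; ring] at e
      have hn := (norma_pos hq hq₁ s p r).ne'
      have z : q ^ (-1 * (((r - p : ℤ) : ℝ) / 2)) = (q ^ r)⁻¹ * q ^ ℓ(p, r) := by
        rw [zpow_eq_rpow, ← rpow_neg hq.le, ← rpow_add hq]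
        congr 1; push_cast; ring
      have b : br q (q * q ^ p) = √(qnum q (p + 1)) * √(qnum q (p + 1)) := by
        rw [mul_self_sqrt (qnum_nonneg hq hq₁ (by positivity)), qnum_eq_br hq,
          rpow_add hq, rpow_one, mul_comm, zpow_eq_rpow]
      congr 1
      rw [Real.sqrt_mul (qnum_nonneg hq hq₁ (by positivity)), b, z]
      simp only [← Complex.ofReal_inv, ← Complex.ofReal_mul]
      congr 1
      field_simp
      linear_combination (-√(qnum q (p + 1))) * e
    · rw [W_eq_zero (by omega), smul_zero, smul_zero]
  · rw [W_eq_zero (by omega), map_zero, smul_zero, eq_comm]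
    by_cases h₂ : p = -1
    · subst h₂
      simp [hq.ne']
    · rw [W_eq_zero (by omega), smul_zero]

theorem opX₀_opK (hq : 0 < q) (hq₁ : q < 1) (δ : ℝ) : opX₀ q * opK q δ = opK q δ * opX₀ q := by
  refine ext_W hq hq₁ fun s p r ho => ?_
  have hd : (bandX q (q ^ sg s)).d = 0 := rfl
  have ho₁ : Odd (p - 1 + (r - 1)) := by grind
  have ho₃ : Odd (p + 1 + (r + 1)) := by grind
  rw [Module.End.mul_apply, Module.End.mul_apply, opK_W _ _ _ ho, map_smul,
    acts_opX₀ hq hq₁ s p r ho, hd]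
  simp only [add_zero, sub_zero, map_add, map_smul, opK_W _ _ _ ho, opK_W _ _ _ ho₁,
    opK_W _ _ _ ho₃, show r - 1 - (p - 1) = r - p by ring, show r + 1 - (p + 1) = r - p by ring]
  module

theorem mid_sub_mid (q v : ℝ) {u w x : ℝ} (hu : 0 < u) (hw : 0 < w) (hx : 0 < x) :
    (bandX q v).mid u w - (bandX q v).mid (x⁻¹ * u) (x * w) =
      (q ^ 2 + 1) * (w / u) * (1 - x ^ 2) * bb q v (u * w) := by
  have e : x⁻¹ * u * (x * w) = u * w := by field_simp
  simp only [bandX, e]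
  field_simp
  ring

theorem up_eq (q v : ℝ) {u w x : ℝ} (hx : 0 < x) :
    (bandX q v).up (x⁻¹ * u) (x * w) = w / u * x ^ 2 * v * br q (q * (x⁻¹ * u)) *
      br q (q * (x * w)) * gSq q (q ^ 2 * (u * w)) := by
  have e : x⁻¹ * u * (x * w) = u * w := by field_simp
  have e' : x * w / (x⁻¹ * u) = w / u * x ^ 2 := by field_simp
  simp only [bandX, e, e']

theorem acts_E (hq : 0 < q) (hq₁ : q < 1) (s : Bool) :
    (bandE q (q ^ sg s)).Acts q s ((opE q * opX₀ q - opX₀ q * opE q) * opK q (-1)) := by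
  have e : (opE q * opX₀ q - opX₀ q * opE q) * opK q (-1) =
      (opE q * opK q (-1)) * opX₀ q - opX₀ q * (opE q * opK q (-1)) := by
    rw [mul_assoc (opE q) (opK q (-1)), ← opX₀_opK hq hq₁]
    rfl
  intro p r ho
  have ho₁ : Odd (p - 1 + (r - 1)) := by grind
  have ho₂ : Odd (p - 1 + (r + 1)) := by grind
  have ho₃ : Odd (p + 1 + (r + 1)) := by grind
  have hd : (bandX q (q ^ sg s)).d = 0 := rfl
  have hd' : (bandE q (q ^ sg s)).d = -1 := rfl
  have hu : 0 < q ^ p := by positivity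
  have hw : 0 < q ^ r := by positivity
  have hq₂ := (regular hq hq₁ ho).h
  rw [e, lsub_apply, Module.End.mul_apply _ (opX₀ q), Module.End.mul_apply (opX₀ q),
    acts_opX₀ hq hq₁ s p r ho, opE_opK_W hq hq₁ s ho, map_smul, acts_opX₀ hq hq₁ s _ _ ho₂, hd,
    hd']
  simp only [add_zero, sub_zero, map_add, map_smul, opE_opK_W hq hq₁ s ho,
    opE_opK_W hq hq₁ s ho₁, opE_opK_W hq hq₁ s ho₃]
  rw [show p + -1 - 1 = p - 1 - 1 by ring, show r - -1 - 1 = r - 1 + 1 by ring,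
    show r + 1 - 1 = r - 1 + 1 by ring, show p + -1 = p - 1 by ring, show r - -1 = r + 1 by ring,
    show p + 1 - 1 = p - 1 + 1 by ring]
  simp only [zpow_sub₀ hq.ne', zpow_add₀ hq.ne', zpow_one]
  have m := mid_sub_mid q (q ^ sg s) hu hw hq
  have t := up_eq q (q ^ sg s) (u := q ^ p) (w := q ^ r) hq
  rw [show q ^ p / q = q⁻¹ * q ^ p by field_simp, show q ^ r * q = q * q ^ r by ring, t]
  generalize q ^ sg s = v at *
  generalize q ^ p = u at *
  generalize q ^ r = w at *
  have c₁ : q⁻¹ * u * br q (q * (w / q)) - u * br q (q * w) = (bandE q v).lo u w := by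
    rw [mul_div_cancel₀ _ hq.ne', br_eq hq.ne' hw.ne', br_eq hq.ne' (by positivity)]
    simp only [bandE]
    field_simp
    ring
  have c₂ : (bandX q v).mid u w * (u * br q (q * w)) -
      u * br q (q * w) * (bandX q v).mid (q⁻¹ * u) (q * w) = (bandE q v).mid u w := by
    rw [mul_comm, ← mul_sub, m]
    simp only [bandE]
    field_simp
    ring
  have c₃ : (bandX q v).up u w * (u * q * br q (q * (q * w))) -
      u * br q (q * w) * (w / u * q ^ 2 * v * br q (q * (q⁻¹ * u)) * br q (q * (q * w)) *
        gSq q (q ^ 2 * (u * w))) = (bandE q v).up u w := by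
    simp only [bandX, bandE]
    rw [mul_inv_cancel_left₀ hq.ne', br_eq hq.ne' hu.ne', br_eq hq.ne' (mul_pos hq hu).ne',
      show q * (q * w) = q ^ 2 * w by ring]
    generalize br q _ = x
    generalize br q _ = y
    generalize gSq q _ = z
    field_simp
    ring
  rw [← c₁, ← c₂, ← c₃]
  simp only [bandX]
  push_cast
  module

theorem acts_F (hq : 0 < q) (hq₁ : q < 1) (s : Bool) :
    (bandF q (q ^ sg s)).Acts q s ((opF q * opX₀ q - opX₀ q * opF q) * opK q (-1)) := by
  have e : (opF q * opX₀ q - opX₀ q * opF q) * opK q (-1) =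
      (opF q * opK q (-1)) * opX₀ q - opX₀ q * (opF q * opK q (-1)) := by
    rw [mul_assoc (opF q) (opK q (-1)), ← opX₀_opK hq hq₁]
    rfl
  intro p r ho
  have ho₁ : Odd (p - 1 + (r - 1)) := by grind
  have ho₂ : Odd (p + 1 + (r - 1)) := by grind
  have ho₃ : Odd (p + 1 + (r + 1)) := by grind
  have hd : (bandX q (q ^ sg s)).d = 0 := rfl
  have hd' : (bandF q (q ^ sg s)).d = 1 := rfl
  have hu : 0 < q ^ p := by positivity
  have hw : 0 < q ^ r := by positivity
  have hq₂ := (regular hq hq₁ ho).h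
  rw [e, lsub_apply, Module.End.mul_apply _ (opX₀ q), Module.End.mul_apply (opX₀ q),
    acts_opX₀ hq hq₁ s p r ho, opF_opK_W hq hq₁ s ho, map_smul, acts_opX₀ hq hq₁ s _ _ ho₂, hd,
    hd']
  simp only [add_zero, sub_zero, map_add, map_smul, opF_opK_W hq hq₁ s ho,
    opF_opK_W hq hq₁ s ho₁, opF_opK_W hq hq₁ s ho₃]
  rw [show p + 1 - 1 = p - 1 + 1 by ring, show r + 1 - 1 = r - 1 + 1 by ring]
  simp only [zpow_sub₀ hq.ne', zpow_add₀ hq.ne', zpow_one]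
  have hq' : 0 < q⁻¹ := by positivity
  have m := mid_sub_mid q (q ^ sg s) hu hw hq'
  have t := up_eq q (q ^ sg s) (u := q ^ p) (w := q ^ r) hq'
  rw [inv_inv] at m t
  rw [show q ^ r / q = q⁻¹ * q ^ r by field_simp, show q ^ p * q = q * q ^ p by ring, t]
  generalize q ^ sg s = v at *
  generalize q ^ p = u at *
  generalize q ^ r = w at *
  have c₁ : (q⁻¹ * w)⁻¹ * br q (q * (u / q)) - w⁻¹ * br q (q * u) = (bandF q v).lo u w := by
    rw [mul_div_cancel₀ _ hq.ne', br_eq hq.ne' hu.ne', br_eq hq.ne' (by positivity)]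
    simp only [bandF]
    field_simp
    ring
  have c₂ : (bandX q v).mid u w * (w⁻¹ * br q (q * u)) -
      w⁻¹ * br q (q * u) * (bandX q v).mid (q * u) (q⁻¹ * w) = (bandF q v).mid u w := by
    rw [mul_comm, ← mul_sub, m]
    simp only [bandF]
    field_simp
    ring
  have c₃ : (bandX q v).up u w * ((w * q)⁻¹ * br q (q * (q * u))) -
      w⁻¹ * br q (q * u) * (w / u * q⁻¹ ^ 2 * v * br q (q * (q * u)) * br q (q * (q⁻¹ * w)) *
        gSq q (q ^ 2 * (u * w))) = (bandF q v).up u w := by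
    simp only [bandX, bandF]
    rw [mul_inv_cancel_left₀ hq.ne', br_eq hq.ne' hw.ne', br_eq hq.ne' (mul_pos hq hw).ne',
      show q * (q * u) = q ^ 2 * u by ring]
    generalize br q _ = x
    generalize br q _ = y
    generalize gSq q _ = z
    field_simp
    ring
  rw [← c₁, ← c₂, ← c₃]
  simp only [bandX]
  push_cast
  module

theorem rpow_sg (q : ℝ) (s : Bool) : q ^ sg s = q ∨ q ^ sg s = q⁻¹ := by
  cases s <;> simp [sg, rpow_neg_one]

/-- The operator `[2]^{1/2} x₁`. -/
def opX₁' (q : ℝ) : Module.End ℂ Dom := (opE q * opX₀ q - opX₀ q * opE q) * opK q (-1)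

/-- The operator `[2]^{1/2} x₋₁`. -/
def opXm₁' (q : ℝ) : Module.End ℂ Dom := (opF q * opX₀ q - opX₀ q * opF q) * opK q (-1)

theorem relations (hq : 0 < q) (hq₁ : q < 1) :
    opXm₁' q * (((1 : ℝ) : ℂ) • 1 + ((-1 : ℝ) : ℂ) • opX₀ q) =
      ((q ^ 2 : ℝ) : ℂ) • ((((1 : ℝ) : ℂ) • 1 + ((-1 : ℝ) : ℂ) • opX₀ q) * opXm₁' q) ∧
    (((1 : ℝ) : ℂ) • 1 + ((-1 : ℝ) : ℂ) • opX₀ q) * opX₁' q =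
      ((q ^ 2 : ℝ) : ℂ) • (opX₁' q * (((1 : ℝ) : ℂ) • 1 + ((-1 : ℝ) : ℂ) • opX₀ q)) ∧
    opX₁' q * opXm₁' q = ((-(q ^ 2)⁻¹ : ℝ) : ℂ) • ((((1 : ℝ) : ℂ) • 1 + ((-1 : ℝ) : ℂ) • opX₀ q) *
      (((q ^ 2 : ℝ) : ℂ) • 1 + ((1 : ℝ) : ℂ) • opX₀ q)) ∧
    opXm₁' q * opX₁' q = ((-1 : ℝ) : ℂ) • ((((1 : ℝ) : ℂ) • 1 + ((-1 : ℝ) : ℂ) • opX₀ q) *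
      (((1 : ℝ) : ℂ) • 1 + ((q ^ 2 : ℝ) : ℂ) • opX₀ q)) := by
  have aX := fun s => (acts_opX₀ hq hq₁ s).affine rfl
  have aE := acts_E hq hq₁
  have aF := acts_F hq hq₁
  have C := fun s p r (ho : Odd (p + r)) => (regular hq hq₁ ho).commutes (rpow_sg q s)
  refine ⟨?_, ?_, ?_, ?_⟩ <;> refine ext_W hq hq₁ fun s p r ho => ?_
  · exact (C s p r ho).1.mul_apply hq (aF s) (aX s _ _) (aX s _ _) (aF s) ho
  · exact (C s p r ho).2.1.mul_apply hq (aX s _ _) (aE s) (aE s) (aX s _ _) ho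
  · exact (C s p r ho).2.2.1.mul_apply hq (aE s) (aF s) (aX s _ _) (aX s _ _) ho
  · exact (C s p r ho).2.2.2.mul_apply hq (aF s) (aE s) (aX s _ _) (aX s _ _) ho

theorem exists_hom_of_relations {R : Type} [Ring R] [Algebra ℂ R] {X E F : R} {c c' : ℂ} (hq : 0 < q)
    (hc : c * c' * (1 + (q : ℂ) ^ 2) ^ 2 = -(q : ℂ) ^ 2)
    (h₁ : F * (((1 : ℝ) : ℂ) • 1 + ((-1 : ℝ) : ℂ) • X) =
      ((q ^ 2 : ℝ) : ℂ) • ((((1 : ℝ) : ℂ) • 1 + ((-1 : ℝ) : ℂ) • X) * F))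
    (h₂ : (((1 : ℝ) : ℂ) • 1 + ((-1 : ℝ) : ℂ) • X) * E =
      ((q ^ 2 : ℝ) : ℂ) • (E * (((1 : ℝ) : ℂ) • 1 + ((-1 : ℝ) : ℂ) • X)))
    (h₃ : E * F = ((-(q ^ 2)⁻¹ : ℝ) : ℂ) • ((((1 : ℝ) : ℂ) • 1 + ((-1 : ℝ) : ℂ) • X) *
      (((q ^ 2 : ℝ) : ℂ) • 1 + ((1 : ℝ) : ℂ) • X)))
    (h₄ : F * E = ((-1 : ℝ) : ℂ) • ((((1 : ℝ) : ℂ) • 1 + ((-1 : ℝ) : ℂ) • X) *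
      (((1 : ℝ) : ℂ) • 1 + ((q ^ 2 : ℝ) : ℂ) • X))) :
    ∃ π : Sphere q →ₐ[ℂ] R, π (Sphere.gen q .A) = (1 + (q : ℂ) ^ 2)⁻¹ • (1 - X) ∧
      π (Sphere.gen q .B) = c • F ∧ π (Sphere.gen q .Bs) = c' • E := by
  have hq' := ofReal_ne_zero hq
  have hq₂ : 1 + (q : ℂ) ^ 2 ≠ 0 := by
    have : (1 + q ^ 2 : ℝ) ≠ 0 := by positivity
    exact_mod_cast this
  have e : ((1 : ℝ) : ℂ) • (1 : R) + ((-1 : ℝ) : ℂ) • X = 1 - X := by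
    push_cast; module
  obtain ⟨Y, hY⟩ : ∃ Y, Y = 1 - X := ⟨_, rfl⟩
  obtain rfl : X = 1 - Y := by rw [hY]; abel
  rw [e, ← hY] at h₁ h₂ h₃ h₄
  rw [← hY]
  have hcc : c' * c = -(q : ℂ) ^ 2 / (1 + (q : ℂ) ^ 2) ^ 2 := by
    rw [← hc]
    field_simp
  let f : SphereGen → R := fun
    | .A => (1 + (q : ℂ) ^ 2)⁻¹ • Y
    | .B => c • F
    | .Bs => c' • E
  have r₁ : f .B * f .A = (q : ℂ) ^ 2 • (f .A * f .B) := by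
    simp only [f, smul_mul_smul_comm, h₁, smul_smul]
    push_cast
    congr 1; ring
  have r₂ : f .A * f .Bs = (q : ℂ) ^ 2 • (f .Bs * f .A) := by
    simp only [f, smul_mul_smul_comm, h₂, smul_smul]
    push_cast
    congr 1; ring
  have r₃ : f .Bs * f .B = f .A - f .A ^ 2 := by
    simp only [f]
    rw [smul_mul_smul_comm, h₃, hcc]
    simp only [pow_two Y, smul_pow, smul_add, smul_sub, mul_add, mul_sub,
      mul_one, mul_smul_comm, smul_smul]
    push_cast
    match_scalars <;> field_simp <;> ring
  have r₄ : f .B * f .Bs = (q : ℂ) ^ 2 • f .A - (q : ℂ) ^ 4 • f .A ^ 2 := by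
    simp only [f]
    rw [smul_mul_smul_comm, h₄, mul_comm c c', hcc]
    simp only [pow_two Y, smul_pow, smul_add, smul_sub,
      mul_add, mul_sub, mul_one, mul_smul_comm, smul_smul]
    push_cast
    match_scalars <;> field_simp <;> ring
  obtain ⟨π, hπ⟩ := Sphere.exists_hom f r₁ r₂ r₃ r₄
  exact ⟨π, hπ .A, hπ .B, hπ .Bs⟩

theorem existsUnique_isSpinRep (hq : 0 < q) (hq₁ : q < 1) :
    ∃! π : Sphere q →ₐ[ℂ] Module.End ℂ Dom, IsSpinRep q π := by
  have hq' := ofReal_ne_zero hq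
  have hq₂ : 1 + (q : ℂ) ^ 2 ≠ 0 := by
    have : (1 + q ^ 2 : ℝ) ≠ 0 := by positivity
    exact_mod_cast this
  have hr₁ : ((√(1 + q⁻¹ ^ 2) : ℝ) : ℂ) ≠ 0 := by
    have : √(1 + q⁻¹ ^ 2) ≠ 0 := by positivity
    exact_mod_cast this
  have hr₂ : ((√(1 + q ^ 2) : ℝ) : ℂ) ≠ 0 := by
    have : √(1 + q ^ 2) ≠ 0 := by positivity
    exact_mod_cast this
  have hr₃ : ((√(qnum q 2) : ℝ) : ℂ) ≠ 0 := by
    have : √(qnum q 2) ≠ 0 := (Real.sqrt_pos.2 (qnum_pos hq hq₁ two_pos)).ne'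
    exact_mod_cast this
  have e₁ : q * √(1 + q⁻¹ ^ 2) = √(1 + q ^ 2) := by
    rw [eq_comm, Real.sqrt_eq_iff_mul_self_eq (by positivity) (by positivity)]
    have := mul_self_sqrt (show 0 ≤ 1 + q⁻¹ ^ 2 by positivity)
    rw [mul_mul_mul_comm, this]
    field_simp
    ring
  have e₂ : q * (√(qnum q 2) * √(qnum q 2)) = 1 + q ^ 2 := by
    rw [mul_self_sqrt (qnum_pos hq hq₁ two_pos).le]
    have hd : q ^ 2 - 1 ≠ 0 := by
      have := pow_lt_one₀ hq.le hq₁ two_ne_zero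
      intro h; linarith
    have := qnum_intCast hq 2
    rw [Int.cast_ofNat] at this
    rw [this, br_eq hq.ne' (by positivity)]
    norm_cast
    field_simp
    ring
  have e₃ := mul_self_sqrt (show 0 ≤ 1 + q ^ 2 by positivity)
  have e₁' : (q : ℂ) * (√(1 + q⁻¹ ^ 2) : ℝ) = (√(1 + q ^ 2) : ℝ) := by exact_mod_cast e₁
  have e₂' : (q : ℂ) * ((√(qnum q 2) : ℝ) * (√(qnum q 2) : ℝ)) = 1 + (q : ℂ) ^ 2 := by
    exact_mod_cast e₂
  have e₃' : ((√(1 + q ^ 2) : ℝ) : ℂ) * (√(1 + q ^ 2) : ℝ) = 1 + (q : ℂ) ^ 2 := by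
    exact_mod_cast e₃
  obtain ⟨h₁, h₂, h₃, h₄⟩ := relations hq hq₁
  obtain ⟨π, hA, hB, hBs⟩ := exists_hom_of_relations (X := opX₀ q) (E := opX₁' q) (F := opXm₁' q) (R := Module.End ℂ Dom)
    (c := ((√(1 + q⁻¹ ^ 2) : ℝ) : ℂ)⁻¹ * ((√(qnum q 2) : ℝ) : ℂ)⁻¹)
    (c' := -((√(1 + q ^ 2) : ℝ) : ℂ)⁻¹ * ((√(qnum q 2) : ℝ) : ℂ)⁻¹) hq (by
      generalize ((√(1 + q⁻¹ ^ 2) : ℝ) : ℂ) = x at *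
      generalize ((√(1 + q ^ 2) : ℝ) : ℂ) = y at *
      generalize ((√(qnum q 2) : ℝ) : ℂ) = z at *
      subst e₁'
      rw [pow_two, ← e₃']
      nth_rw 2 [e₃']
      rw [← e₂']
      field_simp) h₁ h₂ h₃ h₄
  refine ⟨π, ⟨?_, ?_, ?_⟩, fun π' h => ?_⟩
  · rw [hA, smul_smul, mul_inv_cancel₀ hq₂, one_smul]
    exact (sub_sub_cancel (1 : Module.End ℂ Dom) _).symm
  · rw [hB, smul_smul, mul_inv_cancel_left₀ hr₁]
    rfl
  · rw [hBs, smul_smul, ← mul_assoc, neg_mul_neg, mul_inv_cancel₀ hr₂, one_mul]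
    rfl
  · refine Sphere.hom_ext fun g => ?_
    cases g
    · have e : 1 - opX₀ q = (1 + (q : ℂ) ^ 2) • π' (Sphere.gen q .A) := by
        rw [h.map_A]
        exact sub_sub_cancel (1 : Module.End ℂ Dom) _
      rw [hA, e, smul_smul, inv_mul_cancel₀ hq₂, one_smul]
    · rw [hB, mul_smul, ← inv_smul_smul₀ hr₁ (π' _), ← h.map_B]
      rfl
    · rw [hBs, mul_smul, neg_inv, ← inv_smul_smul₀ (neg_ne_zero.2 hr₂) (π' _), ← h.map_Bs]
      rfl

/-! ### Orders of decay of band operators -/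

/-- The `ℓ¹`-norm of a finite combination of basis vectors. -/
def l1 (v : Dom) : ℝ := v.sum fun _ c => ‖c‖

theorem l1_eq_sum {v : Dom} {s : Finset Idx} (h : v.support ⊆ s) : l1 v = ∑ i ∈ s, ‖v i‖ :=
  Finsupp.sum_of_support_subset v h _ fun _ _ => norm_zero

theorem l1_nonneg (v : Dom) : 0 ≤ l1 v := Finset.sum_nonneg fun _ _ => norm_nonneg _

@[simp] theorem l1_zero : l1 0 = 0 := by simp [l1]

@[simp] theorem l1_single (i : Idx) (c : ℂ) : l1 (Finsupp.single i c) = ‖c‖ := by simp [l1]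

theorem l1_add_le (v w : Dom) : l1 (v + w) ≤ l1 v + l1 w := by
  classical
  rw [l1_eq_sum (Finsupp.support_add (g₁ := v) (g₂ := w)),
    l1_eq_sum (s := v.support ∪ w.support) Finset.subset_union_left,
    l1_eq_sum (s := v.support ∪ w.support) Finset.subset_union_right, ← Finset.sum_add_distrib]
  exact Finset.sum_le_sum fun i _ => norm_add_le _ _

@[simp] theorem l1_smul (c : ℂ) (v : Dom) : l1 (c • v) = ‖c‖ * l1 v := by
  rw [l1_eq_sum (Finsupp.support_smul (b := c) (g := v)), l1_eq_sum (v := v) subset_rfl,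
    Finset.mul_sum]
  simp

theorem l1_sum_le {ι : Type} (s : Finset ι) (f : ι → Dom) : l1 (∑ i ∈ s, f i) ≤ ∑ i ∈ s, l1 (f i) := by
  classical
  induction s using Finset.induction_on with
  | empty => simp
  | insert a s ha ih =>
    rw [Finset.sum_insert ha, Finset.sum_insert ha]
    exact (l1_add_le _ _).trans (by gcongr)

theorem norm_apply_le_l1 (v : Dom) (i : Idx) : ‖v i‖ ≤ l1 v := by
  by_cases h : i ∈ v.support
  · exact Finset.single_le_sum (f := fun i => ‖v i‖) (fun _ _ => norm_nonneg _) h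
  · rw [Finsupp.notMem_support_iff.1 h, norm_zero]
    exact l1_nonneg v

theorem map_eq_sum (T : Module.End ℂ Dom) (v : Dom) :
    T v = ∑ j ∈ v.support, v j • T (Finsupp.single j 1) := by
  conv_lhs => rw [← Finsupp.sum_single v, Finsupp.sum, map_sum]
  refine Finset.sum_congr rfl fun j _ => ?_
  rw [← map_smul, Finsupp.smul_single_one]

theorem l1_map_le (T : Module.End ℂ Dom) (v : Dom) :
    l1 (T v) ≤ ∑ j ∈ v.support, ‖v j‖ * l1 (T (Finsupp.single j 1)) := by
  rw [map_eq_sum T v]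
  refine (l1_sum_le _ _).trans_eq ?_
  simp

/-- The labels `i` and `j` differ by at most `N`. -/
def Near (N : ℤ) (i j : Idx) : Prop :=
  |j.1.1.1 - i.1.1.1| ≤ N ∧ |j.1.1.2 - i.1.1.2| ≤ N

theorem Near.mono {N M : ℤ} (h : N ≤ M) {i j : Idx} (hn : Near N i j) : Near M i j :=
  ⟨hn.1.trans h, hn.2.trans h⟩

theorem Near.trans {N M : ℤ} {i j k : Idx} (h : Near N i j) (h' : Near M j k) :
    Near (N + M) i k := by
  obtain ⟨h₁, h₂⟩ := h
  obtain ⟨h₃, h₄⟩ := h'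
  rw [abs_le] at *
  constructor <;> rw [abs_le] <;> constructor <;> linarith

/-- `T` is a band operator whose columns are bounded by `ω`. -/
def Ord (ω : Idx → ℝ) (T : Module.End ℂ Dom) : Prop :=
  ∃ (C : ℝ) (N : ℤ), 0 ≤ C ∧ 0 ≤ N ∧ ∀ i, l1 (T (Finsupp.single i 1)) ≤ C * ω i ∧
    ∀ j ∈ (T (Finsupp.single i 1)).support, Near N i j

/-- The weight `ω` changes by bounded factors between near labels. -/
def Moderate (ω : Idx → ℝ) : Prop :=
  (∀ i, 0 ≤ ω i) ∧ ∀ N : ℤ, ∃ C : ℝ, 0 ≤ C ∧ ∀ i j, Near N i j → ω j ≤ C * ω i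

theorem moderate_one : Moderate 1 := ⟨fun _ => zero_le_one, fun _ => ⟨1, zero_le_one, by simp⟩⟩

theorem Ord.mul {ω ω' : Idx → ℝ} {S T : Module.End ℂ Dom} (hω : Moderate ω) (hS : Ord ω S)
    (hT : Ord ω' T) : Ord (ω * ω') (S * T) := by
  classical
  obtain ⟨C, N, hC, hN, h⟩ := hS
  obtain ⟨C', N', hC', hN', h'⟩ := hT
  obtain ⟨K, hK, hω'⟩ := hω.2 N'
  refine ⟨C * K * C', N' + N, by positivity, by positivity, fun i => ⟨?_, fun j hj => ?_⟩⟩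
  · rw [Module.End.mul_apply]
    have hi := hω.1 i
    calc l1 (S (T (Finsupp.single i 1)))
      _ ≤ ∑ j ∈ (T (Finsupp.single i 1)).support,
          ‖T (Finsupp.single i 1) j‖ * l1 (S (Finsupp.single j 1)) := l1_map_le _ _
      _ ≤ ∑ j ∈ (T (Finsupp.single i 1)).support,
          ‖T (Finsupp.single i 1) j‖ * (C * (K * ω i)) := by
        refine Finset.sum_le_sum fun j hj => ?_
        have := hω' i j ((h' i).2 j hj)
        have := (h j).1
        gcongr
        exact this.trans (by gcongr)
      _ = l1 (T (Finsupp.single i 1)) * (C * (K * ω i)) := by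
        rw [← Finset.sum_mul]
        rfl
      _ ≤ C' * ω' i * (C * (K * ω i)) := by
        have := (h' i).1
        gcongr
      _ = C * K * C' * (ω * ω') i := by
        rw [Pi.mul_apply]
        ring
  · rw [Module.End.mul_apply, map_eq_sum S] at hj
    obtain ⟨k, hk, hj⟩ := Finset.mem_biUnion.1 (Finsupp.support_finset_sum hj)
    exact ((h' i).2 k hk).trans ((h k).2 j (Finsupp.support_smul hj))

theorem Ord.add {ω : Idx → ℝ} (hω : Moderate ω) {S T : Module.End ℂ Dom} (hS : Ord ω S)
    (hT : Ord ω T) : Ord ω (S + T) := by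
  classical
  obtain ⟨C, N, hC, hN, h⟩ := hS
  obtain ⟨C', N', hC', hN', h'⟩ := hT
  refine ⟨C + C', N + N', by positivity, by positivity, fun i => ⟨?_, fun j hj => ?_⟩⟩
  · rw [ladd_apply, add_mul]
    exact (l1_add_le _ _).trans (add_le_add (h i).1 (h' i).1)
  · rw [ladd_apply] at hj
    rcases Finset.mem_union.1 (Finsupp.support_add hj) with hj | hj
    · exact ((h i).2 j hj).mono (by linarith)
    · exact ((h' i).2 j hj).mono (by linarith)

theorem Ord.smul {ω : Idx → ℝ} {T : Module.End ℂ Dom} (hT : Ord ω T) (c : ℂ) : Ord ω (c • T) := by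
  obtain ⟨C, N, hC, hN, h⟩ := hT
  refine ⟨‖c‖ * C, N, by positivity, hN, fun i => ⟨?_, fun j hj => ?_⟩⟩
  · rw [lsmul_apply, l1_smul, mul_assoc]
    exact mul_le_mul_of_nonneg_left (h i).1 (norm_nonneg c)
  · exact (h i).2 j (Finsupp.support_smul hj)

theorem Ord.mono {ω ω' : Idx → ℝ} {K : ℝ} (hK : 0 ≤ K) (h : ∀ i, ω i ≤ K * ω' i)
    {T : Module.End ℂ Dom} (hT : Ord ω T) : Ord ω' T := by
  obtain ⟨C, N, hC, hN, hT⟩ := hT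
  refine ⟨C * K, N, by positivity, hN, fun i => ⟨(hT i).1.trans ?_, (hT i).2⟩⟩
  rw [mul_assoc]
  exact mul_le_mul_of_nonneg_left (h i) hC

theorem ord_diagOp {d : Idx → ℂ} {C : ℝ} (hC : 0 ≤ C) {ω : Idx → ℝ} (h : ∀ i, ‖d i‖ ≤ C * ω i) :
    Ord ω (diagOp d) := by
  refine ⟨C, 0, hC, le_rfl, fun i => ⟨?_, fun j hj => ?_⟩⟩
  · rw [diagOp, opOf_single, l1_smul, l1_single, norm_one, mul_one]
    exact h i
  · rw [diagOp, opOf_single] at hj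
    have := Finsupp.support_single_subset (Finsupp.support_smul hj)
    rw [Finset.mem_singleton] at this
    subst this
    simp [Near]

theorem ord_opγ : Ord 1 opγ := by
  refine ord_diagOp zero_le_one fun i => ?_
  rw [Idx.sgn]
  split_ifs <;> simp

theorem ord_one : Ord 1 (1 : Module.End ℂ Dom) := by
  refine ⟨1, 0, zero_le_one, le_rfl, fun i => ⟨by simp, fun j hj => ?_⟩⟩
  have := Finsupp.support_single_subset hj
  rw [Finset.mem_singleton] at this
  subst this
  simp [Near]

/-- The weight `q^l + q^{l+k}`. -/
def wt (q : ℝ) (i : Idx) : ℝ := q ^ i.l + q ^ (i.l + i.k)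

theorem wt_pos (hq : 0 < q) (i : Idx) : 0 < wt q i :=
  add_pos (rpow_pos_of_pos hq _) (rpow_pos_of_pos hq _)

theorem moderate_wt (hq : 0 < q) (hq₁ : q < 1) : Moderate (wt q) := by
  refine ⟨fun i => (wt_pos hq i).le, fun N => ⟨q ^ (-(N : ℝ)), by positivity, fun i j h => ?_⟩⟩
  obtain ⟨h₁, h₂⟩ := h
  have h₀ : 0 ≤ N := (abs_nonneg _).trans h₁
  rw [abs_le] at h₁ h₂
  have h₁' : ((i.1.1.1 : ℝ)) - N ≤ j.1.1.1 := by
    have : i.1.1.1 - N ≤ j.1.1.1 := by linarith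
    exact_mod_cast this
  have h₂' : ((i.1.1.2 : ℝ)) - N ≤ j.1.1.2 := by
    have : i.1.1.2 - N ≤ j.1.1.2 := by linarith
    exact_mod_cast this
  have h₀' : (0 : ℝ) ≤ N := by exact_mod_cast h₀
  rw [wt, wt, mul_add, ← rpow_add hq, ← rpow_add hq]
  refine add_le_add (rpow_le_rpow_of_exponent_ge hq hq₁.le ?_)
    (rpow_le_rpow_of_exponent_ge hq hq₁.le ?_) <;> simp only [Idx.l, Idx.k] <;> linarith

theorem l_pos (i : Idx) : 0 < Idx.l i := by
  have := i.1.2.1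
  have : (0 : ℝ) < i.1.1.1 := by exact_mod_cast this
  rw [Idx.l]
  positivity

theorem abs_k_le (i : Idx) : |Idx.k i| ≤ Idx.l i := by
  have := i.1.2.2.2.2
  have : |(i.1.1.2 : ℝ)| ≤ i.1.1.1 := by exact_mod_cast this
  rw [Idx.k, Idx.l, abs_div, abs_of_pos (show (0 : ℝ) < 2 by norm_num)]
  gcongr

theorem wt_le (hq : 0 < q) (hq₁ : q < 1) (i : Idx) : wt q i ≤ 2 := by
  have h₁ := l_pos i
  have h₂ := abs_le.1 (abs_k_le i)
  have := rpow_le_one hq.le hq₁.le h₁.le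
  have := rpow_le_one hq.le hq₁.le (show 0 ≤ i.l + i.k by linarith)
  rw [wt]
  linarith

theorem Ord.bounded (hq : 0 < q) (hq₁ : q < 1) {T : Module.End ℂ Dom} (h : Ord (wt q) T) :
    Ord 1 T := h.mono zero_le_two fun i => by simpa using wt_le hq hq₁ i

theorem Ord.mul_bounded (hq : 0 < q) (hq₁ : q < 1) {S T : Module.End ℂ Dom} (hS : Ord (wt q) S)
    (hT : Ord 1 T) : Ord (wt q) (S * T) := by
  simpa using hS.mul (moderate_wt hq hq₁) hT

theorem Ord.bounded_mul {ω : Idx → ℝ} {S T : Module.End ℂ Dom} (hS : Ord 1 S)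
    (hT : Ord ω T) : Ord ω (S * T) := by
  simpa using hS.mul moderate_one hT

/-! ### Matrix entries with respect to the orthonormal basis -/

/-- The vector `v^l_k` with `p = l - k` and `r = l + k`. -/
def V (s : Bool) (p r : ℤ) : Dom := vec (p + r) (r - p) s

theorem V_eq_zero {s : Bool} {p r : ℤ} (h : p < 0 ∨ r < 0) : V s p r = 0 := by
  have : ¬(0 < p + r ∧ Odd (p + r) ∧ Odd (r - p) ∧ |r - p| ≤ p + r) := by
    rintro ⟨_, _, _, h'⟩
    rw [abs_le] at h'
    omega
  rw [V, vec, dif_neg this]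

theorem V_eq {s : Bool} {p r : ℤ} (ho : Odd (p + r)) (hp : 0 ≤ p) (hr : 0 ≤ r) :
    V s p r = Finsupp.single (idx ho hp hr s) 1 := by
  rw [V, vec, dif_pos ((inRange_iff ho).2 ⟨hp, hr⟩)]
  rfl

/-- `T` maps `v^l_{k,s}` to a combination of `v^{l+j}_{k-d,s'}`, `j = -1, 0, 1`. -/
def Hop (T : Module.End ℂ Dom) (d : ℤ) (f : Bool → Bool) (lo mid up : Bool → ℤ → ℤ → ℝ) : Prop :=
  ∀ s p r, Odd (p + r) → 0 ≤ p → 0 ≤ r → T (V s p r) =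
    (lo s p r : ℂ) • V (f s) (p + d - 1) (r - d - 1) + (mid s p r : ℂ) • V (f s) (p + d) (r - d) +
      (up s p r : ℂ) • V (f s) (p + d + 1) (r - d + 1)

theorem Hop.sub {S T : Module.End ℂ Dom} {d : ℤ} {f : Bool → Bool}
    {lo mid up lo' mid' up' : Bool → ℤ → ℤ → ℝ} (hS : Hop S d f lo mid up)
    (hT : Hop T d f lo' mid' up') :
    Hop (S - T) d f (lo - lo') (mid - mid') (up - up') := by
  intro s p r ho hp hr
  rw [lsub_apply, hS s p r ho hp hr, hT s p r ho hp hr]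
  simp only [Pi.sub_apply]
  push_cast
  module

theorem Hop.smul {T : Module.End ℂ Dom} {d : ℤ} {f : Bool → Bool}
    {lo mid up : Bool → ℤ → ℤ → ℝ} (hT : Hop T d f lo mid up) (c : ℝ) :
    Hop ((c : ℂ) • T) d f (c • lo) (c • mid) (c • up) := by
  intro s p r ho hp hr
  rw [lsmul_apply, hT s p r ho hp hr]
  simp only [Pi.smul_apply, smul_eq_mul]
  push_cast
  module

theorem wt_idx {p r : ℤ} (ho : Odd (p + r)) (hp : 0 ≤ p) (hr : 0 ≤ r) (s : Bool) :
    wt q (idx ho hp hr s) = q ^ ℓ(p, r) + q ^ (r : ℝ) := by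
  rw [wt, idx_l, idx_k]
  congr 2
  push_cast
  ring

theorem l1_V_le (s : Bool) (p r : ℤ) : l1 (V s p r) ≤ 1 := by
  rw [V, vec]
  split_ifs <;> simp

theorem mem_support_V {s : Bool} {p r : ℤ} {j : Idx} (h : j ∈ (V s p r).support) :
    j.1.1.1 = p + r ∧ j.1.1.2 = r - p := by
  rw [V, vec] at h
  split_ifs at h with h'
  · have := Finsupp.support_single_subset h
    rw [Finset.mem_singleton] at this
    subst this
    exact ⟨rfl, rfl⟩
  · simp at h

theorem Hop.ord {T : Module.End ℂ Dom} {d : ℤ} {f : Bool → Bool}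
    {lo mid up : Bool → ℤ → ℤ → ℝ} (hT : Hop T d f lo mid up) {ω : Idx → ℝ}
    {C₁ C₂ C₃ : ℝ} (hC₁ : 0 ≤ C₁) (hC₂ : 0 ≤ C₂) (hC₃ : 0 ≤ C₃)
    (h₁ : ∀ s p r (ho : Odd (p + r)) (hp : 0 ≤ p) (hr : 0 ≤ r),
      |lo s p r| ≤ C₁ * ω (idx ho hp hr s))
    (h₂ : ∀ s p r (ho : Odd (p + r)) (hp : 0 ≤ p) (hr : 0 ≤ r),
      |mid s p r| ≤ C₂ * ω (idx ho hp hr s))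
    (h₃ : ∀ s p r (ho : Odd (p + r)) (hp : 0 ≤ p) (hr : 0 ≤ r),
      |up s p r| ≤ C₃ * ω (idx ho hp hr s)) : Ord ω T := by
  classical
  refine ⟨C₁ + C₂ + C₃, 2 * |d| + 2, by positivity, by positivity, fun i => ?_⟩
  obtain ⟨p, r, ho, hp, hr, e⟩ := exists_idx i
  have e' : Finsupp.single i 1 = V i.2 p r := by rw [V_eq ho hp hr, ← e]
  have hd := le_abs_self d
  have hd' := neg_abs_le d
  have hi : i.1.1.1 = p + r ∧ i.1.1.2 = r - p := by
    rw [e]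
    exact ⟨rfl, rfl⟩
  rw [e', hT _ p r ho hp hr]
  constructor
  · refine (l1_add_le _ _).trans ?_
    rw [add_mul, add_mul]
    have b : ∀ (c x : ℝ) (v : Dom), l1 v ≤ 1 → |c| ≤ x → l1 ((c : ℂ) • v) ≤ x := by
      intro c x v hv hc
      rw [l1_smul, Complex.norm_real]
      calc ‖c‖ * l1 v ≤ ‖c‖ * 1 := by gcongr
        _ ≤ x := by simpa using hc
    refine add_le_add ((l1_add_le _ _).trans (add_le_add ?_ ?_)) ?_ <;> rw [e]
    · exact b _ _ _ (l1_V_le _ _ _) (h₁ _ p r ho hp hr)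
    · exact b _ _ _ (l1_V_le _ _ _) (h₂ _ p r ho hp hr)
    · exact b _ _ _ (l1_V_le _ _ _) (h₃ _ p r ho hp hr)
  · intro j hj
    have hj' : ∃ s' p' r', j ∈ (V s' p' r').support ∧ |p' + r' - (p + r)| ≤ 2 * |d| + 2 ∧
        |r' - p' - (r - p)| ≤ 2 * |d| + 2 := by
      rcases Finset.mem_union.1 (Finsupp.support_add hj) with hj | hj
      · rcases Finset.mem_union.1 (Finsupp.support_add hj) with hj | hj
        · refine ⟨_, _, _, Finsupp.support_smul hj, ?_, ?_⟩ <;> rw [abs_le] <;> constructor <;>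
            linarith
        · refine ⟨_, _, _, Finsupp.support_smul hj, ?_, ?_⟩ <;> rw [abs_le] <;> constructor <;>
            linarith
      · refine ⟨_, _, _, Finsupp.support_smul hj, ?_, ?_⟩ <;> rw [abs_le] <;> constructor <;>
            linarith
    obtain ⟨s', p', r', hj, h₄, h₅⟩ := hj'
    have := mem_support_V hj
    rw [Near, this.1, this.2, hi.1, hi.2]
    exact ⟨h₄, h₅⟩

theorem opD_V (q : ℝ) (s : Bool) (p r : ℤ) :
    opD q (V s p r) = ((qnum q (ℓ(p, r) + 1 / 2) : ℝ) : ℂ) • V (!s) p r := by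
  rw [V, V, vec, vec]
  split_ifs with h
  · rw [opD, opOf_single]
    rfl
  · simp

theorem Hop.comm_opD {T : Module.End ℂ Dom} {d : ℤ} {lo mid up : Bool → ℤ → ℤ → ℝ}
    (hT : Hop T d id lo mid up) :
    Hop (opD q * T - T * opD q) d (!·)
      (fun s p r => qnum q (ℓ(p, r) - 1 / 2) * lo s p r -
        qnum q (ℓ(p, r) + 1 / 2) * lo (!s) p r)
      (fun s p r => qnum q (ℓ(p, r) + 1 / 2) * (mid s p r - mid (!s) p r))
      (fun s p r => qnum q (ℓ(p, r) + 3 / 2) * up s p r -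
        qnum q (ℓ(p, r) + 1 / 2) * up (!s) p r) := by
  intro s p r ho hp hr
  have e₁ : ((p + d - 1 + (r - d - 1) : ℤ) : ℝ) / 2 + 1 / 2 = ℓ(p, r) - 1 / 2 := by
    push_cast; ring
  have e₂ : ((p + d + (r - d) : ℤ) : ℝ) / 2 + 1 / 2 = ℓ(p, r) + 1 / 2 := by
    push_cast; ring
  have e₃ : ((p + d + 1 + (r - d + 1) : ℤ) : ℝ) / 2 + 1 / 2 = ℓ(p, r) + 3 / 2 := by
    push_cast; ring
  rw [lsub_apply, Module.End.mul_apply, Module.End.mul_apply, opD_V, map_smul,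
    hT s p r ho hp hr, hT _ p r ho hp hr]
  simp only [map_add, map_smul, opD_V, e₁, e₂, e₃, id]
  push_cast
  module

/-- `(√[p][r]) g(l) q^k` with shifted arguments: the entries of `x₀` up to signs. -/
def entX (q : ℝ) (p r : ℤ) : ℝ :=
  q ^ (((r - p : ℤ) : ℝ) / 2) * √(qnum q p) * √(qnum q r) * gCoeff q ℓ(p, r)

theorem hop_opX₀ (hq : 0 < q) (hq₁ : q < 1) :
    Hop (opX₀ q) 0 id (fun s p r => q ^ (sg s / 2) * entX q p r)
      (fun s p r => (bandX q (q ^ sg s)).mid (q ^ p) (q ^ r))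
      (fun s p r => q ^ (sg s / 2) * entX q (p + 1) (r + 1)) := by
  intro s p r ho hp hr
  have e₁ : αMinus q ℓ(p, r) (((r - p : ℤ) : ℝ) / 2) (sg s) =
      q ^ (sg s / 2) * entX q p r := by
    rw [αMinus_eq, entX, rpow_add hq,
      show ℓ(p, r) - ((r - p : ℤ) : ℝ) / 2 = p by push_cast; ring,
      show ℓ(p, r) + ((r - p : ℤ) : ℝ) / 2 = r by push_cast; ring]
    ring
  have e₂ : αMinus q (ℓ(p, r) + 1) (((r - p : ℤ) : ℝ) / 2) (sg s) =
      q ^ (sg s / 2) * entX q (p + 1) (r + 1) := by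
    rw [αMinus_eq, entX, rpow_add hq,
      show ℓ(p, r) + 1 - ((r - p : ℤ) : ℝ) / 2 = (p + 1 : ℤ) by push_cast; ring,
      show ℓ(p, r) + 1 + ((r - p : ℤ) : ℝ) / 2 = (r + 1 : ℤ) by push_cast; ring,
      show r + 1 - (p + 1) = r - p by ring,
      show ((p + 1 + (r + 1) : ℤ) : ℝ) / 2 = ℓ(p, r) + 1 by push_cast; ring]
    ring
  rw [V_eq ho hp hr, opX₀, opOf_single, idx_l, idx_k, idx_sgn, e₁, e₂, αZero_eq hq hq₁ s ho]
  simp only [V, id, add_zero, sub_zero, show p - 1 + (r - 1) = p + r - 2 by ring,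
    show r - 1 - (p - 1) = r - p by ring, show p + 1 + (r + 1) = p + r + 2 by ring,
    show r + 1 - (p + 1) = r - p by ring]
  rfl

theorem Band.Acts.hop (hq : 0 < q) (hq₁ : q < 1) {b : Bool → Band} {T : Module.End ℂ Dom} {d : ℤ}
    (hT : ∀ s, (b s).Acts q s T) (hd : ∀ s, (b s).d = d) {lo mid up : Bool → ℤ → ℤ → ℝ}
    (hlo : ∀ s p r, Odd (p + r) → 0 ≤ p + d - 1 → 0 ≤ r - d - 1 → 0 ≤ p → 0 ≤ r →
      (b s).lo (q ^ p) (q ^ r) * norma q s p r = lo s p r * norma q s (p + d - 1) (r - d - 1))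
    (hmid : ∀ s p r, Odd (p + r) → 0 ≤ p + d → 0 ≤ r - d → 0 ≤ p → 0 ≤ r →
      (b s).mid (q ^ p) (q ^ r) * norma q s p r = mid s p r * norma q s (p + d) (r - d))
    (hup : ∀ s p r, Odd (p + r) → 0 ≤ p + d + 1 → 0 ≤ r - d + 1 → 0 ≤ p → 0 ≤ r →
      (b s).up (q ^ p) (q ^ r) * norma q s p r = up s p r * norma q s (p + d + 1) (r - d + 1)) :
    Hop T d id lo mid up := by
  intro s p r ho hp hr
  have key : ∀ (x y : ℝ) (p' r' : ℤ), (0 ≤ p' → 0 ≤ r' → x * norma q s p r = y * norma q s p' r') →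
      ((norma q s p r : ℝ) : ℂ) • (x : ℂ) • W q s p' r' = (y : ℂ) • V s p' r' := by
    intro x y p' r' h
    by_cases h' : 0 ≤ p' ∧ 0 ≤ r'
    · rw [V, vec_eq hq hq₁, smul_smul, smul_smul, mul_comm, ← Complex.ofReal_mul,
        h h'.1 h'.2, Complex.ofReal_mul]
    · rw [V_eq_zero (by omega), W_eq_zero (by omega), smul_zero, smul_zero, smul_zero]
  rw [V, vec_eq hq hq₁, map_smul, hT s p r ho, hd, smul_add, smul_add,
    key _ (lo s p r) _ _ fun h h' => hlo s p r ho h h' hp hr,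
    key _ (mid s p r) _ _ fun h h' => hmid s p r ho h h' hp hr,
    key _ (up s p r) _ _ fun h h' => hup s p r ho h h' hp hr]
  rfl

theorem norma_add_two_left (hq : 0 < q) {s : Bool} {p r : ℤ} (hp : 0 ≤ p) (hr : 0 ≤ r)
    (ho : Odd (p + r)) : norma q s (p + 2) r = q ^ (sg s / 2) * (q ^ (-(p : ℝ) - 1) *
      √(qnum q (p + 1)) * √(qnum q (p + 2)) * gCoeff q (ℓ(p, r) + 1)) *
        norma q s p r := by
  have hL : 0 < p + r := by
    rcases ho with ⟨m, hm⟩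
    omega
  have e₁ := rootFact_succ (q := q) hp
  have e₂ := rootFact_succ (q := q) (show 0 ≤ p + 1 by omega)
  rw [show p + 1 + 1 = p + 2 by ring,
    show (((p + 1 : ℤ) : ℝ) + 1) = p + 2 by push_cast; ring] at e₂
  have e₃ : ((r : ℝ) ^ 2 - (p + 2 : ℤ) ^ 2 + sg s * ((p + 2 : ℤ) + r)) / 4 =
      sg s / 2 + (-(p : ℝ) - 1) + ((r : ℝ) ^ 2 - p ^ 2 + sg s * (p + r)) / 4 := by
    push_cast; ring
  rw [norma, norma, e₂, e₁, show p + 2 + r = p + r + 2 by ring, gProd_add_two hL ho, e₃,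
    rpow_add hq, rpow_add hq]
  ring

theorem norma_add_two_right (hq : 0 < q) {s : Bool} {p r : ℤ} (hp : 0 ≤ p) (hr : 0 ≤ r)
    (ho : Odd (p + r)) : norma q s p (r + 2) = q ^ (sg s / 2) * (q ^ ((r : ℝ) + 1) *
      √(qnum q (r + 1)) * √(qnum q (r + 2)) * gCoeff q (ℓ(p, r) + 1)) *
        norma q s p r := by
  have hL : 0 < p + r := by
    rcases ho with ⟨m, hm⟩
    omega
  have e₁ := rootFact_succ (q := q) hr
  have e₂ := rootFact_succ (q := q) (show 0 ≤ r + 1 by omega)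
  rw [show r + 1 + 1 = r + 2 by ring,
    show (((r + 1 : ℤ) : ℝ) + 1) = r + 2 by push_cast; ring] at e₂
  have e₃ : (((r + 2 : ℤ) : ℝ) ^ 2 - p ^ 2 + sg s * (p + (r + 2 : ℤ))) / 4 =
      sg s / 2 + ((r : ℝ) + 1) + ((r : ℝ) ^ 2 - p ^ 2 + sg s * (p + r)) / 4 := by
    push_cast; ring
  rw [norma, norma, e₂, e₁, show p + (r + 2) = p + r + 2 by ring, gProd_add_two hL ho, e₃,
    rpow_add hq, rpow_add hq]
  ring

/-- `q^r √([p][p-1]) g(l)`. -/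
def entL (q : ℝ) (p r : ℤ) : ℝ :=
  q ^ (r : ℝ) * √(qnum q (p - 1)) * √(qnum q p) * gCoeff q ℓ(p, r)

/-- `q^{-p} √([r][r-1]) g(l)`. -/
def entU (q : ℝ) (p r : ℤ) : ℝ :=
  q ^ (-(p : ℝ)) * √(qnum q (r - 1)) * √(qnum q r) * gCoeff q ℓ(p, r)

theorem qnum_mul_self (hq : 0 < q) (hq₁ : q < 1) {x : ℝ} (hx : 0 ≤ x) :
    √(qnum q x) * √(qnum q x) = br q (q ^ x) := by
  rw [mul_self_sqrt (qnum_nonneg hq hq₁ hx), qnum_eq_br hq]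

theorem hop_opX₁' (hq : 0 < q) (hq₁ : q < 1) :
    Hop (opX₁' q) (-1) id (fun s p r => q ^ (sg s / 2) * (-q * entL q p r))
      (fun s p r => (1 + q ^ 2) * (1 - q ^ 2) * (q ^ (((r - p : ℤ) : ℝ) / 2) * √(qnum q p) *
        √(qnum q (r + 1))) * bb q (q ^ sg s) (q ^ p * q ^ r))
      (fun s p r => q ^ (sg s / 2) * entU q p (r + 2)) := by
  refine Band.Acts.hop (d := -1) hq hq₁ (acts_E hq hq₁) (fun _ => rfl) ?_ ?_ ?_
  · intro s p r ho h₁ h₂ hp hr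
    obtain ⟨p, rfl⟩ : ∃ p', p = p' + 2 := ⟨p - 2, by ring⟩
    have ho' : Odd (p + r) := by grind
    rw [norma_add_two_left hq (by linarith) hr ho', show p + 2 + -1 - 1 = p by ring,
      show r - -1 - 1 = r by ring]
    simp only [bandE, entL]
    have e₁ : q ^ (p + 2) * q ^ r * q ^ (-(p : ℝ) - 1) = q * q ^ (r : ℝ) := by
      rw [zpow_eq_rpow, zpow_eq_rpow, ← rpow_add hq, ← rpow_add hq]
      nth_rw 2 [← rpow_one q]
      rw [← rpow_add hq]
      congr 1; push_cast; ring
    rw [show (((p + 2 : ℤ) : ℝ) - 1) = p + 1 by push_cast; ring,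
      show (((p + 2 : ℤ) : ℝ)) = p + 2 by push_cast; ring,
      show (((p + 2 + r : ℤ) : ℝ) / 2) = ℓ(p, r) + 1 by push_cast; ring]
    linear_combination (-(q ^ (sg s / 2) * (√(qnum q (p + 1)) * √(qnum q (p + 2)) *
      gCoeff q (ℓ(p, r) + 1)) * norma q s p r)) * e₁
  · intro s p r ho h₁ h₂ hp hr
    have hr' : (0 : ℝ) ≤ r := by exact_mod_cast hr
    have e := norma_cross (s := s) hq hq₁ (show 0 ≤ p - 1 by linarith) hr
    rw [sub_add_cancel, show p - 1 + r + 1 = p + r by ring,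
      show (((p - 1 : ℤ) : ℝ) + 1) = p by push_cast; ring] at e
    have b := qnum_mul_self hq hq₁ (show 0 ≤ (r : ℝ) + 1 by positivity)
    rw [rpow_add hq, rpow_one, mul_comm _ q] at b
    have e₁ : q ^ (((r - p : ℤ) : ℝ) / 2) * q ^ ℓ(p, r) = q ^ (r : ℝ) := by
      rw [← rpow_add hq]
      congr 1; push_cast; ring
    simp only [bandE]
    rw [show p + -1 = p - 1 by ring, show r - -1 = r + 1 by ring, zpow_eq_rpow q r, ← b, ← e₁]
    linear_combination (-((1 + q ^ 2) * (1 - q ^ 2) * q ^ (((r - p : ℤ) : ℝ) / 2) *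
      √(qnum q (r + 1)) * bb q (q ^ sg s) (q ^ p * (q ^ (((r - p : ℤ) : ℝ) / 2) *
        q ^ ℓ(p, r))))) * e
  · intro s p r ho h₁ h₂ hp hr
    have hr' : (0 : ℝ) ≤ r := by exact_mod_cast hr
    have hp' : (0 : ℝ) ≤ p := by exact_mod_cast hp
    rw [show p + -1 + 1 = p by ring, show r - -1 + 1 = r + 2 by ring,
      norma_add_two_right hq hp hr ho]
    simp only [bandE, entU]
    have b₁ := qnum_mul_self hq hq₁ (show 0 ≤ (r : ℝ) + 1 by positivity)
    have b₂ := qnum_mul_self hq hq₁ (show 0 ≤ (r : ℝ) + 2 by positivity)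
    have g := gCoeff_sq hq hq₁ (l := ℓ(p, r) + 1) (by push_cast; linarith)
    have t : q ^ (2 * (ℓ(p, r) + 1)) = q ^ 2 * (q ^ p * q ^ r) := by
      rw [zpow_eq_rpow, zpow_eq_rpow, ← rpow_natCast, ← rpow_add hq, ← rpow_add hq]
      congr 1; push_cast; ring
    have t₁ : q ^ ((r : ℝ) + 1) = q * q ^ r := by
      rw [rpow_add hq, rpow_one, zpow_eq_rpow, mul_comm]
    have t₂ : q ^ ((r : ℝ) + 2) = q ^ 2 * q ^ r := by
      rw [rpow_add hq, zpow_eq_rpow, mul_comm]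
      norm_cast
    have t₃ : q ^ sg s = q ^ (sg s / 2) * q ^ (sg s / 2) := by
      rw [← rpow_add hq]
      congr 1; ring
    have t₄ : q ^ (-(p : ℝ)) = (q ^ p)⁻¹ := by rw [rpow_neg hq.le, zpow_eq_rpow]
    have hu : 0 < q ^ p := by positivity
    rw [show (((r + 2 : ℤ) : ℝ) - 1) = r + 1 by push_cast; ring,
      show (((r + 2 : ℤ) : ℝ)) = r + 2 by push_cast; ring,
      show (((p + (r + 2) : ℤ) : ℝ) / 2) = ℓ(p, r) + 1 by push_cast; ring,
      ← t, ← g, ← t₁, ← t₂, ← b₁, ← b₂, t₃, t₁, t₄]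
    field_simp

theorem hop_opXm₁' (hq : 0 < q) (hq₁ : q < 1) :
    Hop (opXm₁' q) 1 id (fun s p r => q ^ (sg s / 2) * (-q⁻¹ * entU q p r))
      (fun s p r => (1 + q ^ 2) * (1 - q⁻¹ ^ 2) * (q ^ (((r - p : ℤ) : ℝ) / 2) * √(qnum q r) *
        √(qnum q (p + 1))) * bb q (q ^ sg s) (q ^ p * q ^ r))
      (fun s p r => q ^ (sg s / 2) * entL q (p + 2) r) := by
  refine Band.Acts.hop (d := 1) hq hq₁ (acts_F hq hq₁) (fun _ => rfl) ?_ ?_ ?_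
  · intro s p r ho h₁ h₂ hp hr
    obtain ⟨r, rfl⟩ : ∃ r', r = r' + 2 := ⟨r - 2, by ring⟩
    have ho' : Odd (p + r) := by grind
    rw [norma_add_two_right hq hp (by linarith) ho', show r + 2 - 1 - 1 = r by ring,
      show p + 1 - 1 = p by ring]
    simp only [bandF, entU]
    have e₁ : (q ^ p * q ^ (r + 2))⁻¹ * q ^ ((r : ℝ) + 1) = q⁻¹ * q ^ (-(p : ℝ)) := by
      rw [zpow_eq_rpow, zpow_eq_rpow, ← rpow_add hq, ← rpow_neg hq.le,
        ← rpow_add hq, ← rpow_neg_one, ← rpow_add hq]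
      congr 1; push_cast; ring
    rw [show (((r + 2 : ℤ) : ℝ) - 1) = r + 1 by push_cast; ring,
      show (((r + 2 : ℤ) : ℝ)) = r + 2 by push_cast; ring,
      show (((p + (r + 2) : ℤ) : ℝ) / 2) = ℓ(p, r) + 1 by push_cast; ring]
    linear_combination (-(q ^ (sg s / 2) * (√(qnum q (r + 1)) * √(qnum q (r + 2)) *
      gCoeff q (ℓ(p, r) + 1)) * norma q s p r)) * e₁
  · intro s p r ho h₁ h₂ hp hr
    have hp' : (0 : ℝ) ≤ p := by exact_mod_cast hp
    have e := norma_cross (s := s) hq hq₁ hp (show 0 ≤ r - 1 by linarith)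
    rw [sub_add_cancel, show p + (r - 1) + 1 = p + r by ring,
      show (((r - 1 : ℤ) : ℝ) + 1) = r by push_cast; ring] at e
    have b := qnum_mul_self hq hq₁ (show 0 ≤ (p : ℝ) + 1 by positivity)
    rw [rpow_add hq, rpow_one, mul_comm _ q] at b
    have e₁ : (q ^ p)⁻¹ * q ^ ℓ(p, r) = q ^ (((r - p : ℤ) : ℝ) / 2) := by
      rw [zpow_eq_rpow, ← rpow_neg hq.le, ← rpow_add hq]
      congr 1; push_cast; ring
    simp only [bandF]
    rw [zpow_eq_rpow q p, ← b, ← zpow_eq_rpow q p, ← e₁]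
    linear_combination ((1 + q ^ 2) * (1 - q⁻¹ ^ 2) * (q ^ p)⁻¹ * √(qnum q (p + 1)) *
      bb q (q ^ sg s) (q ^ p * q ^ r)) * e
  · intro s p r ho h₁ h₂ hp hr
    have hr' : (0 : ℝ) ≤ r := by exact_mod_cast hr
    have hp' : (0 : ℝ) ≤ p := by exact_mod_cast hp
    rw [show p + 1 + 1 = p + 2 by ring, show r - 1 + 1 = r by ring,
      norma_add_two_left hq hp hr ho]
    simp only [bandF, entL]
    have b₁ := qnum_mul_self hq hq₁ (show 0 ≤ (p : ℝ) + 1 by positivity)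
    have b₂ := qnum_mul_self hq hq₁ (show 0 ≤ (p : ℝ) + 2 by positivity)
    have g := gCoeff_sq hq hq₁ (l := ℓ(p, r) + 1) (by push_cast; linarith)
    have t : q ^ (2 * (ℓ(p, r) + 1)) = q ^ 2 * (q ^ p * q ^ r) := by
      rw [zpow_eq_rpow, zpow_eq_rpow, ← rpow_natCast, ← rpow_add hq, ← rpow_add hq]
      congr 1; push_cast; ring
    have t₁ : q ^ ((p : ℝ) + 1) = q * q ^ p := by
      rw [rpow_add hq, rpow_one, zpow_eq_rpow, mul_comm]
    have t₂ : q ^ ((p : ℝ) + 2) = q ^ 2 * q ^ p := by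
      rw [rpow_add hq, zpow_eq_rpow, mul_comm]
      norm_cast
    have t₃ : q ^ sg s = q ^ (sg s / 2) * q ^ (sg s / 2) := by
      rw [← rpow_add hq]
      congr 1; ring
    have t₄ : q ^ (-(p : ℝ) - 1) = q⁻¹ * (q ^ p)⁻¹ := by
      rw [Real.rpow_sub hq, rpow_neg hq.le, zpow_eq_rpow, rpow_one]
      field_simp
    have hu : 0 < q ^ p := by positivity
    rw [show (((p + 2 : ℤ) : ℝ) - 1) = p + 1 by push_cast; ring,
      show (((p + 2 : ℤ) : ℝ)) = p + 2 by push_cast; ring,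
      show (((p + 2 + r : ℤ) : ℝ) / 2) = ℓ(p, r) + 1 by push_cast; ring,
      ← t, ← g, ← t₁, ← t₂, ← b₁, ← b₂, t₃, t₄, zpow_eq_rpow q r]
    field_simp

/-! ### Estimates of the matrix entries -/

theorem inv_sub_pos (hq : 0 < q) (hq₁ : q < 1) : 0 < q⁻¹ - q := by
  have := (one_lt_inv₀ hq).2 hq₁
  linarith

theorem qnum_le (hq : 0 < q) (hq₁ : q < 1) (x : ℝ) : qnum q x ≤ (q⁻¹ - q)⁻¹ * q ^ (-x) := by
  have h := inv_sub_pos hq hq₁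
  have e : qnum q x = (q⁻¹ - q)⁻¹ * (q ^ (-x) - q ^ x) := by
    rw [qnum, ← neg_sub q⁻¹ q, ← neg_sub (q ^ (-x)) (q ^ x), neg_div_neg_eq, div_eq_inv_mul]
  have := rpow_pos_of_pos hq x
  rw [e]
  gcongr
  linarith

theorem sqrt_qnum_le (hq : 0 < q) (hq₁ : q < 1) (x : ℝ) :
    √(qnum q x) ≤ √((q⁻¹ - q)⁻¹) * q ^ (-x / 2) := by
  have h := inv_sub_pos hq hq₁
  calc √(qnum q x) ≤ √((q⁻¹ - q)⁻¹ * q ^ (-x)) := Real.sqrt_le_sqrt (qnum_le hq hq₁ x)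
    _ = _ := by
      rw [Real.sqrt_mul (by positivity), Real.sqrt_eq_rpow (q ^ (-x)), ← rpow_mul hq.le]
      congr 2; ring

theorem gCoeff_nonneg (hq : 0 < q) (hq₁ : q < 1) {l : ℝ} (hl : 1 / 2 ≤ l) : 0 ≤ gCoeff q l := by
  rcases hl.eq_or_lt with rfl | hl
  · simp [gCoeff, qnum]
  · exact (gCoeff_pos hq hq₁ hl).le

theorem gCoeff_le (hq : 0 < q) (hq₁ : q < 1) {l : ℝ} (hl : 1 / 2 ≤ l) :
    gCoeff q l ≤ (q ^ 2 + 1) / q ^ 2 * q ^ (3 * l) := by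
  rcases hl.eq_or_lt with rfl | hl
  · simp [gCoeff, qnum]
    positivity
  · refine (pow_le_pow_iff_left₀ (gCoeff_nonneg hq hq₁ hl.le) (by positivity) two_ne_zero).1 ?_
    have ht : 0 < q ^ (2 * l) := rpow_pos_of_pos hq _
    have ht₁ : q ^ (2 * l) ≤ q := by
      nth_rw 2 [← rpow_one q]
      exact rpow_le_rpow_of_exponent_ge hq hq₁.le (by linarith)
    have e : (q ^ (3 * l)) ^ 2 = (q ^ (2 * l)) ^ 3 := by
      rw [← rpow_natCast, ← rpow_mul hq.le, ← rpow_natCast, ← rpow_mul hq.le]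
      congr 1; push_cast; ring
    have hq₂ : q ^ 2 < 1 := pow_lt_one₀ hq.le hq₁ two_ne_zero
    rw [gCoeff_sq hq hq₁ hl, mul_pow, e]
    generalize q ^ (2 * l) = t at *
    rw [gSq_eq hq ht (by linarith), div_pow, div_mul_eq_mul_div]
    have h₁ : t ^ 2 ≤ q ^ 2 := by gcongr
    have h₂ : (q ^ 2 - 1) ^ 2 ≤ (t ^ 2 - 1) ^ 2 := by nlinarith
    have h₃ : q ≤ (t + q) * (q * t + 1) := by nlinarith [mul_pos hq ht, mul_pos ht ht]
    have h₄ : 0 < (q ^ 2 - 1) ^ 2 := by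
      have : q ^ 2 - 1 ≠ 0 := by linarith
      positivity
    calc (q ^ 2 + 1) ^ 2 * (q ^ 2 - 1) ^ 2 * t ^ 3 /
          (q ^ 3 * (t ^ 2 - 1) ^ 2 * ((t + q) * (q * t + 1)))
      _ ≤ (q ^ 2 + 1) ^ 2 * (q ^ 2 - 1) ^ 2 * t ^ 3 / (q ^ 3 * (q ^ 2 - 1) ^ 2 * q) := by
        gcongr
      _ = (q ^ 2 + 1) ^ 2 * t ^ 3 / (q ^ 2) ^ 2 := by
        have h₅ : q ^ 2 - 1 ≠ 0 := by linarith
        field_simp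

/-- The constant in the bounds for the entries. -/
def entC (q : ℝ) : ℝ := √((q⁻¹ - q)⁻¹) * √((q⁻¹ - q)⁻¹) * ((q ^ 2 + 1) / q ^ 2)

theorem entC_nonneg (q : ℝ) : 0 ≤ entC q := by
  rw [entC]
  positivity

theorem half_le {p r : ℤ} (ho : Odd (p + r)) (hp : 0 ≤ p) (hr : 0 ≤ r) :
    1 / 2 ≤ ℓ(p, r) := by
  have : 1 ≤ p + r := by
    obtain ⟨m, hm⟩ := ho
    omega
  have : (1 : ℝ) ≤ ((p + r : ℤ) : ℝ) := by exact_mod_cast this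
  linarith

theorem abs_ent_le (hq : 0 < q) (hq₁ : q < 1) {l : ℝ} (hl : 1 / 2 ≤ l) (a x y b : ℝ)
    (h : b ≤ a - x / 2 - y / 2 + 3 * l) :
    |q ^ a * √(qnum q x) * √(qnum q y) * gCoeff q l| ≤ entC q * q ^ b := by
  have hg := gCoeff_nonneg hq hq₁ hl
  have hp : ∀ x : ℝ, 0 < q ^ x := rpow_pos_of_pos hq
  have := hp a
  rw [abs_of_nonneg (by positivity)]
  calc q ^ a * √(qnum q x) * √(qnum q y) * gCoeff q l
    _ ≤ q ^ a * (√((q⁻¹ - q)⁻¹) * q ^ (-x / 2)) * (√((q⁻¹ - q)⁻¹) * q ^ (-y / 2)) *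
        ((q ^ 2 + 1) / q ^ 2 * q ^ (3 * l)) := by
      have := hp (-x / 2)
      have := hp (-y / 2)
      gcongr
      · exact sqrt_qnum_le hq hq₁ x
      · exact sqrt_qnum_le hq hq₁ y
      · exact gCoeff_le hq hq₁ hl
    _ = entC q * (q ^ a * q ^ (-x / 2) * q ^ (-y / 2) * q ^ (3 * l)) := by
      rw [entC]; ring
    _ = entC q * q ^ (a - x / 2 - y / 2 + 3 * l) := by
      rw [← rpow_add hq, ← rpow_add hq, ← rpow_add hq]
      congr 2; ring
    _ ≤ entC q * q ^ b := mul_le_mul_of_nonneg_left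
      (rpow_le_rpow_of_exponent_ge hq hq₁.le h) (entC_nonneg q)

theorem abs_entX_le (hq : 0 < q) (hq₁ : q < 1) {p r : ℤ} (ho : Odd (p + r)) (hp : 0 ≤ p)
    (hr : 0 ≤ r) : |entX q p r| ≤ entC q * q ^ (ℓ(p, r) + r) := by
  refine abs_ent_le hq hq₁ (half_le ho hp hr) _ _ _ _ ?_
  push_cast
  linarith

theorem abs_entL_le (hq : 0 < q) (hq₁ : q < 1) {p r : ℤ} (ho : Odd (p + r)) (hp : 0 ≤ p)
    (hr : 0 ≤ r) : |entL q p r| ≤ entC q * q ^ (ℓ(p, r) + r) := by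
  refine abs_ent_le hq hq₁ (half_le ho hp hr) _ _ _ _ ?_
  have : (0 : ℝ) ≤ r := by exact_mod_cast hr
  push_cast
  linarith

theorem abs_entU_le (hq : 0 < q) (hq₁ : q < 1) {p r : ℤ} (ho : Odd (p + r)) (hp : 0 ≤ p)
    (hr : 0 ≤ r) : |entU q p r| ≤ entC q * q ^ ℓ(p, r) := by
  refine abs_ent_le hq hq₁ (half_le ho hp hr) _ _ _ _ ?_
  push_cast
  linarith

/-- The constant in the bounds for `bb`. -/
def bbC (q : ℝ) : ℝ := (5 + (q ^ 2)⁻¹) / (1 - q ^ 2) ^ 2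

theorem bbC_nonneg (q : ℝ) : 0 ≤ bbC q := by
  rw [bbC]
  positivity

theorem bb_den (hq : 0 < q) (hq₁ : q < 1) {t : ℝ} (ht : 0 < t) (htq : t ≤ q) :
    (1 - q ^ 2) ^ 2 ≤ (t ^ 2 - 1) * ((q ^ 2 * t) ^ 2 - 1) ∧ 0 < (1 - q ^ 2) ^ 2 := by
  have hq₂ : q ^ 2 < 1 := pow_lt_one₀ hq.le hq₁ two_ne_zero
  have h₁ : t ^ 2 ≤ q ^ 2 := by gcongr
  have h₂ : (q ^ 2 * t) ^ 2 ≤ q ^ 2 := by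
    have : q ^ 2 * t ≤ 1 * q := by gcongr
    rw [one_mul] at this
    gcongr
  have h₃ : 0 < 1 - q ^ 2 := by linarith
  have h₄ : 0 ≤ 1 - t ^ 2 := by linarith
  refine ⟨?_, by positivity⟩
  calc (1 - q ^ 2) ^ 2 = (1 - q ^ 2) * (1 - q ^ 2) := pow_two _
    _ ≤ (1 - t ^ 2) * (1 - (q ^ 2 * t) ^ 2) := by gcongr
    _ = _ := by ring

theorem sq_rpow_sg (hq : 0 < q) (hq₁ : q < 1) (s : Bool) :
    0 ≤ (q ^ sg s) ^ 2 ∧ (q ^ sg s) ^ 2 ≤ (q ^ 2)⁻¹ := by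
  refine ⟨by positivity, ?_⟩
  have h : (1 : ℝ) ≤ (q ^ 2)⁻¹ := (one_le_inv₀ (by positivity)).2 (pow_le_one₀ hq.le hq₁.le)
  have h' : q ^ 2 ≤ 1 := pow_le_one₀ hq.le hq₁.le
  rcases rpow_sg q s with e | e <;> rw [e]
  · linarith
  · rw [inv_pow]

theorem abs_bb_le (hq : 0 < q) (hq₁ : q < 1) (s : Bool) {t : ℝ} (ht : 0 < t) (htq : t ≤ q) :
    |bb q (q ^ sg s) t| ≤ bbC q * t := by
  obtain ⟨h₁, h₂⟩ := bb_den hq hq₁ ht htq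
  obtain ⟨v₁, v₂⟩ := sq_rpow_sg hq hq₁ s
  have hq₂ : q ^ 2 < 1 := pow_lt_one₀ hq.le hq₁ two_ne_zero
  have hqt : q * t ≤ 1 := by nlinarith
  have hqt' : 0 < q * t := mul_pos hq ht
  rw [bb_eq hq ht (by linarith), bbC, abs_div, abs_of_pos (h₂.trans_le h₁), abs_mul,
    abs_of_pos ht, div_mul_eq_mul_div]
  gcongr
  have : (q * t) ^ 2 ≤ 1 := pow_le_one₀ hqt'.le hqt
  have h₃ : (1 + (q ^ sg s) ^ 2) * (q * t) ≤ (1 + (q ^ 2)⁻¹) * 1 := by gcongr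
  have h₄ : 0 ≤ (1 + (q ^ sg s) ^ 2) * (q * t) := by positivity
  rw [abs_le]
  constructor <;> linarith [sq_nonneg (q * t)]

theorem abs_bb_sub_le (hq : 0 < q) (hq₁ : q < 1) (s : Bool) {t : ℝ} (ht : 0 < t) (htq : t ≤ q) :
    |bb q (q ^ sg s) t - bb q (q ^ sg (!s)) t| ≤ bbC q * t ^ 2 := by
  obtain ⟨h₁, h₂⟩ := bb_den hq hq₁ ht htq
  obtain ⟨v₁, v₂⟩ := sq_rpow_sg hq hq₁ s
  obtain ⟨v₃, v₄⟩ := sq_rpow_sg hq hq₁ (!s)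
  have hq₂ : q ^ 2 < 1 := pow_lt_one₀ hq.le hq₁ two_ne_zero
  rw [bb_eq hq ht (by linarith), bb_eq hq ht (by linarith), ← sub_div, bbC, abs_div,
    abs_of_pos (h₂.trans_le h₁), div_mul_eq_mul_div]
  have e : ((1 + (q ^ sg s) ^ 2) * (q * t) - (q * t) ^ 2 - 1) * t -
      ((1 + (q ^ sg (!s)) ^ 2) * (q * t) - (q * t) ^ 2 - 1) * t =
      ((q ^ sg s) ^ 2 - (q ^ sg (!s)) ^ 2) * q * t ^ 2 := by ring
  rw [e, abs_mul, abs_mul, abs_of_pos hq, abs_of_pos (show 0 < t ^ 2 by positivity)]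
  gcongr
  have : |(q ^ sg s) ^ 2 - (q ^ sg (!s)) ^ 2| ≤ (q ^ 2)⁻¹ := by
    rw [abs_le]; constructor <;> linarith
  calc |(q ^ sg s) ^ 2 - (q ^ sg (!s)) ^ 2| * q ≤ (q ^ 2)⁻¹ * 1 := by gcongr
    _ ≤ 5 + (q ^ 2)⁻¹ := by linarith

theorem abs_bb_add_le (hq : 0 < q) (hq₁ : q < 1) (s : Bool) {t : ℝ} (ht : 0 < t) (htq : t ≤ q) :
    |1 + t⁻¹ * bb q (q ^ sg s) t| ≤ bbC q * t := by
  obtain ⟨h₁, h₂⟩ := bb_den hq hq₁ ht htq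
  obtain ⟨v₁, v₂⟩ := sq_rpow_sg hq hq₁ s
  have hq₂ : q ^ 2 < 1 := pow_lt_one₀ hq.le hq₁ two_ne_zero
  have hD := h₂.trans_le h₁
  have hD' := hD.ne'
  rw [bb_eq hq ht (by linarith)]
  generalize q ^ sg s = v at *
  have e : 1 + t⁻¹ * (((1 + v ^ 2) * (q * t) - (q * t) ^ 2 - 1) * t /
      ((t ^ 2 - 1) * ((q ^ 2 * t) ^ 2 - 1))) =
      (t * ((1 + v ^ 2) * q - q ^ 2 * t - t - q ^ 4 * t + q ^ 4 * t ^ 3)) /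
        ((t ^ 2 - 1) * ((q ^ 2 * t) ^ 2 - 1)) := by
    rw [eq_div_iff hD', add_mul, one_mul]
    generalize hd : (t ^ 2 - 1) * ((q ^ 2 * t) ^ 2 - 1) = d at *
    have : t⁻¹ * (((1 + v ^ 2) * (q * t) - (q * t) ^ 2 - 1) * t / d) * d =
      (1 + v ^ 2) * (q * t) - (q * t) ^ 2 - 1 := by field_simp
    rw [this, ← hd]
    ring
  rw [e, bbC, abs_div, abs_of_pos hD, abs_mul, abs_of_pos ht, div_mul_eq_mul_div, mul_comm]
  gcongr
  have ht₁ : t ≤ 1 := htq.trans hq₁.le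
  have hq₄ : q ^ 4 ≤ 1 := pow_le_one₀ hq.le hq₁.le
  have a₁ : (1 + v ^ 2) * q ≤ (1 + (q ^ 2)⁻¹) * 1 := by gcongr
  have a₂ : q ^ 2 * t ≤ 1 * 1 := by gcongr
  have a₃ : q ^ 4 * t ≤ 1 * 1 := by gcongr
  have a₄ : q ^ 4 * t ^ 3 ≤ 1 * 1 := by
    have : t ^ 3 ≤ 1 := pow_le_one₀ ht.le ht₁
    gcongr
  have b₁ : 0 ≤ (1 + v ^ 2) * q := by positivity
  have b₂ : 0 ≤ q ^ 2 * t := by positivity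
  have b₃ : 0 ≤ q ^ 4 * t := by positivity
  have b₄ : 0 ≤ q ^ 4 * t ^ 3 := by positivity
  have b₅ : 0 ≤ (q ^ 2)⁻¹ := by positivity
  rw [abs_le]
  constructor <;> linarith

/-! ### The generators and their commutators with `D` up to lower order -/

/-- The operator with given matrix entries. -/
def hopOp (d : ℤ) (f : Bool → Bool) (lo mid up : Bool → ℤ → ℤ → ℝ) : Module.End ℂ Dom :=
  opOf fun i =>
    let p := (i.1.1.1 - i.1.1.2) / 2
    let r := (i.1.1.1 + i.1.1.2) / 2
    (lo i.2 p r : ℂ) • V (f i.2) (p + d - 1) (r - d - 1) +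
      (mid i.2 p r : ℂ) • V (f i.2) (p + d) (r - d) +
        (up i.2 p r : ℂ) • V (f i.2) (p + d + 1) (r - d + 1)

theorem hop_hopOp (d : ℤ) (f : Bool → Bool) (lo mid up : Bool → ℤ → ℤ → ℝ) :
    Hop (hopOp d f lo mid up) d f lo mid up := by
  intro s p r ho hp hr
  have e₁ : (p + r - (r - p)) / 2 = p := by omega
  have e₂ : (p + r + (r - p)) / 2 = r := by omega
  rw [V_eq ho hp hr, hopOp, opOf_single]
  simp only [idx, e₁, e₂]

theorem hop_one : Hop 1 0 id 0 1 0 := by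
  intro s p r ho hp hr
  simp

theorem rpow_sg_half (hq : 0 < q) (s : Bool) :
    q ^ (sg s / 2) = if s then q ^ (1 / 2 : ℝ) else (q ^ (1 / 2 : ℝ))⁻¹ := by
  cases s
  · simp [sg, ← rpow_neg hq.le, neg_div]
  · simp [sg]

theorem rpow_sg_mul (hq : 0 < q) (s : Bool) (l : ℝ) :
    q ^ (sg s * l) = if s then q ^ l else (q ^ l)⁻¹ := by
  cases s
  · simp [sg, rpow_neg hq.le]
  · simp [sg]

theorem half_mul_half (hq : 0 < q) : q ^ (1 / 2 : ℝ) * q ^ (1 / 2 : ℝ) = q := by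
  rw [← rpow_add hq]; norm_num

theorem qnum_comm_lo (hq : 0 < q) (hq₁ : q < 1) (s : Bool) (l h : ℝ) :
    qnum q (l - 1 / 2) * (q ^ (sg s / 2) * h) - qnum q (l + 1 / 2) * (q ^ (sg (!s) / 2) * h) =
      -q ^ (sg (!s) * l) * h := by
  have hq' := half_mul_half hq
  have hp := rpow_pos_of_pos hq l
  have hr := rpow_pos_of_pos hq (1 / 2 : ℝ)
  have hd := inv_sub_pos hq hq₁
  rw [qnum, qnum, rpow_sg_half hq, rpow_sg_half hq, rpow_sg_mul hq, rpow_neg hq.le,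
    rpow_neg hq.le, Real.rpow_sub hq, rpow_add hq]
  generalize q ^ l = x at *
  generalize q ^ (1 / 2 : ℝ) = y at *
  have hd' : y ^ 4 - 1 ≠ 0 := by
    have := pow_lt_one₀ hq.le hq₁ two_ne_zero
    rw [show y ^ 4 = (y * y) ^ 2 by ring, hq']
    intro h
    linarith
  subst hq'
  have hd₂ : y * y - (y * y)⁻¹ ≠ 0 := by
    intro h; linarith
  cases s <;> simp only [Bool.false_eq_true, if_false, if_true, Bool.not_true, Bool.not_false]
  · field_simp
    ring
  · field_simp
    ring

theorem qnum_comm_up (hq : 0 < q) (hq₁ : q < 1) (s : Bool) (l h : ℝ) :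
    qnum q (l + 3 / 2) * (q ^ (sg s / 2) * h) - qnum q (l + 1 / 2) * (q ^ (sg (!s) / 2) * h) =
      q ^ (sg s * (l + 1)) * h := by
  have e := qnum_comm_lo hq hq₁ (!s) (l + 1) h
  rw [Bool.not_not, show l + 1 - 1 / 2 = l + 1 / 2 by ring,
    show l + 1 + 1 / 2 = l + 3 / 2 by ring] at e
  linear_combination -e

theorem rpow_sg_mul_le (hq : 0 < q) (hq₁ : q < 1) (s : Bool) {l : ℝ} (hl : 0 ≤ l) :
    q ^ (sg s * l) ≤ q ^ (-l) := by
  refine rpow_le_rpow_of_exponent_ge hq hq₁.le ?_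
  cases s <;> simp [sg] <;> linarith

theorem rpow_sg_half_le (hq : 0 < q) (hq₁ : q < 1) (s : Bool) : q ^ (sg s / 2) ≤ q⁻¹ := by
  rw [← rpow_neg_one]
  refine rpow_le_rpow_of_exponent_ge hq hq₁.le ?_
  cases s <;> simp [sg] <;> norm_num

theorem zpow_mul_zpow (hq : 0 < q) (p r : ℤ) :
    q ^ p * q ^ r = q ^ (2 * ℓ(p, r)) := by
  rw [mul_div_cancel₀ _ two_ne_zero, rpow_intCast, zpow_add₀ hq.ne']

theorem zpow_mul_zpow_le (hq : 0 < q) (hq₁ : q < 1) {p r : ℤ} (ho : Odd (p + r)) (hp : 0 ≤ p)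
    (hr : 0 ≤ r) : q ^ p * q ^ r ≤ q := by
  have := half_le ho hp hr
  rw [zpow_mul_zpow hq]
  nth_rw 2 [← rpow_one q]
  exact rpow_le_rpow_of_exponent_ge hq hq₁.le (by linarith)

theorem sqrt_mul_sqrt_le (hq : 0 < q) (hq₁ : q < 1) (a x y b : ℝ) (h : b = a - x / 2 - y / 2) :
    q ^ a * √(qnum q x) * √(qnum q y) ≤ (q⁻¹ - q)⁻¹ * q ^ b := by
  have hd := inv_sub_pos hq hq₁
  have hp : ∀ x : ℝ, 0 < q ^ x := rpow_pos_of_pos hq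
  have := hp a
  have := hp (-x / 2)
  have := hp (-y / 2)
  calc q ^ a * √(qnum q x) * √(qnum q y)
    _ ≤ q ^ a * (√((q⁻¹ - q)⁻¹) * q ^ (-x / 2)) * (√((q⁻¹ - q)⁻¹) * q ^ (-y / 2)) := by
      gcongr
      · exact sqrt_qnum_le hq hq₁ x
      · exact sqrt_qnum_le hq hq₁ y
    _ = √((q⁻¹ - q)⁻¹) * √((q⁻¹ - q)⁻¹) * (q ^ a * q ^ (-x / 2) * q ^ (-y / 2)) := by ring
    _ = (q⁻¹ - q)⁻¹ * q ^ b := by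
      rw [mul_self_sqrt (by positivity), ← rpow_add hq, ← rpow_add hq, h]
      congr 2; ring

theorem abs_one_sub_mid_le (hq : 0 < q) (hq₁ : q < 1) (s : Bool) {p r : ℤ} (ho : Odd (p + r))
    (hp : 0 ≤ p) (hr : 0 ≤ r) : |1 - (bandX q (q ^ sg s)).mid (q ^ p) (q ^ r)| ≤
      2 * bbC q * wt q (idx ho hp hr s) := by
  have ht₁ := zpow_mul_zpow_le hq hq₁ ho hp hr
  have hu : 0 < q ^ p := by positivity
  have hw : 0 < q ^ r := by positivity
  have hw₁ : q ^ r ≤ 1 := by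
    rw [zpow_eq_rpow]
    exact rpow_le_one hq.le hq₁.le (by exact_mod_cast hr)
  have h₁ := abs_bb_le hq hq₁ s (mul_pos hu hw) ht₁
  have h₂ := abs_bb_add_le hq hq₁ s (mul_pos hu hw) ht₁
  have hx : q ^ p * q ^ r ≤ q ^ ℓ(p, r) := by
    rw [zpow_mul_zpow hq]
    have := half_le ho hp hr
    exact rpow_le_rpow_of_exponent_ge hq hq₁.le (by linarith)
  have hb := bbC_nonneg q
  have hq₂ : q ^ 2 ≤ 1 := pow_le_one₀ hq.le hq₁.le
  rw [wt_idx, ← zpow_eq_rpow]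
  simp only [bandX]
  generalize q ^ ℓ(p, r) = x at *
  generalize q ^ sg s = v at *
  generalize q ^ p = u at *
  generalize q ^ r = w at *
  have e : 1 - ((q ^ 2 + 1) * (w / u) - q ^ 2 * (u * w) - (u * w)⁻¹) * bb q v (u * w) =
      (1 + (u * w)⁻¹ * bb q v (u * w)) + q ^ 2 * (u * w) * bb q v (u * w) -
        (q ^ 2 + 1) * (w / u) * bb q v (u * w) := by ring
  have ht : 0 < u * w := mul_pos hu hw
  have ht₂ : u * w ≤ 1 := ht₁.trans hq₁.le
  have a₁ : |q ^ 2 * (u * w) * bb q v (u * w)| ≤ bbC q * (u * w) := by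
    rw [abs_mul, abs_of_pos (by positivity)]
    calc q ^ 2 * (u * w) * |bb q v (u * w)| ≤ 1 * 1 * (bbC q * (u * w)) := by gcongr
      _ = _ := by ring
  have a₂ : |(q ^ 2 + 1) * (w / u) * bb q v (u * w)| ≤ 2 * bbC q * w := by
    rw [abs_mul, abs_of_pos (by positivity)]
    calc (q ^ 2 + 1) * (w / u) * |bb q v (u * w)| ≤ (1 + 1) * (w / u) * (bbC q * (u * w)) := by
          gcongr
      _ = 2 * bbC q * w * w := by field_simp; ring
      _ ≤ 2 * bbC q * w * 1 := by gcongr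
      _ = _ := by ring
  rw [e]
  refine (abs_sub _ _).trans ((add_le_add ((abs_add_le _ _).trans (add_le_add h₂ a₁)) a₂).trans ?_)
  have : bbC q * (u * w) ≤ bbC q * x := by gcongr
  linarith

theorem abs_mid_sub_le (hq : 0 < q) (hq₁ : q < 1) (s : Bool) {p r : ℤ} (ho : Odd (p + r))
    (hp : 0 ≤ p) (hr : 0 ≤ r) : |(bandX q (q ^ sg s)).mid (q ^ p) (q ^ r) -
      (bandX q (q ^ sg (!s))).mid (q ^ p) (q ^ r)| ≤
        4 * bbC q * q ^ (2 * ℓ(p, r)) := by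
  have ht₁ := zpow_mul_zpow_le hq hq₁ ho hp hr
  have hu : 0 < q ^ p := by positivity
  have hw : 0 < q ^ r := by positivity
  have hw₁ : q ^ r ≤ 1 := by
    rw [zpow_eq_rpow]
    exact rpow_le_one hq.le hq₁.le (by exact_mod_cast hr)
  have h₁ := abs_bb_sub_le hq hq₁ s (mul_pos hu hw) ht₁
  have hb := bbC_nonneg q
  have hq₂ : q ^ 2 ≤ 1 := pow_le_one₀ hq.le hq₁.le
  rw [← zpow_mul_zpow hq]
  simp only [bandX]
  generalize q ^ sg s = v at *
  generalize q ^ sg (!s) = v' at *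
  generalize q ^ p = u at *
  generalize q ^ r = w at *
  have ht : 0 < u * w := mul_pos hu hw
  have ht₂ : u * w ≤ 1 := ht₁.trans hq₁.le
  rw [← mul_sub, abs_mul]
  have a : |(q ^ 2 + 1) * (w / u) - q ^ 2 * (u * w) - (u * w)⁻¹| ≤
      2 * (w / u) + 1 * (u * w) + (u * w)⁻¹ := by
    have b₁ : 0 ≤ (q ^ 2 + 1) * (w / u) := by positivity
    have b₂ : (q ^ 2 + 1) * (w / u) ≤ 2 * (w / u) := by
      gcongr
      linarith
    have b₃ : 0 ≤ q ^ 2 * (u * w) := by positivity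
    have b₄ : q ^ 2 * (u * w) ≤ 1 * (u * w) := by gcongr
    have b₅ : 0 ≤ (u * w)⁻¹ := by positivity
    rw [abs_le]
    constructor <;> linarith
  calc |(q ^ 2 + 1) * (w / u) - q ^ 2 * (u * w) - (u * w)⁻¹| *
        |bb q v (u * w) - bb q v' (u * w)|
    _ ≤ (2 * (w / u) + 1 * (u * w) + (u * w)⁻¹) * (bbC q * (u * w) ^ 2) := by gcongr
    _ = bbC q * (u * w) * (2 * (w * w) + (u * w) * (u * w) + 1) := by
      field_simp
    _ ≤ bbC q * (u * w) * (2 * (1 * 1) + 1 * 1 + 1) := by gcongr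
    _ = _ := by ring

theorem qnum_mul_rpow_le (hq : 0 < q) (hq₁ : q < 1) (l b c : ℝ) (h : c ≤ b - l) :
    qnum q (l + 1 / 2) * q ^ b ≤ (q⁻¹ - q)⁻¹ * q⁻¹ * q ^ c := by
  have hd := inv_sub_pos hq hq₁
  have hp := rpow_pos_of_pos hq b
  calc qnum q (l + 1 / 2) * q ^ b ≤ (q⁻¹ - q)⁻¹ * q ^ (-(l + 1 / 2)) * q ^ b := by
        gcongr
        exact qnum_le hq hq₁ _
    _ = (q⁻¹ - q)⁻¹ * q ^ (-(l + 1 / 2) + b) := by rw [mul_assoc, ← rpow_add hq]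
    _ ≤ (q⁻¹ - q)⁻¹ * (q⁻¹ * q ^ c) := by
      refine mul_le_mul_of_nonneg_left ?_ (inv_pos.2 hd).le
      rw [← rpow_neg_one q, ← rpow_add hq]
      exact rpow_le_rpow_of_exponent_ge hq hq₁.le (by linarith)
    _ = _ := by ring

theorem rpow_le_wt (hq : 0 < q) (hq₁ : q < 1) {p r : ℤ} (ho : Odd (p + r)) (hp : 0 ≤ p)
    (hr : 0 ≤ r) (s : Bool) {x : ℝ} (h : ℓ(p, r) ≤ x ∨ (r : ℝ) ≤ x) :
    q ^ x ≤ wt q (idx ho hp hr s) := by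
  rw [wt_idx]
  have h₁ := rpow_pos_of_pos hq ℓ(p, r)
  have h₂ := rpow_pos_of_pos hq (r : ℝ)
  rcases h with h | h
  · have := rpow_le_rpow_of_exponent_ge hq hq₁.le h
    linarith
  · have := rpow_le_rpow_of_exponent_ge hq hq₁.le h
    linarith

theorem odd_add_two {p r : ℤ} (ho : Odd (p + r)) : Odd (p + (r + 2)) ∧ Odd (p + 2 + r) ∧
    Odd (p + 1 + (r + 1)) := by
  obtain ⟨m, hm⟩ := ho
  exact ⟨⟨m + 1, by linarith⟩, ⟨m + 1, by linarith⟩, ⟨m + 1, by linarith⟩⟩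

theorem abs_entX_succ_le (hq : 0 < q) (hq₁ : q < 1) {p r : ℤ} (ho : Odd (p + r)) (hp : 0 ≤ p)
    (hr : 0 ≤ r) : |entX q (p + 1) (r + 1)| ≤ entC q * q ^ (ℓ(p, r) + 1 + r) := by
  refine (abs_entX_le hq hq₁ (odd_add_two ho).2.2 (by omega) (by omega)).trans
    (mul_le_mul_of_nonneg_left (rpow_le_rpow_of_exponent_ge hq hq₁.le ?_) (entC_nonneg q))
  push_cast
  linarith

theorem abs_entL_succ_le (hq : 0 < q) (hq₁ : q < 1) {p r : ℤ} (ho : Odd (p + r)) (hp : 0 ≤ p)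
    (hr : 0 ≤ r) : |entL q (p + 2) r| ≤ entC q * q ^ (ℓ(p, r) + 1 + r) := by
  refine (abs_entL_le hq hq₁ (odd_add_two ho).2.1 (by omega) (by omega)).trans
    (mul_le_mul_of_nonneg_left (rpow_le_rpow_of_exponent_ge hq hq₁.le ?_) (entC_nonneg q))
  push_cast
  linarith

theorem abs_entU_succ_le (hq : 0 < q) (hq₁ : q < 1) {p r : ℤ} (ho : Odd (p + r)) (hp : 0 ≤ p)
    (hr : 0 ≤ r) : |entU q p (r + 2)| ≤ entC q * q ^ (ℓ(p, r) + 1) := by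
  refine (abs_entU_le hq hq₁ (odd_add_two ho).1 (by omega) (by omega)).trans
    (mul_le_mul_of_nonneg_left (rpow_le_rpow_of_exponent_ge hq hq₁.le ?_) (entC_nonneg q))
  push_cast
  linarith

theorem abs_mul_le_wt (hq : 0 < q) (hq₁ : q < 1) {p r : ℤ} (ho : Odd (p + r)) (hp : 0 ≤ p)
    (hr : 0 ≤ r) (s : Bool) {a x c K C b : ℝ} (ha : |a| ≤ C * q ^ c) (hx : |x| ≤ K * q ^ b)
    (hK : 0 ≤ K) (hC : 0 ≤ C) (h : ℓ(p, r) ≤ c + b ∨ (r : ℝ) ≤ c + b) :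
    |a * x| ≤ C * K * wt q (idx ho hp hr s) := by
  have hc := rpow_pos_of_pos hq c
  calc |a * x| = |a| * |x| := abs_mul a x
    _ ≤ (C * q ^ c) * (K * q ^ b) := by gcongr
    _ = C * K * q ^ (c + b) := by rw [rpow_add hq]; ring
    _ ≤ _ := by
      have := rpow_le_wt hq hq₁ ho hp hr s h
      gcongr

theorem abs_rpow_sg_half_le (hq : 0 < q) (hq₁ : q < 1) (s : Bool) :
    |q ^ (sg s / 2)| ≤ q⁻¹ * q ^ (0 : ℝ) := by
  rw [abs_of_pos (rpow_pos_of_pos hq _), Real.rpow_zero, mul_one]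
  exact rpow_sg_half_le hq hq₁ s

theorem abs_rpow_sg_mul_le (hq : 0 < q) (hq₁ : q < 1) (s : Bool) {l : ℝ} (hl : 0 ≤ l) :
    |q ^ (sg s * l)| ≤ 1 * q ^ (-l) := by
  rw [abs_of_pos (rpow_pos_of_pos hq _), one_mul]
  exact rpow_sg_mul_le hq hq₁ s hl

theorem neg_mul_le {x C : ℝ} {a : ℝ} (ha : 0 ≤ a) (h : |x| ≤ C) : |-a * x| ≤ a * C := by
  rw [abs_mul, abs_neg, abs_of_nonneg ha]
  gcongr

/-- `1 - x₀` is of lower order. -/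
theorem ord_one_sub_opX₀ (hq : 0 < q) (hq₁ : q < 1) : Ord (wt q) (1 - opX₀ q) := by
  have hC := entC_nonneg q
  have hb := bbC_nonneg q
  refine (hop_one.sub (hop_opX₀ hq hq₁)).ord (C₁ := q⁻¹ * entC q) (C₂ := 2 * bbC q)
    (C₃ := q⁻¹ * entC q) (by positivity) (by positivity) (by positivity) ?_ ?_ ?_
  · intro s p r ho hp hr
    have hr' : (0 : ℝ) ≤ r := by exact_mod_cast hr
    simp only [Pi.sub_apply, Pi.zero_apply, zero_sub, abs_neg]
    exact abs_mul_le_wt hq hq₁ ho hp hr s (abs_rpow_sg_half_le hq hq₁ s) (abs_entX_le hq hq₁ ho hp hr)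
      hC (by positivity) (Or.inl (by linarith))
  · intro s p r ho hp hr
    exact abs_one_sub_mid_le hq hq₁ s ho hp hr
  · intro s p r ho hp hr
    have hr' : (0 : ℝ) ≤ r := by exact_mod_cast hr
    simp only [Pi.sub_apply, Pi.zero_apply, zero_sub, abs_neg]
    exact abs_mul_le_wt hq hq₁ ho hp hr s (abs_rpow_sg_half_le hq hq₁ s)
      (abs_entX_succ_le hq hq₁ ho hp hr) hC (by positivity) (Or.inl (by linarith))

theorem ord_comm_opX₀ (hq : 0 < q) (hq₁ : q < 1) :
    Ord (wt q) (opD q * opX₀ q - opX₀ q * opD q) := by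
  have hC := entC_nonneg q
  have hb := bbC_nonneg q
  have hd := inv_sub_pos hq hq₁
  refine (hop_opX₀ hq hq₁).comm_opD.ord (C₁ := 1 * entC q)
    (C₂ := 4 * bbC q * ((q⁻¹ - q)⁻¹ * q⁻¹)) (C₃ := 1 * entC q) (by positivity) (by positivity)
    (by positivity) ?_ ?_ ?_
  · intro s p r ho hp hr
    have hl := half_le ho hp hr
    rw [qnum_comm_lo hq hq₁, neg_mul, abs_neg]
    exact abs_mul_le_wt hq hq₁ ho hp hr s (abs_rpow_sg_mul_le hq hq₁ _ (by linarith))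
      (abs_entX_le hq hq₁ ho hp hr) hC zero_le_one (Or.inr (by linarith))
  · intro s p r ho hp hr
    have hl := half_le ho hp hr
    rw [abs_mul, abs_of_nonneg (qnum_nonneg hq hq₁ (by linarith))]
    have hn := qnum_nonneg hq hq₁ (show 0 ≤ ℓ(p, r) + 1 / 2 by linarith)
    calc _ ≤ qnum q (ℓ(p, r) + 1 / 2) * (4 * bbC q *
          q ^ (2 * ℓ(p, r))) := by
          gcongr
          exact abs_mid_sub_le hq hq₁ s ho hp hr
      _ = 4 * bbC q * (qnum q (ℓ(p, r) + 1 / 2) *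
          q ^ (2 * ℓ(p, r))) := by ring
      _ ≤ 4 * bbC q * ((q⁻¹ - q)⁻¹ * q⁻¹ * q ^ ℓ(p, r)) := by
          refine mul_le_mul_of_nonneg_left (qnum_mul_rpow_le hq hq₁ _ _ _ ?_) (by positivity)
          linarith
      _ ≤ 4 * bbC q * ((q⁻¹ - q)⁻¹ * q⁻¹ * wt q (idx ho hp hr s)) := by
          have := rpow_le_wt hq hq₁ ho hp hr s (Or.inl (le_refl ℓ(p, r)))
          gcongr
      _ = _ := by ring
  · intro s p r ho hp hr
    have hl := half_le ho hp hr
    rw [qnum_comm_up hq hq₁]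
    exact abs_mul_le_wt hq hq₁ ho hp hr s (abs_rpow_sg_mul_le hq hq₁ _ (by linarith))
      (abs_entX_succ_le hq hq₁ ho hp hr) hC zero_le_one (Or.inr (by linarith))

theorem abs_sqrt_coeff_le (hq : 0 < q) (hq₁ : q < 1) (κ : ℝ) {p r : ℤ} {x y : ℝ}
    (hxy : x + y = ((p + r : ℤ) : ℝ) + 1) :
    |κ * (q ^ (((r - p : ℤ) : ℝ) / 2) * √(qnum q x) * √(qnum q y))| ≤
      |κ| * ((q⁻¹ - q)⁻¹ * q⁻¹) * q ^ (((r - p : ℤ) : ℝ) / 2 - ℓ(p, r)) := by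
  have hd := inv_sub_pos hq hq₁
  have hp := rpow_pos_of_pos hq (((r - p : ℤ) : ℝ) / 2)
  rw [abs_mul κ, mul_assoc |κ|, abs_of_nonneg (show 0 ≤ q ^ (((r - p : ℤ) : ℝ) / 2) * √(qnum q x) *
    √(qnum q y) by positivity)]
  refine mul_le_mul_of_nonneg_left ?_ (abs_nonneg κ)
  refine (sqrt_mul_sqrt_le hq hq₁ _ _ _ (((r - p : ℤ) : ℝ) / 2 - ℓ(p, r) - 1 / 2)
    (by linarith)).trans ?_
  rw [mul_assoc]
  refine mul_le_mul_of_nonneg_left ?_ (inv_pos.2 hd).le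
  rw [← rpow_neg_one q, ← rpow_add hq]
  exact rpow_le_rpow_of_exponent_ge hq hq₁.le (by linarith)

theorem abs_mid_EF_le (hq : 0 < q) (hq₁ : q < 1) (κ : ℝ) (s : Bool) {p r : ℤ} (ho : Odd (p + r))
    (hp : 0 ≤ p) (hr : 0 ≤ r) {x y : ℝ} (hxy : x + y = ((p + r : ℤ) : ℝ) + 1) :
    |κ * (q ^ (((r - p : ℤ) : ℝ) / 2) * √(qnum q x) * √(qnum q y)) *
      bb q (q ^ sg s) (q ^ p * q ^ r)| ≤
      |κ| * ((q⁻¹ - q)⁻¹ * q⁻¹) * bbC q * wt q (idx ho hp hr s) := by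
  have hb := bbC_nonneg q
  have hd := inv_sub_pos hq hq₁
  have h₁ := abs_bb_le hq hq₁ s (mul_pos (zpow_pos hq p) (zpow_pos hq r))
    (zpow_mul_zpow_le hq hq₁ ho hp hr)
  rw [zpow_mul_zpow hq] at h₁ ⊢
  have hk : (((p + r : ℤ) : ℝ)) / 2 + ((r - p : ℤ) : ℝ) / 2 = r := by push_cast; ring
  refine abs_mul_le_wt hq hq₁ ho hp hr s (c := ((r - p : ℤ) : ℝ) / 2 - ℓ(p, r)) ?_ h₁ hb
    (by positivity) (Or.inr (by linarith))
  exact abs_sqrt_coeff_le hq hq₁ κ hxy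

theorem abs_comm_mid_EF_le (hq : 0 < q) (hq₁ : q < 1) (κ : ℝ) (s : Bool) {p r : ℤ}
    (ho : Odd (p + r)) (hp : 0 ≤ p) (hr : 0 ≤ r) {x y : ℝ} (hxy : x + y = ((p + r : ℤ) : ℝ) + 1) :
    |qnum q (ℓ(p, r) + 1 / 2) *
      (κ * (q ^ (((r - p : ℤ) : ℝ) / 2) * √(qnum q x) * √(qnum q y)) *
        bb q (q ^ sg s) (q ^ p * q ^ r) -
      κ * (q ^ (((r - p : ℤ) : ℝ) / 2) * √(qnum q x) * √(qnum q y)) *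
        bb q (q ^ sg (!s)) (q ^ p * q ^ r))| ≤
      |κ| * ((q⁻¹ - q)⁻¹ * q⁻¹) * ((q⁻¹ - q)⁻¹ * q⁻¹ * bbC q) * wt q (idx ho hp hr s) := by
  have hb := bbC_nonneg q
  have hd := inv_sub_pos hq hq₁
  have hl := half_le ho hp hr
  have hn := qnum_nonneg hq hq₁ (show 0 ≤ ℓ(p, r) + 1 / 2 by linarith)
  have h₁ := abs_bb_sub_le hq hq₁ s (mul_pos (zpow_pos hq p) (zpow_pos hq r))
    (zpow_mul_zpow_le hq hq₁ ho hp hr)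
  rw [zpow_mul_zpow hq] at h₁ ⊢
  rw [← rpow_natCast (q ^ _), ← rpow_mul hq.le] at h₁
  have h₂ : |qnum q (ℓ(p, r) + 1 / 2) *
      (bb q (q ^ sg s) (q ^ (2 * ℓ(p, r))) -
        bb q (q ^ sg (!s)) (q ^ (2 * ℓ(p, r))))| ≤
      (q⁻¹ - q)⁻¹ * q⁻¹ * bbC q * q ^ (3 * ℓ(p, r)) := by
    rw [abs_mul, abs_of_nonneg hn]
    calc _ ≤ qnum q (ℓ(p, r) + 1 / 2) *
          (bbC q * q ^ (2 * ℓ(p, r) * (2 : ℕ))) := by gcongr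
      _ = bbC q * (qnum q (ℓ(p, r) + 1 / 2) *
          q ^ (2 * ℓ(p, r) * (2 : ℕ))) := by ring
      _ ≤ bbC q * ((q⁻¹ - q)⁻¹ * q⁻¹ * q ^ (3 * ℓ(p, r))) := by
        refine mul_le_mul_of_nonneg_left (qnum_mul_rpow_le hq hq₁ _ _ _ ?_) hb
        push_cast
        linarith
      _ = _ := by ring
  have hk : (((p + r : ℤ) : ℝ)) / 2 + ((r - p : ℤ) : ℝ) / 2 = r := by push_cast; ring
  rw [← mul_sub, mul_left_comm]
  refine abs_mul_le_wt hq hq₁ ho hp hr s (c := ((r - p : ℤ) : ℝ) / 2 - ℓ(p, r)) ?_ h₂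
    (by positivity) (by positivity) (Or.inr (by linarith))
  exact abs_sqrt_coeff_le hq hq₁ κ hxy

theorem ord_opX₁' (hq : 0 < q) (hq₁ : q < 1) : Ord (wt q) (opX₁' q) := by
  have hC := entC_nonneg q
  have hb := bbC_nonneg q
  have hd := inv_sub_pos hq hq₁
  refine (hop_opX₁' hq hq₁).ord (C₁ := q⁻¹ * (q * entC q))
    (C₂ := |(1 + q ^ 2) * (1 - q ^ 2)| * ((q⁻¹ - q)⁻¹ * q⁻¹) * bbC q) (C₃ := q⁻¹ * entC q)
    (by positivity) (by positivity) (by positivity) ?_ ?_ ?_ <;> intro s p r ho hp hr <;>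
    have hr' : (0 : ℝ) ≤ r := by exact_mod_cast hr
  · have h := neg_mul_le hq.le (abs_entL_le hq hq₁ ho hp hr)
    rw [← mul_assoc q] at h
    exact abs_mul_le_wt hq hq₁ ho hp hr s (abs_rpow_sg_half_le hq hq₁ s) h (by positivity)
      (by positivity) (Or.inl (by linarith))
  · exact abs_mid_EF_le hq hq₁ _ s ho hp hr (by push_cast; ring)
  · exact abs_mul_le_wt hq hq₁ ho hp hr s (abs_rpow_sg_half_le hq hq₁ s)
      (abs_entU_succ_le hq hq₁ ho hp hr) hC (by positivity) (Or.inl (by linarith))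

theorem ord_opXm₁' (hq : 0 < q) (hq₁ : q < 1) : Ord (wt q) (opXm₁' q) := by
  have hC := entC_nonneg q
  have hb := bbC_nonneg q
  have hd := inv_sub_pos hq hq₁
  refine (hop_opXm₁' hq hq₁).ord (C₁ := q⁻¹ * (q⁻¹ * entC q))
    (C₂ := |(1 + q ^ 2) * (1 - q⁻¹ ^ 2)| * ((q⁻¹ - q)⁻¹ * q⁻¹) * bbC q) (C₃ := q⁻¹ * entC q)
    (by positivity) (by positivity) (by positivity) ?_ ?_ ?_ <;> intro s p r ho hp hr <;>
    have hr' : (0 : ℝ) ≤ r := by exact_mod_cast hr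
  · have h := neg_mul_le (inv_pos.2 hq).le (abs_entU_le hq hq₁ ho hp hr)
    rw [← mul_assoc q⁻¹] at h
    exact abs_mul_le_wt hq hq₁ ho hp hr s (abs_rpow_sg_half_le hq hq₁ s) h (by positivity)
      (by positivity) (Or.inl (by linarith))
  · exact abs_mid_EF_le hq hq₁ _ s ho hp hr (by push_cast; ring)
  · exact abs_mul_le_wt hq hq₁ ho hp hr s (abs_rpow_sg_half_le hq hq₁ s)
      (abs_entL_succ_le hq hq₁ ho hp hr) hC (by positivity) (Or.inl (by linarith))

/-- The leading coefficient of `[D, x₁]`. -/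
def leadE (q : ℝ) (p r : ℤ) : ℝ := q ^ (-(ℓ(p, r) + 1)) * entU q p (r + 2)

/-- The leading coefficient of `[D, x₋₁]`. -/
def leadF (q : ℝ) (p r : ℤ) : ℝ := q ^ (-ℓ(p, r)) * (q⁻¹ * entU q p r)

/-- The leading part of `[D, x₁]`. -/
def opLeadE (q : ℝ) : Module.End ℂ Dom :=
  hopOp (-1) (!·) 0 0 fun s p r => if s then 0 else leadE q p r

/-- The leading part of `[D, x₋₁]`. -/
def opLeadF (q : ℝ) : Module.End ℂ Dom :=
  hopOp 1 (!·) (fun s p r => if s then leadF q p r else 0) 0 0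

theorem abs_leadE_le (hq : 0 < q) (hq₁ : q < 1) {p r : ℤ} (ho : Odd (p + r)) (hp : 0 ≤ p)
    (hr : 0 ≤ r) : |leadE q p r| ≤ entC q := by
  have := rpow_pos_of_pos hq (-(ℓ(p, r) + 1))
  rw [leadE, abs_mul, abs_of_pos this]
  calc _ ≤ q ^ (-(ℓ(p, r) + 1)) * (entC q * q ^ (ℓ(p, r) + 1)) := by
        gcongr
        exact abs_entU_succ_le hq hq₁ ho hp hr
    _ = entC q * (q ^ (-(ℓ(p, r) + 1)) * q ^ (ℓ(p, r) + 1)) := by ring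
    _ = entC q := by rw [← rpow_add hq, neg_add_cancel, Real.rpow_zero, mul_one]

theorem abs_leadF_le (hq : 0 < q) (hq₁ : q < 1) {p r : ℤ} (ho : Odd (p + r)) (hp : 0 ≤ p)
    (hr : 0 ≤ r) : |leadF q p r| ≤ q⁻¹ * entC q := by
  have := rpow_pos_of_pos hq (-ℓ(p, r))
  rw [leadF, abs_mul, abs_of_pos this, abs_mul, abs_of_pos (inv_pos.2 hq)]
  calc _ ≤ q ^ (-ℓ(p, r)) * (q⁻¹ * (entC q * q ^ ℓ(p, r))) := by
        gcongr
        exact abs_entU_le hq hq₁ ho hp hr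
    _ = q⁻¹ * entC q * (q ^ (-ℓ(p, r)) * q ^ ℓ(p, r)) := by ring
    _ = q⁻¹ * entC q := by rw [← rpow_add hq, neg_add_cancel, Real.rpow_zero, mul_one]

theorem ord_opLeadE (hq : 0 < q) (hq₁ : q < 1) : Ord 1 (opLeadE q) := by
  have hC := entC_nonneg q
  refine (hop_hopOp _ _ _ _ _).ord (C₁ := 0) (C₂ := 0) (C₃ := entC q) le_rfl le_rfl hC
    ?_ ?_ ?_ <;> intro s p r ho hp hr
  · simp
  · simp
  · split_ifs
    · simpa using hC
    · simpa using abs_leadE_le hq hq₁ ho hp hr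

theorem ord_opLeadF (hq : 0 < q) (hq₁ : q < 1) : Ord 1 (opLeadF q) := by
  have hC := entC_nonneg q
  have hC' : 0 ≤ q⁻¹ * entC q := by positivity
  refine (hop_hopOp _ _ _ _ _).ord (C₁ := q⁻¹ * entC q) (C₂ := 0) (C₃ := 0) hC' le_rfl le_rfl
    ?_ ?_ ?_ <;> intro s p r ho hp hr
  · split_ifs
    · simpa using abs_leadF_le hq hq₁ ho hp hr
    · simpa using hC'
  · simp
  · simp

theorem ord_comm_opX₁' (hq : 0 < q) (hq₁ : q < 1) :
    Ord (wt q) (opD q * opX₁' q - opX₁' q * opD q - opLeadE q) := by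
  have hC := entC_nonneg q
  have hb := bbC_nonneg q
  have hd := inv_sub_pos hq hq₁
  refine ((hop_opX₁' hq hq₁).comm_opD.sub (hop_hopOp _ _ _ _ _)).ord (C₁ := 1 * (q * entC q))
    (C₂ := |(1 + q ^ 2) * (1 - q ^ 2)| * ((q⁻¹ - q)⁻¹ * q⁻¹) * ((q⁻¹ - q)⁻¹ * q⁻¹ * bbC q))
    (C₃ := 1 * entC q) (by positivity) (by positivity) (by positivity) ?_ ?_ ?_ <;>
    intro s p r ho hp hr <;> have hl := half_le ho hp hr <;>
    simp only [Pi.sub_apply, Pi.zero_apply, sub_zero]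
  · have h := neg_mul_le hq.le (abs_entL_le hq hq₁ ho hp hr)
    rw [← mul_assoc q] at h
    rw [qnum_comm_lo hq hq₁, neg_mul (q ^ (sg (!s) * _)), abs_neg]
    exact abs_mul_le_wt hq hq₁ ho hp hr s (abs_rpow_sg_mul_le hq hq₁ _ (by linarith))
      h (by positivity) zero_le_one (Or.inr (by linarith))
  · exact abs_comm_mid_EF_le hq hq₁ _ s ho hp hr (by push_cast; ring)
  · rw [qnum_comm_up hq hq₁]
    cases s
    · have : 0 ≤ wt q (idx ho hp hr false) := (wt_pos hq _).le
      simp [sg, leadE]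
      positivity
    · simp only [if_true, sub_zero, sg, one_mul]
      rw [← one_mul (entC q)]
      refine abs_mul_le_wt hq hq₁ ho hp hr true (c := ℓ(p, r) + 1) ?_
        (abs_entU_succ_le hq hq₁ ho hp hr) hC zero_le_one (Or.inl (by linarith))
      rw [abs_of_pos (rpow_pos_of_pos hq _), one_mul]

theorem ord_comm_opXm₁' (hq : 0 < q) (hq₁ : q < 1) :
    Ord (wt q) (opD q * opXm₁' q - opXm₁' q * opD q - opLeadF q) := by
  have hC := entC_nonneg q
  have hb := bbC_nonneg q
  have hd := inv_sub_pos hq hq₁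
  refine ((hop_opXm₁' hq hq₁).comm_opD.sub (hop_hopOp _ _ _ _ _)).ord (C₁ := 1 * (q⁻¹ * entC q))
    (C₂ := |(1 + q ^ 2) * (1 - q⁻¹ ^ 2)| * ((q⁻¹ - q)⁻¹ * q⁻¹) * ((q⁻¹ - q)⁻¹ * q⁻¹ * bbC q))
    (C₃ := 1 * entC q) (by positivity) (by positivity) (by positivity) ?_ ?_ ?_ <;>
    intro s p r ho hp hr <;> have hl := half_le ho hp hr <;>
    simp only [Pi.sub_apply, Pi.zero_apply, sub_zero]
  · have h := neg_mul_le (inv_pos.2 hq).le (abs_entU_le hq hq₁ ho hp hr)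
    rw [← mul_assoc q⁻¹] at h
    rw [qnum_comm_lo hq hq₁]
    cases s
    · simp only [Bool.false_eq_true, if_false, sub_zero, sg, one_mul, Bool.not_false, if_true]
      rw [neg_mul (q ^ _), abs_neg, ← one_mul (q⁻¹ * entC q)]
      refine abs_mul_le_wt hq hq₁ ho hp hr false (c := ℓ(p, r)) ?_
        h (by positivity) zero_le_one (Or.inl (by linarith))
      rw [abs_of_pos (rpow_pos_of_pos hq _), one_mul]
    · have : 0 ≤ wt q (idx ho hp hr true) := (wt_pos hq _).le
      simp [sg, leadF]
      positivity
  · exact abs_comm_mid_EF_le hq hq₁ _ s ho hp hr (by push_cast; ring)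
  · rw [qnum_comm_up hq hq₁]
    exact abs_mul_le_wt hq hq₁ ho hp hr s (abs_rpow_sg_mul_le hq hq₁ _ (by linarith))
      (abs_entL_succ_le hq hq₁ ho hp hr) hC zero_le_one (Or.inr (by linarith))

/-! ### The operators `γ a₀ [D, a₁] [D, a₂]` up to lower order -/

theorem leadF_add_two (hq : 0 < q) (p r : ℤ) : leadF q p (r + 2) = q⁻¹ * leadE q p r := by
  rw [leadF, leadE, show ((p + (r + 2) : ℤ) : ℝ) / 2 = ℓ(p, r) + 1 by
    push_cast; ring]
  ring

theorem opLeadE_V (q : ℝ) (s : Bool) (p r : ℤ) (ho : Odd (p + r)) (hp : 0 ≤ p) (hr : 0 ≤ r) :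
    opLeadE q (V s p r) = ((if s then 0 else leadE q p r : ℝ) : ℂ) • V (!s) p (r + 2) := by
  rw [opLeadE, hop_hopOp _ _ _ _ _ s p r ho hp hr, show p + -1 + 1 = p by ring,
    show r - -1 + 1 = r + 2 by ring]
  simp

theorem opLeadF_V (q : ℝ) (s : Bool) (p r : ℤ) (ho : Odd (p + r)) (hp : 0 ≤ p) (hr : 0 ≤ r) :
    opLeadF q (V s p r) = ((if s then leadF q p r else 0 : ℝ) : ℂ) • V (!s) p (r - 2) := by
  rw [opLeadF, hop_hopOp _ _ _ _ _ s p r ho hp hr, show p + 1 - 1 = p by ring,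
    show r - 1 - 1 = r - 2 by ring]
  simp

theorem ext_V {S T : Module.End ℂ Dom}
    (h : ∀ s p r, Odd (p + r) → 0 ≤ p → 0 ≤ r → S (V s p r) = T (V s p r)) : S = T := by
  refine Finsupp.lhom_ext' fun i => LinearMap.ext_ring ?_
  obtain ⟨p, r, ho, hp, hr, e⟩ := exists_idx i
  have h' := h i.2 p r ho hp hr
  rw [V_eq ho hp hr, ← e] at h'
  exact h'

theorem odd_sub_two {p r : ℤ} (ho : Odd (p + r)) : Odd (p + (r - 2)) := by
  rw [← add_sub_assoc]
  exact ho.sub_even even_two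

theorem opLeadE_mul_self (q : ℝ) : opLeadE q * opLeadE q = 0 := by
  refine ext_V fun s p r ho hp hr => ?_
  rw [Module.End.mul_apply, opLeadE_V q s p r ho hp hr, map_smul,
    opLeadE_V q _ p _ (odd_add_two ho).1 hp (by linarith)]
  cases s <;> simp

theorem leadF_eq_zero {p r : ℤ} (h₀ : 0 ≤ r) (h : r < 2) : leadF q p r = 0 := by
  have : r = 0 ∨ r = 1 := by omega
  rcases this with rfl | rfl <;> simp [leadF, entU, qnum]

theorem opLeadF_mul_self (q : ℝ) : opLeadF q * opLeadF q = 0 := by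
  refine ext_V fun s p r ho hp hr => ?_
  rw [Module.End.mul_apply, opLeadF_V q s p r ho hp hr, map_smul]
  rcases lt_or_ge r 2 with h | h
  · rw [V_eq_zero (Or.inr (by linarith))]
    simp
  · rw [opLeadF_V q _ p _ (odd_sub_two ho) hp (by linarith)]
    cases s <;> simp

theorem abs_polynomial_le {T w : ℝ} (hq : 0 < q) (hq₁ : q < 1) (hT₀ : 0 < T) (hT : T ≤ q)
    (hw₀ : 0 < w) (hw₁ : w ≤ 1) :
    |(w ^ 2 - 1) * (w ^ 2 - q ^ 2) - q * (T ^ 2 - 1) ^ 2 * ((T + q) * (q * T + 1))| ≤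
      8 * (T + w) := by
  have hT₁ : T ≤ 1 := hT.trans hq₁.le
  have hq₂ : q ^ 2 ≤ 1 := pow_le_one₀ hq.le hq₁.le
  have hT₂ : T ^ 2 ≤ 1 := pow_le_one₀ hT₀.le hT₁
  have hw₂ : w ^ 2 ≤ 1 := pow_le_one₀ hw₀.le hw₁
  obtain ⟨m, hm⟩ : ∃ m, m = 1 + q ^ 2 + q * T := ⟨_, rfl⟩
  have hm₀ : 0 ≤ m := by rw [hm]; positivity
  have hm₁ : m ≤ 3 := by
    have := mul_le_one₀ hq₁.le hT₀.le hT₁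
    linarith
  have hTm : T * m ≤ 1 * 3 := by gcongr
  have hn₀ : 0 ≤ T * (2 - T ^ 2) := mul_nonneg hT₀.le (by linarith)
  have hn₁ : T * (2 - T ^ 2) ≤ 1 * 2 := by
    have := sq_nonneg T
    refine mul_le_mul hT₁ ?_ ?_ zero_le_one <;> linarith
  have hk₀ : 0 ≤ T * (2 - T ^ 2) * (q + T * m) := by positivity
  have hk₁ : T * (2 - T ^ 2) * (q + T * m) ≤ 1 * 2 * (1 + 1 * 3) := by gcongr
  have h₁ : (w ^ 2 - 1) * (w ^ 2 - q ^ 2) - q * (T ^ 2 - 1) ^ 2 * ((T + q) * (q * T + 1)) =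
      w * (w * (w ^ 2 - 1 - q ^ 2)) - T * (q * (m - T * (2 - T ^ 2) * (q + T * m))) := by
    rw [hm]
    ring
  have h₂ : |w * (w ^ 2 - 1 - q ^ 2)| ≤ 1 * 8 := by
    rw [abs_mul, abs_of_pos hw₀]
    gcongr
    rw [abs_le]
    constructor <;> nlinarith [sq_nonneg q, sq_nonneg w]
  have h₃ : |q * (m - T * (2 - T ^ 2) * (q + T * m))| ≤ 1 * 8 := by
    rw [abs_mul, abs_of_pos hq]
    gcongr
    rw [abs_le]
    constructor <;> linarith
  rw [h₁]
  refine (abs_sub _ _).trans ?_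
  rw [abs_mul, abs_mul T, abs_of_pos hw₀, abs_of_pos hT₀]
  calc _ ≤ w * (1 * 8) + T * (1 * 8) := by gcongr
    _ = _ := by ring

/-- The square of the leading coefficient is asymptotically constant. -/
theorem abs_leadF_sq_sub_one_le (hq : 0 < q) (hq₁ : q < 1) {p r : ℤ} (ho : Odd (p + r))
    (hp : 0 ≤ p) (hr : 0 ≤ r) :
    |q ^ 3 / (1 + q ^ 2) ^ 2 * leadF q p r ^ 2 - 1| ≤
      8 / (q ^ 2 * (1 - q ^ 2) ^ 2) * (q ^ (p + r) + q ^ r) := by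
  have hq₂ : 0 < 1 - q ^ 2 := by nlinarith
  have hT₀ : 0 < q ^ (p + r) := zpow_pos hq _
  have hw₀ : 0 < q ^ r := zpow_pos hq _
  have hw₁ : q ^ r ≤ 1 := by
    simpa using zpow_le_zpow_right_of_le_one₀ hq hq₁.le hr
  have hD : 0 < q ^ 2 * (1 - q ^ 2) ^ 2 := by positivity
  rcases lt_or_ge r 2 with h | h
  · rw [leadF_eq_zero hr h]
    have : q ^ (1 : ℤ) ≤ q ^ r := zpow_le_zpow_right_of_le_one₀ hq hq₁.le (by omega)
    rw [zpow_one] at this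
    rw [div_mul_eq_mul_div 8, le_div_iff₀ hD]
    have : q * (q * (1 - q ^ 2) ^ 2) ≤ q * (1 * 1 ^ 2) := by
      gcongr
      nlinarith
    norm_num
    nlinarith
  · have hl : 1 / 2 < ℓ(p, r) := by
      have : (2 : ℝ) ≤ ((p + r : ℤ) : ℝ) := by exact_mod_cast (by omega : 2 ≤ p + r)
      linarith
    have hT : q ^ (p + r) ≤ q := by
      simpa using zpow_le_zpow_right_of_le_one₀ hq hq₁.le (by omega : 1 ≤ p + r)
    have e₁ : (q ^ (-ℓ(p, r))) ^ 2 = (q ^ (p + r))⁻¹ := by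
      rw [← rpow_natCast, ← rpow_mul hq.le, ← zpow_neg, ← rpow_intCast]
      congr 1; push_cast; ring
    have e₂ : q ^ (-(p : ℝ)) = q ^ r / q ^ (p + r) := by
      rw [← zpow_sub₀ hq.ne', ← rpow_intCast]
      congr 1; push_cast; ring
    have e₃ : √(qnum q r) ^ 2 = br q (q ^ r) := by
      rw [sq_sqrt (qnum_nonneg hq hq₁ (by exact_mod_cast hr)), qnum_intCast hq]
    have e₄ : √(qnum q (r - 1)) ^ 2 = br q (q⁻¹ * q ^ r) := by
      have : (0 : ℝ) ≤ r - 1 := by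
        have : (2 : ℝ) ≤ r := by exact_mod_cast h
        linarith
      rw [sq_sqrt (qnum_nonneg hq hq₁ this), qnum_eq_br hq, Real.rpow_sub hq, rpow_one,
        rpow_intCast, div_eq_inv_mul]
    have e₅ := gCoeff_sq hq hq₁ hl
    rw [mul_div_cancel₀ _ two_ne_zero, rpow_intCast,
      gSq_eq hq hT₀ (by linarith)] at e₅
    have e : q ^ 3 / (1 + q ^ 2) ^ 2 * leadF q p r ^ 2 =
        ((q ^ r) ^ 2 - 1) * ((q ^ r) ^ 2 - q ^ 2) / (q * ((q ^ (p + r)) ^ 2 - 1) ^ 2 *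
          ((q ^ (p + r) + q) * (q * q ^ (p + r) + 1))) := by
      simp only [leadF, entU, mul_pow, e₁, e₂, e₃, e₄, e₅]
      rw [br_eq hq.ne' hw₀.ne', br_eq hq.ne' (by positivity)]
      have h₁ : q ^ 2 - 1 ≠ 0 := by linarith
      have h₂ : (q ^ (p + r)) ^ 2 - 1 ≠ 0 := by nlinarith
      field_simp
      ring
    rw [e]
    generalize q ^ (p + r) = T at *
    generalize q ^ r = w at *
    have hd : q ^ 2 * (1 - q ^ 2) ^ 2 ≤ q * (T ^ 2 - 1) ^ 2 * ((T + q) * (q * T + 1)) := by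
      have : (1 - q ^ 2) ^ 2 ≤ (T ^ 2 - 1) ^ 2 := by
        rw [sq_le_sq, abs_of_pos hq₂, abs_sub_comm, abs_of_nonneg (by nlinarith)]
        nlinarith
      calc q ^ 2 * (1 - q ^ 2) ^ 2 = q * (1 - q ^ 2) ^ 2 * (q * 1) := by ring
        _ ≤ _ := by
          gcongr
          · linarith
          · nlinarith
    rw [div_sub_one (by nlinarith), abs_div, div_mul_eq_mul_div,
      abs_of_pos (hD.trans_le hd)]
    refine div_le_div₀ (by positivity) ?_ hD hd
    exact abs_polynomial_le hq hq₁ hT₀ hT hw₀ hw₁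

theorem abs_leadF_sq_sub_one_le_wt (hq : 0 < q) (hq₁ : q < 1) {p r : ℤ} (ho : Odd (p + r))
    (hp : 0 ≤ p) (hr : 0 ≤ r) (s : Bool) {ρ : ℤ} (hρ : r ≤ ρ) (ho' : Odd (p + ρ)) :
    |q ^ 3 / (1 + q ^ 2) ^ 2 * leadF q p ρ ^ 2 - 1| ≤
      8 / (q ^ 2 * (1 - q ^ 2) ^ 2) * 2 * wt q (idx ho hp hr s) := by
  have hq₂ : 0 < 1 - q ^ 2 := by nlinarith
  refine (abs_leadF_sq_sub_one_le hq hq₁ ho' hp (hr.trans hρ)).trans ?_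
  have hρ' : (r : ℝ) ≤ ρ := by exact_mod_cast hρ
  have hr' : (0 : ℝ) ≤ r := by exact_mod_cast hr
  have hp' : (0 : ℝ) ≤ p := by exact_mod_cast hp
  have h₁ := rpow_le_wt hq hq₁ ho hp hr s (x := ((p + ρ : ℤ) : ℝ))
    (Or.inl (by push_cast; linarith))
  have h₂ := rpow_le_wt hq hq₁ ho hp hr s (x := (ρ : ℝ)) (Or.inr hρ')
  rw [rpow_intCast] at h₁ h₂
  rw [mul_assoc]
  gcongr
  linarith

/-- The projection onto the part of sign `s`. -/
def proj (s : Bool) : Module.End ℂ Dom := diagOp fun i => if i.2 = s then 1 else 0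

theorem hop_proj (s : Bool) : Hop (proj s) 0 id 0 (fun s' _ _ => if s' = s then 1 else 0) 0 := by
  intro s' p r ho hp hr
  rw [V_eq ho hp hr, proj, diagOp, opOf_single]
  simp only [idx, add_zero, sub_zero, id, V_eq ho hp hr]
  split_ifs with h <;> simp [h]

theorem ord_opLeadF_mul_opLeadE (hq : 0 < q) (hq₁ : q < 1) :
    Ord (wt q) (((q ^ 2 / (1 + q ^ 2) ^ 2 : ℝ) : ℂ) • (opLeadF q * opLeadE q) - proj false) := by
  have h : Hop (opLeadF q * opLeadE q) 0 id 0
      (fun s p r => if s then 0 else q * leadF q p (r + 2) ^ 2) 0 := by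
    intro s p r ho hp hr
    rw [Module.End.mul_apply, opLeadE_V q s p r ho hp hr, map_smul,
      opLeadF_V q _ p _ (odd_add_two ho).1 hp (by linarith), smul_smul,
      ← Complex.ofReal_mul, add_sub_cancel_right, add_zero, sub_zero]
    cases s
    · have : leadE q p r * leadF q p (r + 2) = q * leadF q p (r + 2) ^ 2 := by
        rw [leadF_add_two hq]
        field_simp
      simp only [Bool.false_eq_true, if_false, Bool.not_false, if_true, this]
      simp
    · simp
  refine ((h.smul _).sub (hop_proj false)).ord (C₁ := 0)
    (C₂ := 8 / (q ^ 2 * (1 - q ^ 2) ^ 2) * 2) (C₃ := 0) le_rfl (by positivity) le_rfl ?_ ?_ ?_ <;>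
    intro s p r ho hp hr
  · simp
  · cases s
    · have := abs_leadF_sq_sub_one_le_wt hq hq₁ ho hp hr false (ρ := r + 2) (by linarith)
        (odd_add_two ho).1
      convert this using 2
      simp
      ring
    · have := (wt_pos hq (idx ho hp hr true)).le
      simp
      positivity
  · simp

theorem ord_opLeadE_mul_opLeadF (hq : 0 < q) (hq₁ : q < 1) :
    Ord (wt q) (((q ^ 2 / (1 + q ^ 2) ^ 2 : ℝ) : ℂ) • (opLeadE q * opLeadF q) - proj true) := by
  have h : Hop (opLeadE q * opLeadF q) 0 id 0
      (fun s p r => if s then q * leadF q p r ^ 2 else 0) 0 := by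
    intro s p r ho hp hr
    rw [Module.End.mul_apply, opLeadF_V q s p r ho hp hr, map_smul, add_zero, sub_zero]
    rcases lt_or_ge r 2 with h | h
    · have := leadF_eq_zero (q := q) (p := p) hr h
      cases s <;> simp [this]
    · rw [opLeadE_V q _ p _ (odd_sub_two ho) hp (by linarith), sub_add_cancel, smul_smul,
        ← Complex.ofReal_mul]
      have := leadF_add_two hq p (r - 2)
      rw [sub_add_cancel] at this
      cases s
      · simp
      · have : q * leadF q p r ^ 2 = leadF q p r * leadE q p (r - 2) := by
          rw [this]
          field_simp
        simp [← this]
  refine ((h.smul _).sub (hop_proj true)).ord (C₁ := 0)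
    (C₂ := 8 / (q ^ 2 * (1 - q ^ 2) ^ 2) * 2) (C₃ := 0) le_rfl (by positivity) le_rfl ?_ ?_ ?_ <;>
    intro s p r ho hp hr
  · simp
  · cases s
    · have := (wt_pos hq (idx ho hp hr false)).le
      simp
      positivity
    · have := abs_leadF_sq_sub_one_le_wt hq hq₁ ho hp hr true (ρ := r) le_rfl ho
      convert this using 2
      simp
      ring
  · simp

section Ring

variable {R : Type} [Ring R] [Algebra ℂ R]

theorem comm_mul (d x y : R) :
    d * (x * y) - x * y * d = (d * x - x * d) * y + x * (d * y - y * d) := by noncomm_ring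

theorem comm_mul_sub (c l g c' p : R) (t : ℂ) :
    c * p + g * c' - t • l = (c - l) * p + g * c' + l * (p - t • 1) := by
  rw [mul_sub, mul_smul_comm, mul_one]
  noncomm_ring

theorem triple_sub (p c c' l l' : R) (t : ℂ) :
    p * c * c' - t • (l * l') = (p - t • 1) * c * c' + t • ((c - l) * c' + l * (c' - l')) := by
  rw [sub_mul, sub_mul, smul_mul_assoc, smul_mul_assoc, one_mul]
  have : (c - l) * c' + l * (c' - l') = c * c' - l * l' := by noncomm_ring
  rw [this, smul_sub]
  abel

theorem nilpotent_mul {e f : R} (he : e * e = 0) (hf : f * f = 0) (x y z w : ℂ) :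
    (x • f + y • e) * (z • f + w • e) = (x * w) • (f * e) + (y * z) • (e * f) := by
  simp only [add_mul, mul_add, smul_mul_smul_comm, he, hf, smul_zero, zero_add, add_zero]
  rw [add_comm]

theorem triple_split (fe ef p m : R) (t x y w : ℂ) :
    t • ((x * w) • fe + (y * w) • ef) - (t • (x • m) + t • (y • p)) =
      (t * x) • (w • fe - m) + (t * y) • (w • ef - p) := by
  module

end Ring

/-- The factor by which `π(B)` differs from `[2]^{1/2} x₋₁`. -/
def coeffB (q : ℝ) : ℂ := ((√(1 + q⁻¹ ^ 2) : ℝ) : ℂ)⁻¹ * ((√(qnum q 2) : ℝ) : ℂ)⁻¹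

/-- The factor by which `π(B*)` differs from `[2]^{1/2} x₁`. -/
def coeffBs (q : ℝ) : ℂ := -((√(1 + q ^ 2) : ℝ) : ℂ)⁻¹ * ((√(qnum q 2) : ℝ) : ℂ)⁻¹

theorem coeffB_mul_coeffBs (hq : 0 < q) (hq₁ : q < 1) :
    coeffB q * coeffBs q = -((q ^ 2 / (1 + q ^ 2) ^ 2 : ℝ) : ℂ) := by
  have h₂ : qnum q 2 = q⁻¹ * (1 + q ^ 2) := by
    have : q ^ 2 - 1 ≠ 0 := by nlinarith
    rw [qnum_eq_br hq, br_eq hq.ne' (rpow_pos_of_pos hq _).ne', Real.rpow_two]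
    field_simp
    ring
  have e : (√(1 + q⁻¹ ^ 2))⁻¹ * (√(1 + q ^ 2))⁻¹ * ((√(qnum q 2))⁻¹ * (√(qnum q 2))⁻¹) =
      q ^ 2 / (1 + q ^ 2) ^ 2 := by
    rw [← mul_inv (√(qnum q 2)), mul_self_sqrt (by rw [h₂]; positivity), h₂, ← mul_inv,
      ← Real.sqrt_mul (by positivity),
      show (1 + q⁻¹ ^ 2) * (1 + q ^ 2) = (q⁻¹ * (1 + q ^ 2)) ^ 2 by field_simp; ring,
      Real.sqrt_sq (by positivity)]
    field_simp
  rw [← e, coeffB, coeffBs]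
  push_cast
  ring

section Rep

variable {π : Sphere q →ₐ[ℂ] Module.End ℂ Dom}

theorem map_A (hπ : IsSpinRep q π) :
    π (Sphere.gen q .A) = (1 + (q : ℂ) ^ 2)⁻¹ • (1 - opX₀ q) := by
  have hq₂ : 1 + (q : ℂ) ^ 2 ≠ 0 := by
    have : (0 : ℝ) < 1 + q ^ 2 := by positivity
    exact_mod_cast this.ne'
  have e : 1 - opX₀ q = (1 + (q : ℂ) ^ 2) • π (Sphere.gen q .A) := by
    rw [hπ.map_A]
    exact sub_sub_cancel (1 : Module.End ℂ Dom) _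
  rw [e, smul_smul, inv_mul_cancel₀ hq₂, one_smul]

theorem map_B (hπ : IsSpinRep q π) : π (Sphere.gen q .B) = coeffB q • opXm₁' q := by
  have hr : ((√(1 + q⁻¹ ^ 2) : ℝ) : ℂ) ≠ 0 := by
    exact_mod_cast (Real.sqrt_pos.2 (by positivity)).ne'
  rw [coeffB, mul_smul, ← inv_smul_smul₀ hr (π _), ← hπ.map_B]
  rfl

theorem map_Bs (hπ : IsSpinRep q π) : π (Sphere.gen q .Bs) = coeffBs q • opX₁' q := by
  have hr : ((√(1 + q ^ 2) : ℝ) : ℂ) ≠ 0 := by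
    exact_mod_cast (Real.sqrt_pos.2 (by positivity)).ne'
  rw [coeffBs, mul_smul, neg_inv, ← inv_smul_smul₀ (neg_ne_zero.2 hr) (π _), ← hπ.map_Bs]
  rfl

/-- The leading part of `[D, a]`. -/
def lead (hq : 0 < q) (a : Sphere q) : Module.End ℂ Dom :=
  (Sphere.derE hq a * ((rt q)⁻¹ * coeffB q)) • opLeadF q +
    (Sphere.derF hq a * (-(q * (rt q)⁻¹) * coeffBs q)) • opLeadE q

theorem ord_lead (hq : 0 < q) (hq₁ : q < 1) (a : Sphere q) : Ord 1 (lead hq a) :=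
  ((ord_opLeadF hq hq₁).smul _).add moderate_one ((ord_opLeadE hq hq₁).smul _)

theorem lead_mul_lead (hq : 0 < q) (hq₁ : q < 1) (a b : Sphere q) :
    lead hq a * lead hq b =
      (Sphere.derE hq a * Sphere.derF hq b * ((q ^ 2 / (1 + q ^ 2) ^ 2 : ℝ) : ℂ)) •
          (opLeadF q * opLeadE q) +
        (Sphere.derF hq a * Sphere.derE hq b * ((q ^ 2 / (1 + q ^ 2) ^ 2 : ℝ) : ℂ)) •
          (opLeadE q * opLeadF q) := by
  have h := coeffB_mul_coeffBs hq hq₁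
  have hr := rt_ne_zero hq
  have hr' : (q : ℂ) * (rt q)⁻¹ * (rt q)⁻¹ = 1 := by
    rw [← rt_mul_self hq]
    field_simp
  refine (nilpotent_mul (R := Module.End ℂ Dom) (opLeadE_mul_self q) (opLeadF_mul_self q) _ _ _ _).trans ?_
  congr 2
  · linear_combination (-(Sphere.derE hq a * Sphere.derF hq b * (q * (rt q)⁻¹ * (rt q)⁻¹))) * h +
      (Sphere.derE hq a * Sphere.derF hq b * ((q ^ 2 / (1 + q ^ 2) ^ 2 : ℝ) : ℂ)) * hr'
  · linear_combination (-(Sphere.derF hq a * Sphere.derE hq b * (q * (rt q)⁻¹ * (rt q)⁻¹))) * h +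
      (Sphere.derF hq a * Sphere.derE hq b * ((q ^ 2 / (1 + q ^ 2) ^ 2 : ℝ) : ℂ)) * hr'

theorem ord_zero (ω : Idx → ℝ) : Ord ω 0 := ⟨0, 0, le_rfl, le_rfl, fun i => by simp⟩

theorem Ord.of_sub {S T : Module.End ℂ Dom} (h : Ord 1 (S - T)) (hT : Ord 1 T) : Ord 1 S := by
  convert h.add moderate_one hT using 1
  exact (sub_add_cancel (S : Module.End ℂ Dom) T).symm

theorem ord_gen (hq : 0 < q) (hq₁ : q < 1) (hπ : IsSpinRep q π) (g : SphereGen) :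
    Ord (wt q) (π (Sphere.gen q g)) := by
  cases g
  · rw [map_A hπ]
    exact (ord_one_sub_opX₀ hq hq₁).smul _
  · rw [map_B hπ]
    exact (ord_opXm₁' hq hq₁).smul _
  · rw [map_Bs hπ]
    exact (ord_opX₁' hq hq₁).smul _

theorem ord_comm_gen (hq : 0 < q) (hq₁ : q < 1) (hπ : IsSpinRep q π) (g : SphereGen) :
    Ord (wt q) (commD π (Sphere.gen q g) - lead hq (Sphere.gen q g)) := by
  have hr := rt_ne_zero hq
  have hq' := ofReal_ne_zero hq
  have key : ∀ (T L : Module.End ℂ Dom) (c : ℂ), Ord (wt q) (opD q * T - T * opD q - L) →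
      Ord (wt q) (opD q * (c • T) - (c • T) * opD q - c • L) := by
    intro T L c h
    have : opD q * (c • T) - (c • T) * opD q - c • L = c • (opD q * T - T * opD q - L) := by
      refine LinearMap.ext fun v => ?_
      simp [smul_sub]
    rw [this]
    exact h.smul c
  cases g
  · have := key (1 - opX₀ q) 0 (1 + (q : ℂ) ^ 2)⁻¹ (by
      have e : opD q * (1 - opX₀ q) - (1 - opX₀ q) * opD q - 0 =
          (-1 : ℂ) • (opD q * opX₀ q - opX₀ q * opD q) := by
        refine LinearMap.ext fun v => ?_
        simp
      rw [e]
      exact (ord_comm_opX₀ hq hq₁).smul _)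
    rw [← map_A hπ] at this
    convert this using 1
    simp [lead, commD]
  · have := key _ _ (coeffB q) (ord_comm_opXm₁' hq hq₁)
    rw [← map_B hπ] at this
    refine (congrArg (Ord (wt q)) ?_).mp this
    refine congrArg (commD π _ - ·) ?_
    simp [lead, hr]
  · have := key _ _ (coeffBs q) (ord_comm_opX₁' hq hq₁)
    rw [← map_Bs hπ] at this
    refine (congrArg (Ord (wt q)) ?_).mp this
    refine congrArg (commD π _ - ·) ?_
    simp only [lead, Sphere.derE_Bs, Sphere.derF_Bs, zero_mul, zero_smul, zero_add]
    congr 1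
    field_simp

theorem commD_mul (a b : Sphere q) : commD π (a * b) = commD π a * π b + π a * commD π b := by
  rw [commD, map_mul]
  exact comm_mul (R := Module.End ℂ Dom) _ _ _

theorem ord_rep_and_comm (hq : 0 < q) (hq₁ : q < 1) (hπ : IsSpinRep q π) (a : Sphere q) :
    Ord (wt q) (π a - Sphere.aug hq a • 1) ∧ Ord (wt q) (commD π a - lead hq a) := by
  have hm := moderate_wt hq hq₁
  induction a using Sphere.induction_left with
  | one =>
    constructor
    · convert ord_zero (wt q) using 1
      rw [map_one, map_one, one_smul]
      exact sub_self (1 : Module.End ℂ Dom)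
    · convert ord_zero (wt q) using 1
      refine LinearMap.ext fun v => ?_
      simp [commD, lead, Sphere.derE_one, Sphere.derF_one]
  | add x y hx hy =>
    constructor
    · convert hx.1.add hm hy.1 using 1
      rw [map_add, map_add]
      module
    · convert hx.2.add hm hy.2 using 1
      refine LinearMap.ext fun v => ?_
      simp [commD, lead, add_mul, add_smul]
      abel
  | smul c x hx =>
    constructor
    · convert hx.1.smul c using 1
      rw [map_smul, map_smul, smul_eq_mul]
      module
    · convert hx.2.smul c using 1
      refine LinearMap.ext fun v => ?_
      simp [commD, lead, mul_assoc, mul_smul, smul_sub]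
  | mul g x hx =>
    have hg := ord_gen hq hq₁ hπ g
    have hc := ord_comm_gen hq hq₁ hπ g
    have h₁ : Ord 1 (π x) := (hx.1.bounded hq hq₁).of_sub (ord_one.smul (Sphere.aug hq x))
    have h₂ : Ord 1 (commD π x) := (hx.2.bounded hq hq₁).of_sub (ord_lead hq hq₁ x)
    constructor
    · convert hg.mul_bounded hq hq₁ h₁ using 1
      rw [map_mul, map_mul, Sphere.aug_gen, zero_mul, zero_smul]
      exact sub_zero (_ : Module.End ℂ Dom)
    · have e : lead hq (Sphere.gen q g * x) = Sphere.aug hq x • lead hq (Sphere.gen q g) := by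
        simp only [lead, Sphere.derE_mul, Sphere.derF_mul, Sphere.aug_gen, zero_mul, add_zero]
        module
      rw [e, commD_mul]
      have := comm_mul_sub (commD π (Sphere.gen q g)) (lead hq (Sphere.gen q g))
        (π (Sphere.gen q g)) (commD π x) (π x) (Sphere.aug hq x)
      refine this ▸ ?_
      exact ((hc.mul_bounded hq hq₁ h₁).add hm (hg.mul_bounded hq hq₁ h₂)).add hm
        ((ord_lead hq hq₁ _).bounded_mul hx.1)

theorem ord_commD (hq : 0 < q) (hq₁ : q < 1) (hπ : IsSpinRep q π) (a : Sphere q) :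
    Ord 1 (commD π a) :=
  ((ord_rep_and_comm hq hq₁ hπ a).2.bounded hq hq₁).of_sub (ord_lead hq hq₁ a)

/-- The eigenvalues of the leading part of `γ a₀ [D, a₁] [D, a₂]`. -/
def symbol (hq : 0 < q) (a₀ a₁ a₂ : Sphere q) (s : Bool) : ℂ :=
  Sphere.aug hq a₀ * if s then Sphere.derF hq a₁ * Sphere.derE hq a₂
    else -(Sphere.derE hq a₁ * Sphere.derF hq a₂)

theorem ord_triple_sub (hq : 0 < q) (hq₁ : q < 1) (hπ : IsSpinRep q π) (a₀ a₁ a₂ : Sphere q) :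
    Ord (wt q) (opγ * π a₀ * commD π a₁ * commD π a₂ -
      diagOp fun i => symbol hq a₀ a₁ a₂ i.2) := by
  have hm := moderate_wt hq hq₁
  have h₀ := (ord_rep_and_comm hq hq₁ hπ a₀).1
  have h₁ := (ord_rep_and_comm hq hq₁ hπ a₁).2
  have h₂ := (ord_rep_and_comm hq hq₁ hπ a₂).2
  have hc₁ := ord_commD hq hq₁ hπ a₁
  have hc₂ := ord_commD hq hq₁ hπ a₂
  have hA : Ord (wt q) (π a₀ * commD π a₁ * commD π a₂ -
      Sphere.aug hq a₀ • (lead hq a₁ * lead hq a₂)) := by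
    have := triple_sub (π a₀) (commD π a₁) (commD π a₂) (lead hq a₁) (lead hq a₂)
      (Sphere.aug hq a₀)
    refine this ▸ ?_
    exact ((h₀.mul_bounded hq hq₁ hc₁).mul_bounded hq hq₁ hc₂).add hm
      (((h₁.mul_bounded hq hq₁ hc₂).add hm ((ord_lead hq hq₁ a₁).bounded_mul h₂)).smul _)
  have hB : Ord (wt q) (Sphere.aug hq a₀ • (lead hq a₁ * lead hq a₂) -
      (Sphere.aug hq a₀ • ((Sphere.derE hq a₁ * Sphere.derF hq a₂) • proj false) +
        Sphere.aug hq a₀ • ((Sphere.derF hq a₁ * Sphere.derE hq a₂) • proj true))) := by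
    rw [lead_mul_lead hq hq₁]
    have := triple_split (opLeadF q * opLeadE q) (opLeadE q * opLeadF q)
      (proj true) (proj false) (Sphere.aug hq a₀) (Sphere.derE hq a₁ * Sphere.derF hq a₂)
      (Sphere.derF hq a₁ * Sphere.derE hq a₂) ((q ^ 2 / (1 + q ^ 2) ^ 2 : ℝ) : ℂ)
    refine this ▸ ?_
    exact ((ord_opLeadF_mul_opLeadE hq hq₁).smul _).add hm
      ((ord_opLeadE_mul_opLeadF hq hq₁).smul _)
  have := ord_opγ.bounded_mul (hA.add hm hB)
  convert this using 1
  refine Finsupp.lhom_ext' fun i => LinearMap.ext_ring ?_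
  obtain ⟨i, s⟩ := i
  simp only [comp_apply, lsub_apply, ladd_apply, lsmul_apply,
    Module.End.mul_apply, Finsupp.lsingle_apply, map_sub, map_add, map_smul, proj, opγ, diagOp,
    opOf_single]
  cases s
  · simp only [symbol, Idx.sgn, Bool.false_eq_true, if_false, if_true, reduceCtorEq]
    push_cast
    module
  · simp only [symbol, Idx.sgn, Bool.false_eq_true, if_false, if_true, reduceCtorEq]
    push_cast
    module

end Rep

/-! ### Sums over the labels -/

/-- The pair `(l - k, l + k)` and the sign of a label. -/
def pos (i : Idx) : (ℕ × ℕ) × Bool :=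
  ((((i.1.1.1 - i.1.1.2) / 2).toNat, ((i.1.1.1 + i.1.1.2) / 2).toNat), i.2)

theorem pos_idx {p r : ℕ} (ho : Odd ((p : ℤ) + r)) (s : Bool) :
    pos (idx ho (Int.natCast_nonneg p) (Int.natCast_nonneg r) s) = ((p, r), s) := by
  have e₁ : ((p : ℤ) + r - (r - p)) / 2 = p := by omega
  have e₂ : ((p : ℤ) + r + (r - p)) / 2 = r := by omega
  simp only [pos, idx, e₁, e₂, Int.toNat_natCast]

theorem exists_natCast_idx (i : Idx) : ∃ (p r : ℕ) (ho : Odd ((p : ℤ) + r)),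
    i = idx ho (Int.natCast_nonneg p) (Int.natCast_nonneg r) i.2 := by
  obtain ⟨p, r, ho, hp, hr, e⟩ := exists_idx i
  lift p to ℕ using hp
  lift r to ℕ using hr
  exact ⟨p, r, ho, e⟩

theorem pos_injective : Function.Injective pos := by
  intro i j h
  obtain ⟨p, r, ho, e⟩ := exists_natCast_idx i
  obtain ⟨p', r', ho', e'⟩ := exists_natCast_idx j
  rw [e, e', pos_idx, pos_idx] at h
  simp only [Prod.mk.injEq] at h
  obtain ⟨⟨rfl, rfl⟩, h⟩ := h
  rw [e, e', h]

theorem pos_fst (i : Idx) : ((pos i).1.1 : ℝ) = i.l - i.k ∧ ((pos i).1.2 : ℝ) = i.l + i.k := by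
  obtain ⟨p, r, ho, e⟩ := exists_natCast_idx i
  rw [e, pos_idx, idx_l, idx_k]
  push_cast
  constructor <;> ring

theorem summable_rpow (hq : 0 < q) (hq₁ : q < 1) {a b : ℝ} (h₁ : 0 < a - b) (h₂ : 0 < a + b) :
    Summable fun i : Idx => q ^ (a * i.l + b * i.k) := by
  have g : ∀ {x : ℝ}, 0 < x → Summable fun n : ℕ => (q ^ x) ^ n := fun hx =>
    summable_geometric_of_lt_one (rpow_pos_of_pos hq _).le (Real.rpow_lt_one hq.le hq₁ hx)
  have hg := (g (half_pos h₁)).mul_of_nonneg (g (half_pos h₂)) (fun n => by positivity)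
    (fun n => by positivity)
  have hs : Summable fun _ : Bool => (1 : ℝ) := Summable.of_finite
  refine ((hg.mul_of_nonneg hs (fun n => by positivity) (fun n => by positivity)).comp_injective
    pos_injective).congr fun i => ?_
  simp only [Function.comp_apply, mul_one]
  rw [← rpow_natCast, ← rpow_natCast, ← rpow_mul hq.le, ← rpow_mul hq.le,
    ← rpow_add hq, (pos_fst i).1, (pos_fst i).2]
  congr 1
  ring

theorem hasSum_geometric_mul {u v : ℂ} (hu : ‖u‖ < 1) (hv : ‖v‖ < 1) :
    HasSum (fun x : ℕ × ℕ => u ^ x.1 * v ^ x.2) ((1 - u)⁻¹ * (1 - v)⁻¹) :=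
  (hasSum_geometric_of_norm_lt_one hu).mul (hasSum_geometric_of_norm_lt_one hv)
    (summable_mul_of_summable_norm (summable_norm_geometric_of_norm_lt_one hu)
      (summable_norm_geometric_of_norm_lt_one hv))

theorem hasSum_odd {u v : ℂ} (hu : ‖u‖ < 1) (hv : ‖v‖ < 1) :
    HasSum (fun x : ℕ × ℕ => if Odd (x.1 + x.2) then u ^ x.1 * v ^ x.2 else 0)
      ((u + v) / ((1 - u ^ 2) * (1 - v ^ 2))) := by
  have h := ((hasSum_geometric_mul hu hv).sub
    (hasSum_geometric_mul (u := -u) (v := -v) (by simpa) (by simpa))).mul_left (1 / 2)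
  have ne : ∀ {w : ℂ}, ‖w‖ < 1 → 1 - w ≠ 0 ∧ 1 + w ≠ 0 := by
    intro w hw
    constructor
    · intro h
      rw [sub_eq_zero] at h
      simp [← h] at hw
    · intro h
      rw [eq_neg_of_add_eq_zero_right h] at hw
      simp at hw
  have e : 1 / 2 * ((1 - u)⁻¹ * (1 - v)⁻¹ - (1 - -u)⁻¹ * (1 - -v)⁻¹) =
      (u + v) / ((1 - u ^ 2) * (1 - v ^ 2)) := by
    have h₁ := ne hu
    have h₂ := ne hv
    rw [show 1 - u ^ 2 = (1 - u) * (1 + u) by ring, show 1 - v ^ 2 = (1 - v) * (1 + v) by ring,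
      sub_neg_eq_add, sub_neg_eq_add]
    have := h₁.1
    have := h₁.2
    have := h₂.1
    have := h₂.2
    field_simp
    ring
  rw [e] at h
  refine (congrArg (HasSum · _) (funext fun x => ?_)).mp h
  split_ifs with ho
  · rw [neg_pow u, neg_pow v, mul_mul_mul_comm, ← pow_add, ho.neg_one_pow]
    ring
  · rw [neg_pow u, neg_pow v, mul_mul_mul_comm, ← pow_add,
      (Nat.not_odd_iff_even.1 ho).neg_one_pow]
    ring

theorem hasSum_pos {f : ℕ × ℕ → ℂ} {t : ℂ} (hf : HasSum f t)
    (h₀ : ∀ x, ¬Odd (x.1 + x.2) → f x = 0) (c : Bool → ℂ) :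
    HasSum (fun i : Idx => f (pos i).1 * c (pos i).2) (t * (c true + c false)) := by
  have hc : HasSum c (c true + c false) := by
    rw [← Fintype.sum_bool]
    exact hasSum_fintype c
  have hs : Summable fun x : (ℕ × ℕ) × Bool => f x.1 * c x.2 :=
    summable_mul_of_summable_norm hf.summable.norm hc.summable.norm
  refine (pos_injective.hasSum_iff fun x hx => ?_).2 (HasSum.mul hf hc hs)
  obtain ⟨⟨p, r⟩, s⟩ := x
  by_cases ho : Odd (p + r)
  · exact absurd ⟨_, pos_idx (by exact_mod_cast ho) s⟩ hx
  · rw [h₀ _ ho, zero_mul]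

theorem odd_pos (i : Idx) : Odd ((pos i).1.1 + (pos i).1.2) := by
  obtain ⟨p, r, ho, e⟩ := exists_natCast_idx i
  rw [e, pos_idx]
  exact_mod_cast ho

theorem hasSum_label {u v : ℂ} (hu : ‖u‖ < 1) (hv : ‖v‖ < 1) (c : Bool → ℂ) :
    HasSum (fun i : Idx => u ^ (pos i).1.1 * v ^ (pos i).1.2 * c i.2)
      ((u + v) / ((1 - u ^ 2) * (1 - v ^ 2)) * (c true + c false)) := by
  have h := hasSum_pos (hasSum_odd hu hv) (fun x hx => if_neg hx) c
  refine (congrArg (HasSum · _) (funext fun i => ?_)).mp h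
  rw [if_pos (odd_pos i)]
  rfl

/-! ### Trace class operators -/

theorem toH_single (i : Idx) : toH (Finsupp.single i 1) = basisH i := by simp [toH]

theorem inner_basisH_toH (i : Idx) (v : Dom) : inner ℂ (basisH i) (toH v) = v i := by
  induction v using Finsupp.induction_linear with
  | zero => simp
  | add v w hv hw => rw [map_add, inner_add_right, hv, hw, Finsupp.add_apply]
  | single j c =>
    classical
    rw [← Finsupp.smul_single_one, map_smul, toH_single, inner_smul_right,
      orthonormal_iff_ite.1 basisH.orthonormal i j, Finsupp.smul_apply, Finsupp.single_apply]
    simp [eq_comm]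

theorem norm_toH_le (v : Dom) : ‖toH v‖ ≤ l1 v := by
  rw [toH, Finsupp.linearCombination_apply, l1]
  refine (norm_sum_le _ _).trans (Finset.sum_le_sum fun i _ => ?_)
  rw [norm_smul, basisH.orthonormal.1 i, mul_one]

section TraceClass

variable {ι H : Type} [NormedAddCommGroup H] [InnerProductSpace ℂ H] [CompleteSpace H]

theorem norm_abs_apply (S : H →L[ℂ] H) (x : H) : ‖CFC.abs S x‖ = ‖S x‖ := by
  have hs : ContinuousLinearMap.adjoint (CFC.abs S) = CFC.abs S :=
    (CFC.abs_nonneg S).isSelfAdjoint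
  have h : inner ℂ (CFC.abs S x) (CFC.abs S x) = inner ℂ (S x) (S x) := by
    rw [← ContinuousLinearMap.adjoint_inner_right, hs, ← mul_apply_eq_comp,
      CFC.abs_mul_abs, mul_apply_eq_comp, ContinuousLinearMap.star_eq_adjoint,
      ContinuousLinearMap.adjoint_inner_right]
  rw [inner_self_eq_norm_sq_to_K, inner_self_eq_norm_sq_to_K] at h
  have h' : ‖CFC.abs S x‖ ^ 2 = ‖S x‖ ^ 2 := by exact_mod_cast h
  exact (pow_left_inj₀ (norm_nonneg _) (norm_nonneg _) two_ne_zero).1 h'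

theorem isTraceClassOp_of_summable {e : HilbertBasis ι ℂ H} {S : H →L[ℂ] H}
    (h : Summable fun i => ‖S (e i)‖) : IsTraceClassOp e S := by
  refine Summable.of_norm_bounded h fun i => ?_
  calc _ ≤ ‖inner ℂ (e i) (CFC.abs S (e i))‖ := Complex.abs_re_le_norm _
    _ ≤ ‖e i‖ * ‖CFC.abs S (e i)‖ := norm_inner_le_norm _ _
    _ = _ := by rw [e.orthonormal.1 i, one_mul, norm_abs_apply]

end TraceClass

theorem isTraceClass_of_summable {T : Module.End ℂ Dom}
    (h : Summable fun i => l1 (T (Finsupp.single i 1))) : IsTraceClass T := by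
  classical
  have hF : Summable fun i =>
      (innerSL ℂ (basisH i)).smulRight (toH (T (Finsupp.single i 1))) := by
    refine Summable.of_norm_bounded h fun i => ?_
    rw [ContinuousLinearMap.norm_smulRight_apply, innerSL_apply_norm, basisH.orthonormal.1 i,
      one_mul]
    exact norm_toH_le _
  have hS : ∀ j, (∑' i, (innerSL ℂ (basisH i)).smulRight (toH (T (Finsupp.single i 1))))
      (basisH j) = toH (T (Finsupp.single j 1)) := by
    intro j
    have := hF.hasSum.mapL (ContinuousLinearMap.apply ℂ HilbertH (basisH j))
    refine this.unique ?_
    convert hasSum_ite_eq j (toH (T (Finsupp.single j 1))) using 1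
    funext i
    simp only [ContinuousLinearMap.apply_apply, ContinuousLinearMap.smulRight_apply,
      innerSL_apply_apply, orthonormal_iff_ite.1 basisH.orthonormal i j]
    split_ifs with h
    · rw [h, one_smul]
    · rw [zero_smul]
  refine ⟨∑' i, (innerSL ℂ (basisH i)).smulRight (toH (T (Finsupp.single i 1))), fun v => ?_,
    isTraceClassOp_of_summable (h.of_nonneg_of_le (fun _ => norm_nonneg _) fun i => ?_)⟩
  · induction v using Finsupp.induction_linear with
    | zero => simp
    | add v w hv hw => simp only [map_add, hv, hw]
    | single j c =>
      rw [← Finsupp.smul_single_one, map_smul, map_smul, map_smul, map_smul, toH_single, hS]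
  · rw [hS]
    exact norm_toH_le _

/-! ### The zeta functions -/

theorem cpow_of_pos {x : ℝ} (hx : 0 < x) (w : ℂ) : (x : ℂ) ^ w = Complex.exp (w * log x) := by
  rw [Complex.cpow_def_of_ne_zero (by exact_mod_cast hx.ne'), Complex.ofReal_log hx.le, mul_comm]

theorem norm_exp_sub_one_le (w : ℂ) : ‖Complex.exp w - 1‖ ≤ ‖w‖ * Real.exp ‖w‖ := by
  simpa using Complex.norm_exp_sub_sum_le_norm_mul_exp w 1

/-- The number `log ((q⁻¹ - q) q^{l + 1/2})`. -/
def expo (q l : ℝ) : ℝ := log (q⁻¹ - q) + (l + 1 / 2) * log q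

theorem log_qnum (hq : 0 < q) (hq₁ : q < 1) {l : ℝ} (hl : 0 < l) :
    log (qnum q (l + 1 / 2)) = -expo q l + log (1 - q ^ (2 * l + 1)) := by
  have hd := inv_sub_pos hq hq₁
  have hp := rpow_pos_of_pos hq (l + 1 / 2)
  have hy : q ^ (2 * l + 1) < 1 := Real.rpow_lt_one hq.le hq₁ (by linarith)
  have hy' : q ^ (2 * l + 1) = q ^ (l + 1 / 2) * q ^ (l + 1 / 2) := by
    rw [← rpow_add hq]
    congr 1
    ring
  have : qnum q (l + 1 / 2) = ((q⁻¹ - q) * q ^ (l + 1 / 2))⁻¹ * (1 - q ^ (2 * l + 1)) := by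
    rw [qnum, ← neg_sub q⁻¹ q, rpow_neg hq.le, hy']
    generalize q⁻¹ - q = c at *
    field_simp
    ring
  rw [this, Real.log_mul (by positivity) (by linarith), Real.log_inv,
    Real.log_mul hd.ne' hp.ne', Real.log_rpow hq, expo]

theorem abs_log_le (hq : 0 < q) (hq₁ : q < 1) {l : ℝ} (hl : 1 / 2 ≤ l) :
    |log (1 - q ^ (2 * l + 1))| ≤ (1 - q ^ 2)⁻¹ * q ^ l := by
  have hq₂ : 0 < 1 - q ^ 2 := by nlinarith
  have hy : q ^ (2 * l + 1) ≤ q ^ 2 := by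
    rw [← Real.rpow_two]
    exact rpow_le_rpow_of_exponent_ge hq hq₁.le (by linarith)
  have hyl : q ^ (2 * l + 1) ≤ q ^ l :=
    rpow_le_rpow_of_exponent_ge hq hq₁.le (by linarith)
  have hy₀ := rpow_pos_of_pos hq (2 * l + 1)
  have h₁ : 0 < 1 - q ^ (2 * l + 1) := by linarith
  rw [abs_of_nonpos (Real.log_nonpos h₁.le (by linarith)), ← Real.log_inv]
  refine (Real.log_le_sub_one_of_pos (inv_pos.2 h₁)).trans ?_
  have : (1 - q ^ (2 * l + 1))⁻¹ - 1 = (1 - q ^ (2 * l + 1))⁻¹ * q ^ (2 * l + 1) := by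
    field_simp
    ring
  rw [this]
  gcongr

theorem half_le_l (i : Idx) : 1 / 2 ≤ i.l := by
  have : (1 : ℝ) ≤ i.1.1.1 := by exact_mod_cast i.1.2.1
  rw [Idx.l]
  linarith

/-- The eigenvalue of `|D|^{-z}`. -/
theorem qnum_cpow (hq : 0 < q) (hq₁ : q < 1) (i : Idx) (z : ℂ) :
    (qnum q (i.l + 1 / 2) : ℂ) ^ (-z) =
      Complex.exp (z * expo q i.l) * Complex.exp (-z * log (1 - q ^ (2 * i.l + 1))) := by
  have := l_pos i
  rw [cpow_of_pos (qnum_pos hq hq₁ (by linarith)), log_qnum hq hq₁ (l_pos i), ← Complex.exp_add]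
  push_cast
  ring_nf

/-- A bound for `|log (q⁻¹ - q)|` on bounded sets. -/
theorem norm_exp_expo_le (hq : 0 < q) (hq₁ : q < 1) {σ R : ℝ} (hσ : 0 ≤ σ) (i : Idx) {z : ℂ}
    (hz : σ ≤ z.re) (hR : ‖z‖ ≤ R) :
    ‖Complex.exp (z * expo q i.l)‖ ≤ Real.exp (R * |log (q⁻¹ - q)|) * q ^ (σ * i.l) := by
  have hl := l_pos i
  have hL := Real.log_neg hq hq₁
  rw [Complex.norm_exp, Complex.re_mul_ofReal, Real.rpow_def_of_pos hq, ← Real.exp_add, expo]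
  refine Real.exp_le_exp.2 ?_
  have hre : |z.re| ≤ R := (Complex.abs_re_le_norm z).trans hR
  have h₁ : z.re * log (q⁻¹ - q) ≤ R * |log (q⁻¹ - q)| :=
    (le_abs_self _).trans (by rw [abs_mul]; gcongr)
  have h₂ : z.re * ((i.l + 1 / 2) * log q) ≤ log q * (σ * i.l) := by
    have h : σ * i.l ≤ z.re * (i.l + 1 / 2) := by
      apply mul_le_mul hz <;> linarith
    calc _ = (z.re * (i.l + 1 / 2)) * log q := by ring
      _ ≤ (σ * i.l) * log q := mul_le_mul_of_nonpos_right h hL.le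
      _ = _ := by ring
  linarith

/-- The terms of the regular part of the zeta function. -/
def regTerm (q : ℝ) (d : Idx → ℂ) (c : Bool → ℂ) (i : Idx) (z : ℂ) : ℂ :=
  ((q ^ (-2 * i.k) : ℝ) : ℂ) *
    (d i * (qnum q (i.l + 1 / 2) : ℂ) ^ (-z) - c i.2 * Complex.exp (z * expo q i.l))

theorem norm_correction_le (hq : 0 < q) (hq₁ : q < 1) {R : ℝ} (i : Idx) {z : ℂ} (hR : ‖z‖ ≤ R) :
    ‖-z * (log (1 - q ^ (2 * i.l + 1)) : ℂ)‖ ≤ R * (1 - q ^ 2)⁻¹ * q ^ i.l := by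
  have hR₀ : 0 ≤ R := (norm_nonneg z).trans hR
  rw [norm_mul, norm_neg, Complex.norm_real, mul_assoc]
  exact mul_le_mul hR (abs_log_le hq hq₁ (half_le_l i)) (norm_nonneg _) hR₀

theorem norm_regTerm_le (hq : 0 < q) (hq₁ : q < 1) {d : Idx → ℂ} {c : Bool → ℂ} {C σ R : ℝ}
    (hC : 0 ≤ C) (hd : ∀ i, ‖d i - c i.2‖ ≤ C * wt q i) (hσ : 0 ≤ σ) (hR₀ : 0 ≤ R) :
    ∃ K : ℝ, 0 ≤ K ∧ ∀ (i : Idx) (z : ℂ), σ ≤ z.re → ‖z‖ ≤ R →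
      ‖regTerm q d c i z‖ ≤ K * (q ^ (-2 * i.k) * q ^ (σ * i.l) * wt q i) := by
  have hq₂ : 0 < 1 - q ^ 2 := by nlinarith
  refine ⟨Real.exp (R * |log (q⁻¹ - q)|) * (C * Real.exp (R * (1 - q ^ 2)⁻¹) +
    (‖c true‖ + ‖c false‖) * (R * (1 - q ^ 2)⁻¹ * Real.exp (R * (1 - q ^ 2)⁻¹))),
    by positivity, fun i z hz hR => ?_⟩
  have hk := rpow_pos_of_pos hq (-2 * i.k)
  have hql := rpow_pos_of_pos hq i.l
  have hql₁ : q ^ i.l ≤ 1 := rpow_le_one hq.le hq₁.le (l_pos i).le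
  have hqw : q ^ i.l ≤ wt q i := le_add_of_nonneg_right (rpow_pos_of_pos hq _).le
  have hw := wt_pos hq i
  have hc : ‖c i.2‖ ≤ ‖c true‖ + ‖c false‖ := by
    cases i.2
    · exact le_add_of_nonneg_left (norm_nonneg _)
    · exact le_add_of_nonneg_right (norm_nonneg _)
  have h₁ := norm_correction_le hq hq₁ i hR
  have h₁' : ‖-z * (log (1 - q ^ (2 * i.l + 1)) : ℂ)‖ ≤ R * (1 - q ^ 2)⁻¹ :=
    h₁.trans (mul_le_of_le_one_right (by positivity) hql₁)
  have h₂ := norm_exp_expo_le hq hq₁ hσ i hz hR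
  rw [regTerm, qnum_cpow hq hq₁]
  generalize -z * (log (1 - q ^ (2 * i.l + 1)) : ℂ) = w at *
  have e : d i * (Complex.exp (z * expo q i.l) * Complex.exp w) -
      c i.2 * Complex.exp (z * expo q i.l) = Complex.exp (z * expo q i.l) *
        ((d i - c i.2) * Complex.exp w + c i.2 * (Complex.exp w - 1)) := by ring
  have h₃ : ‖Complex.exp w‖ ≤ Real.exp (R * (1 - q ^ 2)⁻¹) :=
    (Complex.norm_exp_le_exp_norm w).trans (Real.exp_le_exp.2 h₁')
  have h₄ : ‖Complex.exp w - 1‖ ≤ R * (1 - q ^ 2)⁻¹ * wt q i * Real.exp (R * (1 - q ^ 2)⁻¹) := by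
    refine (norm_exp_sub_one_le w).trans ?_
    have : ‖w‖ ≤ R * (1 - q ^ 2)⁻¹ * wt q i := h₁.trans (by gcongr)
    gcongr
  rw [e, norm_mul, norm_mul, Complex.norm_real, Real.norm_of_nonneg hk.le]
  calc _ ≤ q ^ (-2 * i.k) * ((Real.exp (R * |log (q⁻¹ - q)|) * q ^ (σ * i.l)) *
        (C * wt q i * Real.exp (R * (1 - q ^ 2)⁻¹) + (‖c true‖ + ‖c false‖) *
          (R * (1 - q ^ 2)⁻¹ * wt q i * Real.exp (R * (1 - q ^ 2)⁻¹)))) := by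
        gcongr
        refine (norm_add_le _ _).trans ?_
        rw [norm_mul, norm_mul]
        have := hd i
        gcongr
    _ = _ := by ring

theorem summable_weight (hq : 0 < q) (hq₁ : q < 1) {σ : ℝ} (hσ : 1 < σ) :
    Summable fun i : Idx => q ^ (-2 * i.k) * q ^ (σ * i.l) * wt q i := by
  refine ((summable_rpow hq hq₁ (a := σ + 1) (b := -2) (by linarith) (by linarith)).add
    (summable_rpow hq hq₁ (a := σ + 1) (b := -1) (by linarith) (by linarith))).congr fun i => ?_
  rw [wt, mul_add, ← rpow_add hq, ← rpow_add hq, ← rpow_add hq]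
  congr 2 <;> ring

theorem analyticAt_regTerm (hq : 0 < q) (hq₁ : q < 1) {d : Idx → ℂ} {c : Bool → ℂ} {C : ℝ}
    (hC : 0 ≤ C) (hd : ∀ i, ‖d i - c i.2‖ ≤ C * wt q i) {z : ℂ} (hz : 1 < z.re) :
    AnalyticAt ℂ (fun z => ∑' i, regTerm q d c i z) z := by
  obtain ⟨K, hK, h⟩ := norm_regTerm_le hq hq₁ hC hd (σ := (1 + z.re) / 2) (R := ‖z‖ + 1)
    (by linarith) (by positivity)
  have hU : IsOpen ({w : ℂ | (1 + z.re) / 2 < w.re} ∩ Metric.ball 0 (‖z‖ + 1)) :=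
    (isOpen_lt continuous_const Complex.continuous_re).inter Metric.isOpen_ball
  refine (Complex.differentiableOn_tsum_of_summable_norm
    ((summable_weight hq hq₁ (σ := (1 + z.re) / 2) (by linarith)).mul_left K) (fun i => ?_) hU
    fun i w hw => h i w hw.1.le ?_).analyticAt (hU.mem_nhds ⟨?_, ?_⟩)
  · refine Differentiable.differentiableOn ?_
    have : regTerm q d c i = fun z => ((q ^ (-2 * i.k) : ℝ) : ℂ) *
        (d i * (Complex.exp (z * expo q i.l) *
          Complex.exp (-z * log (1 - q ^ (2 * i.l + 1)))) -
            c i.2 * Complex.exp (z * expo q i.l)) :=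
      funext fun z => by rw [regTerm, qnum_cpow hq hq₁]
    rw [this]
    fun_prop
  · simpa using (Metric.mem_ball.1 hw.2).le
  · simp only [Set.mem_ofPred_eq]
    linarith
  · simp

/-- The singular part of the zeta function. -/
def sing (q : ℝ) (z : ℂ) : ℂ :=
  Complex.exp (z * expo q 0) *
    ((Complex.exp (log q + z * log q / 2) + Complex.exp (-log q + z * log q / 2)) /
      ((1 - Complex.exp (log q + z * log q / 2) ^ 2) *
        (1 - Complex.exp (-log q + z * log q / 2) ^ 2)))

theorem hasSum_sing (hq : 0 < q) (hq₁ : q < 1) (c : Bool → ℂ) {z : ℂ} (hz : 2 < z.re) :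
    HasSum (fun i : Idx => ((q ^ (-2 * i.k) : ℝ) : ℂ) * (c i.2 * Complex.exp (z * expo q i.l)))
      (sing q z * (c true + c false)) := by
  have hL := Real.log_neg hq hq₁
  have hu : ‖Complex.exp (log q + z * log q / 2)‖ < 1 := by
    rw [Complex.norm_exp, Real.exp_lt_one_iff]
    simp only [Complex.add_re, Complex.ofReal_re, Complex.div_ofNat_re, Complex.re_mul_ofReal]
    nlinarith
  have hv : ‖Complex.exp (-log q + z * log q / 2)‖ < 1 := by
    rw [Complex.norm_exp, Real.exp_lt_one_iff]
    simp only [Complex.add_re, Complex.neg_re, Complex.ofReal_re, Complex.div_ofNat_re,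
      Complex.re_mul_ofReal]
    nlinarith
  have h := (hasSum_label hu hv c).mul_left (Complex.exp (z * expo q 0))
  rw [← mul_assoc] at h
  refine (congrArg (HasSum · _) (funext fun i => ?_)).mp h
  have h₁ : ((pos i).1.1 : ℂ) = i.l - i.k := by exact_mod_cast (pos_fst i).1
  have h₂ : ((pos i).1.2 : ℂ) = i.l + i.k := by exact_mod_cast (pos_fst i).2
  rw [← Complex.exp_nat_mul, ← Complex.exp_nat_mul, h₁, h₂, Real.rpow_def_of_pos hq,
    Complex.ofReal_exp, ← Complex.exp_add, mul_left_comm _ (c i.2), ← Complex.exp_add, mul_comm,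
    mul_right_comm, ← mul_assoc, mul_comm _ (c i.2), mul_assoc, ← Complex.exp_add]
  congr 2
  simp only [expo]
  push_cast
  ring

theorem hasSum_zeta (hq : 0 < q) (hq₁ : q < 1) {d : Idx → ℂ} {c : Bool → ℂ} {C : ℝ}
    (hC : 0 ≤ C) (hd : ∀ i, ‖d i - c i.2‖ ≤ C * wt q i) {z : ℂ} (hz : 2 < z.re) :
    HasSum (fun i : Idx => ((q ^ (-2 * i.k) : ℝ) : ℂ) *
      (d i * (qnum q (i.l + 1 / 2) : ℂ) ^ (-z)))
      (∑' i, regTerm q d c i z + sing q z * (c true + c false)) := by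
  obtain ⟨K, hK, h⟩ := norm_regTerm_le hq hq₁ hC hd (σ := z.re) (R := ‖z‖)
    (by linarith) (by positivity)
  have hs : Summable fun i => regTerm q d c i z :=
    Summable.of_norm_bounded ((summable_weight hq hq₁ (by linarith)).mul_left K)
      fun i => h i z le_rfl le_rfl
  refine (congrArg (HasSum · _) (funext fun i => ?_)).mp (hs.hasSum.add (hasSum_sing hq hq₁ c hz))
  rw [regTerm]
  ring

/-- The residue of the zeta function of `D`. -/
def residue (q : ℝ) : ℝ :=
  Real.exp (2 * expo q 0) * ((Real.exp (2 * log q) + 1) / (1 - Real.exp (2 * log q) ^ 2)) *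
    (-log q)⁻¹

theorem residue_ne_zero (hq : 0 < q) (hq₁ : q < 1) : residue q ≠ 0 := by
  have hL := Real.log_neg hq hq₁
  have h₁ : Real.exp (2 * log q) < 1 := Real.exp_lt_one_iff.2 (by linarith)
  have h₀ := Real.exp_pos (2 * log q)
  have : 0 < 1 - Real.exp (2 * log q) ^ 2 := by nlinarith
  have : 0 < -log q := by linarith
  rw [residue]
  positivity

theorem meromorphicAt_sing (q : ℝ) (z : ℂ) : MeromorphicAt (sing q) z := by
  have h : ∀ f : ℂ → ℂ, Differentiable ℂ f → MeromorphicAt f z := fun f hf =>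
    (hf.analyticAt z).meromorphicAt
  refine (h (fun z => Complex.exp (z * expo q 0)) (by fun_prop)).mul
    ((h (fun z => Complex.exp (log q + z * log q / 2) +
      Complex.exp (-log q + z * log q / 2)) (by fun_prop)).div
    (h (fun z => (1 - Complex.exp (log q + z * log q / 2) ^ 2) *
      (1 - Complex.exp (-log q + z * log q / 2) ^ 2)) (by fun_prop)))

theorem tendsto_sing (hq : 0 < q) (hq₁ : q < 1) :
    Filter.Tendsto (fun z : ℂ => (z - 2) * sing q z) (nhdsWithin 2 {2}ᶜ) (nhds (residue q)) := by
  have hL := Real.log_neg hq hq₁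
  have hL' : (log q : ℂ) ≠ 0 := by exact_mod_cast hL.ne
  have hd : HasDerivAt (fun z : ℂ => 1 - Complex.exp (-log q + z * log q / 2) ^ 2)
      (-log q : ℂ) 2 := by
    have h₁ : HasDerivAt (fun z : ℂ => -(log q : ℂ) + z * log q / 2)
        ((log q : ℂ) / 2) 2 := by
      simpa using (((hasDerivAt_id (2 : ℂ)).mul_const (log q : ℂ)).div_const 2).const_add
        (-(log q : ℂ))
    refine ((h₁.cexp.pow 2).const_sub 1).congr_deriv ?_
    rw [show -(log q : ℂ) + 2 * log q / 2 = 0 by ring, Complex.exp_zero]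
    push_cast
    ring
  have h₁ := (hasDerivAt_iff_tendsto_slope.1 hd).inv₀ (neg_ne_zero.2 hL')
  have hu : (1 : ℂ) - Complex.exp (log q + 2 * log q / 2) ^ 2 ≠ 0 := by
    have : Real.exp (2 * log q) < 1 := Real.exp_lt_one_iff.2 (by linarith)
    have h₀ := Real.exp_pos (2 * log q)
    have : 1 - Real.exp (2 * log q) ^ 2 ≠ 0 := by nlinarith
    rw [show (log q : ℂ) + 2 * log q / 2 = ((2 * log q : ℝ) : ℂ) by push_cast; ring]
    exact_mod_cast this
  have h₂ : ContinuousAt (fun z : ℂ => Complex.exp (z * expo q 0) *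
      ((Complex.exp (log q + z * log q / 2) +
        Complex.exp (-log q + z * log q / 2)) /
      (1 - Complex.exp (log q + z * log q / 2) ^ 2))) 2 := by
    refine ContinuousAt.mul (by fun_prop) (ContinuousAt.div (by fun_prop) (by fun_prop) hu)
  have h₃ := (h₂.tendsto.mono_left nhdsWithin_le_nhds).mul h₁
  have e : Complex.exp (2 * expo q 0) * ((Complex.exp (log q + 2 * log q / 2) +
      Complex.exp (-log q + 2 * log q / 2)) /
      (1 - Complex.exp (log q + 2 * log q / 2) ^ 2)) * (-(log q : ℂ))⁻¹ =
      residue q := by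
    rw [show -(log q : ℂ) + 2 * log q / 2 = 0 by ring, Complex.exp_zero,
      show (log q : ℂ) + 2 * log q / 2 = 2 * log q by ring, residue]
    push_cast
    rfl
  rw [e] at h₃
  refine h₃.congr fun z => ?_
  rw [slope_def_field, show -(log q : ℂ) + 2 * log q / 2 = 0 by ring, Complex.exp_zero,
    one_pow, sub_self, sub_zero, inv_div, sing, ← div_div]
  ring

theorem neg_one_le_meromorphicOrderAt {f : ℂ → ℂ} {x c : ℂ} (hf : MeromorphicAt f x)
    (h : Filter.Tendsto (fun z => (z - x) * f z) (nhdsWithin x {x}ᶜ) (nhds c)) :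
    ((-1 : ℤ) : WithTop ℤ) ≤ meromorphicOrderAt f x := by
  have h₁ : MeromorphicAt (fun z => z - x) x := by fun_prop
  have h₂ := (tendsto_nhds_iff_meromorphicOrderAt_nonneg (h₁.mul hf)).1 ⟨c, h⟩
  have h₃ : meromorphicOrderAt (fun z => z - x) x = (1 : ℤ) := by
    rw [meromorphicOrderAt_eq_int_iff h₁]
    exact ⟨fun _ => 1, analyticAt_const, one_ne_zero, by simp⟩
  rw [meromorphicOrderAt_mul h₁ hf, h₃] at h₂
  cases ho : meromorphicOrderAt f x with
  | top => exact le_top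
  | coe n =>
    rw [ho] at h₂
    have : (0 : ℤ) ≤ 1 + n := by exact_mod_cast h₂
    exact_mod_cast (by omega : -1 ≤ n)

/-! ### The residue cocycle -/

theorem mainOp_single (π : Sphere q →ₐ[ℂ] Module.End ℂ Dom) (a₀ a₁ a₂ : Sphere q) (z : ℂ)
    (i : Idx) : mainOp π a₀ a₁ a₂ z (Finsupp.single i 1) =
      ((qnum q (i.l + 1 / 2) : ℂ) ^ (-z) * ((q ^ (-2 * i.k) : ℝ) : ℂ)) •
        (opγ * π a₀ * commD π a₁ * commD π a₂) (Finsupp.single i 1) := by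
  rw [mainOp, Module.End.mul_apply, Module.End.mul_apply, absDPow, diagOp, opOf_single, opK, diagOp,
    map_smul, opOf_single, map_smul, map_smul, mul_smul]

theorem trace_mainOp (π : Sphere q →ₐ[ℂ] Module.End ℂ Dom) (a₀ a₁ a₂ : Sphere q) (z : ℂ) :
    trace (mainOp π a₀ a₁ a₂ z) = ∑' i : Idx, ((q ^ (-2 * i.k) : ℝ) : ℂ) *
      ((opγ * π a₀ * commD π a₁ * commD π a₂) (Finsupp.single i 1) i *
        (qnum q (i.l + 1 / 2) : ℂ) ^ (-z)) := by
  refine tsum_congr fun i => ?_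
  rw [inner_basisH_toH, mainOp_single, Finsupp.smul_apply, smul_eq_mul]
  ring

variable {π : Sphere q →ₐ[ℂ] Module.End ℂ Dom}

theorem ord_triple (hq : 0 < q) (hq₁ : q < 1) (hπ : IsSpinRep q π) (a₀ a₁ a₂ : Sphere q) :
    Ord 1 (opγ * π a₀ * commD π a₁ * commD π a₂) := by
  have h₀ : Ord 1 (π a₀) :=
    ((ord_rep_and_comm hq hq₁ hπ a₀).1.bounded hq hq₁).of_sub (ord_one.smul _)
  exact ((ord_opγ.bounded_mul h₀).bounded_mul (ord_commD hq hq₁ hπ a₁)).bounded_mul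
    (ord_commD hq hq₁ hπ a₂)

theorem isTraceClass_mainOp (hq : 0 < q) (hq₁ : q < 1) (hπ : IsSpinRep q π)
    (a₀ a₁ a₂ : Sphere q) {z : ℂ} (hz : 2 < z.re) : IsTraceClass (mainOp π a₀ a₁ a₂ z) := by
  obtain ⟨C, _, hC, _, h⟩ := ord_triple hq hq₁ hπ a₀ a₁ a₂
  have hM : ∀ i, ‖Complex.exp (-z * (log (1 - q ^ (2 * Idx.l i + 1)) : ℂ))‖ ≤
      Real.exp (‖z‖ * (1 - q ^ 2)⁻¹) := fun i => by
    have hq₂ : 0 < 1 - q ^ 2 := by nlinarith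
    refine (Complex.norm_exp_le_exp_norm _).trans (Real.exp_le_exp.2 ?_)
    exact (norm_correction_le hq hq₁ i le_rfl).trans
      (mul_le_of_le_one_right (by positivity) (rpow_le_one hq.le hq₁.le (l_pos i).le))
  refine isTraceClass_of_summable (((summable_rpow hq hq₁ (a := z.re) (b := -2) (by linarith)
    (by linarith)).mul_left (Real.exp (‖z‖ * |log (q⁻¹ - q)|) *
      Real.exp (‖z‖ * (1 - q ^ 2)⁻¹) * C)).of_nonneg_of_le (fun _ => l1_nonneg _) fun i => ?_)
  have hk := rpow_pos_of_pos hq (-2 * i.k)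
  have h₁ := norm_exp_expo_le hq hq₁ (show (0 : ℝ) ≤ z.re by linarith) i le_rfl (le_refl ‖z‖)
  have h₂ := (h i).1
  have h₃ := hM i
  rw [Pi.one_apply, mul_one] at h₂
  rw [mainOp_single, l1_smul, norm_mul, qnum_cpow hq hq₁, norm_mul, Complex.norm_real,
    Real.norm_of_nonneg hk.le, rpow_add hq (z.re * i.l)]
  calc _ ≤ Real.exp (‖z‖ * |log (q⁻¹ - q)|) * q ^ (z.re * i.l) *
        Real.exp (‖z‖ * (1 - q ^ 2)⁻¹) * q ^ (-2 * i.k) * C := by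
        have := l1_nonneg ((opγ * π a₀ * commD π a₁ * commD π a₂) (Finsupp.single i 1))
        gcongr
    _ = _ := by ring

theorem exists_zeta (hq : 0 < q) (hq₁ : q < 1) (hπ : IsSpinRep q π) (a₀ a₁ a₂ : Sphere q) :
    ∃ Z : ℂ → ℂ, MeromorphicOn Z {z : ℂ | 1 < z.re} ∧
      (∀ z : ℂ, 2 < z.re → Z z = trace (mainOp π a₀ a₁ a₂ z)) ∧
      ((-1 : ℤ) : WithTop ℤ) ≤ meromorphicOrderAt Z 2 ∧
      Filter.Tendsto (fun z : ℂ => (z - 2) * Z z) (nhdsWithin 2 {2}ᶜ)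
        (nhds (Sphere.form hq (-(residue q : ℂ)) (residue q) a₀ a₁ a₂)) := by
  obtain ⟨C, _, hC, _, h⟩ := ord_triple_sub hq hq₁ hπ a₀ a₁ a₂
  obtain ⟨c, hc⟩ : ∃ c, c = symbol hq a₀ a₁ a₂ := ⟨_, rfl⟩
  obtain ⟨d, hd⟩ : ∃ d : Idx → ℂ, d = fun i =>
    (opγ * π a₀ * commD π a₁ * commD π a₂) (Finsupp.single i 1) i := ⟨_, rfl⟩
  have hdc : ∀ i, ‖d i - c i.2‖ ≤ C * wt q i := by
    intro i
    refine le_trans (le_of_eq ?_) ((norm_apply_le_l1 _ i).trans (h i).1)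
    rw [lsub_apply, Finsupp.sub_apply, hd, hc, diagOp, opOf_single, Finsupp.smul_apply,
      Finsupp.single_eq_same, smul_eq_mul, mul_one]
  have hE : ∀ z : ℂ, 1 < z.re → AnalyticAt ℂ (fun z => ∑' i, regTerm q d c i z) z :=
    fun z hz => analyticAt_regTerm hq hq₁ hC hdc hz
  have hZ : ∀ z : ℂ, 1 < z.re → MeromorphicAt
      (fun z => ∑' i, regTerm q d c i z + sing q z * (c true + c false)) z := fun z hz =>
    (hE z hz).meromorphicAt.add ((meromorphicAt_sing q z).mul (MeromorphicAt.const _ z))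
  have ht : Filter.Tendsto (fun z : ℂ => (z - 2) * (∑' i, regTerm q d c i z +
      sing q z * (c true + c false))) (nhdsWithin 2 {2}ᶜ)
        (nhds (Sphere.form hq (-(residue q : ℂ)) (residue q) a₀ a₁ a₂)) := by
    have h₁ : Filter.Tendsto (fun z : ℂ => (z - 2) * ∑' i, regTerm q d c i z)
        (nhdsWithin 2 {2}ᶜ) (nhds ((2 - 2) * ∑' i, regTerm q d c i 2)) := by
      have : ContinuousAt (fun z : ℂ => (z - 2) * ∑' i, regTerm q d c i z) 2 :=
        ContinuousAt.mul (by fun_prop) (hE 2 (by norm_num)).continuousAt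
      exact this.tendsto.mono_left nhdsWithin_le_nhds
    have h₂ := h₁.add ((tendsto_sing hq hq₁).mul_const (c true + c false))
    have e : (2 - 2) * ∑' i, regTerm q d c i 2 + residue q * (c true + c false) =
        Sphere.form hq (-(residue q : ℂ)) (residue q) a₀ a₁ a₂ := by
      rw [hc, Sphere.form_apply, symbol, symbol]
      simp only [if_true, Bool.false_eq_true, if_false]
      ring
    rw [e] at h₂
    refine h₂.congr fun z => ?_
    ring
  refine ⟨_, fun z hz => hZ z hz, fun z hz => ?_,
    neg_one_le_meromorphicOrderAt (hZ 2 (by norm_num)) ht, ht⟩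
  rw [trace_mainOp, ← (hasSum_zeta hq hq₁ hC hdc hz).tsum_eq, hd]

theorem representsFundamentalClass_form (hq : 0 < q) (hq₁ : q < 1) {t : ℂ} (ht : t ≠ 0) :
    RepresentsFundamentalClass (Sphere.modular hq) (Sphere.form hq (-t) t) ∧
      ∃ κ : ℂ, κ ≠ 0 ∧
        Cohomologous (Sphere.modular hq) (Sphere.form hq (-t) t) (κ • stdCocycle hq) := by
  have hq' := ofReal_ne_zero hq
  have h₁ : pairing (Sphere.form hq (-t) t) (Sphere.resolution hq).cycle ≠ 0 := by
    have : (1 : ℂ) + q ^ 2 ≠ 0 := by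
      have : (0 : ℝ) < 1 + q ^ 2 := by positivity
      exact_mod_cast this.ne'
    rw [Sphere.pairing_form, show -t - (q : ℂ) ^ 2 * t = -(t * (1 + q ^ 2)) by ring]
    exact mul_ne_zero (inv_ne_zero hq') (neg_ne_zero.2 (mul_ne_zero ht this))
  refine ⟨⟨Sphere.form_isTwistedCocycle hq _ _, _, Sphere.isFundamentalCycle hq,
    Sphere.exists_smul_cycle hq hq₁, h₁⟩, ?_⟩
  rw [Sphere.stdCocycle_eq_form]
  refine exists_cohomologous (Sphere.exists_smul_cycle hq hq₁)
    (Sphere.form_isTwistedCocycle hq _ _) (Sphere.form_isTwistedCocycle hq _ _) h₁ ?_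
  rw [Sphere.pairing_form]
  simpa using hq'

end Spin
end Podles
end

theorem theorem1p1 (q : ℝ) (hq₀ : 0 < q) (hq₁ : q < 1) :
    (∃! π : Podles.Sphere q →ₐ[ℂ] Module.End ℂ Podles.Dom, Podles.IsSpinRep q π) ∧
    ∀ π : Podles.Sphere q →ₐ[ℂ] Module.End ℂ Podles.Dom, Podles.IsSpinRep q π →
      ∃ φ : Podles.Sphere q →ₗ[ℂ] Podles.Sphere q →ₗ[ℂ] Podles.Sphere q →ₗ[ℂ] ℂ,
        (∀ a₀ a₁ a₂ : Podles.Sphere q,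
          (∀ z : ℂ, 2 < z.re → Podles.IsTraceClass (Podles.mainOp π a₀ a₁ a₂ z)) ∧
          ∃ Z : ℂ → ℂ,
            MeromorphicOn Z {z : ℂ | 1 < z.re} ∧
            (∀ z : ℂ, 2 < z.re → Z z = Podles.trace (Podles.mainOp π a₀ a₁ a₂ z)) ∧
            ((-1 : ℤ) : WithTop ℤ) ≤ meromorphicOrderAt Z 2 ∧
            Filter.Tendsto (fun z : ℂ => (z - 2) * Z z) (nhdsWithin 2 {2}ᶜ)
              (nhds (φ a₀ a₁ a₂))) ∧
        ∃ σ : Podles.Sphere q ≃ₐ[ℂ] Podles.Sphere q,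
          Podles.RepresentsFundamentalClass σ φ ∧
          ∃ κ : ℂ, κ ≠ 0 ∧ Podles.Cohomologous σ φ (κ • Podles.stdCocycle hq₀) := by
  refine ⟨Podles.Spin.existsUnique_isSpinRep hq₀ hq₁, fun π hπ =>
    ⟨Podles.Sphere.form hq₀ (-(Podles.Spin.residue q : ℂ)) (Podles.Spin.residue q),
      fun a₀ a₁ a₂ => ⟨fun z hz => Podles.Spin.isTraceClass_mainOp hq₀ hq₁ hπ a₀ a₁ a₂ hz,
        Podles.Spin.exists_zeta hq₀ hq₁ hπ a₀ a₁ a₂⟩, Podles.Sphere.modular hq₀,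
      Podles.Spin.representsFundamentalClass_form hq₀ hq₁ ?_⟩⟩
  exact_mod_cast Podles.Spin.residue_ne_zero hq₀ hq₁
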